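/- Let $\mathbb S^2\subset\mathbb R^3$ be the unit sphere with great-circle distance $d$, Riemannian volume $\nu$ and gradient $\nabla$. For $(\varphi,\theta)$ write $P(\varphi,\theta)=(\sin\varphi\cos\theta,\sin\varphi\sin\theta,\cos\varphi)$. Let $f(P(\varphi,\theta))=P(\varphi/2,\theta)$ on the upper hemisphere $0\le\varphi\le\pi/2$, let $D=\{P(\varphi,\theta):0\le\varphi\le\pi/2,\ 0\le\theta\le\pi/2\}$, let $R_x(\alpha),R_y(\alpha)$ be the rotations about the $x$- and $y$-axis with matrices $$R_x(\alpha)=\begin{pmatrix}1&0&0\\0&\cos\alpha&-\sin\alpha\\0&\sin\alpha&\cos\alpha\end{pmatrix},\qquad R_y(\alpha)=\begin{pmatrix}\cos\alpha&0&\sin\alpha\\0&1&0\\-\sin\alpha&0&\cos\alpha\end{pmatrix},$$ and set $f_1=f|_D$, $f_2=R_y(\pi/4)\circ f_1$, $f_3=R_x(-\pi/4)\circ f_1$. **(I)** For $i=1,2,3$ we have $f_i(D)\subseteq D$, and $f_i$ is a bi-Lipschitz contraction on $D$: there are $0<c\le r<1$ with $c\,d(p,q)\le d(f_i(p),f_i(q))\le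 r\,d(p,q)$ for all $p,q\in D$. Let $p_1,p_2,p_3>0$, $p_1+p_2+p_3=1$, and let $\mu$ be an invariant measure, i.e. a Borel probability measure carried by $D$ with $\mu=\sum_i p_i\,\mu\circ f_i^{-1}$. **(II)** $\displaystyle\underline{\dim}_\infty(\mu):=\varliminf_{\delta\to0^+}\frac{\ln\sup_{x\in\operatorname{supp}\mu}\mu(\{y:d(x,y)<\delta\})}{\ln\delta}>0.$ **(III)** Let $\Omega\subseteq\mathbb S^2$ be open with $\operatorname{supp}\mu\subseteq\overline\Omega$ and $\mu(\Omega)>0$. Then the following holds. *Setting.* There is $C>0$ with $\int_\Omega|u|^2d\mu\le C\left(\int_\Omega|\nabla u|^2d\nu+\int_\Omega|u|^2d\nu\right)$ for all $u\in C_c^\infty(\Omega)$ (complex valued). Let $W$ be the closure of $C_c^\infty(\Omega)$ in the $W^{1,2}(\Omega)$ norm. Each $u\in W$ has a unique $L^2(\Omega,\mu)$-representative, the limit in $L^2(\Omega,\mu)$ of some $u_k\in C_c^\infty(\Omega)$ with $u_k\to u$ in $W$. Let $\mathcal N\subseteq W$ be the subspace of those $u$ whose representative is $0$, and $\mathcal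 N^\perp$ its orthogonal complement in $W$ for the $W^{1,2}$ inner product. Let $\operatorname{dom}\mathcal E=\mathcal N^\perp$, regarded as a subspace of $L^2(\Omega,\mu)$, with $\mathcal E(u,v)=\int_\Omega\langle\nabla u,\nabla\bar v\rangle\,d\nu$ and $\|u\|_{\operatorname{dom}\mathcal E}=\mathcal E(u,u)^{1/2}$. Put $\langle u,v\rangle_\mu=\int_\Omega u\bar v\,d\mu$, let $(\operatorname{dom}\mathcal E)'$ be the dual of $\operatorname{dom}\mathcal E$, containing $L^2(\Omega,\mu)$ through $\langle\cdot,\cdot\rangle_\mu$, and define $-\Delta_\mu u=f$ to mean $u\in\operatorname{dom}\mathcal E$ and $\mathcal E(u,v)=\langle f,v\rangle_\mu$ for all $v\in\operatorname{dom}\mathcal E$. There is an orthonormal basis $(\varphi_k)_{k\ge0}$ of $L^2(\Omega,\mu)$ with $-\Delta_\mu\varphi_k=\lambda_k\varphi_k$, $0<\lambda_0\le\lambda_1\le\cdots$, $\lambda_k\to\infty$. Fix any orthonormal basis $(\varphi_k)$ of eigenfunctions, with eigenvalues $\lambda_k$. For $\alpha\ge0$ let $E_\alpha=\{\sum b_k\varphi_k:\sum|b_k|^2\lambda_k^\alpha<\infty\}$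 with norm $(\sum|b_k|^2\lambda_k^\alpha)^{1/2}$; further $\sum c_k\varphi_k\in(\operatorname{dom}\mathcal E)'$ iff $\sum|c_k|^2/\lambda_k<\infty$. $\operatorname{Lip}(X)$ denotes the Lipschitz maps $X\to X$. Let $0<T<\infty$. In the definition of weak solutions and in membership statements such as $\partial_tu\in L^\infty([0,T],X)$, time derivatives are vector-valued distributional derivatives, and functions are their continuous representatives (so $u(t)-u(s)=\int_s^t\partial_tu\,d\tau$ in $X$). A function $u\in L^\infty([0,T],\operatorname{dom}\mathcal E)$ is a weak solution of - the wave equation $\partial_{tt}u-\Delta_\mu u=f$, $u(0)=g$, $\partial_tu(0)=h$, if $\partial_tu\in L^\infty([0,T],L^2(\Omega,\mu))$, $\partial_{tt}u\in L^\infty([0,T],(\operatorname{dom}\mathcal E)')$, the initial conditions hold, and for all $v\in\operatorname{dom}\mathcal E$, $\langle\partial_{tt}u,v\rangle+\mathcal E(u,v)=\langle f(t),v\rangle_\mu$ for a.e. $t\in[0,T]$; - the heat equation $\partial_tu-\Delta_\mu u=f$ (resp. the Schrödinger equation $i\partial_tu+\Delta_\mu u=f$), $u(0)=g$, if $\partial_tu\in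 L^\infty([0,T],(\operatorname{dom}\mathcal E)')$, $u(0)=g$, and for all $v\in\operatorname{dom}\mathcal E$, $\langle\partial_tu,v\rangle+\mathcal E(u,v)=\langle f(t),v\rangle_\mu$ (resp. $\langle i\partial_tu,v\rangle-\mathcal E(u,v)=\langle f(t),v\rangle_\mu$) for a.e. $t\in[0,T]$. A weak solution of a semi-linear equation with right-hand side $F(u)$ is a weak solution of the linear equation with $f(t)=F(u(t))$. Unique means: any two weak solutions agree on $[0,T]$. Write $a_k=\langle g,\varphi_k\rangle_\mu$, $b_k=\langle h,\varphi_k\rangle_\mu$, $\gamma_k(t)=\langle f(t),\varphi_k\rangle_\mu$. *Linear wave equation.* Let $g\in\operatorname{dom}\mathcal E$, $h\in L^2(\Omega,\mu)$, $f\in L^\infty([0,T],\operatorname{dom}\mathcal E)$, and $$u(t)=\sum_k\Big(\tfrac{\sin(\sqrt{\lambda_k}t)}{\sqrt{\lambda_k}}b_k+\cos(\sqrt{\lambda_k}t)a_k+\tfrac1{\sqrt{\lambda_k}}\int_0^t\sin(\sqrt{\lambda_k}(t-\tau))\gamma_k(\tau)d\tau\Big)\varphi_k,$$ $$H(t)=\sum_k\Big(\cos(\sqrt{\lambda_k}t)b_k-\sqrt{\lambda_k}\sin(\sqrt{\lambda_k}t)a_k+\int_0^t\cos(\sqrt{\lambda_k}(t-\tau))\gamma_k(\tau)d\tau\Big)\varphi_k,$$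 $$K(t)=\sum_k\Big(-\sqrt{\lambda_k}\sin(\sqrt{\lambda_k}t)b_k-\lambda_k\cos(\sqrt{\lambda_k}t)a_k+\gamma_k(t)-\sqrt{\lambda_k}\int_0^t\sin(\sqrt{\lambda_k}(t-\tau))\gamma_k(\tau)d\tau\Big)\varphi_k.$$ The first two series converge in $L^2(\Omega,\mu)$ for all $t\in[0,T]$. (a) $u$ is differentiable in $L^2(\Omega,\mu)$ with $\partial_tu=H(t)$ for a.e. $t$. (b) $K(t)\in(\operatorname{dom}\mathcal E)'$ and $H$ is differentiable in $(\operatorname{dom}\mathcal E)'$ with $\partial_{tt}u=\partial_tH=K(t)$ for a.e. $t$. (c) $u$ is the unique weak solution. (d) If $\alpha\ge2$, $g\in E_\alpha$, $h\in E_{\alpha-1}$, $f\in L^\infty([0,T],E_\alpha)$, then $u\in L^\infty([0,T],E_\alpha)$ and $\partial_tu\in L^\infty([0,T],E_{\alpha-2})$. (e) There are constants $c_1,c_2>0$, independent of $T,g,h$, such that if $f\equiv0$ and $h\in\operatorname{dom}\mathcal E$, then for all $t\in[0,T]$, $u(t)\in\operatorname{dom}\mathcal E$, $\|u(t)\|_\mu^2\le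 c_1\|h\|_{\operatorname{dom}\mathcal E}^2+\|g\|_\mu^2$ and $\mathcal E(u(t),u(t))\le c_2\mathcal E(h,h)+\mathcal E(g,g)$. *Linear heat equation.* Let $g\in\operatorname{dom}\mathcal E$, $f\in L^\infty([0,T],\operatorname{dom}\mathcal E)$, and $$u(t)=\sum_k\Big(e^{-\lambda_kt}a_k+\int_0^te^{-\lambda_k(t-\tau)}\gamma_k(\tau)d\tau\Big)\varphi_k,\quad K(t)=\sum_k\Big(-\lambda_ke^{-\lambda_kt}a_k+\gamma_k(t)-\lambda_k\int_0^te^{-\lambda_k(t-\tau)}\gamma_k(\tau)d\tau\Big)\varphi_k.$$ The first series converges in $L^2(\Omega,\mu)$ for all $t\in[0,T]$. (a) $K(t)\in(\operatorname{dom}\mathcal E)'$ and $u$ is differentiable in $(\operatorname{dom}\mathcal E)'$ with $\partial_tu=K(t)$ for a.e. $t$. (b) $u$ is the unique weak solution. (c) If $\alpha\ge2$, $g\in E_\alpha$, $f\in L^\infty([0,T],E_\alpha)$, then $u\in L^\infty([0,T],E_\alpha)$ and $\partial_tu\in L^\infty([0,T],E_{\alpha-2})$. (d) If $f\equiv0$,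 then for all $t\in[0,T]$, $u(t)\in\operatorname{dom}\mathcal E$, $\|u(t)\|_\mu\le\|g\|_\mu$ and $\mathcal E(u(t),u(t))\le\mathcal E(g,g)$. *Linear Schrödinger equation.* The same statements (a)–(d) hold with $$u(t)=\sum_k\Big(e^{-i\lambda_kt}a_k-i\int_0^te^{-i\lambda_k(t-\tau)}\gamma_k(\tau)d\tau\Big)\varphi_k,\quad K(t)=\sum_k\Big(-i\lambda_ke^{-i\lambda_kt}a_k-i\gamma_k(t)-\lambda_k\int_0^te^{-i\lambda_k(t-\tau)}\gamma_k(\tau)d\tau\Big)\varphi_k,$$ and with equalities $\|u(t)\|_\mu=\|g\|_\mu$, $\mathcal E(u(t),u(t))=\mathcal E(g,g)$ in (d). *Semi-linear equations.* Let $F\in\operatorname{Lip}(\operatorname{dom}\mathcal E)$, $g\in\operatorname{dom}\mathcal E$ (and $h\in L^2(\Omega,\mu)$ for the wave equation). Each of the wave, heat and Schrödinger equations with right-hand side $F(u)$ has a unique weak solution $u\in L^\infty([0,T],\operatorname{dom}\mathcal E)$, and for all $t\in[0,T]$ it is given by the series for $u(t)$ above with $\gamma_k(\tau)=\langle F(u(\tau)),\varphi_k\rangle_\mu$.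 If moreover $\alpha\ge2$, $F\in\operatorname{Lip}(E_\alpha)$ and $g\in E_\alpha$, then: for heat and Schrödinger, $u\in L^\infty([0,T],E_\alpha)$ and $\partial_tu\in L^\infty([0,T],E_{\alpha-2})$; for wave, if also $h\in E_{\alpha-1}$, $u\in L^\infty([0,T],E_\alpha)$, $\partial_tu\in L^\infty([0,T],E_{\alpha-1})$ and $\partial_{tt}u\in L^\infty([0,T],E_{\alpha-2})$. -/

import Mathlib

open MeasureTheory Filter Set
open scoped Topology Manifold ContDiff ComplexConjugate

noncomputable section

namespace KreinFeller

/-! ### The unit sphere and the iterated function system -/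

/-- Euclidean 3-space. -/
abbrev E3 : Type := EuclideanSpace ℝ (Fin 3)

/-- The unit 2-sphere. -/
abbrev S2 : Type := Metric.sphere (0 : E3) 1

/-- The Riemannian (great-circle) distance on the unit sphere. -/
def sphereDist (p q : S2) : ℝ := Real.arccos (inner ℝ (p : E3) (q : E3))

theorem mem_sphere_iff (v : E3) :
    v ∈ Metric.sphere (0 : E3) 1 ↔ v 0 ^ 2 + v 1 ^ 2 + v 2 ^ 2 = 1 := by
  rw [mem_sphere_zero_iff_norm, EuclideanSpace.norm_eq, Real.sqrt_eq_one, Fin.sum_univ_three]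
  simp

/-- The point with polar angle `φ` and azimuthal angle `θ`. -/
def polar (φ θ : ℝ) : S2 :=
  ⟨!₂[Real.sin φ * Real.cos θ, Real.sin φ * Real.sin θ, Real.cos φ], by
    rw [mem_sphere_iff]
    simp
    nlinarith [Real.sin_sq_add_cos_sq φ, Real.sin_sq_add_cos_sq θ]⟩

/-- The map that halves the polar angle and keeps the azimuthal angle. -/
def halfPolar (p : S2) : S2 :=
  polar (Real.arccos ((p : E3) 2) / 2) (Complex.arg ⟨(p : E3) 0, (p : E3) 1⟩)

/-- On the closed upper hemisphere `halfPolar` is `(φ, θ) ↦ (φ / 2, θ)`. -/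
theorem halfPolar_polar (φ θ : ℝ) (h0 : 0 ≤ φ) (h1 : φ ≤ Real.pi / 2) :
    halfPolar (polar φ θ) = polar (φ / 2) θ := by
  have hpi := Real.pi_pos
  have ha : Real.arccos (((polar φ θ : S2) : E3) 2) = φ := by
    simpa [polar] using Real.arccos_cos h0 (by linarith)
  rcases h0.eq_or_lt with rfl | hpos
  · apply Subtype.ext
    simp only [halfPolar, ha]
    simp [polar]
  · have hs : 0 < Real.sin φ := Real.sin_pos_of_pos_of_lt_pi hpos (by linarith)
    set z : ℂ := ⟨((polar φ θ : S2) : E3) 0, ((polar φ θ : S2) : E3) 1⟩ with hz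
    have hre : z.re = Real.sin φ * Real.cos θ := by simp [hz, polar]
    have him : z.im = Real.sin φ * Real.sin θ := by simp [hz, polar]
    have hn : ‖z‖ = Real.sin φ := by
      have : ‖z‖ ^ 2 = Real.sin φ ^ 2 := by
        rw [Complex.sq_norm, Complex.normSq_apply, hre, him]
        nlinarith [Real.sin_sq_add_cos_sq θ]
      exact (pow_left_inj₀ (norm_nonneg _) hs.le two_ne_zero).1 this
    have hz0 : z ≠ 0 := by
      intro h
      rw [h, norm_zero] at hn
      linarith
    have hc : Real.cos z.arg = Real.cos θ := by
      rw [Complex.cos_arg hz0, hre, hn]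
      field_simp
    have hsn : Real.sin z.arg = Real.sin θ := by
      rw [Complex.sin_arg, him, hn]
      field_simp
    apply Subtype.ext
    simp only [halfPolar, ha, ← hz]
    simp [polar, hc, hsn]

/-- The matrix of the rotation about the `x`-axis through the angle `α`. -/
def rotXMatrix (α : ℝ) : Matrix (Fin 3) (Fin 3) ℝ :=
  !![1, 0, 0; 0, Real.cos α, -Real.sin α; 0, Real.sin α, Real.cos α]

/-- The matrix of the rotation about the `y`-axis through the angle `α`. -/
def rotYMatrix (α : ℝ) : Matrix (Fin 3) (Fin 3) ℝ :=
  !![Real.cos α, 0, Real.sin α; 0, 1, 0; -Real.sin α, 0, Real.cos α]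

/-- The rotation of the sphere about the `x`-axis through the angle `α`. -/
def rotX (α : ℝ) (p : S2) : S2 :=
  ⟨WithLp.toLp 2 (Matrix.mulVec (rotXMatrix α) (WithLp.ofLp (p : E3))), by
    have h := (mem_sphere_iff _).1 p.2
    rw [mem_sphere_iff]
    simp [rotXMatrix, Matrix.mulVec, dotProduct, Fin.sum_univ_three]
    linear_combination h + ((p : E3) 1 ^ 2 + (p : E3) 2 ^ 2) * Real.sin_sq_add_cos_sq α⟩

/-- The rotation of the sphere about the `y`-axis through the angle `α`. -/
def rotY (α : ℝ) (p : S2) : S2 :=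
  ⟨WithLp.toLp 2 (Matrix.mulVec (rotYMatrix α) (WithLp.ofLp (p : E3))), by
    have h := (mem_sphere_iff _).1 p.2
    rw [mem_sphere_iff]
    simp [rotYMatrix, Matrix.mulVec, dotProduct, Fin.sum_univ_three]
    linear_combination h + ((p : E3) 0 ^ 2 + (p : E3) 2 ^ 2) * Real.sin_sq_add_cos_sq α⟩

/-- The quarter of the closed upper hemisphere with azimuthal angle in `[0, π/2]`. -/
def quarter : Set S2 :=
  {p | ∃ φ ∈ Icc 0 (Real.pi / 2), ∃ θ ∈ Icc 0 (Real.pi / 2), p = polar φ θ}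

/-- The three maps of the iterated function system; only their values on `quarter` matter. -/
def ifs : Fin 3 → S2 → S2 :=
  ![halfPolar, rotY (Real.pi / 4) ∘ halfPolar, rotX (-(Real.pi / 4)) ∘ halfPolar]

/-- `f` is a bi-Lipschitz contraction on `D` for the Riemannian distance of the sphere. -/
def IsBiLipschitzContractionOn (f : S2 → S2) (D : Set S2) : Prop :=
  ∃ c r : ℝ, 0 < c ∧ c ≤ r ∧ r < 1 ∧ ∀ p ∈ D, ∀ q ∈ D,
    c * sphereDist p q ≤ sphereDist (f p) (f q) ∧ sphereDist (f p) (f q) ≤ r * sphereDist p q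

/-- A Borel probability measure `μ` on the sphere, carried by `quarter`, is an invariant measure of
the IFS for the probability vector `w` if `μ = ∑ i, w i • (μ ∘ (f i)⁻¹)`. -/
structure IsInvariantMeasure (w : Fin 3 → NNReal) (μ : Measure S2) : Prop where
  pos : ∀ i, 0 < w i
  sum_one : ∑ i, w i = 1
  prob : IsProbabilityMeasure μ
  carried : μ quarterᶜ = 0
  invariant : μ = ∑ i, w i • μ.map (ifs i)

/-- The lower `L^∞`-dimension of a measure on the sphere, with values in the extended reals. -/
def lowerLinftyDim (μ : Measure S2) : EReal :=
  liminf (fun δ : ℝ =>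
    ((Real.log (⨆ x ∈ μ.support, μ {y | sphereDist x y < δ}).toReal / Real.log δ : ℝ) : EReal))
    (𝓝[>] 0)

/-! ### Test functions, Sobolev space, and the energy form -/

/-- The Riemannian volume measure of the unit sphere (the surface measure). -/
def vol : Measure S2 := (volume : Measure E3).toSphere

/-- The extension of a function on the sphere that is constant along rays from the origin. -/
def radialExt (u : S2 → ℂ) (y : E3) : ℂ :=
  open Classical in
  if h : y = 0 then 0 else u ⟨(‖y‖⁻¹ : ℝ) • y, by
    rw [mem_sphere_zero_iff_norm, norm_smul, norm_inv, norm_norm, inv_mul_cancel₀ (norm_ne_zero_iff.2 h)]⟩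

/-- The Riemannian gradient of a (complex valued) function on the sphere, as a vector of the
complexified ambient space. It is the Euclidean gradient of the extension that is constant along
rays, which is tangent to the sphere. -/
def grad (u : S2 → ℂ) (x : S2) : EuclideanSpace ℂ (Fin 3) :=
  WithLp.toLp 2 fun j => fderiv ℝ (radialExt u) (x : E3) (EuclideanSpace.single j 1)

/-- `u ∈ C_c^∞(Ω)`, extended by zero to the sphere. -/
def IsTest (Ω : Set S2) (u : S2 → ℂ) : Prop :=
  ContMDiff (𝓡 2) 𝓘(ℝ, ℂ) ∞ u ∧ HasCompactSupport u ∧ tsupport u ⊆ Ω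

/-- `L²(Ω, μ)`, complex valued. -/
abbrev L2 (μ : Measure S2) (Ω : Set S2) : Type := Lp ℂ 2 (μ.restrict Ω)

/-- The Hilbert space `L²(Ω, ν) × L²(Ω, ν; ℂ³)` of pairs (function, gradient), `ν` being the
Riemannian volume; its inner product restricts to that of `W^{1,2}(Ω)`. -/
abbrev H1 (Ω : Set S2) : Type :=
  WithLp 2 (Lp ℂ 2 (vol.restrict Ω) × Lp (EuclideanSpace ℂ (Fin 3)) 2 (vol.restrict Ω))

/-- `h` is the pair (function, gradient) of the function `u` on `Ω`. -/
def IsJet (Ω : Set S2) (u : S2 → ℂ) (h : H1 Ω) : Prop :=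
  (h.fst : S2 → ℂ) =ᵐ[vol.restrict Ω] u ∧
    (h.snd : S2 → EuclideanSpace ℂ (Fin 3)) =ᵐ[vol.restrict Ω] grad u

/-- `W_0^{1,2}(Ω)`, the closure of `C_c^∞(Ω)` in the `W^{1,2}` norm (for `Ω` the whole sphere this
is `W^{1,2}`). An element is recorded together with its weak gradient. -/
def W0 (Ω : Set S2) : Set (H1 Ω) :=
  closure {h | ∃ u, IsTest Ω u ∧ IsJet Ω u h}

section Form

variable (μ : Measure S2) (Ω : Set S2)

/-- `w` is the `L²(Ω, μ)`-representative of `h ∈ W_0^{1,2}(Ω)`: there are `u_k ∈ C_c^∞(Ω)` with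
`u_k → h` in `W^{1,2}` and `u_k → w` in `L²(Ω, μ)`. -/
def IsRep (h : H1 Ω) (w : L2 μ Ω) : Prop :=
  (h, w) ∈ closure {q : H1 Ω × L2 μ Ω |
    ∃ u, IsTest Ω u ∧ IsJet Ω u q.1 ∧ (q.2 : S2 → ℂ) =ᵐ[μ.restrict Ω] u}

/-- The subspace of those `h ∈ W_0^{1,2}(Ω)` whose `L²(Ω, μ)`-representative is zero. -/
def nullSpace : Set (H1 Ω) := {h | h ∈ W0 Ω ∧ IsRep μ Ω h 0}

/-- The orthogonal complement of `nullSpace` in `W_0^{1,2}(Ω)`. -/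
def nullPerp : Set (H1 Ω) := {h | h ∈ W0 Ω ∧ ∀ n ∈ nullSpace μ Ω, inner ℂ n h = 0}

/-- The domain of the energy form, as a subspace of `L²(Ω, μ)`. -/
def dom : Set (L2 μ Ω) := {w | ∃ h ∈ nullPerp μ Ω, IsRep μ Ω h w}

/-- The Poincaré inequality for `μ` with respect to the `W^{1,2}` norm. It makes
`h ↦ w` in `IsRep` a bounded operator from `W_0^{1,2}(Ω)` to `L²(Ω, μ)`. -/
def PoincareInequality : Prop :=
  ∃ C > 0, ∀ u, IsTest Ω u → ∫ x in Ω, ‖u x‖ ^ 2 ∂μ ≤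
    C * (∫ x in Ω, ‖grad u x‖ ^ 2 ∂vol + ∫ x in Ω, ‖u x‖ ^ 2 ∂vol)

/-- The element of `nullPerp` that `w ∈ dom` represents (there is exactly one); zero off `dom`. -/
def lift (w : L2 μ Ω) : H1 Ω :=
  open Classical in if h : w ∈ dom μ Ω then h.choose else 0

/-- The energy form `(u, v) ↦ ∫_Ω ⟨∇u, ∇v̄⟩ dν` on `dom`; linear in `u`, antilinear in `v`. -/
def energy (u v : L2 μ Ω) : ℂ := inner ℂ (lift μ Ω v).snd (lift μ Ω u).snd

/-- The norm of `dom`, the square root of the energy. -/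
def energyNorm (u : L2 μ Ω) : ℝ := Real.sqrt (energy μ Ω u u).re

/-- The pairing `∫_Ω u v̄ dμ`. -/
def pair (u v : L2 μ Ω) : ℂ := inner ℂ v u

/-- `u ∈ dom Δ_μ` and `-Δ_μ u = f`. -/
def IsNegLaplacian (u f : L2 μ Ω) : Prop :=
  u ∈ dom μ Ω ∧ ∀ v ∈ dom μ Ω, energy μ Ω u v = pair μ Ω f v

/-- `φ` is an orthonormal basis of `L²(Ω, μ)` with `-Δ_μ φ_k = lam_k φ_k`. -/
def IsEigenbasis (φ : HilbertBasis ℕ ℂ (L2 μ Ω)) (lam : ℕ → ℝ) : Prop :=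
  ∀ k, IsNegLaplacian μ Ω (φ k) ((lam k : ℂ) • φ k)

/-! ### Function spaces in time, dual of `dom`, derivatives -/

/-- `u ∈ L^∞([0,T], dom)`. -/
def LinftyDom (T : ℝ) (u : ℝ → L2 μ Ω) : Prop :=
  AEStronglyMeasurable (fun t => lift μ Ω (u t)) (volume.restrict (Icc 0 T)) ∧
    (∀ᵐ t ∂volume.restrict (Icc 0 T), u t ∈ dom μ Ω) ∧
    ∃ C : ℝ, ∀ᵐ t ∂volume.restrict (Icc 0 T), energyNorm μ Ω (u t) ≤ C

/-- `ψ` belongs to the dual of `dom`. Functionals are antilinear, like `v ↦ pair w v`. -/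
def IsDualElement (ψ : L2 μ Ω → ℂ) : Prop :=
  (∀ v ∈ dom μ Ω, ∀ w ∈ dom μ Ω, ψ (v + w) = ψ v + ψ w) ∧
    (∀ (c : ℂ), ∀ v ∈ dom μ Ω, ψ (c • v) = conj c * ψ v) ∧
    ∃ C : ℝ, ∀ v ∈ dom μ Ω, ‖ψ v‖ ≤ C * energyNorm μ Ω v

/-- `ψ ∈ L^∞([0,T], dom')` (the dual being a separable Hilbert space, measurability is tested
against the elements of `dom`). -/
def LinftyDual (T : ℝ) (ψ : ℝ → L2 μ Ω → ℂ) : Prop :=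
  (∀ v ∈ dom μ Ω, AEStronglyMeasurable (fun t => ψ t v) (volume.restrict (Icc 0 T))) ∧
    (∀ᵐ t ∂volume.restrict (Icc 0 T), IsDualElement μ Ω (ψ t)) ∧
    ∃ C : ℝ, ∀ᵐ t ∂volume.restrict (Icc 0 T), ∀ v ∈ dom μ Ω, ‖ψ t v‖ ≤ C * energyNorm μ Ω v

/-- `v` is the derivative of `u` on `[0,T]` in `L²(Ω, μ)` in the sense of vector-valued
distributions, `u` being the continuous representative: `u` is an indefinite integral of `v`. -/
def HasL2Deriv (T : ℝ) (u v : ℝ → L2 μ Ω) : Prop :=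
  IntervalIntegrable v volume 0 T ∧
    ∀ s ∈ Icc 0 T, ∀ t ∈ Icc 0 T, u t - u s = ∫ τ in s..t, v τ

/-- `ψ` is the derivative of `u` on `[0,T]` in the dual of `dom`, in the same sense. -/
def HasDualDeriv (T : ℝ) (u : ℝ → L2 μ Ω) (ψ : ℝ → L2 μ Ω → ℂ) : Prop :=
  ∀ v ∈ dom μ Ω, ∀ s ∈ Icc 0 T, ∀ t ∈ Icc 0 T,
    pair μ Ω (u t) v - pair μ Ω (u s) v = ∫ τ in s..t, ψ τ v

/-- `u` is differentiable at `t` in the norm of the dual of `dom`, with derivative `ψ`. -/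
def HasDualDerivAt (u : ℝ → L2 μ Ω) (ψ : L2 μ Ω → ℂ) (t : ℝ) : Prop :=
  IsDualElement μ Ω ψ ∧ ∀ ε > 0, ∀ᶠ s in 𝓝[≠] (0 : ℝ), ∀ v ∈ dom μ Ω,
    ‖pair μ Ω (((s⁻¹ : ℝ) : ℂ) • (u (t + s) - u t)) v - ψ v‖ ≤ ε * energyNorm μ Ω v

/-- The functional `∑ c_k φ_k` on `dom`. -/
def dualSeries (φ : HilbertBasis ℕ ℂ (L2 μ Ω)) (c : ℕ → ℂ) (v : L2 μ Ω) : ℂ :=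
  ∑' k, c k * pair μ Ω (φ k) v

/-- `∑ c_k φ_k` belongs to the dual of `dom`, i.e. `∑ |c_k|² / lam_k < ∞`. -/
def MemDual (lam : ℕ → ℝ) (c : ℕ → ℂ) : Prop := Summable fun k => ‖c k‖ ^ 2 / lam k

/-- `F ∈ Lip(dom)`. -/
def LipDom (F : L2 μ Ω → L2 μ Ω) : Prop :=
  MapsTo F (dom μ Ω) (dom μ Ω) ∧ ∃ c > 0, ∀ u ∈ dom μ Ω, ∀ v ∈ dom μ Ω,
    energyNorm μ Ω (F u - F v) ≤ c * energyNorm μ Ω (u - v)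

/-- The space `E_α(Ω, μ)` of all `∑ b_k φ_k` with `∑ |b_k|² lam_k^α < ∞`. -/
def memE (φ : HilbertBasis ℕ ℂ (L2 μ Ω)) (lam : ℕ → ℝ) (α : ℝ) : Set (L2 μ Ω) :=
  {w | Summable fun k => ‖inner ℂ (φ k) w‖ ^ 2 * lam k ^ α}

/-- The norm of `E_α(Ω, μ)`. -/
def normE (φ : HilbertBasis ℕ ℂ (L2 μ Ω)) (lam : ℕ → ℝ) (α : ℝ) (w : L2 μ Ω) : ℝ :=
  Real.sqrt (∑' k, ‖inner ℂ (φ k) w‖ ^ 2 * lam k ^ α)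

/-- `u ∈ L^∞([0,T], E_α(Ω, μ))`. -/
def LinftyE (φ : HilbertBasis ℕ ℂ (L2 μ Ω)) (lam : ℕ → ℝ) (α T : ℝ) (u : ℝ → L2 μ Ω) : Prop :=
  AEStronglyMeasurable u (volume.restrict (Icc 0 T)) ∧
    (∀ᵐ t ∂volume.restrict (Icc 0 T), u t ∈ memE μ Ω φ lam α) ∧
    ∃ C : ℝ, ∀ᵐ t ∂volume.restrict (Icc 0 T), normE μ Ω φ lam α (u t) ≤ C

/-- `F ∈ Lip(E_α(Ω, μ))`. -/
def LipE (φ : HilbertBasis ℕ ℂ (L2 μ Ω)) (lam : ℕ → ℝ) (α : ℝ) (F : L2 μ Ω → L2 μ Ω) : Prop :=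
  MapsTo F (memE μ Ω φ lam α) (memE μ Ω φ lam α) ∧
    ∃ c > 0, ∀ u ∈ memE μ Ω φ lam α, ∀ v ∈ memE μ Ω φ lam α,
      normE μ Ω φ lam α (F u - F v) ≤ c * normE μ Ω φ lam α (u - v)

/-! ### Weak solutions -/

/-- `u` is a weak solution of `∂_tt u - Δ_μ u = f` on `Ω × [0,T]` with `u = g`, `∂_t u = h` at
`t = 0` (and `u = 0` on `∂Ω`). -/
def IsWaveSolution (T : ℝ) (g h : L2 μ Ω) (f u : ℝ → L2 μ Ω) : Prop :=
  ∃ (u' : ℝ → L2 μ Ω) (u'' : ℝ → L2 μ Ω → ℂ),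
    LinftyDom μ Ω T u ∧
    MemLp u' ⊤ (volume.restrict (Icc 0 T)) ∧ HasL2Deriv μ Ω T u u' ∧
    LinftyDual μ Ω T u'' ∧ HasDualDeriv μ Ω T u' u'' ∧
    (∀ v ∈ dom μ Ω, ∀ᵐ t ∂volume.restrict (Icc 0 T),
      u'' t v + energy μ Ω (u t) v = pair μ Ω (f t) v) ∧
    u 0 = g ∧ u' 0 = h

/-- `u` is a weak solution of `∂_t u - Δ_μ u = f` on `Ω × [0,T]` with `u = g` at `t = 0`. -/
def IsHeatSolution (T : ℝ) (g : L2 μ Ω) (f u : ℝ → L2 μ Ω) : Prop :=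
  ∃ u' : ℝ → L2 μ Ω → ℂ,
    LinftyDom μ Ω T u ∧ LinftyDual μ Ω T u' ∧ HasDualDeriv μ Ω T u u' ∧
    (∀ v ∈ dom μ Ω, ∀ᵐ t ∂volume.restrict (Icc 0 T),
      u' t v + energy μ Ω (u t) v = pair μ Ω (f t) v) ∧
    u 0 = g

/-- `u` is a weak solution of `i ∂_t u + Δ_μ u = f` on `Ω × [0,T]` with `u = g` at `t = 0`. -/
def IsSchrodingerSolution (T : ℝ) (g : L2 μ Ω) (f u : ℝ → L2 μ Ω) : Prop :=
  ∃ u' : ℝ → L2 μ Ω → ℂ,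
    LinftyDom μ Ω T u ∧ LinftyDual μ Ω T u' ∧ HasDualDeriv μ Ω T u u' ∧
    (∀ v ∈ dom μ Ω, ∀ᵐ t ∂volume.restrict (Icc 0 T),
      Complex.I * u' t v - energy μ Ω (u t) v = pair μ Ω (f t) v) ∧
    u 0 = g

/-- `u` satisfies `S`, and every function that satisfies `S` agrees with `u` on `[0,T]`. -/
def IsUniqueSolution (T : ℝ) (S : (ℝ → L2 μ Ω) → Prop) (u : ℝ → L2 μ Ω) : Prop :=
  S u ∧ ∀ v, S v → ∀ t ∈ Icc 0 T, v t = u t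

end Form

/-! ### The explicit coefficients -/

/-- Coefficient of the solution of the wave equation; `a`, `b`, `γ` are the coefficients of the
initial position, the initial velocity and the forcing term. -/
def waveCoeff (l : ℝ) (a b : ℂ) (γ : ℝ → ℂ) (t : ℝ) : ℂ :=
  (Real.sin (√l * t) / √l : ℝ) * b + (Real.cos (√l * t) : ℝ) * a +
    (1 / √l : ℝ) * ∫ τ in (0 : ℝ)..t, (Real.sin (√l * (t - τ)) : ℝ) * γ τ

/-- Coefficient of the first time derivative. -/
def waveCoeff' (l : ℝ) (a b : ℂ) (γ : ℝ → ℂ) (t : ℝ) : ℂ :=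
  (Real.cos (√l * t) : ℝ) * b - (√l * Real.sin (√l * t) : ℝ) * a +
    ∫ τ in (0 : ℝ)..t, (Real.cos (√l * (t - τ)) : ℝ) * γ τ

/-- Coefficient of the second time derivative. -/
def waveCoeff'' (l : ℝ) (a b : ℂ) (γ : ℝ → ℂ) (t : ℝ) : ℂ :=
  -((√l * Real.sin (√l * t) : ℝ) * b) - (l * Real.cos (√l * t) : ℝ) * a + γ t -
    (√l : ℝ) * ∫ τ in (0 : ℝ)..t, (Real.sin (√l * (t - τ)) : ℝ) * γ τ

/-- Coefficient of the solution of the heat equation. -/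
def heatCoeff (l : ℝ) (b : ℂ) (β : ℝ → ℂ) (t : ℝ) : ℂ :=
  (Real.exp (-l * t) : ℝ) * b + ∫ τ in (0 : ℝ)..t, (Real.exp (-l * (t - τ)) : ℝ) * β τ

/-- Coefficient of its time derivative. -/
def heatCoeff' (l : ℝ) (b : ℂ) (β : ℝ → ℂ) (t : ℝ) : ℂ :=
  -((l * Real.exp (-l * t) : ℝ) * b) + β t -
    (l : ℂ) * ∫ τ in (0 : ℝ)..t, (Real.exp (-l * (t - τ)) : ℝ) * β τ

/-- Coefficient of the solution of the Schrödinger equation. -/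
def schrodingerCoeff (l : ℝ) (b : ℂ) (β : ℝ → ℂ) (t : ℝ) : ℂ :=
  Complex.exp (-Complex.I * l * t) * b -
    Complex.I * ∫ τ in (0 : ℝ)..t, Complex.exp (-Complex.I * l * (t - τ)) * β τ

/-- Coefficient of its time derivative. -/
def schrodingerCoeff' (l : ℝ) (b : ℂ) (β : ℝ → ℂ) (t : ℝ) : ℂ :=
  -(Complex.I * l * Complex.exp (-Complex.I * l * t) * b) - Complex.I * β t -
    (l : ℂ) * ∫ τ in (0 : ℝ)..t, Complex.exp (-Complex.I * l * (t - τ)) * β τ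

/-! ### The conclusions of the well-posedness theorems -/

section Conclusions

variable (μ : Measure S2) (Ω : Set S2) (φ : HilbertBasis ℕ ℂ (L2 μ Ω)) (lam : ℕ → ℝ)

/-- Linear wave equation. -/
def WaveLinear : Prop :=
  (∀ T > 0, ∀ g ∈ dom μ Ω, ∀ (h : L2 μ Ω) (f : ℝ → L2 μ Ω), LinftyDom μ Ω T f →
    ∃ u H : ℝ → L2 μ Ω,
      (∀ t ∈ Icc 0 T, HasSum (fun k => waveCoeff (lam k) (inner ℂ (φ k) g) (inner ℂ (φ k) h)
        (fun τ => inner ℂ (φ k) (f τ)) t • φ k) (u t)) ∧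
      (∀ t ∈ Icc 0 T, HasSum (fun k => waveCoeff' (lam k) (inner ℂ (φ k) g) (inner ℂ (φ k) h)
        (fun τ => inner ℂ (φ k) (f τ)) t • φ k) (H t)) ∧
      (∀ᵐ t ∂volume.restrict (Icc 0 T), HasDerivAt u (H t) t) ∧
      (∀ᵐ t ∂volume.restrict (Icc 0 T),
        MemDual lam (fun k => waveCoeff'' (lam k) (inner ℂ (φ k) g) (inner ℂ (φ k) h)
          (fun τ => inner ℂ (φ k) (f τ)) t) ∧
        HasDualDerivAt μ Ω H (dualSeries μ Ω φ fun k =>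
          waveCoeff'' (lam k) (inner ℂ (φ k) g) (inner ℂ (φ k) h)
            (fun τ => inner ℂ (φ k) (f τ)) t) t) ∧
      IsUniqueSolution μ Ω T (IsWaveSolution μ Ω T g h f) u ∧
      (∀ α ≥ 2, g ∈ memE μ Ω φ lam α → h ∈ memE μ Ω φ lam (α - 1) → LinftyE μ Ω φ lam α T f →
        LinftyE μ Ω φ lam α T u ∧ LinftyE μ Ω φ lam (α - 2) T H)) ∧
  ∃ c₁ > 0, ∃ c₂ > 0, ∀ T > 0, ∀ g ∈ dom μ Ω, ∀ h ∈ dom μ Ω, ∀ u : ℝ → L2 μ Ω,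
    (∀ t ∈ Icc 0 T, HasSum (fun k => waveCoeff (lam k) (inner ℂ (φ k) g) (inner ℂ (φ k) h)
      (fun _ => 0) t • φ k) (u t)) →
    ∀ t ∈ Icc 0 T, u t ∈ dom μ Ω ∧
      ‖u t‖ ^ 2 ≤ c₁ * energyNorm μ Ω h ^ 2 + ‖g‖ ^ 2 ∧
      (energy μ Ω (u t) (u t)).re ≤ c₂ * (energy μ Ω h h).re + (energy μ Ω g g).re

/-- Semi-linear wave equation. -/
def WaveSemilinear : Prop :=
  ∀ F : L2 μ Ω → L2 μ Ω, LipDom μ Ω F → ∀ T > 0, ∀ g ∈ dom μ Ω, ∀ h : L2 μ Ω,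
    ∃ u : ℝ → L2 μ Ω,
      IsUniqueSolution μ Ω T (fun u => IsWaveSolution μ Ω T g h (fun t => F (u t)) u) u ∧
      (∀ t ∈ Icc 0 T, HasSum (fun k => waveCoeff (lam k) (inner ℂ (φ k) g) (inner ℂ (φ k) h)
        (fun τ => inner ℂ (φ k) (F (u τ))) t • φ k) (u t)) ∧
      (∀ α ≥ 2, LipE μ Ω φ lam α F → g ∈ memE μ Ω φ lam α → h ∈ memE μ Ω φ lam (α - 1) →
        LinftyE μ Ω φ lam α T u ∧ ∃ u' u'' : ℝ → L2 μ Ω,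
          HasL2Deriv μ Ω T u u' ∧ LinftyE μ Ω φ lam (α - 1) T u' ∧
          HasL2Deriv μ Ω T u' u'' ∧ LinftyE μ Ω φ lam (α - 2) T u'')

/-- Linear heat equation. -/
def HeatLinear : Prop :=
  (∀ T > 0, ∀ g ∈ dom μ Ω, ∀ f : ℝ → L2 μ Ω, LinftyDom μ Ω T f →
    ∃ u : ℝ → L2 μ Ω,
      (∀ t ∈ Icc 0 T, HasSum (fun k => heatCoeff (lam k) (inner ℂ (φ k) g)
        (fun τ => inner ℂ (φ k) (f τ)) t • φ k) (u t)) ∧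
      (∀ᵐ t ∂volume.restrict (Icc 0 T),
        MemDual lam (fun k => heatCoeff' (lam k) (inner ℂ (φ k) g)
          (fun τ => inner ℂ (φ k) (f τ)) t) ∧
        HasDualDerivAt μ Ω u (dualSeries μ Ω φ fun k =>
          heatCoeff' (lam k) (inner ℂ (φ k) g) (fun τ => inner ℂ (φ k) (f τ)) t) t) ∧
      IsUniqueSolution μ Ω T (IsHeatSolution μ Ω T g f) u ∧
      (∀ α ≥ 2, g ∈ memE μ Ω φ lam α → LinftyE μ Ω φ lam α T f →
        LinftyE μ Ω φ lam α T u ∧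
          ∃ u' : ℝ → L2 μ Ω, HasL2Deriv μ Ω T u u' ∧ LinftyE μ Ω φ lam (α - 2) T u')) ∧
  ∀ T > 0, ∀ g ∈ dom μ Ω, ∀ u : ℝ → L2 μ Ω,
    (∀ t ∈ Icc 0 T, HasSum (fun k => heatCoeff (lam k) (inner ℂ (φ k) g) (fun _ => 0) t • φ k)
      (u t)) →
    ∀ t ∈ Icc 0 T, u t ∈ dom μ Ω ∧ ‖u t‖ ≤ ‖g‖ ∧
      (energy μ Ω (u t) (u t)).re ≤ (energy μ Ω g g).re

/-- Semi-linear heat equation. -/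
def HeatSemilinear : Prop :=
  ∀ F : L2 μ Ω → L2 μ Ω, LipDom μ Ω F → ∀ T > 0, ∀ g ∈ dom μ Ω,
    ∃ u : ℝ → L2 μ Ω,
      IsUniqueSolution μ Ω T (fun u => IsHeatSolution μ Ω T g (fun t => F (u t)) u) u ∧
      (∀ t ∈ Icc 0 T, HasSum (fun k => heatCoeff (lam k) (inner ℂ (φ k) g)
        (fun τ => inner ℂ (φ k) (F (u τ))) t • φ k) (u t)) ∧
      (∀ α ≥ 2, LipE μ Ω φ lam α F → g ∈ memE μ Ω φ lam α →
        LinftyE μ Ω φ lam α T u ∧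
          ∃ u' : ℝ → L2 μ Ω, HasL2Deriv μ Ω T u u' ∧ LinftyE μ Ω φ lam (α - 2) T u')

/-- Linear Schrödinger equation. -/
def SchrodingerLinear : Prop :=
  (∀ T > 0, ∀ g ∈ dom μ Ω, ∀ f : ℝ → L2 μ Ω, LinftyDom μ Ω T f →
    ∃ u : ℝ → L2 μ Ω,
      (∀ t ∈ Icc 0 T, HasSum (fun k => schrodingerCoeff (lam k) (inner ℂ (φ k) g)
        (fun τ => inner ℂ (φ k) (f τ)) t • φ k) (u t)) ∧
      (∀ᵐ t ∂volume.restrict (Icc 0 T),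
        MemDual lam (fun k => schrodingerCoeff' (lam k) (inner ℂ (φ k) g)
          (fun τ => inner ℂ (φ k) (f τ)) t) ∧
        HasDualDerivAt μ Ω u (dualSeries μ Ω φ fun k =>
          schrodingerCoeff' (lam k) (inner ℂ (φ k) g) (fun τ => inner ℂ (φ k) (f τ)) t) t) ∧
      IsUniqueSolution μ Ω T (IsSchrodingerSolution μ Ω T g f) u ∧
      (∀ α ≥ 2, g ∈ memE μ Ω φ lam α → LinftyE μ Ω φ lam α T f →
        LinftyE μ Ω φ lam α T u ∧
          ∃ u' : ℝ → L2 μ Ω, HasL2Deriv μ Ω T u u' ∧ LinftyE μ Ω φ lam (α - 2) T u')) ∧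
  ∀ T > 0, ∀ g ∈ dom μ Ω, ∀ u : ℝ → L2 μ Ω,
    (∀ t ∈ Icc 0 T, HasSum (fun k => schrodingerCoeff (lam k) (inner ℂ (φ k) g)
      (fun _ => 0) t • φ k) (u t)) →
    ∀ t ∈ Icc 0 T, u t ∈ dom μ Ω ∧ ‖u t‖ = ‖g‖ ∧
      (energy μ Ω (u t) (u t)).re = (energy μ Ω g g).re

/-- Semi-linear Schrödinger equation. -/
def SchrodingerSemilinear : Prop :=
  ∀ F : L2 μ Ω → L2 μ Ω, LipDom μ Ω F → ∀ T > 0, ∀ g ∈ dom μ Ω,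
    ∃ u : ℝ → L2 μ Ω,
      IsUniqueSolution μ Ω T (fun u => IsSchrodingerSolution μ Ω T g (fun t => F (u t)) u) u ∧
      (∀ t ∈ Icc 0 T, HasSum (fun k => schrodingerCoeff (lam k) (inner ℂ (φ k) g)
        (fun τ => inner ℂ (φ k) (F (u τ))) t • φ k) (u t)) ∧
      (∀ α ≥ 2, LipE μ Ω φ lam α F → g ∈ memE μ Ω φ lam α →
        LinftyE μ Ω φ lam α T u ∧
          ∃ u' : ℝ → L2 μ Ω, HasL2Deriv μ Ω T u u' ∧ LinftyE μ Ω φ lam (α - 2) T u')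

end Conclusions

end KreinFeller

end

/-! The equations are diagonal in an eigenbasis of the energy form, so the proof has two halves:
obtaining the spectral picture from the geometry of the measure, and solving scalar equations with
bounds that are uniform in the eigenvalue.

Geometry. In polar coordinates `1 - ⟨p, q⟩` is a sum of a polar and an azimuthal term. Half-angle
formulas show that halving the polar angle multiplies each term by a factor in `[1/4, 1/2]`. Hence
chords shrink by a factor in `[1/2, 1/√2]` (`dist_ifs`), and part (I) follows by passing to arcs.
The sets `f₁(f₁(D))` and `f₂(D)` (indices 0 and 1 in `ifs`) are a positive distance apart. A small
ball therefore loses at least one of two terms in the invariance identity, and its mass drops by a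
fixed factor when its radius is divided by 8 (`exists_ball_decay`). Iteration gives `μ(B(x, t)) ≤ C
t^s` with `s > 0`, which yields part (II) and is the only property of `μ` needed for the trace
theory.

Form. Functions on the sphere are extended to be constant along rays. Integrating differentials
along segments, with a weight adapted to `s`, bounds the `L²(μ)` oscillation at scale `r` by `r^s`
times the Dirichlet energy (`lintegral_oscillation_le`). This gives the trace inequality and, after
replacing a function by finitely many ball averages, compactness of the trace. On the complement of
the null space the gradient alone controls the full norm (`exists_coercive`): either test functions
vanish on a set of positive volume, or some bump away from `D` lies in the null space and
orthogonality to it controls a mean. Thus `dom` is a Hilbert space of gradients, compactly and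
densely embedded in `L²(Ω, μ)` (`FormData`). The spectral theorem produces an eigenbasis, and every
eigenbasis identifies `dom` isometrically with `E_1` and its dual with `E_{-1}` (`SpectralData`).

Evolution. Testing a weak solution with `φ k` gives `c' = z c + γ` with `Re z ≤ 0`; the wave
equation factors into two such equations. Duhamel's formula gives uniqueness and bounds by `|a|²`
and `∫ |γ|²`, which can be summed over `k`. Semi-linear equations become Volterra equations in
`E_α`. Conjugation by a power of the eigenvalues moves them to `L²`, where some Picard iterate is a
contraction. Higher regularity follows because the solution built in `E_α` also solves the problem
in `E_1`, where solutions are unique. -/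

noncomputable section

/-! ### Scalar evolution equations and their explicit solutions. -/

namespace KreinFeller

/-! ### Primitives of essentially bounded functions on `[0, T]` -/

section Primitive

variable {E : Type*} [NormedAddCommGroup E]

/-- `γ` is measurable and essentially bounded on `[0, T]`. -/
abbrev EssBdd (T : ℝ) (γ : ℝ → E) : Prop := MemLp γ ⊤ (volume.restrict (Icc 0 T))

theorem essBdd_of_bound {T C : ℝ} {γ : ℝ → E}
    (hm : AEStronglyMeasurable γ (volume.restrict (Icc 0 T)))
    (hC : ∀ᵐ t ∂volume.restrict (Icc 0 T), ‖γ t‖ ≤ C) : EssBdd T γ :=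
  memLp_top_of_bound hm C hC

theorem EssBdd.exists_bound {T : ℝ} {γ : ℝ → E} (h : EssBdd T γ) :
    ∃ C : ℝ, 0 ≤ C ∧ ∀ᵐ t ∂volume.restrict (Icc 0 T), ‖γ t‖ ≤ C := by
  refine ⟨(eLpNorm γ ⊤ (volume.restrict (Icc 0 T))).toReal, ENNReal.toReal_nonneg, ?_⟩
  have h1 := ae_le_eLpNormEssSup (f := γ) (μ := volume.restrict (Icc 0 T))
  filter_upwards [h1] with t ht
  have h2 : eLpNormEssSup γ (volume.restrict (Icc 0 T)) ≠ ⊤ := by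
    simpa using h.2.ne
  rw [eLpNorm_exponent_top]
  have := ENNReal.toReal_mono h2 ht
  simpa using this

theorem EssBdd.mono_interval {T s t : ℝ} {γ : ℝ → E} (h : EssBdd T γ) (hs : s ∈ Icc 0 T)
    (ht : t ∈ Icc 0 T) : IntervalIntegrable γ volume s t := by
  have : IntegrableOn γ (Icc 0 T) := h.integrable le_top
  refine (this.mono_set ?_).intervalIntegrable
  exact uIcc_subset_Icc hs ht

theorem ae_restrict_uIoc_of_Icc {T s t : ℝ} {p : ℝ → Prop}
    (h : ∀ᵐ x ∂volume.restrict (Icc 0 T), p x) (hs : s ∈ Icc 0 T) (ht : t ∈ Icc 0 T) :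
    ∀ᵐ x ∂volume, x ∈ uIoc s t → p x := by
  rw [ae_restrict_iff' measurableSet_Icc] at h
  filter_upwards [h] with x hx hxs
  exact hx (uIcc_subset_Icc hs ht (uIoc_subset_uIcc hxs))

theorem _root_.ContinuousOn.essBdd {T : ℝ} {c : ℝ → E} (h : ContinuousOn c (Icc 0 T)) :
    EssBdd T c := by
  obtain ⟨C, hC⟩ := isCompact_Icc.exists_bound_of_continuousOn h
  exact essBdd_of_bound (h.aestronglyMeasurable measurableSet_Icc)
    ((ae_restrict_iff' measurableSet_Icc).2 (Eventually.of_forall hC))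

variable [NormedSpace ℝ E]

/-- `c` is an indefinite integral on `[0, T]` of the essentially bounded function `g`. -/
def IsPrimitive (T : ℝ) (c g : ℝ → E) : Prop :=
  EssBdd T g ∧ ∀ s ∈ Icc 0 T, ∀ t ∈ Icc 0 T, c t - c s = ∫ τ in s..t, g τ

theorem IsPrimitive.lipschitz {T : ℝ} {c g : ℝ → E} (h : IsPrimitive T c g) :
    ∃ K : NNReal, LipschitzOnWith K c (Icc 0 T) := by
  obtain ⟨C, hC0, hC⟩ := h.1.exists_bound
  refine ⟨⟨C, hC0⟩, LipschitzOnWith.of_dist_le_mul fun x hx y hy => ?_⟩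
  rw [dist_eq_norm, h.2 y hy x hx, dist_comm, Real.dist_eq, abs_sub_comm]
  exact intervalIntegral.norm_integral_le_of_norm_le_const_ae
    (ae_restrict_uIoc_of_Icc hC hy hx)

theorem IsPrimitive.continuousOn {T : ℝ} {c g : ℝ → E} (h : IsPrimitive T c g) :
    ContinuousOn c (Icc 0 T) :=
  h.lipschitz.choose_spec.continuousOn

theorem IsPrimitive.ac {T : ℝ} {c g : ℝ → E} (hT : 0 ≤ T) (h : IsPrimitive T c g) :
    AbsolutelyContinuousOnInterval c 0 T := by
  obtain ⟨K, hK⟩ := h.lipschitz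
  rw [← uIcc_of_le hT] at hK
  exact hK.absolutelyContinuousOnInterval

theorem IsPrimitive.of_zero {T : ℝ} {c g : ℝ → E} (hg : EssBdd T g)
    (h : ∀ t ∈ Icc 0 T, c t = c 0 + ∫ τ in (0 : ℝ)..t, g τ) : IsPrimitive T c g := by
  refine ⟨hg, fun s hs t ht => ?_⟩
  have h0 : (0 : ℝ) ∈ Icc 0 T := ⟨le_rfl, hs.1.trans hs.2⟩
  rw [h s hs, h t ht, ← intervalIntegral.integral_interval_sub_left (hg.mono_interval h0 ht)
    (hg.mono_interval h0 hs)]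
  abel

theorem IsPrimitive.ae_hasDerivAt [CompleteSpace E] {T : ℝ} {c g : ℝ → E}
    (h : IsPrimitive T c g) :
    ∀ᵐ t ∂volume.restrict (Icc 0 T), HasDerivAt c (g t) t := by
  rcases lt_or_ge T 0 with hT | hT
  · simp [Icc_eq_empty hT.not_ge]
  have h0 : (0 : ℝ) ∈ Icc 0 T := ⟨le_rfl, hT⟩
  have h1 := (h.1.mono_interval h0 ⟨hT, le_rfl⟩).ae_hasDerivAt_integral
  rw [ae_restrict_iff' measurableSet_Icc]
  -- The endpoints are discarded: `c` is arbitrary outside `[0, T]`, so a two-sided derivative may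
  -- fail to exist there.
  have e0 : ∀ᵐ x : ℝ, x ≠ 0 := by simp [ae_iff, measure_singleton]
  have e1 : ∀ᵐ x : ℝ, x ≠ T := by simp [ae_iff, measure_singleton]
  filter_upwards [h1, e0, e1] with t ht ht0 htT htI
  have ht' := ht (by rwa [uIcc_of_le hT]) 0 (by simp)
  have : HasDerivAt (fun x => c 0 + ∫ τ in (0 : ℝ)..x, g τ) (g t) t := ht'.const_add _
  refine this.congr_of_eventuallyEq ?_
  have hmem : Ioo 0 T ∈ 𝓝 t :=
    Ioo_mem_nhds (lt_of_le_of_ne htI.1 (Ne.symm ht0)) (lt_of_le_of_ne htI.2 htT)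
  filter_upwards [hmem] with x hx
  rw [← h.2 0 h0 x ⟨hx.1.le, hx.2.le⟩]
  abel

theorem IsPrimitive.integral {T : ℝ} {g : ℝ → E} (hg : EssBdd T g) :
    IsPrimitive T (fun t => ∫ τ in (0 : ℝ)..t, g τ) g :=
  .of_zero hg fun t _ => by simp

theorem IsPrimitive.congr {T : ℝ} {c c' g g' : ℝ → E} (h : IsPrimitive T c g)
    (hc : ∀ t ∈ Icc 0 T, c t = c' t) (hg : ∀ᵐ t ∂volume.restrict (Icc 0 T), g t = g' t) :
    IsPrimitive T c' g' := by
  refine ⟨(memLp_congr_ae hg).1 h.1, fun s hs t ht => ?_⟩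
  rw [← hc s hs, ← hc t ht, h.2 s hs t ht]
  exact intervalIntegral.integral_congr_ae (ae_restrict_uIoc_of_Icc hg hs ht)

theorem IsPrimitive.add {T : ℝ} {c c' g g' : ℝ → E} (h : IsPrimitive T c g)
    (h' : IsPrimitive T c' g') : IsPrimitive T (fun t => c t + c' t) (fun t => g t + g' t) := by
  refine ⟨h.1.add h'.1, fun s hs t ht => ?_⟩
  rw [intervalIntegral.integral_add (h.1.mono_interval hs ht) (h'.1.mono_interval hs ht),
    ← h.2 s hs t ht, ← h'.2 s hs t ht]
  exact add_sub_add_comm _ _ _ _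

theorem IsPrimitive.sub {T : ℝ} {c c' g g' : ℝ → E} (h : IsPrimitive T c g)
    (h' : IsPrimitive T c' g') : IsPrimitive T (fun t => c t - c' t) (fun t => g t - g' t) := by
  refine ⟨h.1.sub h'.1, fun s hs t ht => ?_⟩
  rw [intervalIntegral.integral_sub (h.1.mono_interval hs ht) (h'.1.mono_interval hs ht),
    ← h.2 s hs t ht, ← h'.2 s hs t ht]
  exact sub_sub_sub_comm _ _ _ _

theorem IsPrimitive.const_mul {T : ℝ} {c g : ℝ → ℂ} (h : IsPrimitive T c g) (z : ℂ) :
    IsPrimitive T (fun t => z * c t) (fun t => z * g t) := by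
  refine ⟨h.1.const_mul z, fun s hs t ht => ?_⟩
  rw [intervalIntegral.integral_const_mul, ← h.2 s hs t ht]
  ring

/-- A Lipschitz function whose derivative vanishes almost everywhere is constant. -/
theorem IsPrimitive.mul_exp_const {T : ℝ} (hT : 0 ≤ T) {c g : ℝ → ℂ} (h : IsPrimitive T c g)
    (w : ℂ) : IsPrimitive T (fun t => Complex.exp (w * t) * c t)
      (fun t => w * Complex.exp (w * t) * c t + Complex.exp (w * t) * g t) := by
  have hexp : Continuous fun t : ℝ => Complex.exp (w * t) := by fun_prop
  have hb : EssBdd T fun t : ℝ => w * Complex.exp (w * t) * c t + Complex.exp (w * t) * g t := by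
    refine MemLp.add ?_ ?_
    · exact ((continuous_const.mul hexp).continuousOn.mul h.continuousOn).essBdd
    · exact h.1.mul (r := ⊤) hexp.continuousOn.essBdd
  refine IsPrimitive.of_zero hb ?_
  -- The product rule is only available almost everywhere. The product minus the integral of its
  -- a.e. derivative is absolutely continuous with derivative zero a.e., hence constant.
  have hI := IsPrimitive.integral hb
  have hac : AbsolutelyContinuousOnInterval
      (fun t : ℝ => Complex.exp (w * t) * c t -
        ∫ τ in (0 : ℝ)..t, (w * Complex.exp (w * τ) * c τ + Complex.exp (w * τ) * g τ)) 0 T := by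
    have h1 : AbsolutelyContinuousOnInterval (fun t : ℝ => Complex.exp (w * t)) 0 T :=
      ContDiffOn.absolutelyContinuousOnInterval
        (((contDiff_const.mul Complex.ofRealCLM.contDiff).cexp).contDiffOn)
    exact (h1.fun_smul (h.ac hT)).fun_sub (hI.ac hT)
  obtain ⟨C, hC⟩ := hac.const_of_ae_hasDerivAt_zero (by
    have h1 := h.ae_hasDerivAt
    have h2 := hI.ae_hasDerivAt
    rw [ae_restrict_iff' measurableSet_Icc] at h1 h2
    filter_upwards [h1, h2] with t h1 h2 ht
    rw [uIcc_of_le hT] at ht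
    have h3 : HasDerivAt (fun t : ℝ => Complex.exp (w * t)) (Complex.exp (w * t) * (w * 1)) t :=
      ((hasDerivAt_id t).ofReal_comp.const_mul w).cexp
    have := (h3.mul (h1 ht)).sub (h2 ht)
    convert! this using 1
    ring)
  intro t ht
  rw [uIcc_of_le hT] at hC
  have a1 := hC t ht
  have a2 := hC 0 ⟨le_rfl, hT⟩
  simp only [intervalIntegral.integral_same, sub_zero] at a2
  rw [a2, ← a1]
  ring

end Primitive

/-! ### The scalar Duhamel formula -/

/-- The solution of `c' = z c + γ`, `c 0 = a`. -/
def duhamel (z a : ℂ) (γ : ℝ → ℂ) (t : ℝ) : ℂ :=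
  Complex.exp (z * t) * a + ∫ τ in (0 : ℝ)..t, Complex.exp (z * (t - τ)) * γ τ

/-- Pulling `exp (z t)` out of the integral leaves `t` only in the upper limit, so that the product
rule `mul_exp_const` applies. -/
theorem duhamel_eq (z a : ℂ) (γ : ℝ → ℂ) (t : ℝ) : duhamel z a γ t =
    Complex.exp (z * t) * (a + ∫ τ in (0 : ℝ)..t, Complex.exp (-z * τ) * γ τ) := by
  rw [duhamel, mul_add, ← intervalIntegral.integral_const_mul]
  congr 2
  ext τ
  rw [← mul_assoc, ← Complex.exp_add]
  ring_nf

theorem duhamel_isPrimitive {T : ℝ} (hT : 0 ≤ T) (z a : ℂ) {γ : ℝ → ℂ} (hγ : EssBdd T γ) :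
    IsPrimitive T (duhamel z a γ) (fun t => z * duhamel z a γ t + γ t) := by
  have hexp : Continuous fun t : ℝ => Complex.exp (-z * t) := by fun_prop
  have h1 : EssBdd T (fun τ : ℝ => Complex.exp (-z * τ) * γ τ) :=
    hγ.mul (r := ⊤) hexp.continuousOn.essBdd
  have h2 : IsPrimitive T (fun t : ℝ => a + ∫ τ in (0 : ℝ)..t, Complex.exp (-z * τ) * γ τ)
      (fun τ : ℝ => Complex.exp (-z * τ) * γ τ) := .of_zero h1 fun t _ => by simp
  refine (h2.mul_exp_const hT z).congr (fun t _ => (duhamel_eq z a γ t).symm)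
    (Eventually.of_forall fun t => ?_)
  rw [duhamel_eq, ← mul_assoc (Complex.exp _) (Complex.exp _), ← Complex.exp_add]
  simp
  ring

/-- The integrating factor `exp (-z t)` cancels the linear term, so the initial value and the
forcing determine `c`. This is the source of all uniqueness statements for the linear equations. -/
theorem eq_duhamel {T : ℝ} (hT : 0 ≤ T) (z : ℂ) {c γ : ℝ → ℂ}
    (h : IsPrimitive T c (fun t => z * c t + γ t)) : ∀ t ∈ Icc 0 T, c t = duhamel z (c 0) γ t := by
  intro t ht
  have h1 := (h.mul_exp_const hT (-z)).2 0 ⟨le_rfl, hT⟩ t ht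
  have h2 : ∀ τ : ℝ, -z * Complex.exp (-z * τ) * c τ + Complex.exp (-z * τ) * (z * c τ + γ τ) =
      Complex.exp (-z * τ) * γ τ := fun τ => by ring
  simp only [h2] at h1
  rw [duhamel_eq, ← h1]
  simp only [Complex.ofReal_zero, mul_zero, Complex.exp_zero, one_mul, add_sub_cancel]
  rw [← mul_assoc, ← Complex.exp_add]
  simp

/-- Cauchy–Schwarz, from `∫ (‖γ‖ - x)² ≥ 0` with `x` equal to the mean of `‖γ‖` over `[0, t]`. -/
theorem integral_norm_sq_le {T t : ℝ} {γ : ℝ → ℂ} (hγ : EssBdd T γ) (ht : t ∈ Icc 0 T) :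
    (∫ τ in (0 : ℝ)..t, ‖γ τ‖) ^ 2 ≤ t * ∫ τ in (0 : ℝ)..t, ‖γ τ‖ ^ 2 := by
  have h0 : (0 : ℝ) ∈ Icc 0 T := ⟨le_rfl, ht.1.trans ht.2⟩
  have i1 : IntervalIntegrable (fun τ => ‖γ τ‖) volume 0 t := EssBdd.mono_interval (T := T) hγ.norm h0 ht
  have i2 : IntervalIntegrable (fun τ => ‖γ τ‖ ^ 2) volume 0 t := by
    have : EssBdd T (fun τ => ‖γ τ‖ * ‖γ τ‖) := hγ.norm.mul (r := ⊤) hγ.norm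
    simpa [sq] using EssBdd.mono_interval this h0 ht
  set A := ∫ τ in (0 : ℝ)..t, ‖γ τ‖
  set B := ∫ τ in (0 : ℝ)..t, ‖γ τ‖ ^ 2
  have key : ∀ x : ℝ, 0 ≤ B - 2 * x * A + x ^ 2 * t := by
    intro x
    have : ∫ τ in (0 : ℝ)..t, (‖γ τ‖ - x) ^ 2 = B - 2 * x * A + x ^ 2 * t := by
      have e : ∀ τ, (‖γ τ‖ - x) ^ 2 = ‖γ τ‖ ^ 2 - 2 * x * ‖γ τ‖ + x ^ 2 := fun τ => by ring
      simp only [e]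
      rw [intervalIntegral.integral_add (i2.sub (i1.const_mul _)) (by simp),
        intervalIntegral.integral_sub i2 (i1.const_mul _), intervalIntegral.integral_const_mul,
        intervalIntegral.integral_const]
      simp [A, B]; ring
    rw [← this]
    exact intervalIntegral.integral_nonneg ht.1 fun _ _ => sq_nonneg _
  rcases ht.1.eq_or_lt with h | h
  · subst h; simp [A]
  · have := key (A / t)
    have e : B - 2 * (A / t) * A + (A / t) ^ 2 * t = B - A ^ 2 / t := by field_simp; ring
    rw [e, sub_nonneg, div_le_iff₀ h] at this
    linarith

/-- `∫_0^T |γ|²`, used as a dominating constant. -/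
def sqInt (T : ℝ) (γ : ℝ → ℂ) : ℝ := ∫ τ in Icc 0 T, ‖γ τ‖ ^ 2

theorem sqInt_nonneg (T : ℝ) (γ : ℝ → ℂ) : 0 ≤ sqInt T γ :=
  integral_nonneg fun _ => by positivity

theorem integral_mul_sq_le {T t M : ℝ} {γ κ : ℝ → ℂ} (hγ : EssBdd T γ) (ht : t ∈ Icc 0 T)
    (hκ : ∀ s ∈ Icc 0 T, ‖κ s‖ ≤ M) :
    ‖∫ τ in (0 : ℝ)..t, κ (t - τ) * γ τ‖ ^ 2 ≤ M ^ 2 * (t * ∫ τ in (0 : ℝ)..t, ‖γ τ‖ ^ 2) := by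
  have h0 : (0 : ℝ) ∈ Icc 0 T := ⟨le_rfl, ht.1.trans ht.2⟩
  have h1 : ‖∫ τ in (0 : ℝ)..t, κ (t - τ) * γ τ‖ ≤ M * ∫ τ in (0 : ℝ)..t, ‖γ τ‖ := by
    rw [← intervalIntegral.integral_const_mul]
    refine intervalIntegral.norm_integral_le_of_norm_le ht.1 (Eventually.of_forall ?_)
      ((EssBdd.mono_interval (T := T) hγ.norm h0 ht).const_mul M)
    intro τ hτ
    rw [norm_mul]
    gcongr
    exact hκ _ ⟨by linarith [hτ.2], by linarith [hτ.1, ht.2]⟩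
  calc _ ≤ (M * ∫ τ in (0 : ℝ)..t, ‖γ τ‖) ^ 2 := by gcongr
    _ = M ^ 2 * (∫ τ in (0 : ℝ)..t, ‖γ τ‖) ^ 2 := by ring
    _ ≤ _ := by gcongr; exact integral_norm_sq_le hγ ht

theorem integral_sq_le_sqInt {T t : ℝ} {γ : ℝ → ℂ} (hγ : EssBdd T γ) (ht : t ∈ Icc 0 T) :
    ∫ τ in (0 : ℝ)..t, ‖γ τ‖ ^ 2 ≤ sqInt T γ := by
  have : EssBdd T (fun τ => ‖γ τ‖ * ‖γ τ‖) := hγ.norm.mul (r := ⊤) hγ.norm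
  have : IntegrableOn (fun τ => ‖γ τ‖ ^ 2) (Icc 0 T) := by
    simpa [sq, IntegrableOn] using this.integrable le_top
  rw [intervalIntegral.integral_of_le ht.1, sqInt]
  exact setIntegral_mono_set this (Eventually.of_forall fun _ => by positivity)
    (LE.le.eventuallyLE fun x hx => ⟨hx.1.le, hx.2.trans ht.2⟩)

/-- Since `Re z ≤ 0` the kernel is bounded by 1, so the bound does not involve the eigenvalue. It
uses `∫ |γ|²` rather than a supremum because integrals, unlike suprema, can be interchanged with the
sum over the basis. -/
theorem duhamel_norm_sq_le {T t : ℝ} {z a : ℂ} (hz : z.re ≤ 0) {γ : ℝ → ℂ} (hγ : EssBdd T γ)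
    (ht : t ∈ Icc 0 T) : ‖duhamel z a γ t‖ ^ 2 ≤ 2 * ‖a‖ ^ 2 + 2 * T * sqInt T γ := by
  have hexp : ∀ s : ℝ, 0 ≤ s → ‖Complex.exp (z * s)‖ ≤ 1 := fun s hs => by
    rw [Complex.norm_exp, Complex.re_mul_ofReal, Real.exp_le_one_iff]
    exact mul_nonpos_of_nonpos_of_nonneg hz hs
  have h1 := integral_mul_sq_le (M := 1) (κ := fun s => Complex.exp (z * s)) hγ ht
    fun s hs => hexp s hs.1
  have h2 := integral_sq_le_sqInt hγ ht
  have h3 : t * ∫ τ in (0 : ℝ)..t, ‖γ τ‖ ^ 2 ≤ T * sqInt T γ :=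
    mul_le_mul ht.2 h2 (intervalIntegral.integral_nonneg ht.1 fun _ _ => by positivity)
      (ht.1.trans ht.2)
  push_cast at h1
  have h4 : ‖Complex.exp (z * t) * a‖ ≤ ‖a‖ := by
    rw [norm_mul]
    exact mul_le_of_le_one_left (norm_nonneg _) (hexp t ht.1)
  have h5 := norm_add_le (Complex.exp (z * t) * a)
    (∫ τ in (0 : ℝ)..t, Complex.exp (z * (t - τ)) * γ τ)
  rw [duhamel]
  set A := ‖∫ τ in (0 : ℝ)..t, Complex.exp (z * (t - τ)) * γ τ‖
  set B := ‖Complex.exp (z * t) * a‖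
  have hA : 0 ≤ A := norm_nonneg _
  have hB : 0 ≤ B := norm_nonneg _
  calc _ ≤ (B + A) ^ 2 := by gcongr
    _ ≤ 2 * B ^ 2 + 2 * A ^ 2 := by nlinarith [sq_nonneg (B - A)]
    _ ≤ 2 * ‖a‖ ^ 2 + 2 * A ^ 2 := by gcongr
    _ ≤ _ := by nlinarith

/-! ### The coefficients of the three equations -/

theorem heatCoeff_eq_duhamel (l : ℝ) (a : ℂ) (γ : ℝ → ℂ) (t : ℝ) :
    heatCoeff l a γ t = duhamel (-l) a γ t := by
  simp [heatCoeff, duhamel]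

theorem heatCoeff'_eq (l : ℝ) (a : ℂ) (γ : ℝ → ℂ) (t : ℝ) :
    heatCoeff' l a γ t = -l * duhamel (-l) a γ t + γ t := by
  simp [heatCoeff', duhamel]
  ring

theorem schrodingerCoeff_eq_duhamel (l : ℝ) (a : ℂ) (γ : ℝ → ℂ) (t : ℝ) :
    schrodingerCoeff l a γ t = duhamel (-Complex.I * l) a (fun τ => -Complex.I * γ τ) t := by
  simp only [schrodingerCoeff, duhamel, mul_left_comm _ (-Complex.I) (γ _),
    intervalIntegral.integral_const_mul]
  ring

theorem schrodingerCoeff'_eq (l : ℝ) (a : ℂ) (γ : ℝ → ℂ) (t : ℝ) :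
    schrodingerCoeff' l a γ t = -Complex.I * l *
      duhamel (-Complex.I * l) a (fun τ => -Complex.I * γ τ) t + -Complex.I * γ t := by
  simp only [schrodingerCoeff', duhamel, mul_left_comm _ (-Complex.I) (γ _),
    intervalIntegral.integral_const_mul]
  linear_combination (-(l : ℂ) * ∫ τ in (0 : ℝ)..t, Complex.exp (-Complex.I * l * (t - τ)) * γ τ) * Complex.I_sq

theorem cos_add_I_sin (x : ℝ) :
    ((Real.cos x : ℝ) : ℂ) + Complex.I * (Real.sin x : ℝ) = Complex.exp (Complex.I * x) := by
  rw [mul_comm Complex.I (x : ℂ), Complex.exp_mul_I]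
  push_cast
  ring

theorem cos_sub_I_sin (x : ℝ) :
    ((Real.cos x : ℝ) : ℂ) - Complex.I * (Real.sin x : ℝ) = Complex.exp (-Complex.I * x) := by
  have := cos_add_I_sin (-x)
  simp only [Real.cos_neg, Real.sin_neg] at this
  push_cast at this ⊢
  rw [show -Complex.I * (x : ℂ) = Complex.I * -x by ring, ← this]
  ring

section Wave

variable {l T : ℝ}

/-- With `ω = √l`, the operator `∂² + l` factors as `(∂ - iω)(∂ + iω)`, so `c' + iω c` and `c' - iω
c` solve first order equations with rates `iω` and `-iω`. Everything about the wave coefficients is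
read off from these two combinations. -/
theorem wave_add (hl : 0 < l) (a b : ℂ) {γ : ℝ → ℂ} (hγ : EssBdd T γ) {t : ℝ} (ht : t ∈ Icc 0 T) :
    waveCoeff' l a b γ t + Complex.I * √l * waveCoeff l a b γ t =
      duhamel (Complex.I * √l) (b + Complex.I * √l * a) γ t := by
  have h0 : (0 : ℝ) ∈ Icc 0 T := ⟨le_rfl, ht.1.trans ht.2⟩
  have hw : ((√l : ℝ) : ℂ) ≠ 0 := by
    simpa using (Real.sqrt_pos.2 hl).ne'
  have i1 : IntervalIntegrable (fun τ => ((Real.cos (√l * (t - τ)) : ℝ) : ℂ) * γ τ) volume 0 t :=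
    ((hγ.mono_interval h0 ht).continuousOn_mul (by fun_prop))
  have i2 : IntervalIntegrable (fun τ => ((Real.sin (√l * (t - τ)) : ℝ) : ℂ) * γ τ) volume 0 t :=
    ((hγ.mono_interval h0 ht).continuousOn_mul (by fun_prop))
  have e : ∫ τ in (0 : ℝ)..t, Complex.exp (Complex.I * √l * (t - τ)) * γ τ =
      (∫ τ in (0 : ℝ)..t, ((Real.cos (√l * (t - τ)) : ℝ) : ℂ) * γ τ) +
      Complex.I * ∫ τ in (0 : ℝ)..t, ((Real.sin (√l * (t - τ)) : ℝ) : ℂ) * γ τ := by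
    rw [← intervalIntegral.integral_const_mul, ← intervalIntegral.integral_add i1 (i2.const_mul _)]
    refine intervalIntegral.integral_congr fun τ _ => ?_
    have := cos_add_I_sin (√l * (t - τ))
    push_cast at this ⊢
    rw [show Complex.I * √l * (t - τ) = Complex.I * (√l * (t - τ)) by ring, ← this]
    ring
  have e2 : Complex.exp (Complex.I * √l * t) = Real.cos (√l * t) + Complex.I * Real.sin (√l * t) := by
    rw [cos_add_I_sin]; push_cast; ring_nf
  rw [waveCoeff, waveCoeff', duhamel, e, e2]
  push_cast
  field_simp
  ring_nf
  simp only [Complex.I_sq]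
  ring

theorem wave_sub (hl : 0 < l) (a b : ℂ) {γ : ℝ → ℂ} (hγ : EssBdd T γ) {t : ℝ} (ht : t ∈ Icc 0 T) :
    waveCoeff' l a b γ t - Complex.I * √l * waveCoeff l a b γ t =
      duhamel (-(Complex.I * √l)) (b - Complex.I * √l * a) γ t := by
  have h0 : (0 : ℝ) ∈ Icc 0 T := ⟨le_rfl, ht.1.trans ht.2⟩
  have hw : ((√l : ℝ) : ℂ) ≠ 0 := by
    simpa using (Real.sqrt_pos.2 hl).ne'
  have i1 : IntervalIntegrable (fun τ => ((Real.cos (√l * (t - τ)) : ℝ) : ℂ) * γ τ) volume 0 t :=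
    ((hγ.mono_interval h0 ht).continuousOn_mul (by fun_prop))
  have i2 : IntervalIntegrable (fun τ => ((Real.sin (√l * (t - τ)) : ℝ) : ℂ) * γ τ) volume 0 t :=
    ((hγ.mono_interval h0 ht).continuousOn_mul (by fun_prop))
  have e : ∫ τ in (0 : ℝ)..t, Complex.exp (-(Complex.I * √l) * (t - τ)) * γ τ =
      (∫ τ in (0 : ℝ)..t, ((Real.cos (√l * (t - τ)) : ℝ) : ℂ) * γ τ) -
      Complex.I * ∫ τ in (0 : ℝ)..t, ((Real.sin (√l * (t - τ)) : ℝ) : ℂ) * γ τ := by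
    rw [← intervalIntegral.integral_const_mul, ← intervalIntegral.integral_sub i1 (i2.const_mul _)]
    refine intervalIntegral.integral_congr fun τ _ => ?_
    have := cos_sub_I_sin (√l * (t - τ))
    push_cast at this ⊢
    rw [show -(Complex.I * √l) * (t - τ) = -Complex.I * (√l * (t - τ)) by ring, ← this]
    ring
  have e2 : Complex.exp (-(Complex.I * √l) * t) =
      Real.cos (√l * t) - Complex.I * Real.sin (√l * t) := by
    rw [cos_sub_I_sin]; push_cast; ring_nf
  rw [waveCoeff, waveCoeff', duhamel, e, e2]
  push_cast
  field_simp
  ring_nf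
  simp only [Complex.I_sq]
  ring

theorem waveCoeff''_eq (hl : 0 < l) (a b : ℂ) (γ : ℝ → ℂ) (t : ℝ) :
    waveCoeff'' l a b γ t = -l * waveCoeff l a b γ t + γ t := by
  have hw : ((√l : ℝ) : ℂ) ≠ 0 := by
    simpa using (Real.sqrt_pos.2 hl).ne'
  have hs : (l : ℂ) = (√l : ℂ) * √l := by
    rw [← Complex.ofReal_mul, Real.mul_self_sqrt hl.le]
  rw [waveCoeff, waveCoeff'']
  push_cast
  generalize (∫ τ in (0 : ℝ)..t, Complex.sin (√l * (t - τ)) * γ τ) = J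
  rw [hs]
  field_simp
  ring

theorem wave_isPrimitive (hl : 0 < l) (a b : ℂ) {γ : ℝ → ℂ} (hγ : EssBdd T γ) (hT : 0 ≤ T) :
    IsPrimitive T (waveCoeff l a b γ) (waveCoeff' l a b γ) ∧
      IsPrimitive T (waveCoeff' l a b γ) (waveCoeff'' l a b γ) := by
  have hw : ((√l : ℝ) : ℂ) ≠ 0 := by
    simpa using (Real.sqrt_pos.2 hl).ne'
  have hs : (l : ℂ) = (√l : ℂ) * √l := by
    rw [← Complex.ofReal_mul, Real.mul_self_sqrt hl.le]
  have hP := duhamel_isPrimitive hT (Complex.I * √l) (b + Complex.I * √l * a) hγ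
  have hQ := duhamel_isPrimitive hT (-(Complex.I * √l)) (b - Complex.I * √l * a) hγ
  constructor
  · refine ((hP.sub hQ).const_mul (1 / (2 * Complex.I * √l))).congr (fun t ht => ?_) ?_
    · rw [← wave_add hl a b hγ ht, ← wave_sub hl a b hγ ht]
      field_simp
      ring
    · refine (ae_restrict_iff' measurableSet_Icc).2 (Eventually.of_forall fun t ht => ?_)
      rw [← wave_add hl a b hγ ht, ← wave_sub hl a b hγ ht]
      field_simp
      ring
  · refine ((hP.add hQ).const_mul (1 / 2)).congr (fun t ht => ?_) ?_
    · rw [← wave_add hl a b hγ ht, ← wave_sub hl a b hγ ht]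
      ring
    · refine (ae_restrict_iff' measurableSet_Icc).2 (Eventually.of_forall fun t ht => ?_)
      rw [← wave_add hl a b hγ ht, ← wave_sub hl a b hγ ht, waveCoeff''_eq hl, hs]
      linear_combination ((√l : ℂ) * √l * waveCoeff l a b γ t) * Complex.I_sq

/-- The parallelogram law turns the bounds on `c' ± i√l c` into a bound on the energy `‖c'‖² + l
‖c‖²`, with no loss in `l`. -/
theorem wave_norm_sq_le (hl : 0 < l) (a b : ℂ) {γ : ℝ → ℂ} (hγ : EssBdd T γ) {t : ℝ} (ht : t ∈ Icc 0 T) :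
    l * ‖waveCoeff l a b γ t‖ ^ 2 ≤ 4 * ‖b‖ ^ 2 + 4 * (l * ‖a‖ ^ 2) + 2 * T * sqInt T γ ∧
    ‖waveCoeff' l a b γ t‖ ^ 2 ≤ 4 * ‖b‖ ^ 2 + 4 * (l * ‖a‖ ^ 2) + 2 * T * sqInt T γ := by
  have hP := duhamel_norm_sq_le (z := Complex.I * √l) (a := b + Complex.I * √l * a) (by simp) hγ ht
  have hQ := duhamel_norm_sq_le (z := -(Complex.I * √l)) (a := b - Complex.I * √l * a)
    (by simp) hγ ht
  rw [← wave_add hl a b hγ ht] at hP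
  rw [← wave_sub hl a b hγ ht] at hQ
  have par := parallelogram_law_with_norm ℂ (waveCoeff' l a b γ t)
    (Complex.I * √l * waveCoeff l a b γ t)
  have par2 := parallelogram_law_with_norm ℂ b (Complex.I * √l * a)
  have n1 : ∀ x : ℂ, ‖Complex.I * √l * x‖ ^ 2 = l * ‖x‖ ^ 2 := fun x => by
    rw [norm_mul, norm_mul, Complex.norm_I, Complex.norm_real, Real.norm_eq_abs,
      abs_of_nonneg (Real.sqrt_nonneg l)]
    nlinarith [Real.mul_self_sqrt hl.le]
  rw [n1] at par par2
  have p1 : 0 ≤ l * ‖waveCoeff l a b γ t‖ ^ 2 := by positivity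
  constructor <;> nlinarith [sq_nonneg ‖waveCoeff' l a b γ t‖]

/-- Uniqueness for the two first order factors; their difference is `2i√l c`, and `l > 0` allows
division. -/
theorem eq_wave (hl : 0 < l) (hT : 0 ≤ T) {c c' γ : ℝ → ℂ} (hγ : EssBdd T γ) (h1 : IsPrimitive T c c')
    (h2 : IsPrimitive T c' (fun t => -l * c t + γ t)) : ∀ t ∈ Icc 0 T,
    c t = waveCoeff l (c 0) (c' 0) γ t := by
  have hw : ((√l : ℝ) : ℂ) ≠ 0 := by
    simpa using (Real.sqrt_pos.2 hl).ne'
  have hs : (l : ℂ) = (√l : ℂ) * √l := by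
    rw [← Complex.ofReal_mul, Real.mul_self_sqrt hl.le]
  intro t ht
  have hp : IsPrimitive T (fun t => c' t + Complex.I * √l * c t)
      (fun t => Complex.I * √l * (c' t + Complex.I * √l * c t) + γ t) :=
    (h2.add (h1.const_mul (Complex.I * √l))).congr (fun _ _ => rfl)
      (Eventually.of_forall fun t => by
        rw [hs]; linear_combination (-(√l : ℂ) * √l * c t) * Complex.I_sq)
  have hq : IsPrimitive T (fun t => c' t - Complex.I * √l * c t)
      (fun t => -(Complex.I * √l) * (c' t - Complex.I * √l * c t) + γ t) :=
    (h2.sub (h1.const_mul (Complex.I * √l))).congr (fun _ _ => rfl)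
      (Eventually.of_forall fun t => by
        rw [hs]; linear_combination (-(√l : ℂ) * √l * c t) * Complex.I_sq)
  have e1 := eq_duhamel hT _ hp t ht
  have e2 := eq_duhamel hT _ hq t ht
  rw [← wave_add hl (c 0) (c' 0) hγ ht] at e1
  rw [← wave_sub hl (c 0) (c' 0) hγ ht] at e2
  have : 2 * (Complex.I * √l) * c t = 2 * (Complex.I * √l) * waveCoeff l (c 0) (c' 0) γ t := by
    linear_combination e1 - e2
  exact mul_left_cancel₀ (by simp [hw]) this

end Wave

end KreinFeller

end


/-! ### Hilbert basis expansions and the weighted scale of spaces. -/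

noncomputable section

namespace KreinFeller

/-! ### Expansions in a Hilbert basis -/

section Basis

variable {X : Type*} [NormedAddCommGroup X] [InnerProductSpace ℂ X] (φ : HilbertBasis ℕ ℂ X)

/-- The vector with the given coefficients. -/
def ofCoef (c : ℕ → ℂ) : X := ∑' k, c k • φ k

theorem exists_hasSum_coef [CompleteSpace X] {c : ℕ → ℂ} (h : Summable fun k => ‖c k‖ ^ 2) :
    ∃ w, HasSum (fun k => c k • φ k) w := by
  have hm : Memℓp c 2 := memℓp_gen (by simpa using h)
  exact ⟨_, φ.hasSum_repr_symm ⟨c, hm⟩⟩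

theorem hasSum_ofCoef [CompleteSpace X] {c : ℕ → ℂ} (h : Summable fun k => ‖c k‖ ^ 2) :
    HasSum (fun k => c k • φ k) (ofCoef φ c) := by
  obtain ⟨w, hw⟩ := exists_hasSum_coef φ h
  rwa [ofCoef, hw.tsum_eq]

theorem hasSum_iff_coef {c : ℕ → ℂ} {w : X} :
    HasSum (fun k => c k • φ k) w ↔ ∀ k, inner ℂ (φ k) w = c k := by
  constructor
  · intro h k
    have h1 := (innerSL ℂ (φ k)).hasSum h
    have h2 : HasSum (fun j => (innerSL ℂ (φ k)) (c j • φ j)) (c k) := by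
      have := hasSum_ite_eq k (c k)
      refine this.congr_fun fun j => ?_
      have := orthonormal_iff_ite.1 φ.orthonormal k j
      simp only [innerSL_apply_apply, inner_smul_right, this]
      split_ifs with h1 h2 h2
      · simp [h1]
      · exact absurd h1.symm h2
      · exact absurd h2.symm h1
      · simp
    simpa using h1.unique h2
  · intro h
    have := φ.hasSum_repr w
    simpa [φ.repr_apply_apply, h] using this

theorem inner_ofCoef [CompleteSpace X] {c : ℕ → ℂ} (h : Summable fun k => ‖c k‖ ^ 2) (k : ℕ) :
    inner ℂ (φ k) (ofCoef φ c) = c k :=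
  (hasSum_iff_coef φ).1 (hasSum_ofCoef φ h) k

theorem hasSum_coef (w : X) : HasSum (fun k => (inner ℂ (φ k) w : ℂ) • φ k) w :=
  (hasSum_iff_coef φ).2 fun _ => rfl

theorem ext_coef {v w : X} (h : ∀ k, (inner ℂ (φ k) v : ℂ) = inner ℂ (φ k) w) : v = w :=
  ((hasSum_iff_coef φ).2 h).unique (hasSum_coef φ w)

theorem hasSum_inner_coef (v w : X) :
    HasSum (fun k => (inner ℂ (φ k) w : ℂ) * conj (inner ℂ (φ k) v : ℂ)) (inner ℂ v w) := by
  refine (φ.hasSum_inner_mul_inner v w).congr_fun fun k => ?_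
  rw [← inner_conj_symm v (φ k), mul_comm]

theorem hasSum_norm_sq_coef (w : X) : HasSum (fun k => ‖(inner ℂ (φ k) w : ℂ)‖ ^ 2) (‖w‖ ^ 2) := by
  have := hasSum_inner_coef φ w w
  rw [inner_self_eq_norm_sq_to_K] at this
  simp only [RCLike.mul_conj] at this
  exact_mod_cast this

theorem norm_sq_ofCoef [CompleteSpace X] {c : ℕ → ℂ} (h : Summable fun k => ‖c k‖ ^ 2) :
    ‖ofCoef φ c‖ ^ 2 = ∑' k, ‖c k‖ ^ 2 := by
  rw [← (hasSum_norm_sq_coef φ (ofCoef φ c)).tsum_eq]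
  simp only [inner_ofCoef φ h]

theorem sum_norm_sq_coef_le (w : X) (s : Finset ℕ) :
    ∑ k ∈ s, ‖(inner ℂ (φ k) w : ℂ)‖ ^ 2 ≤ ‖w‖ ^ 2 :=
  sum_le_hasSum s (fun _ _ => by positivity) (hasSum_norm_sq_coef φ w)

theorem aestronglyMeasurable_of_coef {Y : Type*} [MeasurableSpace Y] {ν : Measure Y} {u : Y → X}
    (h : ∀ k, AEStronglyMeasurable (fun y => (inner ℂ (φ k) (u y) : ℂ)) ν) :
    AEStronglyMeasurable u ν := by
  refine aestronglyMeasurable_of_tendsto_ae atTop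
    (f := fun n y => ∑ k ∈ Finset.range n, (inner ℂ (φ k) (u y) : ℂ) • φ k) (fun n => ?_)
    (Eventually.of_forall fun y => (hasSum_coef φ (u y)).tendsto_sum_nat)
  exact Finset.aestronglyMeasurable_fun_sum _ fun k _ => (h k).smul_const _

theorem AEStronglyMeasurable.coef {Y : Type*} [MeasurableSpace Y] {ν : Measure Y} {u : Y → X}
    (h : AEStronglyMeasurable u ν) (k : ℕ) :
    AEStronglyMeasurable (fun y => (inner ℂ (φ k) (u y) : ℂ)) ν :=
  (innerSL ℂ (φ k)).continuous.comp_aestronglyMeasurable h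

/-- A curve is a primitive if all its coefficients are. -/
theorem IsPrimitive.of_coef [CompleteSpace X] {T : ℝ} {U V : ℝ → X} (hV : EssBdd T V)
    (h : ∀ k, IsPrimitive T (fun t => (inner ℂ (φ k) (U t) : ℂ))
      (fun t => (inner ℂ (φ k) (V t) : ℂ))) : IsPrimitive T U V := by
  refine ⟨hV, fun s hs t ht => ext_coef φ fun k => ?_⟩
  rw [inner_sub_right, (h k).2 s hs t ht]
  exact (innerSL ℂ (φ k)).intervalIntegral_comp_comm (hV.mono_interval hs ht)

theorem IsPrimitive.inner_left [CompleteSpace X] {T : ℝ} {U V : ℝ → X} (h : IsPrimitive T U V)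
    (w : X) : IsPrimitive T (fun t => (inner ℂ w (U t) : ℂ)) (fun t => (inner ℂ w (V t) : ℂ)) := by
  refine ⟨?_, fun s hs t ht => ?_⟩
  · obtain ⟨C, hC0, hC⟩ := h.1.exists_bound
    refine essBdd_of_bound (C := ‖w‖ * C)
      ((innerSL ℂ w).continuous.comp_aestronglyMeasurable h.1.1) ?_
    filter_upwards [hC] with t ht
    exact (norm_inner_le_norm _ _).trans (by gcongr)
  · rw [← inner_sub_right, h.2 s hs t ht]
    exact ((innerSL ℂ w).intervalIntegral_comp_comm (h.1.mono_interval hs ht)).symm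

/-- A curve with continuous, uniformly dominated coefficients is continuous. -/
theorem continuousOn_of_coef {T : ℝ} {U : ℝ → X} {m : ℕ → ℝ} (hm : Summable m)
    (hc : ∀ k, ContinuousOn (fun t => (inner ℂ (φ k) (U t) : ℂ)) (Icc 0 T))
    (hb : ∀ k, ∀ t ∈ Icc 0 T, ‖(inner ℂ (φ k) (U t) : ℂ)‖ ^ 2 ≤ m k) :
    ContinuousOn U (Icc 0 T) := by
  intro t ht
  rw [ContinuousWithinAt, tendsto_iff_norm_sub_tendsto_zero]
  -- Dominated convergence for the series of squared coefficients of `U s - U t`. The bound `4 * m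
  -- k` comes from `|x - y|² ≤ 2|x|² + 2|y|²`.
  have key : Tendsto (fun s => ∑' k, ‖(inner ℂ (φ k) (U s - U t) : ℂ)‖ ^ 2) (𝓝[Icc 0 T] t)
      (𝓝 (∑' _ : ℕ, (0 : ℝ))) := by
    refine tendsto_tsum_of_dominated_convergence (bound := fun k => 4 * m k) (hm.mul_left 4)
      (fun k => ?_) ?_
    · have h1 := Tendsto.sub (hc k t ht) (tendsto_const_nhds (x := (inner ℂ (φ k) (U t) : ℂ)))
      rw [sub_self] at h1
      have h2 := (h1.norm).pow 2
      simpa [inner_sub_right] using h2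
    · filter_upwards [self_mem_nhdsWithin] with s hs k
      have h1 := hb k s hs
      have h2 := hb k t ht
      rw [inner_sub_right, Real.norm_of_nonneg (by positivity)]
      have h3 := norm_sub_le (inner ℂ (φ k) (U s) : ℂ) (inner ℂ (φ k) (U t) : ℂ)
      have h4 := norm_nonneg ((inner ℂ (φ k) (U s) : ℂ) - inner ℂ (φ k) (U t))
      nlinarith [sq_nonneg (‖(inner ℂ (φ k) (U s) : ℂ)‖ - ‖(inner ℂ (φ k) (U t) : ℂ)‖)]
  simp only [tsum_zero, (hasSum_norm_sq_coef φ _).tsum_eq] at key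
  have := key.sqrt
  simpa using this

end Basis

/-! ### Weighted square summability of families of functions -/

section Weighted

variable {lam : ℕ → ℝ} {c₀ : ℝ}

/-- The lower bound `c₀` of the spectrum makes the scale nested: a larger exponent gives a smaller
space, with a continuous inclusion. -/
theorem rpow_le_mul_rpow (h0 : 0 < c₀) {x : ℝ} (hx : c₀ ≤ x) {α β : ℝ} (h : α ≤ β) :
    x ^ α ≤ c₀ ^ (α - β) * x ^ β := by
  have hx0 : 0 < x := h0.trans_le hx
  have : x ^ α = x ^ (α - β) * x ^ β := by rw [← Real.rpow_add hx0]; simp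
  rw [this]
  exact mul_le_mul_of_nonneg_right (Real.rpow_le_rpow_of_nonpos h0 hx (sub_nonpos.2 h))
    (Real.rpow_nonneg hx0.le _)

theorem summable_two {a b x : ℕ → ℝ} (ha : Summable a) (hb : Summable b) (hx : ∀ k, 0 ≤ x k)
    (h : ∀ k, x k ≤ 2 * a k + 2 * b k) :
    Summable x ∧ ∑' k, x k ≤ 2 * ∑' k, a k + 2 * ∑' k, b k := by
  have hs := (ha.mul_left 2).add (hb.mul_left 2)
  have hx' := Summable.of_nonneg_of_le hx h hs
  refine ⟨hx', (hx'.tsum_le_tsum h hs).trans_eq ?_⟩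
  rw [(ha.mul_left 2).tsum_add (hb.mul_left 2), tsum_mul_left, tsum_mul_left]

/-- Essential boundedness on `[0, T]` of the weighted `ℓ²` norm of a family of functions. -/
def CoefBdd (lam : ℕ → ℝ) (α T : ℝ) (c : ℕ → ℝ → ℂ) : Prop :=
  (∀ k, AEStronglyMeasurable (c k) (volume.restrict (Icc 0 T))) ∧
    ∃ B : ℝ, ∀ᵐ t ∂volume.restrict (Icc 0 T),
      Summable (fun k => ‖c k t‖ ^ 2 * lam k ^ α) ∧ ∑' k, ‖c k t‖ ^ 2 * lam k ^ α ≤ B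

theorem summable_weight_mono (h0 : 0 < c₀) (hl : ∀ k, c₀ ≤ lam k) {x : ℕ → ℝ} (hx : ∀ k, 0 ≤ x k)
    {α β : ℝ} (h : α ≤ β) (hs : Summable fun k => x k * lam k ^ β) :
    Summable (fun k => x k * lam k ^ α) ∧
      ∑' k, x k * lam k ^ α ≤ c₀ ^ (α - β) * ∑' k, x k * lam k ^ β := by
  have hle : ∀ k, x k * lam k ^ α ≤ c₀ ^ (α - β) * (x k * lam k ^ β) := fun k => by
    calc _ ≤ x k * (c₀ ^ (α - β) * lam k ^ β) :=
          mul_le_mul_of_nonneg_left (rpow_le_mul_rpow h0 (hl k) h) (hx k)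
      _ = _ := by ring
  have h1 : Summable (fun k => x k * lam k ^ α) :=
    Summable.of_nonneg_of_le (fun k => mul_nonneg (hx k)
      (Real.rpow_nonneg (h0.le.trans (hl k)) _)) hle (hs.mul_left _)
  exact ⟨h1, (h1.tsum_le_tsum hle (hs.mul_left _)).trans_eq tsum_mul_left⟩

theorem CoefBdd.mono (h0 : 0 < c₀) (hl : ∀ k, c₀ ≤ lam k) {α β T : ℝ} (h : α ≤ β)
    {c : ℕ → ℝ → ℂ} (hc : CoefBdd lam β T c) : CoefBdd lam α T c := by
  obtain ⟨B, hB⟩ := hc.2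
  refine ⟨hc.1, c₀ ^ (α - β) * B, ?_⟩
  filter_upwards [hB] with t ht
  obtain ⟨h1, h2⟩ := summable_weight_mono h0 hl (fun k => sq_nonneg ‖c k t‖) h ht.1
  refine ⟨h1, h2.trans ?_⟩
  have := Real.rpow_nonneg h0.le (α - β)
  gcongr
  exact ht.2

theorem CoefBdd.of_dominated {α T : ℝ} (hl : ∀ k, 0 ≤ lam k) {c : ℕ → ℝ → ℂ} {m : ℕ → ℝ}
    (hm : Summable m)
    (hc : ∀ k, AEStronglyMeasurable (c k) (volume.restrict (Icc 0 T)))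
    (hb : ∀ k, ∀ t ∈ Icc 0 T, ‖c k t‖ ^ 2 * lam k ^ α ≤ m k) : CoefBdd lam α T c := by
  refine ⟨hc, ∑' k, m k, (ae_restrict_iff' measurableSet_Icc).2 (Eventually.of_forall fun t ht => ?_)⟩
  have h1 : Summable (fun k => ‖c k t‖ ^ 2 * lam k ^ α) :=
    Summable.of_nonneg_of_le (fun k => mul_nonneg (sq_nonneg _) (Real.rpow_nonneg (hl k) _))
      (fun k => hb k t ht) hm
  exact ⟨h1, h1.tsum_le_tsum (fun k => hb k t ht) hm⟩

/-- The shape of the derivative in first order equations. -/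
theorem CoefBdd.mul_add {α T : ℝ} (h0 : 0 < c₀) (hl : ∀ k, c₀ ≤ lam k) {c γ : ℕ → ℝ → ℂ}
    (hc : CoefBdd lam (α + 2) T c) (hγ : CoefBdd lam α T γ) {ζ σ : ℂ} (hζ : ‖ζ‖ = 1)
    (hσ : ‖σ‖ = 1) : CoefBdd lam α T (fun k t => ζ * lam k * c k t + σ * γ k t) := by
  obtain ⟨B, hB⟩ := hc.2
  obtain ⟨B', hB'⟩ := hγ.2
  refine ⟨fun k => ((hc.1 k).const_mul _).add ((hγ.1 k).const_mul _), 2 * B + 2 * B', ?_⟩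
  filter_upwards [hB, hB'] with t h1 h2
  have hp : ∀ k, 0 < lam k := fun k => h0.trans_le (hl k)
  have := summable_two h1.1 h2.1 (x := fun k => ‖ζ * lam k * c k t + σ * γ k t‖ ^ 2 * lam k ^ α)
    (fun k => mul_nonneg (sq_nonneg _) (Real.rpow_nonneg (hp k).le _)) fun k => by
      have e1 : ‖ζ * lam k * c k t‖ = lam k * ‖c k t‖ := by
        rw [norm_mul, norm_mul, hζ, Complex.norm_real, Real.norm_of_nonneg (hp k).le, one_mul]
      have e2 : ‖σ * γ k t‖ = ‖γ k t‖ := by rw [norm_mul, hσ, one_mul]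
      have e3 := norm_add_le (ζ * lam k * c k t) (σ * γ k t)
      rw [e1, e2] at e3
      have e4 : lam k ^ (α + 2) = lam k ^ 2 * lam k ^ α := by
        rw [Real.rpow_add (hp k), mul_comm]; norm_num
      have e5 := (Real.rpow_pos_of_pos (hp k) α)
      calc _ ≤ (lam k * ‖c k t‖ + ‖γ k t‖) ^ 2 * lam k ^ α := by gcongr
        _ ≤ (2 * (lam k * ‖c k t‖) ^ 2 + 2 * ‖γ k t‖ ^ 2) * lam k ^ α := by
          gcongr
          nlinarith [sq_nonneg (lam k * ‖c k t‖ - ‖γ k t‖)]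
        _ = _ := by rw [e4]; ring
  exact ⟨this.1, this.2.trans (by linarith [h1.2, h2.2])⟩

theorem CoefBdd.essBdd {α T : ℝ} (hl : ∀ k, 0 < lam k) {c : ℕ → ℝ → ℂ}
    (hc : CoefBdd lam α T c) (k : ℕ) : EssBdd T (c k) := by
  obtain ⟨B, hB⟩ := hc.2
  refine essBdd_of_bound (C := √(B / lam k ^ α)) (hc.1 k) ?_
  filter_upwards [hB] with t ht
  have hp := Real.rpow_pos_of_pos (hl k) α
  refine Real.le_sqrt_of_sq_le ?_
  rw [le_div_iff₀ hp]
  exact (ht.1.le_tsum k fun j _ => mul_nonneg (sq_nonneg _)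
    (Real.rpow_nonneg (hl j).le _)).trans ht.2

/-- Finite sums commute with the time integral, and the integrand is at most `B`, so every partial
sum is at most `B * T`. This makes the scalar bounds in terms of `sqInt` summable. -/
theorem CoefBdd.summable_sqInt {α T : ℝ} (hT : 0 ≤ T) (hl : ∀ k, 0 < lam k) {c : ℕ → ℝ → ℂ}
    (hc : CoefBdd lam α T c) : Summable fun k => sqInt T (c k) * lam k ^ α := by
  obtain ⟨B, hB⟩ := hc.2
  have hp := fun k => Real.rpow_pos_of_pos (hl k) α
  have hi : ∀ k, Integrable (fun t => ‖c k t‖ ^ 2) (volume.restrict (Icc 0 T)) := fun k => by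
    have : EssBdd T (fun τ => ‖c k τ‖ * ‖c k τ‖) := (hc.essBdd hl k).norm.mul (r := ⊤)
      (hc.essBdd hl k).norm
    simpa [sq] using this.integrable le_top
  refine summable_of_sum_le (c := B * T)
    (fun k => mul_nonneg (sqInt_nonneg _ _) (hp k).le) fun s => ?_
  have e : ∑ k ∈ s, sqInt T (c k) * lam k ^ α = ∫ t in Icc 0 T, ∑ k ∈ s, ‖c k t‖ ^ 2 * lam k ^ α := by
    rw [integral_finsetSum _ fun k _ => (hi k).mul_const _]
    exact Finset.sum_congr rfl fun k _ => (integral_mul_const _ _).symm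
  rw [e]
  have : ∫ t in Icc 0 T, ∑ k ∈ s, ‖c k t‖ ^ 2 * lam k ^ α ≤ ∫ t in Icc 0 T, B := by
    refine integral_mono_ae (integrable_finsetSum _ fun k _ => (hi k).mul_const _) (by simp) ?_
    filter_upwards [hB] with t ht
    exact (ht.1.sum_le_tsum s fun k _ => mul_nonneg (sq_nonneg _) (hp k).le).trans ht.2
  simpa [hT, mul_comm] using this

end Weighted

/-! ### The scale of spaces defined by a Hilbert basis -/

section Scale

variable {X : Type*} [NormedAddCommGroup X] [InnerProductSpace ℂ X]
  (φ : HilbertBasis ℕ ℂ X) (lam : ℕ → ℝ)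

/-- `w` belongs to the space with weight `lam ^ α`. -/
def EMem (α : ℝ) (w : X) : Prop := Summable fun k => ‖(inner ℂ (φ k) w : ℂ)‖ ^ 2 * lam k ^ α

/-- The norm of the space with weight `lam ^ α`. -/
def ENorm (α : ℝ) (w : X) : ℝ := √(∑' k, ‖(inner ℂ (φ k) w : ℂ)‖ ^ 2 * lam k ^ α)

/-- Essentially bounded functions with values in the space with weight `lam ^ α`. -/
def ELinfty (α T : ℝ) (u : ℝ → X) : Prop :=
  AEStronglyMeasurable u (volume.restrict (Icc 0 T)) ∧
    (∀ᵐ t ∂volume.restrict (Icc 0 T), EMem φ lam α (u t)) ∧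
    ∃ C : ℝ, ∀ᵐ t ∂volume.restrict (Icc 0 T), ENorm φ lam α (u t) ≤ C

variable {lam}

theorem eLinfty_iff (hl : ∀ k, 0 ≤ lam k) {α T : ℝ} {u : ℝ → X} :
    ELinfty φ lam α T u ↔ CoefBdd lam α T (fun k t => (inner ℂ (φ k) (u t) : ℂ)) := by
  constructor
  · rintro ⟨h1, h2, C, h3⟩
    refine ⟨fun k => AEStronglyMeasurable.coef φ h1 k, C ^ 2, ?_⟩
    filter_upwards [h2, h3] with t h2 h3
    refine ⟨h2, ?_⟩
    have h4 : 0 ≤ ∑' k, ‖(inner ℂ (φ k) (u t) : ℂ)‖ ^ 2 * lam k ^ α :=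
      tsum_nonneg fun k => mul_nonneg (sq_nonneg _) (Real.rpow_nonneg (hl k) _)
    rw [← Real.sq_sqrt h4]
    exact pow_le_pow_left₀ (Real.sqrt_nonneg _) h3 2
  · rintro ⟨h1, B, h2⟩
    refine ⟨aestronglyMeasurable_of_coef φ h1, ?_, √B, ?_⟩
    · filter_upwards [h2] with t h using h.1
    · filter_upwards [h2] with t h using Real.sqrt_le_sqrt h.2

variable (lam) in
/-- Multiplication of the coefficients by `lam ^ α`. -/
def diagPow (α : ℝ) (w : X) : X := ofCoef φ fun k => (lam k ^ α : ℝ) * inner ℂ (φ k) w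

theorem norm_sq_weight {x α : ℝ} (hx : 0 < x) (z : ℂ) :
    ‖((x ^ (α / 2) : ℝ) : ℂ) * z‖ ^ 2 = ‖z‖ ^ 2 * x ^ α := by
  rw [norm_mul, Complex.norm_real, Real.norm_of_nonneg (Real.rpow_nonneg hx.le _), mul_pow,
    ← Real.rpow_natCast (x ^ (α / 2)), ← Real.rpow_mul hx.le, mul_comm]
  norm_num

theorem EMem.summable (hl : ∀ k, 0 < lam k) {α : ℝ} {w : X} (h : EMem φ lam α w) :
    Summable fun k => ‖((lam k ^ (α / 2) : ℝ) : ℂ) * (inner ℂ (φ k) w : ℂ)‖ ^ 2 := by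
  refine (summable_congr fun k => ?_).1 h
  rw [norm_sq_weight (hl k)]

theorem EMem.inner_diagPow [CompleteSpace X] (hl : ∀ k, 0 < lam k) {α : ℝ} {w : X} (h : EMem φ lam α w) (k : ℕ) :
    (inner ℂ (φ k) (diagPow φ lam (α / 2) w) : ℂ) = (lam k ^ (α / 2) : ℝ) * inner ℂ (φ k) w :=
  inner_ofCoef φ (h.summable φ hl) k

/-- With the halved exponent, `diagPow` is an isometry from the space of weight `lam ^ α` to `X`.
Questions in the scale are moved to `X` through it. -/
theorem EMem.norm_diagPow [CompleteSpace X] (hl : ∀ k, 0 < lam k) {α : ℝ} {w : X} (h : EMem φ lam α w) :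
    ‖diagPow φ lam (α / 2) w‖ = ENorm φ lam α w := by
  rw [ENorm, ← Real.sqrt_sq (norm_nonneg (diagPow φ lam (α / 2) w)), diagPow,
    norm_sq_ofCoef φ (h.summable φ hl)]
  simp only [norm_sq_weight (hl _)]

theorem EMem.add {α : ℝ} (hl : ∀ k, 0 < lam k) {v w : X} (hv : EMem φ lam α v)
    (hw : EMem φ lam α w) : EMem φ lam α (v + w) := by
  have hp := fun k => Real.rpow_pos_of_pos (hl k) α
  refine (summable_two hv hw (fun k => mul_nonneg (sq_nonneg _) (hp k).le) fun k => ?_).1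
  rw [inner_add_right]
  have := norm_add_le (inner ℂ (φ k) v : ℂ) (inner ℂ (φ k) w)
  calc _ ≤ (‖(inner ℂ (φ k) v : ℂ)‖ + ‖(inner ℂ (φ k) w : ℂ)‖) ^ 2 * lam k ^ α := by
        have := hp k; gcongr
    _ ≤ (2 * ‖(inner ℂ (φ k) v : ℂ)‖ ^ 2 + 2 * ‖(inner ℂ (φ k) w : ℂ)‖ ^ 2) * lam k ^ α := by
        have := hp k
        gcongr
        nlinarith [sq_nonneg (‖(inner ℂ (φ k) v : ℂ)‖ - ‖(inner ℂ (φ k) w : ℂ)‖)]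
    _ = _ := by ring

theorem EMem.smul {α : ℝ} {v : X} (hv : EMem φ lam α v) (z : ℂ) : EMem φ lam α (z • v) := by
  refine (hv.mul_left (‖z‖ ^ 2)).congr fun k => ?_
  rw [inner_smul_right, norm_mul]
  ring

theorem EMem.sub {α : ℝ} (hl : ∀ k, 0 < lam k) {v w : X} (hv : EMem φ lam α v)
    (hw : EMem φ lam α w) : EMem φ lam α (v - w) := by
  have := hv.add φ hl (hw.smul φ (-1))
  simpa [sub_eq_add_neg] using this

end Scale

end KreinFeller

end


noncomputable section

namespace KreinFeller

/-! ### Coefficient families of the linear equations -/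

section Families

variable {lam : ℕ → ℝ} {c₀ T : ℝ}

/-- A summable majorant independent of `t` gives, at once, convergence of the series at every time,
measurability of the bound and a uniform norm estimate. -/
theorem duhamel_dominated (hT : 0 ≤ T) (hl : ∀ k, 0 < lam k) {ζ σ : ℂ} (hζ : ζ.re ≤ 0)
    (hσ : ‖σ‖ = 1) {α : ℝ} {a : ℕ → ℂ} {γ : ℕ → ℝ → ℂ}
    (ha : Summable fun k => ‖a k‖ ^ 2 * lam k ^ α) (hγ : CoefBdd lam α T γ) :
    ∃ m : ℕ → ℝ, Summable m ∧ ∀ k, ∀ t ∈ Icc 0 T,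
      ‖duhamel (ζ * lam k) (a k) (fun τ => σ * γ k τ) t‖ ^ 2 * lam k ^ α ≤ m k := by
  refine ⟨fun k => 2 * (‖a k‖ ^ 2 * lam k ^ α) + 2 * T * (sqInt T (γ k) * lam k ^ α),
    (ha.mul_left 2).add ((hγ.summable_sqInt hT hl).mul_left _), fun k t ht => ?_⟩
  have hz : (ζ * lam k).re ≤ 0 := by
    rw [Complex.re_mul_ofReal]
    exact mul_nonpos_of_nonpos_of_nonneg hζ (hl k).le
  have h1 := duhamel_norm_sq_le (a := a k) hz ((hγ.essBdd hl k).const_mul σ) ht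
  have h2 : sqInt T (fun τ => σ * γ k τ) = sqInt T (γ k) := by
    simp only [sqInt, norm_mul, hσ, one_mul]
  rw [h2] at h1
  have hp := Real.rpow_pos_of_pos (hl k) α
  calc _ ≤ (2 * ‖a k‖ ^ 2 + 2 * T * sqInt T (γ k)) * lam k ^ α := by gcongr
    _ = _ := by ring

/-- The scalar energy bound contains `l ‖c‖²`, so one power of the eigenvalue is gained: position of
order `α` needs velocity and forcing only of order `α - 1`. -/
theorem wave_dominated (hT : 0 ≤ T) (hl : ∀ k, 0 < lam k) {α : ℝ} {a b : ℕ → ℂ} {γ : ℕ → ℝ → ℂ}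
    (ha : Summable fun k => ‖a k‖ ^ 2 * lam k ^ α)
    (hb : Summable fun k => ‖b k‖ ^ 2 * lam k ^ (α - 1)) (hγ : CoefBdd lam (α - 1) T γ) :
    ∃ m : ℕ → ℝ, Summable m ∧ ∀ k, ∀ t ∈ Icc 0 T,
      ‖waveCoeff (lam k) (a k) (b k) (γ k) t‖ ^ 2 * lam k ^ α ≤ m k ∧
      ‖waveCoeff' (lam k) (a k) (b k) (γ k) t‖ ^ 2 * lam k ^ (α - 1) ≤ m k := by
  refine ⟨fun k => 4 * (‖b k‖ ^ 2 * lam k ^ (α - 1)) + 4 * (‖a k‖ ^ 2 * lam k ^ α) +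
    2 * T * (sqInt T (γ k) * lam k ^ (α - 1)),
    ((hb.mul_left 4).add (ha.mul_left 4)).add ((hγ.summable_sqInt hT hl).mul_left _),
    fun k t ht => ?_⟩
  obtain ⟨h1, h2⟩ := wave_norm_sq_le (hl k) (a k) (b k) (hγ.essBdd hl k) ht
  have hp := Real.rpow_pos_of_pos (hl k) (α - 1)
  have e : lam k ^ α = lam k * lam k ^ (α - 1) := by
    nth_rewrite 2 [← Real.rpow_one (lam k)]
    rw [← Real.rpow_add (hl k)]; ring_nf
  constructor
  · calc _ = (lam k * ‖waveCoeff (lam k) (a k) (b k) (γ k) t‖ ^ 2) * lam k ^ (α - 1) := by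
          rw [e]; ring
      _ ≤ _ := mul_le_mul_of_nonneg_right h1 hp.le
      _ = _ := by beta_reduce; rw [e]; ring
  · calc _ ≤ _ := mul_le_mul_of_nonneg_right h2 hp.le
      _ = _ := by beta_reduce; rw [e]; ring

theorem summable_of_dominated {x m : ℕ → ℝ} (hx : ∀ k, 0 ≤ x k) (hm : Summable m)
    (h : ∀ k, x k ≤ m k) : Summable x :=
  Summable.of_nonneg_of_le hx h hm

end Families

section Curves

variable {X : Type*} [NormedAddCommGroup X] [InnerProductSpace ℂ X] [CompleteSpace X]
  (φ : HilbertBasis ℕ ℂ X) {lam : ℕ → ℝ} {T : ℝ}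

variable (lam) in
/-- The vector with coefficients `lam ^ (α / 2) c`. -/
def weighted (α : ℝ) (c : ℕ → ℂ) : X := ofCoef φ fun k => ((lam k ^ (α / 2) : ℝ) : ℂ) * c k

/-- In contrast to `diagPow`, `weighted` acts on bare coefficient sequences. For negative `α` these
may be functionals that are not vectors of `X`. -/
theorem inner_weighted (hl : ∀ k, 0 < lam k) {α : ℝ} {c : ℕ → ℂ}
    (h : Summable fun k => ‖c k‖ ^ 2 * lam k ^ α) (k : ℕ) :
    inner ℂ (φ k) (weighted φ lam α c) = ((lam k ^ (α / 2) : ℝ) : ℂ) * c k := by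
  refine inner_ofCoef φ ?_ k
  simpa only [norm_sq_weight (hl _)] using h

theorem norm_sq_weighted (hl : ∀ k, 0 < lam k) {α : ℝ} {c : ℕ → ℂ}
    (h : Summable fun k => ‖c k‖ ^ 2 * lam k ^ α) :
    ‖weighted φ lam α c‖ ^ 2 = ∑' k, ‖c k‖ ^ 2 * lam k ^ α := by
  have : Summable fun k => ‖((lam k ^ (α / 2) : ℝ) : ℂ) * c k‖ ^ 2 := by
    simpa only [norm_sq_weight (hl _)] using h
  rw [weighted, norm_sq_ofCoef φ this]
  simp only [norm_sq_weight (hl _)]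

theorem CoefBdd.essBdd_weighted (hl : ∀ k, 0 < lam k) {α : ℝ} {d : ℕ → ℝ → ℂ}
    (hd : CoefBdd lam α T d) : EssBdd T fun t => weighted φ lam α fun k => d k t := by
  obtain ⟨B, hB⟩ := hd.2
  refine essBdd_of_bound (C := √B) (aestronglyMeasurable_of_coef φ fun k => ?_) ?_
  · refine ((hd.1 k).const_mul ((lam k ^ (α / 2) : ℝ) : ℂ)).congr ?_
    filter_upwards [hB] with t ht
    rw [inner_weighted φ hl ht.1]
  · filter_upwards [hB] with t ht
    refine Real.le_sqrt_of_sq_le ?_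
    rw [norm_sq_weighted φ hl ht.1]
    exact ht.2

/-- Differentiation in the space of weight `lam ^ α` becomes differentiation in the Hilbert space
`X`. The order `α = -1` realises differentiation in the dual of `dom`. -/
theorem isPrimitive_weighted (hl : ∀ k, 0 < lam k) {α : ℝ} {c d : ℕ → ℝ → ℂ}
    (hc : ∀ t ∈ Icc 0 T, Summable fun k => ‖c k t‖ ^ 2 * lam k ^ α) (hd : CoefBdd lam α T d)
    (h : ∀ k, IsPrimitive T (c k) (d k)) :
    IsPrimitive T (fun t => weighted φ lam α fun k => c k t)
      (fun t => weighted φ lam α fun k => d k t) := by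
  refine .of_coef φ (hd.essBdd_weighted φ hl) fun k => ?_
  obtain ⟨B, hB⟩ := hd.2
  refine ((h k).const_mul ((lam k ^ (α / 2) : ℝ) : ℂ)).congr (fun t ht => ?_) ?_
  · rw [inner_weighted φ hl (hc t ht)]
  · filter_upwards [hB] with t ht
    rw [inner_weighted φ hl ht.1]

/-- Convergence of a series with dominated coefficients. -/
theorem exists_curve {c₀ : ℝ} (h0 : 0 < c₀) (hl : ∀ k, c₀ ≤ lam k) {α : ℝ} (hα : 0 ≤ α)
    {c : ℕ → ℝ → ℂ} {m : ℕ → ℝ} (hm : Summable m)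
    (hb : ∀ k, ∀ t ∈ Icc 0 T, ‖c k t‖ ^ 2 * lam k ^ α ≤ m k) :
    ∃ u : ℝ → X, ∀ t ∈ Icc 0 T, HasSum (fun k => c k t • φ k) (u t) := by
  refine ⟨fun t => ofCoef φ fun k => c k t, fun t ht => hasSum_ofCoef φ ?_⟩
  have h1 : Summable fun k => ‖c k t‖ ^ 2 * lam k ^ α := summable_of_dominated
    (fun k => mul_nonneg (sq_nonneg _) (Real.rpow_nonneg (h0.le.trans (hl k)) _)) hm
    fun k => hb k t ht
  simpa using (summable_weight_mono h0 hl (fun k => sq_nonneg ‖c k t‖) hα h1).1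

theorem eLinfty_of_hasSum (hl : ∀ k, 0 < lam k) {α : ℝ} {c : ℕ → ℝ → ℂ} {u : ℝ → X}
    (hc : CoefBdd lam α T c) (hu : ∀ t ∈ Icc 0 T, HasSum (fun k => c k t • φ k) (u t)) :
    ELinfty φ lam α T u := by
  rw [eLinfty_iff φ fun k => (hl k).le]
  have hae : ∀ᵐ t ∂volume.restrict (Icc 0 T), ∀ k, c k t = inner ℂ (φ k) (u t) :=
    (ae_restrict_iff' measurableSet_Icc).2 (Eventually.of_forall fun t ht k =>
      ((hasSum_iff_coef φ).1 (hu t ht) k).symm)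
  obtain ⟨B, hB⟩ := hc.2
  refine ⟨fun k => (hc.1 k).congr (by filter_upwards [hae] with t ht using ht k), B, ?_⟩
  filter_upwards [hae, hB] with t ht hB
  simpa only [ht] using hB

/-- The derivative of a curve whose coefficients have derivatives in a weighted space of
nonnegative order. -/
theorem exists_derivative {c₀ : ℝ} (h0 : 0 < c₀) (hl : ∀ k, c₀ ≤ lam k) {α : ℝ} (hα : 0 ≤ α)
    {c d : ℕ → ℝ → ℂ} {u : ℝ → X} (hd : CoefBdd lam α T d)
    (hu : ∀ t ∈ Icc 0 T, HasSum (fun k => c k t • φ k) (u t))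
    (h : ∀ k, IsPrimitive T (c k) (d k)) :
    ∃ v : ℝ → X, IsPrimitive T u v ∧ ELinfty φ lam α T v := by
  have hp : ∀ k, 0 < lam k := fun k => h0.trans_le (hl k)
  have hd0 := hd.mono h0 hl hα
  have e : ∀ c : ℕ → ℂ, weighted φ lam 0 c = ofCoef φ c := fun c => by simp [weighted]
  have hp1 := isPrimitive_weighted φ hp (α := 0) (c := c) (fun t ht => by
    simp only [Real.rpow_zero, mul_one]
    have := (hasSum_norm_sq_coef φ (u t)).summable
    simpa only [(hasSum_iff_coef φ).1 (hu t ht)] using this) hd0 h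
  simp only [e] at hp1
  refine ⟨_, hp1.congr (fun t ht => (hu t ht).tsum_eq) (Eventually.of_forall fun _ => rfl), ?_⟩
  rw [eLinfty_iff φ fun k => (hp k).le]
  obtain ⟨B0, hB0⟩ := hd0.2
  have hae : ∀ᵐ t ∂volume.restrict (Icc 0 T), ∀ k,
      d k t = inner ℂ (φ k) (ofCoef φ fun k => d k t) := by
    filter_upwards [hB0] with t ht k
    rw [inner_ofCoef φ]
    simpa using ht.1
  obtain ⟨B, hB⟩ := hd.2
  refine ⟨fun k => (hd.1 k).congr (by filter_upwards [hae] with t ht using ht k), B, ?_⟩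
  filter_upwards [hae, hB] with t ht hB
  simpa only [← ht] using hB

end Curves

end KreinFeller

end


/-! ### Volterra fixed points and semi-linear equations in the scale. -/

noncomputable section

namespace KreinFeller

/-! ### Volterra equations -/

theorem volterra_iterate {T K B : ℝ} (hK : 0 ≤ K) {e : ℕ → ℝ → ℝ}
    (hm : ∀ n, EssBdd T (e n)) (h0 : ∀ᵐ t ∂volume.restrict (Icc 0 T), e 0 t ≤ B)
    (hs : ∀ n, ∀ t ∈ Icc 0 T, e (n + 1) t ≤ K * ∫ τ in (0 : ℝ)..t, e n τ) (n : ℕ) :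
    ∀ t ∈ Icc 0 T, e (n + 1) t ≤ B * (K * t) ^ (n + 1) / (n + 1).factorial := by
  -- An almost everywhere bound for `e n` is enough, since it enters only through an integral, and
  -- it returns a bound for `e (n + 1)` at every point.
  have step : ∀ n, (∀ᵐ t ∂volume.restrict (Icc 0 T), e n t ≤ B * (K * t) ^ n / n.factorial) →
      ∀ t ∈ Icc 0 T, e (n + 1) t ≤ B * (K * t) ^ (n + 1) / (n + 1).factorial := by
    intro n hn t ht
    have hT : (0 : ℝ) ∈ Icc 0 T := ⟨le_rfl, ht.1.trans ht.2⟩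
    have h1 : ∫ τ in (0 : ℝ)..t, e n τ ≤ ∫ τ in (0 : ℝ)..t, B * (K * τ) ^ n / n.factorial := by
      refine intervalIntegral.integral_mono_ae_restrict ht.1 ((hm n).mono_interval hT ht)
        (Continuous.intervalIntegrable (by fun_prop) _ _) ?_
      exact ae_restrict_of_ae_restrict_of_subset (Icc_subset_Icc_right ht.2) hn
    have h2 : ∫ τ in (0 : ℝ)..t, B * (K * τ) ^ n / n.factorial =
        B * K ^ n / n.factorial * (t ^ (n + 1) / (n + 1)) := by
      have : ∀ τ : ℝ, B * (K * τ) ^ n / n.factorial = B * K ^ n / n.factorial * τ ^ n := fun τ => by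
        rw [mul_pow]; ring
      simp only [this, intervalIntegral.integral_const_mul, integral_pow]
      simp
    calc _ ≤ K * ∫ τ in (0 : ℝ)..t, e n τ := hs n t ht
      _ ≤ K * (B * K ^ n / n.factorial * (t ^ (n + 1) / (n + 1))) := by rw [← h2]; gcongr
      _ = _ := by rw [Nat.factorial_succ, mul_pow]; push_cast; field_simp; ring
  have all : ∀ n, ∀ᵐ t ∂volume.restrict (Icc 0 T), e n t ≤ B * (K * t) ^ n / n.factorial := by
    intro n
    induction n with
    | zero => simpa using h0
    | succ n ih =>
      exact (ae_restrict_iff' measurableSet_Icc).2 (Eventually.of_forall (step n ih))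
  exact step n (all n)

theorem tendsto_mul_pow_div_factorial (B x : ℝ) :
    Tendsto (fun n : ℕ => B * x ^ (n + 1) / (n + 1).factorial) atTop (𝓝 0) := by
  have := ((FloorSemiring.tendsto_pow_div_factorial_atTop x).comp (tendsto_add_atTop_nat 1)).const_mul B
  simpa [mul_div_assoc] using this

/-- Apply the iteration to the constant sequence `e`: then `e t` is below `B (K t)^(n+1) / (n+1)!`
for every `n`. -/
theorem volterra_eq_zero {T K : ℝ} (hK : 0 ≤ K) {e : ℝ → ℝ} (hm : EssBdd T e)
    (hs : ∀ t ∈ Icc 0 T, e t ≤ K * ∫ τ in (0 : ℝ)..t, e τ) : ∀ t ∈ Icc 0 T, e t ≤ 0 := by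
  intro t ht
  obtain ⟨B, _, hB⟩ := hm.exists_bound
  refine ge_of_tendsto' (tendsto_mul_pow_div_factorial B (K * t)) fun n => ?_
  exact volterra_iterate hK (e := fun _ => e) (fun _ => hm)
    (by filter_upwards [hB] with t ht using (le_abs_self _).trans ht) (fun _ => hs) n t ht

/-- The scalar solution operators of a diagonal linear evolution equation on `[0, T]`, as functions
of the forcing term. -/
structure IsSolutionFamily (T N : ℝ) (S : ℕ → (ℝ → ℂ) → ℝ → ℂ) : Prop where
  nonneg : 0 ≤ N
  congr : ∀ k γ γ', (∀ᵐ t ∂volume.restrict (Icc 0 T), γ t = γ' t) → ∀ t ∈ Icc 0 T,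
    S k γ t = S k γ' t
  continuousOn : ∀ k γ, EssBdd T γ → ContinuousOn (S k γ) (Icc 0 T)
  lipschitz : ∀ k γ γ', EssBdd T γ → EssBdd T γ' → ∀ t ∈ Icc 0 T,
    ‖S k γ t - S k γ' t‖ ^ 2 ≤ N * ∫ τ in (0 : ℝ)..t, ‖γ τ - γ' τ‖ ^ 2

section Volterra

variable {X : Type*} [NormedAddCommGroup X] [InnerProductSpace ℂ X]
  (φ : HilbertBasis ℕ ℂ X) {T N : ℝ} {S : ℕ → (ℝ → ℂ) → ℝ → ℂ}

theorem EssBdd.coef {f : ℝ → X} (hf : EssBdd T f) (k : ℕ) :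
    EssBdd T fun t => (inner ℂ (φ k) (f t) : ℂ) := by
  obtain ⟨C, _, hC⟩ := hf.exists_bound
  refine essBdd_of_bound (C := C) (AEStronglyMeasurable.coef φ hf.1 k) ?_
  filter_upwards [hC] with t ht
  refine (norm_inner_le_norm _ _).trans ?_
  rw [φ.orthonormal.1 k, one_mul]
  exact ht

theorem EssBdd.norm_sq {E : Type*} [NormedAddCommGroup E] {f : ℝ → E} (hf : EssBdd T f) :
    EssBdd T fun t => ‖f t‖ ^ 2 := by
  have : EssBdd T (fun τ => ‖f τ‖ * ‖f τ‖) := hf.norm.mul (r := ⊤) hf.norm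
  simpa [sq] using this

/-- The scalar Lipschitz bound is quadratic and integrated in time, so finite sums over `k` pass
inside the integral and Bessel's inequality finishes. -/
theorem IsSolutionFamily.sum_le (hS : IsSolutionFamily T N S) {f f' : ℝ → X} (hf : EssBdd T f)
    (hf' : EssBdd T f') {t : ℝ} (ht : t ∈ Icc 0 T) (s : Finset ℕ) :
    ∑ k ∈ s, ‖S k (fun τ => inner ℂ (φ k) (f τ)) t - S k (fun τ => inner ℂ (φ k) (f' τ)) t‖ ^ 2 ≤
      N * ∫ τ in (0 : ℝ)..t, ‖f τ - f' τ‖ ^ 2 := by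
  have h0 : (0 : ℝ) ∈ Icc 0 T := ⟨le_rfl, ht.1.trans ht.2⟩
  have hd : EssBdd T fun τ => f τ - f' τ := hf.sub hf'
  calc _ ≤ ∑ k ∈ s, N * ∫ τ in (0 : ℝ)..t, ‖(inner ℂ (φ k) (f τ - f' τ) : ℂ)‖ ^ 2 := by
        refine Finset.sum_le_sum fun k _ => ?_
        simpa only [inner_sub_right] using hS.lipschitz k _ _ (hf.coef φ k) (hf'.coef φ k) t ht
    _ = N * ∫ τ in (0 : ℝ)..t, ∑ k ∈ s, ‖(inner ℂ (φ k) (f τ - f' τ) : ℂ)‖ ^ 2 := by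
        rw [intervalIntegral.integral_finsetSum fun k _ =>
          (hd.coef φ k).norm_sq.mono_interval h0 ht, Finset.mul_sum]
    _ ≤ _ := by
        refine mul_le_mul_of_nonneg_left ?_ hS.nonneg
        refine intervalIntegral.integral_mono_on ht.1 ?_ (hd.norm_sq.mono_interval h0 ht)
          fun τ _ => sum_norm_sq_coef_le φ _ s
        have := IntervalIntegrable.sum s (f := fun k τ => ‖(inner ℂ (φ k) (f τ - f' τ) : ℂ)‖ ^ 2)
          fun k _ => (hd.coef φ k).norm_sq.mono_interval h0 ht
        exact this.congr fun τ _ => by simp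

/-- Compare with zero forcing: the difference is controlled by `N ∫ |⟨φ k, f⟩|²`, which is summable
in `k` by Bessel. -/
theorem IsSolutionFamily.dominated (hS : IsSolutionFamily T N S) (hT : 0 ≤ T) {m₀ : ℕ → ℝ}
    (hm : Summable m₀) (hb : ∀ k, ∀ t ∈ Icc 0 T, ‖S k (fun _ => 0) t‖ ^ 2 ≤ m₀ k) {f : ℝ → X}
    (hf : EssBdd T f) : ∃ m : ℕ → ℝ, Summable m ∧ ∀ k, ∀ t ∈ Icc 0 T,
      ‖S k (fun τ => inner ℂ (φ k) (f τ)) t‖ ^ 2 ≤ m k := by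
  have hz : EssBdd T fun _ => (0 : ℂ) := continuousOn_const.essBdd
  have hTT : T ∈ Icc 0 T := ⟨hT, le_rfl⟩
  have h00 : (0 : ℝ) ∈ Icc 0 T := ⟨le_rfl, hT⟩
  refine ⟨fun k => 2 * m₀ k + 2 * (N * ∫ τ in (0 : ℝ)..T, ‖(inner ℂ (φ k) (f τ) : ℂ)‖ ^ 2),
    (hm.mul_left 2).add (Summable.mul_left 2 (Summable.mul_left N ?_)), fun k t ht => ?_⟩
  · refine summable_of_sum_le (c := ∫ τ in (0 : ℝ)..T, ‖f τ‖ ^ 2)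
      (fun k => intervalIntegral.integral_nonneg hT fun _ _ => sq_nonneg _) fun s => ?_
    rw [← intervalIntegral.integral_finsetSum fun k _ =>
          (hf.coef φ k).norm_sq.mono_interval h00 hTT]
    refine intervalIntegral.integral_mono_on hT ?_ (hf.norm_sq.mono_interval h00 hTT)
          fun τ _ => sum_norm_sq_coef_le φ _ s
    have := IntervalIntegrable.sum s (f := fun k τ => ‖(inner ℂ (φ k) (f τ) : ℂ)‖ ^ 2)
          fun k _ => (hf.coef φ k).norm_sq.mono_interval h00 hTT
    exact this.congr fun τ _ => by simp
  · have h1 := hS.lipschitz k _ _ (hf.coef φ k) hz t ht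
    simp only [sub_zero] at h1
    have h2 : ∫ τ in (0 : ℝ)..t, ‖(inner ℂ (φ k) (f τ) : ℂ)‖ ^ 2 ≤
        ∫ τ in (0 : ℝ)..T, ‖(inner ℂ (φ k) (f τ) : ℂ)‖ ^ 2 :=
      intervalIntegral.integral_mono_interval le_rfl ht.1 ht.2
        (Eventually.of_forall fun _ => sq_nonneg _) ((hf.coef φ k).norm_sq.mono_interval h00 hTT)
    have h3 := mul_le_mul_of_nonneg_left h2 hS.nonneg
    have h4 := hb k t ht
    have h6 : ‖S k (fun τ => inner ℂ (φ k) (f τ)) t‖ ≤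
      ‖S k (fun τ => inner ℂ (φ k) (f τ)) t - S k (fun _ => 0) t‖ + ‖S k (fun _ => 0) t‖ := by
      simpa using norm_add_le (S k (fun τ => inner ℂ (φ k) (f τ)) t - S k (fun _ => 0) t)
        (S k (fun _ => 0) t)
    set A := ‖S k (fun τ => inner ℂ (φ k) (f τ)) t - S k (fun _ => 0) t‖
    set A' := ‖S k (fun _ => 0) t‖
    calc _ ≤ (A + A') ^ 2 := by gcongr
      _ ≤ 2 * A' ^ 2 + 2 * A ^ 2 := by nlinarith [sq_nonneg (A - A')]
      _ ≤ _ := by linarith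

theorem _root_.LipschitzWith.essBdd_comp {X : Type*} [NormedAddCommGroup X] {K : NNReal}
    {G : X → X} (hG : LipschitzWith K G)
    {f : ℝ → X} (hf : EssBdd T f) : EssBdd T fun t => G (f t) := by
  obtain ⟨C, _, hC⟩ := hf.exists_bound
  refine essBdd_of_bound (C := K * C + ‖G 0‖) (hG.continuous.comp_aestronglyMeasurable hf.1) ?_
  filter_upwards [hC] with t ht
  have h1 := hG.dist_le_mul (f t) 0
  rw [dist_eq_norm, dist_zero_right] at h1
  calc ‖G (f t)‖ = ‖(G (f t) - G 0) + G 0‖ := by simp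
    _ ≤ ‖G (f t) - G 0‖ + ‖G 0‖ := norm_add_le _ _
    _ ≤ _ := by gcongr; exact h1.trans (by gcongr)

/-- `x` solves the equation with right-hand side `G x` on `[0, T]`. -/
def IsVolterraSolution (T : ℝ) (S : ℕ → (ℝ → ℂ) → ℝ → ℂ) (G : X → X) (x : ℝ → X) : Prop :=
  ∀ t ∈ Icc 0 T, ∀ k, inner ℂ (φ k) (x t) = S k (fun τ => inner ℂ (φ k) (G (x τ))) t

/-- A linear Volterra inequality for squared distances. With `x' = x`, `y' = y` it gives uniqueness;
with `x'`, `y'` the next Picard iterates it gives contraction. -/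
theorem norm_sq_sub_le (hS : IsSolutionFamily T N S) {K : NNReal} {G : X → X}
    (hG : LipschitzWith K G) {x y x' y' : ℝ → X} (hx : EssBdd T x) (hy : EssBdd T y) {t : ℝ}
    (ht : t ∈ Icc 0 T)
    (hx' : ∀ k, inner ℂ (φ k) (x' t) = S k (fun τ => inner ℂ (φ k) (G (x τ))) t)
    (hy' : ∀ k, inner ℂ (φ k) (y' t) = S k (fun τ => inner ℂ (φ k) (G (y τ))) t) :
    ‖x' t - y' t‖ ^ 2 ≤ N * K ^ 2 * ∫ τ in (0 : ℝ)..t, ‖x τ - y τ‖ ^ 2 := by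
  have h0 : (0 : ℝ) ∈ Icc 0 T := ⟨le_rfl, ht.1.trans ht.2⟩
  have hGx := hG.essBdd_comp hx
  have hGy := hG.essBdd_comp hy
  have h1 : ‖x' t - y' t‖ ^ 2 ≤ N * ∫ τ in (0 : ℝ)..t, ‖G (x τ) - G (y τ)‖ ^ 2 := by
    refine le_of_tendsto' (hasSum_norm_sq_coef φ (x' t - y' t)) fun s => ?_
    simpa only [inner_sub_right, hx', hy'] using hS.sum_le φ hGx hGy ht s
  refine h1.trans ?_
  rw [mul_assoc, ← intervalIntegral.integral_const_mul ((K : ℝ) ^ 2)]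
  refine mul_le_mul_of_nonneg_left ?_ hS.nonneg
  refine intervalIntegral.integral_mono_on ht.1
    (EssBdd.mono_interval (EssBdd.norm_sq (hGx.sub hGy)) h0 ht)
    ((EssBdd.mono_interval (EssBdd.norm_sq (hx.sub hy)) h0 ht).const_mul _) fun τ _ => ?_
  rw [← mul_pow, ← dist_eq_norm, ← dist_eq_norm]
  exact pow_le_pow_left₀ dist_nonneg (hG.dist_le_mul _ _) 2

theorem IsVolterraSolution.unique (hS : IsSolutionFamily T N S) {K : NNReal} {G : X → X}
    (hG : LipschitzWith K G) {x y : ℝ → X} (hx : EssBdd T x) (hy : EssBdd T y)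
    (h : IsVolterraSolution φ T S G x) (h' : IsVolterraSolution φ T S G y) :
    ∀ t ∈ Icc 0 T, x t = y t := by
  intro t ht
  have h1 := volterra_eq_zero (K := N * K ^ 2) (mul_nonneg hS.nonneg (by positivity))
    (EssBdd.norm_sq (hx.sub hy))
    (fun t ht => norm_sq_sub_le φ hS hG hx hy ht (h t ht) (h' t ht)) t ht
  have h2 : ‖x t - y t‖ = 0 := by
    have := sq_nonneg ‖x t - y t‖
    exact pow_eq_zero_iff two_ne_zero |>.1 (le_antisymm h1 this)
  exact sub_eq_zero.1 (norm_eq_zero.1 h2)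

/-- Picard iteration in `C([0, T], X)`. No smallness of `T` is needed because the Lipschitz
constants of the iterates decay like a factorial. -/
theorem exists_isVolterraSolution [CompleteSpace X] (hT : 0 < T) (hS : IsSolutionFamily T N S)
    {m₀ : ℕ → ℝ} (hm : Summable m₀) (hb : ∀ k, ∀ t ∈ Icc 0 T, ‖S k (fun _ => 0) t‖ ^ 2 ≤ m₀ k)
    {K : NNReal} {G : X → X} (hG : LipschitzWith K G) :
    ∃ x : ℝ → X, EssBdd T x ∧ IsVolterraSolution φ T S G x := by
  have hT' := hT.le
  let Y := C(Icc (0 : ℝ) T, X)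
  -- Constant extension beyond the endpoints, only to have a function on `ℝ`; the values outside
  -- `[0, T]` never enter.
  let ext : Y → ℝ → X := fun x => IccExtend hT' x
  have hext : ∀ x, EssBdd T (ext x) := fun x =>
    (x.continuous.Icc_extend').continuousOn.essBdd
  let Ψ : Y → ℝ → X := fun x t => ofCoef φ fun k => S k (fun τ => inner ℂ (φ k) (G (ext x τ))) t
  have hΨ : ∀ x, ∀ t ∈ Icc 0 T, ∀ k, inner ℂ (φ k) (Ψ x t) =
      S k (fun τ => inner ℂ (φ k) (G (ext x τ))) t := by
    intro x t ht k
    obtain ⟨m, hm1, hm2⟩ := hS.dominated φ hT' hm hb (hG.essBdd_comp (hext x))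
    exact inner_ofCoef φ (summable_of_dominated (fun _ => sq_nonneg _) hm1
      fun k => hm2 k t ht) k
  have hΨc : ∀ x, ContinuousOn (Ψ x) (Icc 0 T) := by
    intro x
    obtain ⟨m, hm1, hm2⟩ := hS.dominated φ hT' hm hb (hG.essBdd_comp (hext x))
    refine continuousOn_of_coef φ hm1 (fun k => ?_) fun k t ht => ?_
    · exact (hS.continuousOn k _ ((hG.essBdd_comp (hext x)).coef φ k)).congr
        fun t ht => hΨ x t ht k
    · rw [hΨ x t ht k]
      exact hm2 k t ht
  let Φ : Y → Y := fun x => ⟨(Icc 0 T).domRestrict (Ψ x), (hΨc x).domRestrict⟩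
  have hΦ : ∀ x, ∀ t ∈ Icc 0 T, ext (Φ x) t = Ψ x t := fun x t ht => by
    simp only [ext, Φ, IccExtend_of_mem hT' _ ht]
    rfl
  have est : ∀ x y : Y, ∀ n : ℕ, ∀ t ∈ Icc 0 T,
      ‖ext (Φ^[n + 1] x) t - ext (Φ^[n + 1] y) t‖ ^ 2 ≤
        dist x y ^ 2 * (N * K ^ 2 * t) ^ (n + 1) / (n + 1).factorial := by
    intro x y n
    refine volterra_iterate (K := N * K ^ 2) (mul_nonneg hS.nonneg (by positivity))
      (e := fun n t => ‖ext (Φ^[n] x) t - ext (Φ^[n] y) t‖ ^ 2)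
      (fun n => EssBdd.norm_sq ((hext _).sub (hext _))) (Eventually.of_forall fun t => ?_)
      (fun n t ht => ?_) n
    · rw [← dist_eq_norm]
      exact pow_le_pow_left₀ dist_nonneg (ContinuousMap.dist_apply_le_dist _) 2
    · refine norm_sq_sub_le φ hS hG (hext _) (hext _) ht ?_ ?_
      · intro k
        rw [Function.iterate_succ_apply', hΦ _ t ht, hΨ _ t ht]
      · intro k
        rw [Function.iterate_succ_apply', hΦ _ t ht, hΨ _ t ht]
  -- The estimate is for squared distances, so `1 / 4` here gives the contraction constant `1 / 2`.
  obtain ⟨n, hn⟩ := ((tendsto_mul_pow_div_factorial 1 (N * K ^ 2 * T)).eventually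
    (gt_mem_nhds (show (0 : ℝ) < 1 / 4 by norm_num))).exists
  have hcon : ContractingWith (1 / 2) (Φ^[n + 1]) := by
    refine ⟨by norm_num, LipschitzWith.of_dist_le_mul fun x y => ?_⟩
    refine (ContinuousMap.dist_le (by positivity)).2 fun t => ?_
    have h1 := est x y n t.1 t.2
    have e1 : ∀ z : Y, ext z t.1 = z t := fun z => by simp [ext]
    rw [e1, e1, ← dist_eq_norm] at h1
    have h2 : (N * K ^ 2 * t.1) ^ (n + 1) ≤ (N * K ^ 2 * T) ^ (n + 1) := by
      have := hS.nonneg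
      have := t.2.1
      have := t.2.2
      gcongr
    have h3 : dist x y ^ 2 * (N * K ^ 2 * t.1) ^ (n + 1) / (n + 1).factorial ≤
        dist x y ^ 2 * (1 / 4) := by
      rw [mul_div_assoc]
      refine mul_le_mul_of_nonneg_left ?_ (sq_nonneg _)
      refine le_trans ?_ hn.le
      rw [one_mul]
      gcongr
    have h4 : dist (Φ^[n + 1] x t) (Φ^[n + 1] y t) ^ 2 ≤ (1 / 2 * dist x y) ^ 2 := by
      refine (h1.trans h3).trans_eq (by ring)
    simpa using (pow_le_pow_iff_left₀ dist_nonneg (by positivity) two_ne_zero).1 h4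
  -- The unique fixed point of an iterate is fixed by the map itself.
  have hfix := hcon.isFixedPt_fixedPoint_iterate
  set x := ContractingWith.fixedPoint (Φ^[n + 1]) hcon
  refine ⟨ext x, hext x, fun t ht k => ?_⟩
  rw [← hΨ x t ht k, ← hΦ x t ht, hfix]

end Volterra

end KreinFeller

end


noncomputable section

namespace KreinFeller

/-! ### Semi-linear equations in the scale of spaces -/

section Semilinear

variable {X : Type*} [NormedAddCommGroup X] [InnerProductSpace ℂ X] [CompleteSpace X]
  (φ : HilbertBasis ℕ ℂ X) {lam : ℕ → ℝ} {c₀ α T N : ℝ}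

theorem rpow_half_mul_rpow_neg_half {x : ℝ} (hx : 0 < x) (α : ℝ) :
    x ^ (α / 2) * x ^ (-α / 2) = 1 := by
  rw [← Real.rpow_add hx]
  ring_nf
  simp

theorem rpow_half_mul_rpow_neg_half' {x : ℝ} (hx : 0 < x) (α : ℝ) :
    ((x ^ (α / 2) : ℝ) : ℂ) * ((x ^ (-α / 2) : ℝ) : ℂ) = 1 := by
  rw [← Complex.ofReal_mul, rpow_half_mul_rpow_neg_half hx, Complex.ofReal_one]

theorem rpow_neg_half_mul_rpow_half' {x : ℝ} (hx : 0 < x) (α : ℝ) :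
    ((x ^ (-α / 2) : ℝ) : ℂ) * ((x ^ (α / 2) : ℝ) : ℂ) = 1 := by
  rw [mul_comm, rpow_half_mul_rpow_neg_half' hx]

theorem emem_neg (h0 : 0 < c₀) (hl : ∀ k, c₀ ≤ lam k)
    (hα : 0 ≤ α) (x : X) : EMem φ lam (-α) x := by
  have h := (hasSum_norm_sq_coef φ x).summable
  refine (summable_weight_mono h0 hl (fun k => sq_nonneg ‖(inner ℂ (φ k) x : ℂ)‖)
    (neg_nonpos.2 hα) ?_).1
  simpa using h

theorem inner_diagPow_neg (h0 : 0 < c₀) (hl : ∀ k, c₀ ≤ lam k)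
    (hα : 0 ≤ α) (x : X) (k : ℕ) :
    (inner ℂ (φ k) (diagPow φ lam (-α / 2) x) : ℂ) = (lam k ^ (-α / 2) : ℝ) * inner ℂ (φ k) x :=
  (emem_neg φ h0 hl hα x).inner_diagPow φ (fun k => h0.trans_le (hl k)) k

theorem emem_diagPow_neg (h0 : 0 < c₀) (hl : ∀ k, c₀ ≤ lam k)
    (hα : 0 ≤ α) (x : X) : EMem φ lam α (diagPow φ lam (-α / 2) x) := by
  have hp : ∀ k, 0 < lam k := fun k => h0.trans_le (hl k)
  refine (hasSum_norm_sq_coef φ x).summable.congr fun k => ?_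
  rw [inner_diagPow_neg φ h0 hl hα, norm_sq_weight (hp k), mul_assoc, ← Real.rpow_add (hp k)]
  simp

theorem diagPow_diagPow_neg (h0 : 0 < c₀) (hl : ∀ k, c₀ ≤ lam k)
    (hα : 0 ≤ α) (x : X) :
    diagPow φ lam (α / 2) (diagPow φ lam (-α / 2) x) = x := by
  have hp : ∀ k, 0 < lam k := fun k => h0.trans_le (hl k)
  refine ext_coef φ fun k => ?_
  rw [(emem_diagPow_neg φ h0 hl hα x).inner_diagPow φ hp, inner_diagPow_neg φ h0 hl hα, ← mul_assoc,
    rpow_half_mul_rpow_neg_half' (hp k), one_mul]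

theorem diagPow_neg_diagPow (h0 : 0 < c₀) (hl : ∀ k, c₀ ≤ lam k)
    (hα : 0 ≤ α) {w : X} (hw : EMem φ lam α w) :
    diagPow φ lam (-α / 2) (diagPow φ lam (α / 2) w) = w := by
  have hp : ∀ k, 0 < lam k := fun k => h0.trans_le (hl k)
  refine ext_coef φ fun k => ?_
  rw [inner_diagPow_neg φ h0 hl hα, hw.inner_diagPow φ hp, ← mul_assoc,
    rpow_neg_half_mul_rpow_half' (hp k), one_mul]

theorem norm_diagPow_sub (h0 : 0 < c₀) (hl : ∀ k, c₀ ≤ lam k)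
    {v w : X} (hv : EMem φ lam α v) (hw : EMem φ lam α w) :
    ‖diagPow φ lam (α / 2) v - diagPow φ lam (α / 2) w‖ = ENorm φ lam α (v - w) := by
  have hp : ∀ k, 0 < lam k := fun k => h0.trans_le (hl k)
  rw [← (hv.sub φ hp hw).norm_diagPow φ hp]
  congr 1
  refine ext_coef φ fun k => ?_
  rw [(hv.sub φ hp hw).inner_diagPow φ hp, inner_sub_right, hv.inner_diagPow φ hp,
    hw.inner_diagPow φ hp, inner_sub_right]
  ring

variable (lam) in
/-- Lipschitz maps of the space with weight `lam ^ α`. -/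
def ELip (α : ℝ) (F : X → X) : Prop :=
  MapsTo F {w | EMem φ lam α w} {w | EMem φ lam α w} ∧
    ∃ c > 0, ∀ u, EMem φ lam α u → ∀ v, EMem φ lam α v →
      ENorm φ lam α (F u - F v) ≤ c * ENorm φ lam α (u - v)

variable (lam) in
/-- The map `F` read in the unweighted space. -/
def conjMap (α : ℝ) (F : X → X) (x : X) : X :=
  diagPow φ lam (α / 2) (F (diagPow φ lam (-α / 2) x))

/-- `diagPow` with exponent `-α / 2` maps all of `X` isometrically onto the weighted space, so
conjugation turns a Lipschitz map of that space into a globally Lipschitz map of `X`. -/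
theorem ELip.lipschitz (h0 : 0 < c₀) (hl : ∀ k, c₀ ≤ lam k)
    (hα : 0 ≤ α) {F : X → X} (hF : ELip φ lam α F) :
    ∃ K : NNReal, LipschitzWith K (conjMap φ lam α F) := by
  obtain ⟨h1, c, hc, h2⟩ := hF
  refine ⟨⟨c, hc.le⟩, LipschitzWith.of_dist_le_mul fun x y => ?_⟩
  have hx := emem_diagPow_neg φ h0 hl hα x
  have hy := emem_diagPow_neg φ h0 hl hα y
  rw [dist_eq_norm, conjMap, conjMap, norm_diagPow_sub φ h0 hl (h1 hx) (h1 hy)]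
  refine (h2 _ hx _ hy).trans_eq ?_
  rw [← norm_diagPow_sub φ h0 hl hx hy, diagPow_diagPow_neg φ h0 hl hα,
    diagPow_diagPow_neg φ h0 hl hα, dist_eq_norm]
  rfl

theorem ELinfty.essBdd_diagPow (h0 : 0 < c₀) (hl : ∀ k, c₀ ≤ lam k)
    {u : ℝ → X} (hu : ELinfty φ lam α T u) :
    EssBdd T fun t => diagPow φ lam (α / 2) (u t) := by
  have hp : ∀ k, 0 < lam k := fun k => h0.trans_le (hl k)
  exact ((eLinfty_iff φ fun k => (hp k).le).1 hu).essBdd_weighted φ hp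

theorem eLinfty_of_essBdd_diagPow (h0 : 0 < c₀) (hl : ∀ k, c₀ ≤ lam k)
    {u : ℝ → X}
    (hu : ∀ᵐ t ∂volume.restrict (Icc 0 T), EMem φ lam α (u t))
    (h : EssBdd T fun t => diagPow φ lam (α / 2) (u t)) : ELinfty φ lam α T u := by
  have hp : ∀ k, 0 < lam k := fun k => h0.trans_le (hl k)
  refine ⟨aestronglyMeasurable_of_coef φ fun k => ?_, hu, ?_⟩
  · refine ((AEStronglyMeasurable.coef φ h.1 k).const_mul ((lam k ^ (-α / 2) : ℝ) : ℂ)).congr ?_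
    filter_upwards [hu] with t ht
    rw [ht.inner_diagPow φ hp, ← mul_assoc, rpow_neg_half_mul_rpow_half' (hp k), one_mul]
  · obtain ⟨C, _, hC⟩ := h.exists_bound
    refine ⟨C, ?_⟩
    filter_upwards [hu, hC] with t h1 h2
    rwa [← h1.norm_diagPow φ hp]

theorem ELip.comp_eLinfty (h0 : 0 < c₀) (hl : ∀ k, c₀ ≤ lam k)
    (hα : 0 ≤ α) {F : X → X} (hF : ELip φ lam α F) {u : ℝ → X}
    (hu : ELinfty φ lam α T u) : ELinfty φ lam α T fun t => F (u t) := by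
  obtain ⟨K, hK⟩ := hF.lipschitz φ h0 hl hα
  have h1 := hK.essBdd_comp (hu.essBdd_diagPow φ h0 hl)
  refine eLinfty_of_essBdd_diagPow φ h0 hl ?_ ((memLp_congr_ae ?_).1 h1)
  · filter_upwards [hu.2.1] with t ht using hF.1 ht
  · filter_upwards [hu.2.1] with t ht
    rw [conjMap, diagPow_neg_diagPow φ h0 hl hα ht]

variable (lam) in
/-- The solution family read in the unweighted space. -/
def conjFamily (α : ℝ) (S : ℕ → (ℝ → ℂ) → ℝ → ℂ) (k : ℕ) (γ : ℝ → ℂ) (t : ℝ) : ℂ :=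
  ((lam k ^ (α / 2) : ℝ) : ℂ) * S k (fun τ => ((lam k ^ (-α / 2) : ℝ) : ℂ) * γ τ) t

/-- The factor `lam ^ (-α)` from the forcing and `lam ^ α` from the output cancel in the quadratic
estimate, so the constant `N` is the same at every order. -/
theorem IsSolutionFamily.conj (hp : ∀ k, 0 < lam k) {S : ℕ → (ℝ → ℂ) → ℝ → ℂ}
    (hS : IsSolutionFamily T N S) : IsSolutionFamily T N (conjFamily lam α S) where
  nonneg := hS.nonneg
  congr k γ γ' h t ht := by
    rw [conjFamily, conjFamily]
    congr 1
    refine hS.congr k _ _ ?_ t ht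
    filter_upwards [h] with τ hτ
    rw [hτ]
  continuousOn k γ hγ := continuousOn_const.mul (hS.continuousOn k _ (hγ.const_mul _))
  lipschitz k γ γ' hγ hγ' t ht := by
    have h1 := hS.lipschitz k _ _ (hγ.const_mul ((lam k ^ (-α / 2) : ℝ) : ℂ))
      (hγ'.const_mul ((lam k ^ (-α / 2) : ℝ) : ℂ)) t ht
    have e : ∀ τ, ‖((lam k ^ (-α / 2) : ℝ) : ℂ) * γ τ - ((lam k ^ (-α / 2) : ℝ) : ℂ) * γ' τ‖ ^ 2 =
        lam k ^ (-α) * ‖γ τ - γ' τ‖ ^ 2 := fun τ => by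
      rw [← mul_sub, norm_sq_weight (hp k), mul_comm]
    simp only [e, intervalIntegral.integral_const_mul] at h1
    rw [conjFamily, conjFamily, ← mul_sub, norm_sq_weight (hp k)]
    have hq := Real.rpow_pos_of_pos (hp k) α
    calc _ ≤ (N * (lam k ^ (-α) * ∫ τ in (0 : ℝ)..t, ‖γ τ - γ' τ‖ ^ 2)) * lam k ^ α := by gcongr
      _ = _ := by rw [Real.rpow_neg (hp k).le]; field_simp

theorem exists_semilinear_solution (h0 : 0 < c₀) (hl : ∀ k, c₀ ≤ lam k)
    (hα : 0 ≤ α) (hT : 0 < T) {S : ℕ → (ℝ → ℂ) → ℝ → ℂ}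
    (hS : IsSolutionFamily T N S) {m : ℕ → ℝ} (hm : Summable m)
    (hb : ∀ k, ∀ t ∈ Icc 0 T, ‖S k (fun _ => 0) t‖ ^ 2 * lam k ^ α ≤ m k) {F : X → X}
    (hF : ELip φ lam α F) : ∃ u : ℝ → X, ELinfty φ lam α T u ∧ IsVolterraSolution φ T S F u := by
  have hp : ∀ k, 0 < lam k := fun k => h0.trans_le (hl k)
  obtain ⟨K, hK⟩ := hF.lipschitz φ h0 hl hα
  obtain ⟨x, hx, hx'⟩ := exists_isVolterraSolution φ hT (hS.conj hp (α := α)) hm (fun k t ht => by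
    simpa only [conjFamily, mul_zero, norm_sq_weight (hp k)] using hb k t ht) hK
  refine ⟨fun t => diagPow φ lam (-α / 2) (x t), eLinfty_of_essBdd_diagPow φ h0 hl
    (Eventually.of_forall fun t => emem_diagPow_neg φ h0 hl hα _) ?_, fun t ht k => ?_⟩
  · simpa only [diagPow_diagPow_neg φ h0 hl hα] using hx
  · rw [inner_diagPow_neg φ h0 hl hα, hx' t ht k, conjFamily, ← mul_assoc,
      rpow_neg_half_mul_rpow_half' (hp k), one_mul]
    congr 1
    ext τ
    rw [conjMap, (hF.1 (emem_diagPow_neg φ h0 hl hα _)).inner_diagPow φ hp, ← mul_assoc,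
      rpow_neg_half_mul_rpow_half' (hp k), one_mul]

/-- Membership is required at every time, not just almost everywhere: off the weighted space
`diagPow` loses the coefficients and cannot be inverted. -/
theorem semilinear_unique (h0 : 0 < c₀) (hl : ∀ k, c₀ ≤ lam k)
    (hα : 0 ≤ α) {S : ℕ → (ℝ → ℂ) → ℝ → ℂ}
    (hS : IsSolutionFamily T N S) {F : X → X} (hF : ELip φ lam α F) {u v : ℝ → X}
    (hu : ELinfty φ lam α T u) (hv : ELinfty φ lam α T v) (hu' : ∀ t ∈ Icc 0 T, EMem φ lam α (u t))
    (hv' : ∀ t ∈ Icc 0 T, EMem φ lam α (v t)) (h : IsVolterraSolution φ T S F u)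
    (h' : IsVolterraSolution φ T S F v) : ∀ t ∈ Icc 0 T, u t = v t := by
  have hp : ∀ k, 0 < lam k := fun k => h0.trans_le (hl k)
  obtain ⟨K, hK⟩ := hF.lipschitz φ h0 hl hα
  have key : ∀ u : ℝ → X, (∀ t ∈ Icc 0 T, EMem φ lam α (u t)) → IsVolterraSolution φ T S F u →
      IsVolterraSolution φ T (conjFamily lam α S) (conjMap φ lam α F)
        (fun t => diagPow φ lam (α / 2) (u t)) := by
    intro u hu h t ht k
    rw [(hu t ht).inner_diagPow φ hp, h t ht k, conjFamily]
    congr 1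
    refine hS.congr k _ _ ((ae_restrict_iff' measurableSet_Icc).2 (Eventually.of_forall
      fun τ hτ => ?_)) t ht
    rw [conjMap, diagPow_neg_diagPow φ h0 hl hα (hu τ hτ), (hF.1 (hu τ hτ)).inner_diagPow φ hp,
      ← mul_assoc, rpow_neg_half_mul_rpow_half' (hp k), one_mul]
  intro t ht
  have h1 := (key u hu' h).unique φ (hS.conj hp (α := α)) hK (hu.essBdd_diagPow φ h0 hl)
    (hv.essBdd_diagPow φ h0 hl) (key v hv' h') t ht
  rw [← diagPow_neg_diagPow φ h0 hl hα (hu' t ht), h1, diagPow_neg_diagPow φ h0 hl hα (hv' t ht)]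

end Semilinear

/-! ### The solution families of the three equations -/

section Families

variable {lam : ℕ → ℝ} {c₀ T : ℝ}

/-- The forcing enters linearly through a kernel bounded by 1, so Cauchy–Schwarz in time gives the
constant `T`. -/
theorem duhamel_isSolutionFamily (hT : 0 ≤ T) (hl : ∀ k, 0 < lam k) {ζ σ : ℂ} (hζ : ζ.re ≤ 0)
    (hσ : ‖σ‖ = 1) (a : ℕ → ℂ) :
    IsSolutionFamily T T fun k γ => duhamel (ζ * lam k) (a k) fun τ => σ * γ τ where
  nonneg := hT
  congr k γ γ' h t ht := by
    have h0 : (0 : ℝ) ∈ Icc 0 T := ⟨le_rfl, hT⟩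
    simp only [duhamel]
    congr 1
    refine intervalIntegral.integral_congr_ae ?_
    filter_upwards [ae_restrict_uIoc_of_Icc h h0 ht] with τ hτ hτ'
    rw [hτ hτ']
  continuousOn k γ hγ := (duhamel_isPrimitive hT _ _ (hγ.const_mul σ)).continuousOn
  lipschitz k γ γ' hγ hγ' t ht := by
    have h0 : (0 : ℝ) ∈ Icc 0 T := ⟨le_rfl, hT⟩
    have hd : EssBdd T fun τ => γ τ - γ' τ := hγ.sub hγ'
    have i : ∀ γ, EssBdd T γ → IntervalIntegrable
        (fun τ : ℝ => Complex.exp (ζ * lam k * (t - τ)) * (σ * γ τ)) volume 0 t := fun γ hγ =>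
      (EssBdd.mono_interval (T := T) (hγ.const_mul σ) h0 ht).continuousOn_mul (by fun_prop)
    have e : duhamel (ζ * lam k) (a k) (fun τ => σ * γ τ) t -
        duhamel (ζ * lam k) (a k) (fun τ => σ * γ' τ) t =
        σ * ∫ τ in (0 : ℝ)..t, Complex.exp (ζ * lam k * (t - τ)) * (γ τ - γ' τ) := by
      rw [duhamel, duhamel, add_sub_add_left_eq_sub, ← intervalIntegral.integral_sub (i γ hγ) (i γ' hγ'),
        ← intervalIntegral.integral_const_mul]
      congr 1
      ext τ
      ring
    rw [e, norm_mul, hσ, one_mul]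
    have := integral_mul_sq_le (M := 1) (κ := fun s => Complex.exp (ζ * lam k * s)) hd ht
      fun s hs => by
        rw [Complex.norm_exp, Complex.re_mul_ofReal, Complex.re_mul_ofReal, Real.exp_le_one_iff]
        exact mul_nonpos_of_nonpos_of_nonneg
          (mul_nonpos_of_nonpos_of_nonneg hζ (hl k).le) hs.1
    push_cast at this
    refine this.trans ?_
    rw [one_pow, one_mul]
    exact mul_le_mul_of_nonneg_right ht.2
      (intervalIntegral.integral_nonneg ht.1 fun _ _ => sq_nonneg _)

/-- As for Duhamel's formula, with the extra factor `1 / √λ`, whose square is at most `c₀⁻¹`. -/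
theorem wave_isSolutionFamily (hT : 0 ≤ T) (h0 : 0 < c₀) (hl : ∀ k, c₀ ≤ lam k) (a b : ℕ → ℂ) :
    IsSolutionFamily T (c₀⁻¹ * T) fun k γ => waveCoeff (lam k) (a k) (b k) γ where
  nonneg := by positivity
  congr k γ γ' h t ht := by
    have h0 : (0 : ℝ) ∈ Icc 0 T := ⟨le_rfl, hT⟩
    simp only [waveCoeff]
    congr 2
    refine intervalIntegral.integral_congr_ae ?_
    filter_upwards [ae_restrict_uIoc_of_Icc h h0 ht] with τ hτ hτ'
    rw [hτ hτ']
  continuousOn k γ hγ := (wave_isPrimitive (h0.trans_le (hl k)) _ _ hγ hT).1.continuousOn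
  lipschitz k γ γ' hγ hγ' t ht := by
    have h00 : (0 : ℝ) ∈ Icc 0 T := ⟨le_rfl, hT⟩
    have hd : EssBdd T fun τ => γ τ - γ' τ := hγ.sub hγ'
    have i : ∀ γ, EssBdd T γ → IntervalIntegrable
        (fun τ : ℝ => ((Real.sin (√(lam k) * (t - τ)) : ℝ) : ℂ) * γ τ) volume 0 t := fun γ hγ =>
      (hγ.mono_interval h00 ht).continuousOn_mul (by fun_prop)
    have e : waveCoeff (lam k) (a k) (b k) γ t - waveCoeff (lam k) (a k) (b k) γ' t =
        (1 / √(lam k) : ℝ) *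
          ∫ τ in (0 : ℝ)..t, ((Real.sin (√(lam k) * (t - τ)) : ℝ) : ℂ) * (γ τ - γ' τ) := by
      rw [waveCoeff, waveCoeff, add_sub_add_left_eq_sub, ← mul_sub,
        ← intervalIntegral.integral_sub (i γ hγ) (i γ' hγ')]
      congr 2
      ext τ
      ring
    have hp := h0.trans_le (hl k)
    have := integral_mul_sq_le (M := 1) (κ := fun s => ((Real.sin (√(lam k) * s) : ℝ) : ℂ)) hd ht
      fun s hs => by
        rw [Complex.norm_real, Real.norm_eq_abs]
        exact Real.abs_sin_le_one _
    rw [e, norm_mul, mul_pow, Complex.norm_real, Real.norm_eq_abs, sq_abs, div_pow, one_pow,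
      Real.sq_sqrt hp.le, one_div]
    have hi : 0 ≤ ∫ τ in (0 : ℝ)..t, ‖γ τ - γ' τ‖ ^ 2 :=
      intervalIntegral.integral_nonneg ht.1 fun _ _ => sq_nonneg _
    calc _ ≤ c₀⁻¹ * (1 ^ 2 * (t * ∫ τ in (0 : ℝ)..t, ‖γ τ - γ' τ‖ ^ 2)) := by
          gcongr
          exact hl k
      _ ≤ c₀⁻¹ * (1 ^ 2 * (T * ∫ τ in (0 : ℝ)..t, ‖γ τ - γ' τ‖ ^ 2)) := by
          gcongr
          exact ht.2
      _ = _ := by ring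

end Families

end KreinFeller

end


/-! ### The equations on `L²(Ω, μ)`, given the spectral description of the form. -/

noncomputable section

namespace KreinFeller

/-! ### Linear equations on `L²(Ω, μ)` -/

/-- The relation between the energy form and an eigenbasis. -/
structure SpectralData (μ : Measure S2) (Ω : Set S2) (φ : HilbertBasis ℕ ℂ (L2 μ Ω))
    (lam : ℕ → ℝ) (c₀ : ℝ) : Prop where
  pos : 0 < c₀
  le : ∀ k, c₀ ≤ lam k
  mem_dom : ∀ w, w ∈ dom μ Ω ↔ EMem φ lam 1 w
  energy_eq : ∀ u ∈ dom μ Ω, ∀ v ∈ dom μ Ω, energy μ Ω u v =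
    inner ℂ (diagPow φ lam (1 / 2) v) (diagPow φ lam (1 / 2) u)
  linftyDom_iff : ∀ T u, LinftyDom μ Ω T u ↔ ELinfty φ lam 1 T u

namespace SpectralData

variable {μ : Measure S2} {Ω : Set S2} {φ : HilbertBasis ℕ ℂ (L2 μ Ω)} {lam : ℕ → ℝ} {c₀ T : ℝ}

theorem lam_pos (h : SpectralData μ Ω φ lam c₀) (k : ℕ) : 0 < lam k := h.pos.trans_le (h.le k)

theorem energy_re (h : SpectralData μ Ω φ lam c₀) {u : L2 μ Ω} (hu : u ∈ dom μ Ω) :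
    (energy μ Ω u u).re = ∑' k, ‖(inner ℂ (φ k) u : ℂ)‖ ^ 2 * lam k ^ (1 : ℝ) := by
  rw [h.energy_eq u hu u hu]
  refine (inner_self_eq_norm_sq (𝕜 := ℂ) _).trans ?_
  rw [((h.mem_dom u).1 hu).norm_diagPow φ h.lam_pos, ENorm, Real.sq_sqrt (tsum_nonneg fun k => mul_nonneg (sq_nonneg _)
    (Real.rpow_nonneg (h.lam_pos k).le _))]

theorem energyNorm_eq (h : SpectralData μ Ω φ lam c₀) {u : L2 μ Ω} (hu : u ∈ dom μ Ω) :
    energyNorm μ Ω u = ENorm φ lam 1 u := by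
  rw [energyNorm, h.energy_re hu, ENorm]

theorem energyNorm_eq_norm (h : SpectralData μ Ω φ lam c₀) {u : L2 μ Ω} (hu : u ∈ dom μ Ω) :
    energyNorm μ Ω u = ‖diagPow φ lam (1 / 2) u‖ := by
  rw [h.energyNorm_eq hu, ((h.mem_dom u).1 hu).norm_diagPow φ h.lam_pos]

theorem basis_mem (h : SpectralData μ Ω φ lam c₀) (k : ℕ) : φ k ∈ dom μ Ω := by
  rw [h.mem_dom, EMem]
  refine summable_of_ne_finset_zero (s := {k}) fun j hj => ?_
  rw [Finset.mem_singleton] at hj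
  rw [φ.orthonormal.2 hj]
  simp

theorem inner_diagPow_basis (h : SpectralData μ Ω φ lam c₀) (k : ℕ) (w : L2 μ Ω) :
    inner ℂ (diagPow φ lam (1 / 2) (φ k)) w = ((lam k ^ (1 / 2 : ℝ) : ℝ) : ℂ) * inner ℂ (φ k) w := by
  have e : diagPow φ lam (1 / 2) (φ k) = ((lam k ^ (1 / 2 : ℝ) : ℝ) : ℂ) • φ k := by
    refine ext_coef φ fun j => ?_
    rw [((h.mem_dom _).1 (h.basis_mem k)).inner_diagPow φ h.lam_pos, inner_smul_right]
    by_cases hj : j = k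
    · rw [hj]
    · rw [φ.orthonormal.2 hj]
      simp
  rw [e, inner_smul_left, Complex.conj_ofReal]

theorem energy_basis (h : SpectralData μ Ω φ lam c₀) {u : L2 μ Ω} (hu : u ∈ dom μ Ω) (k : ℕ) :
    energy μ Ω u (φ k) = lam k * inner ℂ (φ k) u := by
  rw [h.energy_eq u hu _ (h.basis_mem k), h.inner_diagPow_basis,
    ((h.mem_dom _).1 hu).inner_diagPow φ h.lam_pos, ← mul_assoc, ← Complex.ofReal_mul,
    ← Real.rpow_add (h.lam_pos k)]
  norm_num

/-- Functionals on `dom` with square summable weighted coefficients. -/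
theorem dualSeries_eq (h : SpectralData μ Ω φ lam c₀) {c : ℕ → ℂ}
    (hc : Summable fun k => ‖c k‖ ^ 2 * lam k ^ (-1 : ℝ)) {v : L2 μ Ω} (hv : v ∈ dom μ Ω) :
    dualSeries μ Ω φ c v = inner ℂ (diagPow φ lam (1 / 2) v) (weighted φ lam (-1) c) := by
  rw [← (hasSum_inner_coef φ _ _).tsum_eq, dualSeries]
  refine tsum_congr fun k => ?_
  rw [inner_weighted φ h.lam_pos hc, ((h.mem_dom _).1 hv).inner_diagPow φ h.lam_pos, map_mul,
    Complex.conj_ofReal, inner_conj_symm, mul_mul_mul_comm,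
    rpow_neg_half_mul_rpow_half' (h.lam_pos k) 1, one_mul, pair]

theorem summable_neg_one (h : SpectralData μ Ω φ lam c₀) (w : L2 μ Ω) :
    Summable fun k => ‖(inner ℂ (φ k) w : ℂ)‖ ^ 2 * lam k ^ (-1 : ℝ) :=
  emem_neg φ h.pos h.le zero_le_one w

/-- Both the `L²` pairing and the functionals `dualSeries` become inner products against `diagPow`
of the test vector, whose norm is the energy norm. This identifies the dual of `dom` with sequences
of weight `lam ^ (-1)`, and so with the Hilbert space itself. -/
theorem pair_eq (h : SpectralData μ Ω φ lam c₀) (w : L2 μ Ω) {v : L2 μ Ω} (hv : v ∈ dom μ Ω) :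
    pair μ Ω w v = inner ℂ (diagPow φ lam (1 / 2) v)
      (weighted φ lam (-1) fun k => inner ℂ (φ k) w) := by
  rw [← h.dualSeries_eq (h.summable_neg_one w) hv, pair, ← (hasSum_inner_coef φ v w).tsum_eq,
    dualSeries]
  refine tsum_congr fun k => ?_
  rw [inner_conj_symm]
  rfl

theorem norm_dualSeries_le (h : SpectralData μ Ω φ lam c₀) {c : ℕ → ℂ}
    (hc : Summable fun k => ‖c k‖ ^ 2 * lam k ^ (-1 : ℝ)) {v : L2 μ Ω} (hv : v ∈ dom μ Ω) :
    ‖dualSeries μ Ω φ c v‖ ≤ ‖weighted φ lam (-1) c‖ * energyNorm μ Ω v := by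
  rw [h.dualSeries_eq hc hv, h.energyNorm_eq_norm hv, mul_comm]
  exact norm_inner_le_norm _ _

theorem dom_add (h : SpectralData μ Ω φ lam c₀) {v w : L2 μ Ω} (hv : v ∈ dom μ Ω)
    (hw : w ∈ dom μ Ω) : v + w ∈ dom μ Ω :=
  (h.mem_dom _).2 (((h.mem_dom _).1 hv).add φ h.lam_pos ((h.mem_dom _).1 hw))

theorem dom_smul (h : SpectralData μ Ω φ lam c₀) (z : ℂ) {v : L2 μ Ω} (hv : v ∈ dom μ Ω) :
    z • v ∈ dom μ Ω :=
  (h.mem_dom _).2 (((h.mem_dom _).1 hv).smul φ z)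

theorem isDualElement (h : SpectralData μ Ω φ lam c₀) {c : ℕ → ℂ}
    (hc : Summable fun k => ‖c k‖ ^ 2 * lam k ^ (-1 : ℝ)) :
    IsDualElement μ Ω (dualSeries μ Ω φ c) := by
  have e1 : ∀ v ∈ dom μ Ω, ∀ w ∈ dom μ Ω, diagPow φ lam (1 / 2) (v + w) =
      diagPow φ lam (1 / 2) v + diagPow φ lam (1 / 2) w := fun v hv w hw => by
    refine ext_coef φ fun k => ?_
    rw [((h.mem_dom _).1 (h.dom_add hv hw)).inner_diagPow φ h.lam_pos, inner_add_right,
      inner_add_right, ((h.mem_dom _).1 hv).inner_diagPow φ h.lam_pos,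
      ((h.mem_dom _).1 hw).inner_diagPow φ h.lam_pos, mul_add]
  have e2 : ∀ z : ℂ, ∀ v ∈ dom μ Ω, diagPow φ lam (1 / 2) (z • v) =
      z • diagPow φ lam (1 / 2) v := fun z v hv => by
    refine ext_coef φ fun k => ?_
    rw [((h.mem_dom _).1 (h.dom_smul z hv)).inner_diagPow φ h.lam_pos, inner_smul_right,
      inner_smul_right, ((h.mem_dom _).1 hv).inner_diagPow φ h.lam_pos]
    ring
  refine ⟨fun v hv w hw => ?_, fun z v hv => ?_, _, fun v hv => h.norm_dualSeries_le hc hv⟩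
  · rw [h.dualSeries_eq hc (h.dom_add hv hw), e1 v hv w hw, inner_add_left,
      h.dualSeries_eq hc hv, h.dualSeries_eq hc hw]
  · rw [h.dualSeries_eq hc (h.dom_smul z hv), e2 z v hv, inner_smul_left, h.dualSeries_eq hc hv]

theorem memDual_iff (c : ℕ → ℂ) :
    MemDual lam c ↔ Summable fun k => ‖c k‖ ^ 2 * lam k ^ (-1 : ℝ) := by
  simp only [MemDual, div_eq_mul_inv, Real.rpow_neg_one]

theorem isPrimitive_dual (h : SpectralData μ Ω φ lam c₀) {U : ℝ → L2 μ Ω} {c d : ℕ → ℝ → ℂ}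
    (hU : ∀ t ∈ Icc 0 T, HasSum (fun k => c k t • φ k) (U t)) (hd : CoefBdd lam (-1) T d)
    (hcd : ∀ k, IsPrimitive T (c k) (d k)) :
    IsPrimitive T (fun t => weighted φ lam (-1) fun k => inner ℂ (φ k) (U t))
      (fun t => weighted φ lam (-1) fun k => d k t) := by
  have e : ∀ t ∈ Icc 0 T, ∀ k, c k t = inner ℂ (φ k) (U t) := fun t ht k =>
    ((hasSum_iff_coef φ).1 (hU t ht) k).symm
  refine isPrimitive_weighted φ h.lam_pos (c := fun k t => inner ℂ (φ k) (U t))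
    (fun t _ => h.summable_neg_one (U t)) hd fun k => (hcd k).congr (fun t ht => e t ht k)
    (Eventually.of_forall fun _ => rfl)

/-- Lebesgue differentiation of the curve transported to the Hilbert space by `weighted` of order
`-1`. Norm convergence of its difference quotients is convergence uniform over test vectors of
energy norm at most 1. -/
theorem hasDualDerivAt (h : SpectralData μ Ω φ lam c₀) {U : ℝ → L2 μ Ω} {c d : ℕ → ℝ → ℂ}
    (hU : ∀ t ∈ Icc 0 T, HasSum (fun k => c k t • φ k) (U t)) (hd : CoefBdd lam (-1) T d)
    (hcd : ∀ k, IsPrimitive T (c k) (d k)) :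
    ∀ᵐ t ∂volume.restrict (Icc 0 T), MemDual lam (fun k => d k t) ∧
      HasDualDerivAt μ Ω U (dualSeries μ Ω φ fun k => d k t) t := by
  obtain ⟨B, hB⟩ := hd.2
  filter_upwards [hB, (h.isPrimitive_dual hU hd hcd).ae_hasDerivAt] with t ht hder
  refine ⟨(memDual_iff _).2 ht.1, h.isDualElement ht.1, fun ε hε => ?_⟩
  have h1 := (hasDerivAt_iff_tendsto_slope_zero.1 hder)
  have h2 := (tendsto_iff_norm_sub_tendsto_zero.1 h1).eventually (gt_mem_nhds hε)
  filter_upwards [h2] with s hs v hv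
  have e : weighted φ lam (-1) (fun k => inner ℂ (φ k) (((s⁻¹ : ℝ) : ℂ) • (U (t + s) - U t))) =
      s⁻¹ • (weighted φ lam (-1) (fun k => inner ℂ (φ k) (U (t + s))) -
        weighted φ lam (-1) fun k => inner ℂ (φ k) (U t)) := by
    refine ext_coef φ fun k => ?_
    rw [inner_weighted φ h.lam_pos (h.summable_neg_one _), inner_smul_right, inner_sub_right,
      RCLike.real_smul_eq_coe_smul (K := ℂ) s⁻¹, inner_smul_right, inner_sub_right,
      inner_weighted φ h.lam_pos (h.summable_neg_one _),
      inner_weighted φ h.lam_pos (h.summable_neg_one _)]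
    change _ = ((s⁻¹ : ℝ) : ℂ) * _
    ring
  rw [h.pair_eq _ hv, h.dualSeries_eq ht.1 hv, ← inner_sub_right, h.energyNorm_eq_norm hv, e]
  refine (norm_inner_le_norm _ _).trans ?_
  rw [mul_comm]
  gcongr

theorem linftyDual (h : SpectralData μ Ω φ lam c₀) {d : ℕ → ℝ → ℂ} (hd : CoefBdd lam (-1) T d) :
    LinftyDual μ Ω T fun t => dualSeries μ Ω φ fun k => d k t := by
  obtain ⟨B, hB⟩ := hd.2
  have hE := hd.essBdd_weighted φ h.lam_pos
  refine ⟨fun v hv => ?_, ?_, ?_⟩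
  · refine ((innerSL ℂ (diagPow φ lam (1 / 2) v)).continuous.comp_aestronglyMeasurable
      hE.1).congr ?_
    filter_upwards [hB] with t ht
    rw [h.dualSeries_eq ht.1 hv]
    rfl
  · filter_upwards [hB] with t ht using h.isDualElement ht.1
  · obtain ⟨C, _, hC⟩ := hE.exists_bound
    refine ⟨C, ?_⟩
    filter_upwards [hB, hC] with t ht htC v hv
    refine (h.norm_dualSeries_le ht.1 hv).trans ?_
    gcongr
    exact Real.sqrt_nonneg _

theorem hasDualDeriv (h : SpectralData μ Ω φ lam c₀) {U : ℝ → L2 μ Ω} {c d : ℕ → ℝ → ℂ}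
    (hU : ∀ t ∈ Icc 0 T, HasSum (fun k => c k t • φ k) (U t)) (hd : CoefBdd lam (-1) T d)
    (hcd : ∀ k, IsPrimitive T (c k) (d k)) :
    HasDualDeriv μ Ω T U fun t => dualSeries μ Ω φ fun k => d k t := by
  intro v hv s hs t ht
  obtain ⟨B, hB⟩ := hd.2
  rw [h.pair_eq _ hv, h.pair_eq _ hv,
    ((h.isPrimitive_dual hU hd hcd).inner_left (diagPow φ lam (1 / 2) v)).2 s hs t ht]
  refine intervalIntegral.integral_congr_ae (ae_restrict_uIoc_of_Icc ?_ hs ht)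
  filter_upwards [hB] with τ hτ
  rw [h.dualSeries_eq hτ.1 hv]

/-- The equation satisfied by the functional with coefficients `ζ lam u + σ f`. -/
theorem dualSeries_equation (h : SpectralData μ Ω φ lam c₀) {u f v : L2 μ Ω} (hu : u ∈ dom μ Ω)
    (hv : v ∈ dom μ Ω) (ζ σ : ℂ) :
    dualSeries μ Ω φ (fun k => ζ * lam k * inner ℂ (φ k) u + σ * inner ℂ (φ k) f) v =
      ζ * energy μ Ω u v + σ * pair μ Ω f v := by
  have h1 := (hasSum_inner_coef φ (diagPow φ lam (1 / 2) v) (diagPow φ lam (1 / 2) u)).mul_left ζ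
  have h2 := (hasSum_inner_coef φ v f).mul_left σ
  rw [h.energy_eq u hu v hv, pair, ← (h1.add h2).tsum_eq, dualSeries]
  refine tsum_congr fun k => ?_
  rw [((h.mem_dom _).1 hu).inner_diagPow φ h.lam_pos, ((h.mem_dom _).1 hv).inner_diagPow φ h.lam_pos,
    map_mul, Complex.conj_ofReal, inner_conj_symm, pair]
  have e : ((lam k : ℝ) : ℂ) = ((lam k ^ (1 / 2 : ℝ) : ℝ) : ℂ) * ((lam k ^ (1 / 2 : ℝ) : ℝ) : ℂ) := by
    rw [← Complex.ofReal_mul, ← Real.rpow_add (h.lam_pos k)]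
    norm_num
  rw [e]
  ring

theorem hasL2Deriv (hT : 0 ≤ T) {U V : ℝ → L2 μ Ω} (h : IsPrimitive T U V) :
    HasL2Deriv μ Ω T U V :=
  ⟨h.1.mono_interval ⟨le_rfl, hT⟩ ⟨hT, le_rfl⟩, h.2⟩

/-- The coefficients of a weak solution of an equation of first order in time. -/
theorem coef_of_weak (h : SpectralData μ Ω φ lam c₀) (hT : 0 ≤ T) {U f : ℝ → L2 μ Ω}
    {ψ : ℝ → L2 μ Ω → ℂ} {ζ σ : ℂ} (hU : LinftyDom μ Ω T U) (hψ : LinftyDual μ Ω T ψ)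
    (hd : HasDualDeriv μ Ω T U ψ)
    (he : ∀ v ∈ dom μ Ω, ∀ᵐ t ∂volume.restrict (Icc 0 T),
      ψ t v = ζ * energy μ Ω (U t) v + σ * pair μ Ω (f t) v) (k : ℕ) : ∀ t ∈ Icc 0 T,
      inner ℂ (φ k) (U t) = duhamel (ζ * lam k) (inner ℂ (φ k) (U 0))
        (fun τ => σ * inner ℂ (φ k) (f τ)) t := by
  have hk := h.basis_mem k
  obtain ⟨C, hC⟩ := hψ.2.2
  have hψk : EssBdd T fun t => ψ t (φ k) := essBdd_of_bound (hψ.1 _ hk)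
    (by filter_upwards [hC] with t ht using ht _ hk)
  have h1 : IsPrimitive T (fun t => (inner ℂ (φ k) (U t) : ℂ)) (fun t => ψ t (φ k)) :=
    ⟨hψk, fun s hs t ht => hd _ hk s hs t ht⟩
  -- No bound on `f` is assumed here: the essentially bounded derivative `ψ t (φ k)` agrees a.e.
  -- with the right-hand side of the scalar equation.
  refine eq_duhamel hT _ (h1.congr (fun _ _ => rfl) ?_)
  filter_upwards [he _ hk, hU.2.1] with t h2 h3
  rw [h2, h.energy_basis h3, mul_assoc]
  rfl

/-- The coefficients of a weak solution of the wave equation. -/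
theorem coef_of_wave (h : SpectralData μ Ω φ lam c₀) (hT : 0 ≤ T) {U f : ℝ → L2 μ Ω} {g g' : L2 μ Ω}
    (hf : ∀ k, EssBdd T fun t => (inner ℂ (φ k) (f t) : ℂ)) (hU : IsWaveSolution μ Ω T g g' f U)
    (k : ℕ) : ∀ t ∈ Icc 0 T, inner ℂ (φ k) (U t) = waveCoeff (lam k) (inner ℂ (φ k) g)
        (inner ℂ (φ k) g') (fun τ => inner ℂ (φ k) (f τ)) t := by
  obtain ⟨u', ψ, hU, hm, hu', hψ, hd, he, rfl, rfl⟩ := hU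
  have hk := h.basis_mem k
  obtain ⟨C, hC⟩ := hψ.2.2
  have hψk : EssBdd T fun t => ψ t (φ k) := essBdd_of_bound (hψ.1 _ hk)
    (by filter_upwards [hC] with t ht using ht _ hk)
  have h1 : IsPrimitive T (fun t => (inner ℂ (φ k) (u' t) : ℂ)) (fun t => ψ t (φ k)) :=
    ⟨hψk, fun s hs t ht => hd _ hk s hs t ht⟩
  have h2 : IsPrimitive T (fun t => (inner ℂ (φ k) (U t) : ℂ))
      (fun t => (inner ℂ (φ k) (u' t) : ℂ)) :=
    IsPrimitive.inner_left (⟨hm, hu'.2⟩ : IsPrimitive T U u') _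
  refine eq_wave (h.lam_pos k) hT (hf k) h2 (h1.congr (fun _ _ => rfl) ?_)
  filter_upwards [he _ hk, hU.2.1] with t h2 h3
  rw [h.energy_basis h3] at h2
  have : ψ t (φ k) = pair μ Ω (f t) (φ k) - lam k * inner ℂ (φ k) (U t) := by rw [← h2]; ring
  rw [this, pair]
  ring

end SpectralData

end KreinFeller

end


noncomputable section

namespace KreinFeller

/-! ### Well-posedness -/

section Abstract

variable {X : Type*} [NormedAddCommGroup X] [InnerProductSpace ℂ X]
  (φ : HilbertBasis ℕ ℂ X) {lam : ℕ → ℝ} {c₀ T N : ℝ}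

theorem ELinfty.mono (h0 : 0 < c₀) (hl : ∀ k, c₀ ≤ lam k) {α β : ℝ} (hαβ : α ≤ β) {u : ℝ → X}
    (hu : ELinfty φ lam β T u) : ELinfty φ lam α T u := by
  have hp : ∀ k, 0 ≤ lam k := fun k => h0.le.trans (hl k)
  rw [eLinfty_iff φ hp] at hu ⊢
  exact hu.mono h0 hl hαβ

theorem ELinfty.essBdd {u : ℝ → X} (hu : ELinfty φ lam 0 T u) : EssBdd T u := by
  obtain ⟨C, hC⟩ := hu.2.2
  refine essBdd_of_bound (C := C) hu.1 ?_
  filter_upwards [hC] with t ht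
  simpa [ENorm, (hasSum_norm_sq_coef φ (u t)).tsum_eq] using ht

theorem ELinfty.congr {α : ℝ} {u v : ℝ → X} (hu : ELinfty φ lam α T u)
    (h : ∀ t ∈ Icc 0 T, u t = v t) : ELinfty φ lam α T v := by
  have hae : ∀ᵐ t ∂volume.restrict (Icc 0 T), u t = v t :=
    (ae_restrict_iff' measurableSet_Icc).2 (Eventually.of_forall h)
  obtain ⟨h1, h2, C, h3⟩ := hu
  refine ⟨h1.congr hae, ?_, C, ?_⟩
  · filter_upwards [hae, h2] with t ht h2
    rwa [← ht]
  · filter_upwards [hae, h3] with t ht h3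
    rwa [← ht]

theorem coefBdd_zero (α : ℝ) : CoefBdd lam α T fun _ _ => 0 :=
  ⟨fun _ => aestronglyMeasurable_const, 0, Eventually.of_forall fun t => by simp [summable_zero]⟩

/-- Domination of the solutions of a family of scalar equations in the space of order `α`. -/
def IsDominated (lam : ℕ → ℝ) (α T : ℝ) (S : ℕ → (ℝ → ℂ) → ℝ → ℂ) : Prop :=
  ∀ γ : ℕ → ℝ → ℂ, CoefBdd lam α T γ → ∃ m : ℕ → ℝ, Summable m ∧
    ∀ k, ∀ t ∈ Icc 0 T, ‖S k (γ k) t‖ ^ 2 * lam k ^ α ≤ m k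

/-- Regularity is obtained by solving a second time, in the smaller space of order `α`. That
solution also has order 1 and therefore coincides with the first one, so the two Lipschitz constants
of `F` need not be related. -/
theorem semilinear_wellposed [CompleteSpace X] (h0 : 0 < c₀) (hl : ∀ k, c₀ ≤ lam k) (hT : 0 < T)
    {S : ℕ → (ℝ → ℂ) → ℝ → ℂ} (hS : IsSolutionFamily T N S) (hd : IsDominated lam 1 T S) {F : X → X}
    (hF : ELip φ lam 1 F) : ∃ u : ℝ → X, ELinfty φ lam 1 T u ∧ IsVolterraSolution φ T S F u ∧
      (∀ v, ELinfty φ lam 1 T v → IsVolterraSolution φ T S F v → ∀ t ∈ Icc 0 T, v t = u t) ∧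
      ∀ α ≥ 1, ELip φ lam α F → IsDominated lam α T S →
        ELinfty φ lam α T u ∧ ELinfty φ lam α T fun t => F (u t) := by
  have hp : ∀ k, 0 < lam k := fun k => h0.trans_le (hl k)
  -- The solution formula holds at every time and has a majorant independent of `t`, which upgrades
  -- membership from almost every time to every time.
  have key : ∀ v, ELinfty φ lam 1 T v → IsVolterraSolution φ T S F v →
      ∀ t ∈ Icc 0 T, EMem φ lam 1 (v t) := by
    intro v hv hv' t ht
    obtain ⟨m, hm, hb⟩ := hd _ ((eLinfty_iff φ fun k => (hp k).le).1
      (hF.comp_eLinfty φ h0 hl zero_le_one hv))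
    refine summable_of_dominated (fun k => mul_nonneg (sq_nonneg _)
      (Real.rpow_nonneg (hp k).le _)) hm fun k => ?_
    rw [hv' t ht k]
    exact hb k t ht
  obtain ⟨m, hm, hb⟩ := hd _ (coefBdd_zero 1)
  obtain ⟨u, hu, hu'⟩ := exists_semilinear_solution φ h0 hl zero_le_one hT hS hm hb hF
  have huniq : ∀ v, ELinfty φ lam 1 T v → IsVolterraSolution φ T S F v →
      ∀ t ∈ Icc 0 T, v t = u t := fun v hv hv' =>
    semilinear_unique φ h0 hl zero_le_one hS hF hv hu (key v hv hv') (key u hu hu') hv' hu'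
  refine ⟨u, hu, hu', huniq, fun α hα hFα hdα => ?_⟩
  have hα0 : 0 ≤ α := zero_le_one.trans hα
  obtain ⟨m, hm, hb⟩ := hdα _ (coefBdd_zero α)
  obtain ⟨v, hv, hv'⟩ := exists_semilinear_solution φ h0 hl hα0 hT hS hm hb hFα
  have huα := hv.congr φ (huniq v (hv.mono φ h0 hl hα) hv')
  exact ⟨huα, hFα.comp_eLinfty φ h0 hl hα0 huα⟩

theorem duhamel_isDominated (hT : 0 ≤ T) (hl : ∀ k, 0 < lam k) {ζ σ : ℂ} (hζ : ζ.re ≤ 0)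
    (hσ : ‖σ‖ = 1) {α : ℝ} {g : X} (hg : EMem φ lam α g) :
    IsDominated lam α T fun k γ => duhamel (ζ * lam k) (inner ℂ (φ k) g) fun τ => σ * γ τ :=
  fun _ hγ => duhamel_dominated hT hl hζ hσ hg hγ

theorem wave_isDominated (h0 : 0 < c₀) (hl : ∀ k, c₀ ≤ lam k) (hT : 0 ≤ T) {α : ℝ} {g h : X}
    (hg : EMem φ lam α g) (hh : EMem φ lam (α - 1) h) :
    IsDominated lam α T fun k γ => waveCoeff (lam k) (inner ℂ (φ k) g) (inner ℂ (φ k) h) γ := by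
  intro γ hγ
  obtain ⟨m, hm, hb⟩ := wave_dominated hT (fun k => h0.trans_le (hl k)) hg hh
    (hγ.mono h0 hl (by linarith))
  exact ⟨m, hm, fun k t ht => (hb k t ht).1⟩

theorem duhamel_zero (z a : ℂ) (γ : ℝ → ℂ) : duhamel z a γ 0 = a := by simp [duhamel]

theorem heatCoeff_eq (l : ℝ) (a : ℂ) (γ : ℝ → ℂ) :
    heatCoeff l a γ = duhamel (-1 * l) a fun τ => 1 * γ τ := by
  ext t
  simp [heatCoeff_eq_duhamel]

theorem schrodingerCoeff_eq (l : ℝ) (a : ℂ) (γ : ℝ → ℂ) :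
    schrodingerCoeff l a γ = duhamel (-Complex.I * l) a fun τ => -Complex.I * γ τ := by
  ext t
  rw [schrodingerCoeff_eq_duhamel]

end Abstract

namespace SpectralData

variable {μ : Measure S2} {Ω : Set S2} {φ : HilbertBasis ℕ ℂ (L2 μ Ω)} {lam : ℕ → ℝ} {c₀ T : ℝ}

theorem eLip_of_lipDom (h : SpectralData μ Ω φ lam c₀) {F : L2 μ Ω → L2 μ Ω}
    (hF : LipDom μ Ω F) : ELip φ lam 1 F := by
  obtain ⟨h1, c, hc, h2⟩ := hF
  have hm := h.mem_dom
  have sub_mem : ∀ {v w}, v ∈ dom μ Ω → w ∈ dom μ Ω → v - w ∈ dom μ Ω := fun hv hw =>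
    (hm _).2 (((hm _).1 hv).sub φ h.lam_pos ((hm _).1 hw))
  refine ⟨fun w hw => (hm _).1 (h1 ((hm _).2 hw)), c, hc, fun u hu v hv => ?_⟩
  have hu := (hm _).2 hu
  have hv := (hm _).2 hv
  rw [← h.energyNorm_eq (sub_mem (h1 hu) (h1 hv)), ← h.energyNorm_eq (sub_mem hu hv)]
  exact h2 u hu v hv

section FirstOrder

variable {ζ σ : ℂ} {g : L2 μ Ω} {f u : ℝ → L2 μ Ω}

/-- Weak formulation of `∂_t u = -ζ Δ_μ u + σ f`, `u 0 = g`. -/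
def IsWeak (μ : Measure S2) (Ω : Set S2) (T : ℝ) (ζ σ : ℂ) (g : L2 μ Ω) (f u : ℝ → L2 μ Ω) : Prop :=
  ∃ ψ : ℝ → L2 μ Ω → ℂ,
    LinftyDom μ Ω T u ∧ LinftyDual μ Ω T ψ ∧ HasDualDeriv μ Ω T u ψ ∧
    (∀ v ∈ dom μ Ω, ∀ᵐ t ∂volume.restrict (Icc 0 T),
      ψ t v = ζ * energy μ Ω (u t) v + σ * pair μ Ω (f t) v) ∧
    u 0 = g

theorem isHeatSolution_iff : IsHeatSolution μ Ω T g f u ↔ IsWeak μ Ω T (-1) 1 g f u := by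
  refine exists_congr fun ψ => and_congr_right fun _ => and_congr_right fun _ =>
    and_congr_right fun _ => and_congr_left fun _ => forall₂_congr fun v _ => ?_
  refine eventually_congr (Eventually.of_forall fun t => ?_)
  constructor
  · intro h; linear_combination h
  · intro h; linear_combination h

/-- Multiplication of the equation by `-i`, respectively by `i`. -/
theorem isSchrodingerSolution_iff : IsSchrodingerSolution μ Ω T g f u ↔
    IsWeak μ Ω T (-Complex.I) (-Complex.I) g f u := by
  refine exists_congr fun ψ => and_congr_right fun _ => and_congr_right fun _ =>
    and_congr_right fun _ => and_congr_left fun _ => forall₂_congr fun v _ => ?_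
  refine eventually_congr (Eventually.of_forall fun t => ?_)
  constructor
  · intro h; linear_combination (-Complex.I) * h + (ψ t v) * Complex.I_sq
  · intro h
    linear_combination Complex.I * h - (energy μ Ω (u t) v + pair μ Ω (f t) v) * Complex.I_sq

theorem IsWeak.coef (h : SpectralData μ Ω φ lam c₀) (hT : 0 ≤ T) (hu : IsWeak μ Ω T ζ σ g f u)
    (k : ℕ) : ∀ t ∈ Icc 0 T, inner ℂ (φ k) (u t) = duhamel (ζ * lam k) (inner ℂ (φ k) g)
        (fun τ => σ * inner ℂ (φ k) (f τ)) t := by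
  obtain ⟨ψ, h1, h2, h3, h4, rfl⟩ := hu
  exact h.coef_of_weak hT h1 h2 h3 h4 k

theorem firstOrder (h : SpectralData μ Ω φ lam c₀) (hT : 0 ≤ T) (hζ : ζ.re ≤ 0) (hζ1 : ‖ζ‖ = 1)
    (hσ : ‖σ‖ = 1) {α : ℝ} (hg : EMem φ lam α g) (hf : ELinfty φ lam α T f)
    (hfb : ∀ k, EssBdd T fun t => (inner ℂ (φ k) (f t) : ℂ))
    (hu : ∀ t ∈ Icc 0 T, HasSum (fun k => duhamel (ζ * lam k) (inner ℂ (φ k) g)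
      (fun τ => σ * inner ℂ (φ k) (f τ)) t • φ k) (u t)) :
    ELinfty φ lam α T u ∧ CoefBdd lam (α - 2) T (fun k t => ζ * lam k * duhamel (ζ * lam k)
      (inner ℂ (φ k) g) (fun τ => σ * inner ℂ (φ k) (f τ)) t + σ * inner ℂ (φ k) (f t)) ∧
      ∀ k, IsPrimitive T (duhamel (ζ * lam k)
        (inner ℂ (φ k) g) (fun τ => σ * inner ℂ (φ k) (f τ))) (fun t => ζ * lam k *
          duhamel (ζ * lam k) (inner ℂ (φ k) g) (fun τ => σ * inner ℂ (φ k) (f τ)) t +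
          σ * inner ℂ (φ k) (f t)) := by
  have hp := h.lam_pos
  have hfc := (eLinfty_iff φ fun k => (hp k).le).1 hf
  obtain ⟨m, hm, hb⟩ := duhamel_dominated hT hp hζ hσ hg hfc
  have hprim : ∀ k, IsPrimitive T (duhamel (ζ * lam k)
        (inner ℂ (φ k) g) (fun τ => σ * inner ℂ (φ k) (f τ))) _ := fun k =>
    duhamel_isPrimitive hT (ζ * lam k) (inner ℂ (φ k) g) ((hfb k).const_mul σ)
  have hc := CoefBdd.of_dominated (fun k => (hp k).le) hm
    (fun k => (hprim k).continuousOn.aestronglyMeasurable measurableSet_Icc) hb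
  refine ⟨eLinfty_of_hasSum φ hp hc hu, ?_, hprim⟩
  exact CoefBdd.mul_add h.pos h.le (by simpa using hc) (hfc.mono h.pos h.le (by linarith)) hζ1 hσ

/-- Used with `(ζ, σ) = (-1, 1)` for heat and `(-i, -i)` for Schrödinger. The derivative loses two
orders: from order 1 it lands in order `-1`, the dual of `dom`, and from `α ≥ 2` it stays in `L²`.
-/
theorem firstOrder_linear (h : SpectralData μ Ω φ lam c₀) (hT : 0 < T) (hζ : ζ.re ≤ 0)
    (hζ1 : ‖ζ‖ = 1) (hσ : ‖σ‖ = 1) (hg : g ∈ dom μ Ω) (hf : LinftyDom μ Ω T f)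
    (hu : ∀ t ∈ Icc 0 T, HasSum (fun k => duhamel (ζ * lam k) (inner ℂ (φ k) g)
      (fun τ => σ * inner ℂ (φ k) (f τ)) t • φ k) (u t)) :
    (∀ᵐ t ∂volume.restrict (Icc 0 T),
        MemDual lam (fun k => ζ * lam k * duhamel (ζ * lam k) (inner ℂ (φ k) g)
          (fun τ => σ * inner ℂ (φ k) (f τ)) t + σ * inner ℂ (φ k) (f t)) ∧
        HasDualDerivAt μ Ω u (dualSeries μ Ω φ fun k => ζ * lam k * duhamel (ζ * lam k)
          (inner ℂ (φ k) g) (fun τ => σ * inner ℂ (φ k) (f τ)) t + σ * inner ℂ (φ k) (f t)) t) ∧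
      IsUniqueSolution μ Ω T (IsWeak μ Ω T ζ σ g f) u ∧
      (∀ α ≥ 2, g ∈ memE μ Ω φ lam α → LinftyE μ Ω φ lam α T f →
        LinftyE μ Ω φ lam α T u ∧
          ∃ u' : ℝ → L2 μ Ω, HasL2Deriv μ Ω T u u' ∧ LinftyE μ Ω φ lam (α - 2) T u') := by
  have hp := h.lam_pos
  have hf1 := (h.linftyDom_iff T f).1 hf
  have hfc := (eLinfty_iff φ fun k => (hp k).le).1 hf1
  have hfb := hfc.essBdd hp
  obtain ⟨h1, h2, h3⟩ := h.firstOrder hT.le hζ hζ1 hσ ((h.mem_dom g).1 hg) hf1 hfb hu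
  rw [show (1 : ℝ) - 2 = -1 by norm_num] at h2
  refine ⟨h.hasDualDerivAt hu h2 h3, ⟨⟨_, (h.linftyDom_iff T u).2 h1, h.linftyDual h2,
    h.hasDualDeriv hu h2 h3, fun v hv => ?_, ?_⟩, fun v hv t ht => ext_coef φ fun k => ?_⟩,
    fun α hα hgα hfα => ?_⟩
  · rw [ae_restrict_iff' measurableSet_Icc]
    have h4 := h1.2.1
    rw [ae_restrict_iff' measurableSet_Icc] at h4
    filter_upwards [h4] with t h4 ht
    rw [← h.dualSeries_equation ((h.mem_dom _).2 (h4 ht)) hv]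
    simp only [(hasSum_iff_coef φ).1 (hu t ht)]
  · refine ext_coef φ fun k => ?_
    rw [(hasSum_iff_coef φ).1 (hu 0 ⟨le_rfl, hT.le⟩), duhamel_zero]
  · rw [hv.coef h hT.le k t ht, (hasSum_iff_coef φ).1 (hu t ht)]
  · obtain ⟨h5, h6, -⟩ := h.firstOrder hT.le hζ hζ1 hσ hgα hfα hfb hu
    obtain ⟨v, hv, hv'⟩ := exists_derivative φ h.pos h.le (by linarith) h6 hu h3
    exact ⟨h5, v, hasL2Deriv hT.le hv, hv'⟩

theorem firstOrder_exists (h : SpectralData μ Ω φ lam c₀) (hT : 0 < T) (hζ : ζ.re ≤ 0)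
    (hσ : ‖σ‖ = 1) (hg : g ∈ dom μ Ω) (hf : LinftyDom μ Ω T f) :
    ∃ u : ℝ → L2 μ Ω, ∀ t ∈ Icc 0 T, HasSum (fun k => duhamel (ζ * lam k) (inner ℂ (φ k) g)
      (fun τ => σ * inner ℂ (φ k) (f τ)) t • φ k) (u t) := by
  have hfc := (eLinfty_iff φ fun k => (h.lam_pos k).le).1 ((h.linftyDom_iff T f).1 hf)
  obtain ⟨m, hm, hb⟩ := duhamel_dominated hT.le h.lam_pos hζ hσ ((h.mem_dom g).1 hg) hfc
  exact exists_curve φ h.pos h.le zero_le_one hm hb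

/-- The fixed point solves the linear equation with the frozen forcing `F (u t)`, so the linear
theory supplies the weak formulation and the derivative. Conversely every weak solution satisfies
Duhamel's formula, hence is the fixed point. -/
theorem firstOrder_semilinear (h : SpectralData μ Ω φ lam c₀) (hT : 0 < T) (hζ : ζ.re ≤ 0)
    (hζ1 : ‖ζ‖ = 1) (hσ : ‖σ‖ = 1) (hg : g ∈ dom μ Ω) {F : L2 μ Ω → L2 μ Ω} (hF : LipDom μ Ω F) :
    ∃ u : ℝ → L2 μ Ω,
      IsUniqueSolution μ Ω T (fun u => IsWeak μ Ω T ζ σ g (fun t => F (u t)) u) u ∧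
      (∀ t ∈ Icc 0 T, HasSum (fun k => duhamel (ζ * lam k) (inner ℂ (φ k) g)
        (fun τ => σ * inner ℂ (φ k) (F (u τ))) t • φ k) (u t)) ∧
      (∀ α ≥ 2, LipE μ Ω φ lam α F → g ∈ memE μ Ω φ lam α →
        LinftyE μ Ω φ lam α T u ∧
          ∃ u' : ℝ → L2 μ Ω, HasL2Deriv μ Ω T u u' ∧ LinftyE μ Ω φ lam (α - 2) T u') := by
  have hF1 := h.eLip_of_lipDom hF
  have hg1 := (h.mem_dom g).1 hg
  obtain ⟨u, hu, hu', huniq, hreg⟩ := semilinear_wellposed φ h.pos h.le hT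
    (duhamel_isSolutionFamily hT.le h.lam_pos hζ hσ fun k => inner ℂ (φ k) g)
    (duhamel_isDominated φ hT.le h.lam_pos hζ hσ hg1) hF1
  have hs : ∀ t ∈ Icc 0 T, HasSum (fun k => duhamel (ζ * lam k) (inner ℂ (φ k) g)
        (fun τ => σ * inner ℂ (φ k) (F (u τ))) t • φ k) (u t) := fun t ht =>
    (hasSum_iff_coef φ).2 (hu' t ht)
  have hFu := hF1.comp_eLinfty φ h.pos h.le zero_le_one hu
  obtain ⟨-, h2, h3⟩ := h.firstOrder_linear hT hζ hζ1 hσ hg ((h.linftyDom_iff _ _).2 hFu) hs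
  refine ⟨u, ⟨h2.1, fun v hv => ?_⟩, hs, fun α hα hFα hgα => ?_⟩
  · exact huniq v ((h.linftyDom_iff _ _).1 hv.choose_spec.1) fun t ht k => hv.coef h hT.le k t ht
  · exact h3 α hα hgα (hreg α (by linarith) hFα
      (duhamel_isDominated φ hT.le h.lam_pos hζ hσ hgα)).2

end FirstOrder

theorem norm_sq_le_of_coef {u g : L2 μ Ω}
    (hc : ∀ k, ‖(inner ℂ (φ k) u : ℂ)‖ ≤ ‖(inner ℂ (φ k) g : ℂ)‖) : ‖u‖ ≤ ‖g‖ := by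
  have h1 := hasSum_le (fun k => pow_le_pow_left₀ (norm_nonneg _) (hc k) 2)
    (hasSum_norm_sq_coef φ u) (hasSum_norm_sq_coef φ g)
  exact (pow_le_pow_iff_left₀ (norm_nonneg _) (norm_nonneg _) two_ne_zero).1 h1

theorem energy_le_of_coef (h : SpectralData μ Ω φ lam c₀) {u g : L2 μ Ω} (hg : g ∈ dom μ Ω)
    (hc : ∀ k, ‖(inner ℂ (φ k) u : ℂ)‖ ≤ ‖(inner ℂ (φ k) g : ℂ)‖) :
    u ∈ dom μ Ω ∧ (energy μ Ω u u).re ≤ (energy μ Ω g g).re := by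
  have hp := fun k => Real.rpow_pos_of_pos (h.lam_pos k) 1
  have hg1 := (h.mem_dom g).1 hg
  have hle : ∀ k, ‖(inner ℂ (φ k) u : ℂ)‖ ^ 2 * lam k ^ (1 : ℝ) ≤
      ‖(inner ℂ (φ k) g : ℂ)‖ ^ 2 * lam k ^ (1 : ℝ) := fun k => by
    have := hc k
    have := hp k
    gcongr
  have hu1 : EMem φ lam 1 u := summable_of_dominated
    (fun k => mul_nonneg (sq_nonneg _) (hp k).le) hg1 hle
  have hu := (h.mem_dom u).2 hu1
  refine ⟨hu, ?_⟩
  rw [h.energy_re hu, h.energy_re hg]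
  exact hu1.tsum_le_tsum hle hg1

theorem heatLinear (h : SpectralData μ Ω φ lam c₀) : HeatLinear μ Ω φ lam := by
  refine ⟨fun T hT g hg f hf => ?_, fun T hT g hg u hu t ht => ?_⟩
  · obtain ⟨u, hu⟩ := h.firstOrder_exists (ζ := -1) (σ := 1) hT (by simp) (by simp) hg hf
    obtain ⟨h1, h2, h3⟩ := h.firstOrder_linear hT (by simp) (by simp) (by simp) hg hf hu
    have e : ∀ k t, heatCoeff' (lam k) (inner ℂ (φ k) g) (fun τ => inner ℂ (φ k) (f τ)) t =
        -1 * lam k * duhamel (-1 * lam k) (inner ℂ (φ k) g)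
          (fun τ => 1 * inner ℂ (φ k) (f τ)) t + 1 * inner ℂ (φ k) (f t) := fun k t => by
      rw [heatCoeff'_eq]; simp
    refine ⟨u, ?_, ?_, ?_, h3⟩
    · simpa only [heatCoeff_eq] using hu
    · simpa only [e] using h1
    · exact ⟨isHeatSolution_iff.2 h2.1, fun v hv => h2.2 v (isHeatSolution_iff.1 hv)⟩
  · have hc : ∀ k, ‖(inner ℂ (φ k) (u t) : ℂ)‖ ≤ ‖(inner ℂ (φ k) g : ℂ)‖ := fun k => by
      rw [(hasSum_iff_coef φ).1 (hu t ht) k]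
      simp only [heatCoeff, mul_zero, intervalIntegral.integral_zero, add_zero, norm_mul]
      rw [Complex.norm_real, Real.norm_of_nonneg (Real.exp_pos _).le]
      refine mul_le_of_le_one_left (norm_nonneg _) (Real.exp_le_one_iff.2 ?_)
      nlinarith [mul_nonneg (h.lam_pos k).le ht.1]
    obtain ⟨h1, h2⟩ := h.energy_le_of_coef hg hc
    exact ⟨h1, norm_sq_le_of_coef hc, h2⟩

theorem schrodingerLinear (h : SpectralData μ Ω φ lam c₀) : SchrodingerLinear μ Ω φ lam := by
  refine ⟨fun T hT g hg f hf => ?_, fun T hT g hg u hu t ht => ?_⟩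
  · obtain ⟨u, hu⟩ := h.firstOrder_exists (ζ := -Complex.I) (σ := -Complex.I) hT (by simp)
      (by simp) hg hf
    obtain ⟨h1, h2, h3⟩ := h.firstOrder_linear hT (by simp) (by simp) (by simp) hg hf hu
    refine ⟨u, ?_, ?_, ?_, h3⟩
    · simpa only [schrodingerCoeff_eq] using hu
    · simpa only [schrodingerCoeff'_eq] using h1
    · exact ⟨isSchrodingerSolution_iff.2 h2.1, fun v hv => h2.2 v (isSchrodingerSolution_iff.1 hv)⟩
  · have hc : ∀ k, ‖(inner ℂ (φ k) (u t) : ℂ)‖ = ‖(inner ℂ (φ k) g : ℂ)‖ := fun k => by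
      rw [(hasSum_iff_coef φ).1 (hu t ht) k]
      simp only [schrodingerCoeff, mul_zero, intervalIntegral.integral_zero, sub_zero, norm_mul]
      rw [Complex.norm_exp]
      simp
    obtain ⟨h1, h2⟩ := h.energy_le_of_coef hg fun k => (hc k).le
    obtain ⟨-, h3⟩ := h.energy_le_of_coef h1 fun k => (hc k).ge
    exact ⟨h1, (norm_sq_le_of_coef fun k => (hc k).le).antisymm
      (norm_sq_le_of_coef fun k => (hc k).ge), h2.antisymm h3⟩

theorem heatSemilinear (h : SpectralData μ Ω φ lam c₀) : HeatSemilinear μ Ω φ lam := by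
  intro F hF T hT g hg
  obtain ⟨u, h1, h2, h3⟩ := h.firstOrder_semilinear (ζ := -1) (σ := 1) hT (by simp) (by simp)
    (by simp) hg hF
  refine ⟨u, ?_, ?_, h3⟩
  · simpa only [← isHeatSolution_iff] using h1
  · simpa only [heatCoeff_eq] using h2

theorem schrodingerSemilinear (h : SpectralData μ Ω φ lam c₀) :
    SchrodingerSemilinear μ Ω φ lam := by
  intro F hF T hT g hg
  obtain ⟨u, h1, h2, h3⟩ := h.firstOrder_semilinear (ζ := -Complex.I) (σ := -Complex.I) hT
    (by simp) (by simp) (by simp) hg hF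
  refine ⟨u, ?_, ?_, h3⟩
  · simpa only [← isSchrodingerSolution_iff] using h1
  · simpa only [schrodingerCoeff_eq] using h2

section Wave

variable {g g' : L2 μ Ω} {f u H : ℝ → L2 μ Ω}

theorem wave_coefBdd (h : SpectralData μ Ω φ lam c₀) (hT : 0 ≤ T) {α : ℝ} (hg : EMem φ lam α g)
    (hg' : EMem φ lam (α - 1) g') (hf : CoefBdd lam (α - 1) T fun k t => inner ℂ (φ k) (f t)) :
    CoefBdd lam α T (fun k => waveCoeff (lam k) (inner ℂ (φ k) g) (inner ℂ (φ k) g')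
        (fun τ => inner ℂ (φ k) (f τ))) ∧
      CoefBdd lam (α - 1) T (fun k => waveCoeff' (lam k) (inner ℂ (φ k) g) (inner ℂ (φ k) g')
        (fun τ => inner ℂ (φ k) (f τ))) ∧
      CoefBdd lam (α - 2) T (fun k => waveCoeff'' (lam k) (inner ℂ (φ k) g) (inner ℂ (φ k) g')
        (fun τ => inner ℂ (φ k) (f τ))) := by
  have hp := h.lam_pos
  obtain ⟨m, hm, hb⟩ := wave_dominated hT hp hg hg' hf
  have hprim := fun k => wave_isPrimitive (hp k) (inner ℂ (φ k) g) (inner ℂ (φ k) g')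
    (hf.essBdd hp k) hT
  have h1 := CoefBdd.of_dominated (fun k => (hp k).le) hm
    (fun k => (hprim k).1.continuousOn.aestronglyMeasurable measurableSet_Icc)
    fun k t ht => (hb k t ht).1
  refine ⟨h1, CoefBdd.of_dominated (fun k => (hp k).le) hm
    (fun k => (hprim k).2.continuousOn.aestronglyMeasurable measurableSet_Icc)
    fun k t ht => (hb k t ht).2, ?_⟩
  have h2 := CoefBdd.mul_add (α := α - 2) (ζ := -1) (σ := 1) h.pos h.le (by simpa using h1)
    (hf.mono h.pos h.le (by linarith)) (by simp) (by simp)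
  refine (congrArg _ (funext₂ fun k t => ?_)).mp h2
  rw [waveCoeff''_eq (hp k)]
  ring

/-- Each time derivative costs one order. Starting from order 1 the solution, its velocity and its
acceleration lie in `dom`, `L²` and the dual of `dom`; this is why `g'` need only be in `L²`. -/
theorem wave_linear (h : SpectralData μ Ω φ lam c₀) (hT : 0 < T) (hg : g ∈ dom μ Ω)
    (hf : LinftyDom μ Ω T f)
    (hu : ∀ t ∈ Icc 0 T, HasSum (fun k => waveCoeff (lam k) (inner ℂ (φ k) g) (inner ℂ (φ k) g')
      (fun τ => inner ℂ (φ k) (f τ)) t • φ k) (u t))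
    (hH : ∀ t ∈ Icc 0 T, HasSum (fun k => waveCoeff' (lam k) (inner ℂ (φ k) g) (inner ℂ (φ k) g')
      (fun τ => inner ℂ (φ k) (f τ)) t • φ k) (H t)) :
    IsPrimitive T u H ∧
      (∀ᵐ t ∂volume.restrict (Icc 0 T),
        MemDual lam (fun k => waveCoeff'' (lam k) (inner ℂ (φ k) g) (inner ℂ (φ k) g')
          (fun τ => inner ℂ (φ k) (f τ)) t) ∧
        HasDualDerivAt μ Ω H (dualSeries μ Ω φ fun k =>
          waveCoeff'' (lam k) (inner ℂ (φ k) g) (inner ℂ (φ k) g')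
            (fun τ => inner ℂ (φ k) (f τ)) t) t) ∧
      IsUniqueSolution μ Ω T (IsWaveSolution μ Ω T g g' f) u ∧
      ∀ α ≥ 2, g ∈ memE μ Ω φ lam α → g' ∈ memE μ Ω φ lam (α - 1) → LinftyE μ Ω φ lam α T f →
        LinftyE μ Ω φ lam α T u ∧ LinftyE μ Ω φ lam (α - 1) T H ∧
          ∃ v, IsPrimitive T H v ∧ LinftyE μ Ω φ lam (α - 2) T v := by
  have hp := h.lam_pos
  have hf1 := (h.linftyDom_iff T f).1 hf
  have hfc := (eLinfty_iff φ fun k => (hp k).le).1 hf1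
  have hfb := hfc.essBdd hp
  have hg'0 : EMem φ lam (1 - 1) g' := by
    simpa [EMem] using (hasSum_norm_sq_coef φ g').summable
  obtain ⟨b1, b2, b3⟩ := h.wave_coefBdd hT.le ((h.mem_dom g).1 hg) hg'0
    (hfc.mono h.pos h.le (by norm_num))
  rw [show (1 : ℝ) - 2 = -1 by norm_num] at b3
  rw [sub_self] at b2
  have hprim := fun k => wave_isPrimitive (hp k) (inner ℂ (φ k) g) (inner ℂ (φ k) g') (hfb k) hT.le
  have hu1 := eLinfty_of_hasSum φ hp b1 hu
  have hHb := (eLinfty_of_hasSum φ hp b2 hH).essBdd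
  have hcu : ∀ t ∈ Icc 0 T, ∀ k, _ := fun t ht => (hasSum_iff_coef φ).1 (hu t ht)
  have hcH : ∀ t ∈ Icc 0 T, ∀ k, _ := fun t ht => (hasSum_iff_coef φ).1 (hH t ht)
  have huH : IsPrimitive T u H := .of_coef φ hHb fun k => (hprim k).1.congr
    (fun t ht => (hcu t ht k).symm) ((ae_restrict_iff' measurableSet_Icc).2
      (Eventually.of_forall fun t ht => (hcH t ht k).symm))
  refine ⟨huH, h.hasDualDerivAt hH b3 fun k => (hprim k).2,
    ⟨⟨H, _, (h.linftyDom_iff T u).2 hu1, hHb, hasL2Deriv hT.le huH, h.linftyDual b3,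
      h.hasDualDeriv hH b3 fun k => (hprim k).2, fun v hv => ?_, ?_, ?_⟩,
      fun v hv t ht => ext_coef φ fun k => ?_⟩, fun α hα hgα hgα' hfα => ?_⟩
  · rw [ae_restrict_iff' measurableSet_Icc]
    have h4 := hu1.2.1
    rw [ae_restrict_iff' measurableSet_Icc] at h4
    filter_upwards [h4] with t h4 ht
    have h5 := h.dualSeries_equation (f := f t) ((h.mem_dom _).2 (h4 ht)) hv (-1) 1
    have e : (fun k => waveCoeff'' (lam k) (inner ℂ (φ k) g) (inner ℂ (φ k) g')
          (fun τ => inner ℂ (φ k) (f τ)) t) =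
        fun k => -1 * lam k * inner ℂ (φ k) (u t) + 1 * inner ℂ (φ k) (f t) := by
      ext k
      rw [waveCoeff''_eq (hp k), hcu t ht k]
      ring
    rw [e, h5]
    ring
  · refine ext_coef φ fun k => ?_
    rw [hcu 0 ⟨le_rfl, hT.le⟩ k]
    simp [waveCoeff]
  · refine ext_coef φ fun k => ?_
    rw [hcH 0 ⟨le_rfl, hT.le⟩ k]
    simp [waveCoeff']
  · rw [h.coef_of_wave hT.le hfb hv k t ht, hcu t ht k]
  · obtain ⟨d1, d2, d3⟩ := h.wave_coefBdd hT.le hgα hgα'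
      (((eLinfty_iff φ fun k => (hp k).le).1 hfα).mono h.pos h.le (by linarith))
    exact ⟨eLinfty_of_hasSum φ hp d1 hu, eLinfty_of_hasSum φ hp d2 hH,
      exists_derivative φ h.pos h.le (by linarith) d3 hH fun k => (hprim k).2⟩

theorem wave_exists (h : SpectralData μ Ω φ lam c₀) (hT : 0 < T) (hg : g ∈ dom μ Ω)
    (g' : L2 μ Ω) (hf : LinftyDom μ Ω T f) : ∃ u H : ℝ → L2 μ Ω,
    (∀ t ∈ Icc 0 T, HasSum (fun k => waveCoeff (lam k) (inner ℂ (φ k) g) (inner ℂ (φ k) g')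
      (fun τ => inner ℂ (φ k) (f τ)) t • φ k) (u t)) ∧
    ∀ t ∈ Icc 0 T, HasSum (fun k => waveCoeff' (lam k) (inner ℂ (φ k) g) (inner ℂ (φ k) g')
      (fun τ => inner ℂ (φ k) (f τ)) t • φ k) (H t) := by
  have hp := h.lam_pos
  have hfc := (eLinfty_iff φ fun k => (hp k).le).1 ((h.linftyDom_iff T f).1 hf)
  have hg'0 : EMem φ lam (1 - 1) g' := by
    simpa [EMem] using (hasSum_norm_sq_coef φ g').summable
  obtain ⟨m, hm, hb⟩ := wave_dominated hT.le hp ((h.mem_dom g).1 hg) hg'0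
    (hfc.mono h.pos h.le (by norm_num))
  obtain ⟨u, hu⟩ := exists_curve φ h.pos h.le zero_le_one hm fun k t ht => (hb k t ht).1
  obtain ⟨H, hH⟩ := exists_curve φ h.pos h.le (sub_self (1 : ℝ)).ge hm fun k t ht => (hb k t ht).2
  exact ⟨u, H, hu, hH⟩

/-- Cauchy–Schwarz with `sin² + cos² = 1`. It keeps the coefficient of `‖a‖²` equal to 1, which the
triangle inequality would not. -/
theorem wave_free_bound {l : ℝ} (hl : 0 < l) (a b : ℂ) (t : ℝ) :
    ‖waveCoeff l a b (fun _ => 0) t‖ ^ 2 ≤ ‖b‖ ^ 2 / l + ‖a‖ ^ 2 := by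
  have hs := Real.sqrt_pos.2 hl
  set x := Real.sin (√l * t)
  set y := Real.cos (√l * t)
  have hxy : x ^ 2 + y ^ 2 = 1 := Real.sin_sq_add_cos_sq _
  have h1 : ‖waveCoeff l a b (fun _ => 0) t‖ ≤ |x| * (‖b‖ / √l) + |y| * ‖a‖ := by
    simp only [waveCoeff, mul_zero, intervalIntegral.integral_zero, add_zero]
    refine (norm_add_le _ _).trans_eq ?_
    rw [norm_mul, norm_mul, Complex.norm_real, Complex.norm_real, Real.norm_eq_abs,
      Real.norm_eq_abs, abs_div, abs_of_pos hs]
    ring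
  have h2 : (‖b‖ / √l) ^ 2 = ‖b‖ ^ 2 / l := by rw [div_pow, Real.sq_sqrt hl.le]
  rw [← h2]
  refine (pow_le_pow_left₀ (norm_nonneg _) h1 2).trans ?_
  have hx : |x| ^ 2 + |y| ^ 2 = 1 := by rw [sq_abs, sq_abs, hxy]
  nlinarith [sq_nonneg (|x| * ‖a‖ - |y| * (‖b‖ / √l))]

theorem waveLinear (h : SpectralData μ Ω φ lam c₀) : WaveLinear μ Ω φ lam := by
  have hp := h.lam_pos
  -- The constants come from `|b|² / λ ≤ c₀⁻² λ |b|²` and `|b|² ≤ c₀⁻¹ λ |b|²`, both consequences of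
  -- `c₀ ≤ λ`.
  refine ⟨fun T hT g hg g' f hf => ?_, (c₀ ^ 2)⁻¹, by have := h.pos; positivity, c₀⁻¹,
    inv_pos.2 h.pos, fun T hT g hg g' hg' u hu t ht => ?_⟩
  · obtain ⟨u, H, hu, hH⟩ := h.wave_exists hT hg g' hf
    obtain ⟨h1, h2, h3, h4⟩ := h.wave_linear hT hg hf hu hH
    refine ⟨u, H, hu, hH, h1.ae_hasDerivAt, h2, h3, fun α hα hgα hgα' hfα => ?_⟩
    obtain ⟨h5, h6, -⟩ := h4 α hα hgα hgα' hfα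
    exact ⟨h5, ELinfty.mono φ h.pos h.le (by linarith) h6⟩
  · have hg1 := (h.mem_dom g).1 hg
    have hg1' := (h.mem_dom g').1 hg'
    have hG := (hasSum_norm_sq_coef φ g).summable
    have hG' := (hasSum_norm_sq_coef φ g').summable
    have hc : ∀ k, ‖(inner ℂ (φ k) (u t) : ℂ)‖ ^ 2 ≤
        ‖(inner ℂ (φ k) g' : ℂ)‖ ^ 2 / lam k + ‖(inner ℂ (φ k) g : ℂ)‖ ^ 2 := fun k => by
      rw [(hasSum_iff_coef φ).1 (hu t ht) k]
      exact wave_free_bound (hp k) _ _ t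
    have hc1 : ∀ k, ‖(inner ℂ (φ k) (u t) : ℂ)‖ ^ 2 * lam k ^ (1 : ℝ) ≤
        c₀⁻¹ * (‖(inner ℂ (φ k) g' : ℂ)‖ ^ 2 * lam k ^ (1 : ℝ)) +
          ‖(inner ℂ (φ k) g : ℂ)‖ ^ 2 * lam k ^ (1 : ℝ) := fun k => by
      have h1 := mul_le_mul_of_nonneg_right (hc k) (hp k).le
      rw [add_mul, div_mul_cancel₀ _ (hp k).ne'] at h1
      rw [Real.rpow_one]
      refine h1.trans (add_le_add ?_ le_rfl)
      rw [inv_mul_eq_div, le_div_iff₀ h.pos]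
      exact mul_le_mul_of_nonneg_left (h.le k) (sq_nonneg _)
    have hs := (hg1'.mul_left c₀⁻¹).add hg1
    have hu1 : EMem φ lam 1 (u t) := summable_of_dominated (fun k => mul_nonneg (sq_nonneg _)
      (Real.rpow_nonneg (hp k).le _)) hs hc1
    have hut := (h.mem_dom _).2 hu1
    have hE : energyNorm μ Ω g' ^ 2 = ∑' k, ‖(inner ℂ (φ k) g' : ℂ)‖ ^ 2 * lam k ^ (1 : ℝ) := by
      rw [h.energyNorm_eq hg', ENorm, Real.sq_sqrt (tsum_nonneg fun k => mul_nonneg (sq_nonneg _)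
        (Real.rpow_nonneg (hp k).le _))]
    refine ⟨hut, ?_, ?_⟩
    · rw [hE]
      have hc2 : ∀ k, ‖(inner ℂ (φ k) (u t) : ℂ)‖ ^ 2 ≤
          (c₀ ^ 2)⁻¹ * (‖(inner ℂ (φ k) g' : ℂ)‖ ^ 2 * lam k ^ (1 : ℝ)) +
            ‖(inner ℂ (φ k) g : ℂ)‖ ^ 2 := fun k => by
        refine (hc k).trans (add_le_add ?_ le_rfl)
        have h0 := h.pos
        have hk := h.le k
        rw [Real.rpow_one, inv_mul_eq_div, div_le_div_iff₀ (hp k) (by positivity), mul_assoc]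
        refine mul_le_mul_of_nonneg_left ?_ (sq_nonneg _)
        nlinarith
      exact hasSum_le hc2 (hasSum_norm_sq_coef φ _)
        ((hg1'.hasSum.mul_left _).add (hasSum_norm_sq_coef φ g))
    · rw [h.energy_re hut, h.energy_re hg', h.energy_re hg]
      exact hasSum_le hc1 hu1.hasSum ((hg1'.hasSum.mul_left _).add hg1.hasSum)

theorem waveSemilinear (h : SpectralData μ Ω φ lam c₀) : WaveSemilinear μ Ω φ lam := by
  intro F hF T hT g hg g'
  have hp := h.lam_pos
  have hF1 := h.eLip_of_lipDom hF
  have hg1 := (h.mem_dom g).1 hg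
  have hg'0 : EMem φ lam (1 - 1) g' := by
    simpa [EMem] using (hasSum_norm_sq_coef φ g').summable
  obtain ⟨u, hu, hu', huniq, hreg⟩ := semilinear_wellposed φ h.pos h.le hT
    (wave_isSolutionFamily hT.le h.pos h.le (fun k => inner ℂ (φ k) g) fun k => inner ℂ (φ k) g')
    (wave_isDominated φ h.pos h.le hT.le hg1 hg'0) hF1
  have hs : ∀ t ∈ Icc 0 T, HasSum (fun k => waveCoeff (lam k) (inner ℂ (φ k) g) (inner ℂ (φ k) g')
        (fun τ => inner ℂ (φ k) (F (u τ))) t • φ k) (u t) := fun t ht =>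
    (hasSum_iff_coef φ).2 (hu' t ht)
  have hcomp : ∀ v, ELinfty φ lam 1 T v → LinftyDom μ Ω T fun t => F (v t) := fun v hv =>
    (h.linftyDom_iff _ _).2 (hF1.comp_eLinfty φ h.pos h.le zero_le_one hv)
  obtain ⟨_, H, -, hH⟩ := h.wave_exists hT hg g' (hcomp u hu)
  obtain ⟨h1, -, h3, h4⟩ := h.wave_linear hT hg (hcomp u hu) hs hH
  refine ⟨u, ⟨h3.1, fun v hv => ?_⟩, hs, fun α hα hFα hgα hgα' => ?_⟩
  · have hv1 : ELinfty φ lam 1 T v := (h.linftyDom_iff _ _).1 hv.choose_spec.choose_spec.1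
    have hb := ((eLinfty_iff φ fun k => (hp k).le).1
      ((h.linftyDom_iff _ _).1 (hcomp v hv1))).essBdd hp
    exact huniq v hv1 fun t ht k => h.coef_of_wave hT.le hb hv k t ht
  · obtain ⟨h5, h6, w, h7, h8⟩ := h4 α hα hgα hgα' (hreg α (by linarith) hFα
      (wave_isDominated φ h.pos h.le hT.le hgα hgα')).2
    exact ⟨h5, H, w, hasL2Deriv hT.le h1, h6, hasL2Deriv hT.le h7, h8⟩

end Wave

end SpectralData

end KreinFeller

end


/-! ### Spectral theory of a compactly embedded form. -/

noncomputable section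

namespace KreinFeller

/-! ### Eigenbases of compact embeddings -/

/-- A function with finite sublevel sets can be enumerated increasingly. -/
theorem exists_monotone_enumeration {ι : Type*} [Infinite ι] (l : ι → ℝ)
    (hl : ∀ c, {i | l i ≤ c}.Finite) :
    ∃ e : ℕ ≃ ι, Monotone (l ∘ e) ∧ Tendsto (l ∘ e) atTop atTop := by
  classical
  -- Outside a finite set the infimum of `l` is attained, because only finitely many indices compete
  -- with a given one. Repeatedly picking such a minimiser gives the enumeration.
  have hmin : ∀ S : Finset ι, ∃ i, i ∉ S ∧ ∀ j, j ∉ S → l i ≤ l j := fun S => by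
    obtain ⟨i₀, hi₀⟩ := Infinite.exists_notMem_finset S
    have hf : {i | i ∉ S ∧ l i ≤ l i₀}.Finite := (hl (l i₀)).subset fun i hi => hi.2
    obtain ⟨i, hi, hm⟩ := hf.exists_minimalFor l _ ⟨i₀, hi₀, le_rfl⟩
    refine ⟨i, hi.1, fun j hj => ?_⟩
    by_contra! h
    exact absurd (hm ⟨hj, h.le.trans hi.2⟩ h.le) (not_le.2 h)
  choose pick hp hpm using hmin
  let S : ℕ → Finset ι := fun n => (fun s => insert (pick s) s)^[n] ∅
  have hS : ∀ n, S (n + 1) = insert (pick (S n)) (S n) := fun n =>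
    Function.iterate_succ_apply' _ _ _
  have hSm : Monotone S := monotone_nat_of_le_succ fun n => by
    rw [hS]
    exact Finset.subset_insert _ _
  let e : ℕ → ι := fun n => pick (S n)
  have hmem : ∀ {m n}, m < n → e m ∈ S n := fun {m n} h => by
    refine hSm (Nat.succ_le_of_lt h) ?_
    rw [Nat.succ_eq_add_one, hS]
    exact Finset.mem_insert_self _ _
  have hinj : Function.Injective e := by
    intro m n h
    rcases lt_trichotomy m n with hmn | hmn | hmn
    · exact absurd (show e n ∈ S n from h ▸ hmem hmn) (hp (S n))
    · exact hmn
    · exact absurd (show e m ∈ S m from h ▸ hmem hmn) (hp (S m))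
  have hmono : Monotone (l ∘ e) := monotone_nat_of_le_succ fun n =>
    hpm (S n) _ fun h => hp (S (n + 1)) (hSm n.le_succ h)
  have hsurj : Function.Surjective e := by
    intro i
    by_contra! h
    have hi : ∀ n, i ∉ S n := by
      intro n
      induction n with
      | zero => simp [S]
      | succ n ih =>
        rw [hS, Finset.mem_insert, not_or]
        exact ⟨fun h' => h n h'.symm, ih⟩
    -- An index never picked would bound `l` on all the infinitely many picked ones.
    exact Set.infinite_range_of_injective hinj ((hl (l i)).subset (by
      rintro _ ⟨n, rfl⟩
      exact hpm (S n) i (hi n)))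
  refine ⟨Equiv.ofBijective e ⟨hinj, hsurj⟩, hmono, tendsto_atTop_atTop.2 fun c => ?_⟩
  have hfin : {n | l (e n) ≤ c}.Finite := (hl c).preimage hinj.injOn
  obtain ⟨N, hN⟩ := hfin.bddAbove
  refine ⟨N + 1, fun n hn => ?_⟩
  by_contra! h
  exact absurd (hN (show n ∈ {n | l (e n) ≤ c} from h.le)) (by omega)

section Compact

variable {X R : Type*} [NormedAddCommGroup X] [InnerProductSpace ℂ X]
  [NormedAddCommGroup R] [InnerProductSpace ℂ R] [CompleteSpace R]

/-- Eigenvectors of a compact operator with eigenvalues bounded away from zero. -/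
theorem finite_of_eigenvectors {ι : Type*} {T : X →L[ℂ] X} (hT : IsCompactOperator T) {v : ι → X}
    (hv : Orthonormal ℂ v) {κ : ι → ℂ} (hκ : ∀ i, T (v i) = κ i • v i) {ε : ℝ} (hε : 0 < ε) :
    {i | ε ≤ ‖κ i‖}.Finite := by
  by_contra hinf
  have hinf' : Set.Infinite {i | ε ≤ ‖κ i‖} := hinf
  let f := hinf'.natEmbedding
  have hK := hT.isCompact_closure_image_closedBall (f := (T : X →ₗ[ℂ] X)) 1
  have hx : ∀ n, T (v (f n)) ∈ closure ((T : X →ₗ[ℂ] X) '' Metric.closedBall 0 1) := fun n =>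
    subset_closure ⟨v (f n), by simp [hv.1], rfl⟩
  obtain ⟨a, -, ψ, hψ, hlim⟩ := hK.tendsto_subseq hx
  have hc := hlim.cauchySeq
  obtain ⟨N, hN⟩ := Metric.cauchySeq_iff.1 hc ε hε
  have h := hN N le_rfl (N + 1) (Nat.le_succ N)
  have hne : (f (ψ N) : ι) ≠ f (ψ (N + 1)) := fun h' =>
    (hψ (Nat.lt_succ_self N)).ne (f.injective (Subtype.ext h'))
  simp only [Function.comp_apply, dist_eq_norm, hκ] at h
  -- By Pythagoras the images of two distinct eigenvectors are at distance at least `ε`, so no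
  -- subsequence is Cauchy.
  have hpy := norm_sub_sq (𝕜 := ℂ) (κ (f (ψ N)) • v (f (ψ N))) (κ (f (ψ (N + 1))) • v (f (ψ (N + 1))))
  rw [inner_smul_left, inner_smul_right, hv.2 hne, norm_smul, norm_smul, hv.1, hv.1] at hpy
  simp only [mul_zero, map_zero, sub_zero, mul_one] at hpy
  have h1 : ε ≤ ‖κ (f (ψ N))‖ := (f (ψ N)).2
  nlinarith [norm_nonneg (κ (f (ψ N)) • v (f (ψ N)) - κ (f (ψ (N + 1))) • v (f (ψ (N + 1)))),
    sq_nonneg ‖κ (f (ψ (N + 1)))‖]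

/-- Diagonalise the compact self-adjoint operator `J J*`, injective because `J` has dense range. An
eigenvector `v` has eigenvalue `‖J* v‖²`, whose inverse is `lam`, and `ρ = lam • J* v` satisfies `J
ρ = v` and the weak eigenvalue equation by the definition of the adjoint. -/
theorem exists_eigenbasis_of_compact [CompleteSpace X] (J : R →L[ℂ] X) (hc : IsCompactOperator J)
    (hd : DenseRange J) (hinf : ¬ FiniteDimensional ℂ X) :
    ∃ (φ : HilbertBasis ℕ ℂ X) (lam : ℕ → ℝ), (∀ k, 0 < lam k) ∧ Monotone lam ∧
      Tendsto lam atTop atTop ∧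
      ∀ k, ∃ ρ, J ρ = φ k ∧ ∀ b, (inner ℂ b ρ : ℂ) = lam k * inner ℂ (J b) (φ k) := by
  classical
  let Jd := ContinuousLinearMap.adjoint J
  let T : X →L[ℂ] X := J ∘L Jd
  have hTc : IsCompactOperator T := hc.comp_clm Jd
  have hin : ∀ x y, (inner ℂ (T x) y : ℂ) = inner ℂ (Jd x) (Jd y) := fun x y =>
    (ContinuousLinearMap.adjoint_inner_right J _ _).symm
  have hin' : ∀ x y, (inner ℂ x (T y) : ℂ) = inner ℂ (Jd x) (Jd y) := fun x y =>
    (ContinuousLinearMap.adjoint_inner_left J _ _).symm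
  have hTs : (T : X →ₗ[ℂ] X).IsSymmetric := fun x y => (hin x y).trans (hin' x y).symm
  have hJd : ∀ x, Jd x = 0 → x = 0 := fun x hx => by
    refine hd.eq_zero_of_inner_right ℂ fun b => ?_
    rw [← ContinuousLinearMap.adjoint_inner_right]
    exact (congrArg _ hx).trans (inner_zero_right _)
  have hTi : ∀ x, T x = 0 → x = 0 := fun x hx => hJd x (inner_self_eq_zero.1
    (by rw [← hin, hx, inner_zero_left]))
  -- Compactness only handles `κ ≠ 0`; at `κ = 0` the eigenspace is trivial by injectivity.
  have hfd : ∀ κ : ℂ, FiniteDimensional ℂ (Module.End.eigenspace (T : X →ₗ[ℂ] X) κ) := fun κ => by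
    by_cases hκ : κ = 0
    · have : Module.End.eigenspace (T : X →ₗ[ℂ] X) κ = ⊥ := by
        rw [Submodule.eq_bot_iff]
        intro x hx
        rw [Module.End.mem_eigenspace_iff, hκ, zero_smul] at hx
        exact hTi x hx
      rw [this]
      infer_instance
    · exact ContinuousLinearMap.finite_dimensional_eigenspace hTc κ hκ
  -- All complex numbers serve as labels; those that are not eigenvalues contribute the empty type
  -- `Fin 0`.
  let ι := Σ κ : ℂ, Fin (Module.finrank ℂ (Module.End.eigenspace (T : X →ₗ[ℂ] X) κ))
  let v : ι → X := fun a => (stdOrthonormalBasis ℂ (Module.End.eigenspace (T : X →ₗ[ℂ] X) a.1) a.2 : X)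
  have hv : Orthonormal ℂ v := hTs.orthogonalFamily_eigenspaces.orthonormal_sigma_orthonormal
    (fun κ => (stdOrthonormalBasis ℂ (Module.End.eigenspace (T : X →ₗ[ℂ] X) κ)).orthonormal)
  have hTv : ∀ a, T (v a) = a.1 • v a := fun a =>
    Module.End.mem_eigenspace_iff.1 (stdOrthonormalBasis ℂ
      (Module.End.eigenspace (T : X →ₗ[ℂ] X) a.1) a.2).2
  have hpos : ∀ a : ι, 0 < ‖Jd (v a)‖ ^ 2 := fun a => by
    have : Jd (v a) ≠ 0 := fun h => hv.ne_zero a (hJd _ h)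
    positivity
  have hκ : ∀ a : ι, a.1 = ((‖Jd (v a)‖ ^ 2 : ℝ) : ℂ) := fun a => by
    have h := hin' (v a) (v a)
    rw [hTv, inner_smul_right, inner_self_eq_norm_sq_to_K, inner_self_eq_norm_sq_to_K, hv.1] at h
    simpa using h
  have hsp : (Submodule.span ℂ (Set.range v))ᗮ = ⊥ := by
    rw [Submodule.eq_bot_iff]
    intro x hx
    have hx' : x ∈ (⨆ κ, Module.End.eigenspace (T : X →ₗ[ℂ] X) κ)ᗮ := by
      rw [Submodule.mem_orthogonal]
      intro u hu
      refine Submodule.iSup_induction _ (motive := fun u => inner ℂ u x = 0) hu (fun κ y hy => ?_)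
        (inner_zero_left _) fun y z hy hz => by rw [inner_add_left, hy, hz, add_zero]
      let B := stdOrthonormalBasis ℂ (Module.End.eigenspace (T : X →ₗ[ℂ] X) κ)
      have h1 : y = ∑ i, (B.repr ⟨y, hy⟩ i) • (B i : X) := by
        have := congrArg (Subtype.val) (B.sum_repr ⟨y, hy⟩)
        simpa using this.symm
      rw [h1, sum_inner]
      refine Finset.sum_eq_zero fun i _ => ?_
      rw [inner_smul_left, (Submodule.mem_orthogonal _ _).1 hx (B i : X)
        (Submodule.subset_span ⟨⟨κ, i⟩, rfl⟩), mul_zero]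
    rwa [ContinuousLinearMap.orthogonalComplement_iSup_eigenspaces_eq_bot hTc hTs,
      Submodule.mem_bot] at hx'
  let Φ : HilbertBasis ι ℂ X := HilbertBasis.mkOfOrthogonalEqBot hv hsp
  have hΦ : ∀ a, Φ a = v a := fun a => by rw [HilbertBasis.coe_mkOfOrthogonalEqBot]
  have hι : Infinite ι := by
    by_contra h
    rw [not_infinite_iff_finite] at h
    have := Fintype.ofFinite ι
    exact hinf (Module.Finite.of_basis Φ.toOrthonormalBasis.toBasis)
  let l : ι → ℝ := fun a => (‖Jd (v a)‖ ^ 2)⁻¹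
  have hl : ∀ c, {a | l a ≤ c}.Finite := fun c => by
    -- The maximum with 1 keeps the threshold positive when `c ≤ 0`.
    refine (finite_of_eigenvectors hTc hv hTv (ε := (max c 1)⁻¹) (by positivity)).subset fun a ha => ?_
    have ha' : (‖Jd (v a)‖ ^ 2)⁻¹ ≤ max c 1 := ha.trans (le_max_left _ _)
    show (max c 1)⁻¹ ≤ ‖a.1‖
    rw [hκ, Complex.norm_real, Real.norm_eq_abs, abs_of_pos (hpos a)]
    exact inv_le_of_inv_le₀ (hpos a) ha'
  obtain ⟨e, he, he'⟩ := exists_monotone_enumeration l hl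
  have hsp' : (Submodule.span ℂ (Set.range (v ∘ e)))ᗮ = ⊥ := by
    rwa [e.surjective.range_comp]
  let φ : HilbertBasis ℕ ℂ X := HilbertBasis.mkOfOrthogonalEqBot (hv.comp e e.injective) hsp'
  refine ⟨φ, l ∘ e, fun k => inv_pos.2 (hpos _), he, he', fun k => ?_⟩
  have hφ : φ k = v (e k) := by rw [HilbertBasis.coe_mkOfOrthogonalEqBot]; rfl
  have hne : ((‖Jd (v (e k))‖ ^ 2 : ℝ) : ℂ) ≠ 0 := Complex.ofReal_ne_zero.2 (hpos _).ne'
  have hlk : (((l ∘ e) k : ℝ) : ℂ) = ((‖Jd (v (e k))‖ ^ 2 : ℝ) : ℂ)⁻¹ := Complex.ofReal_inv _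
  refine ⟨(((l ∘ e) k : ℝ) : ℂ) • Jd (v (e k)), ?_, fun b => ?_⟩
  · rw [map_smul, hφ, hlk]
    refine (congrArg _ (hTv (e k))).trans ?_
    rw [hκ, smul_smul, inv_mul_cancel₀ hne, one_smul]
  · rw [inner_smul_right, hφ, ContinuousLinearMap.adjoint_inner_right]

/-- The eigenvectors of a compact embedding, rescaled in its domain, form a Hilbert basis there. -/
theorem exists_basis_of_eigenbasis (J : R →L[ℂ] X) (hJ : Function.Injective J)
    (φ : HilbertBasis ℕ ℂ X) (lam : ℕ → ℝ)
    (h : ∀ k, ∃ ρ, J ρ = φ k ∧ ∀ b, (inner ℂ b ρ : ℂ) = lam k * inner ℂ (J b) (φ k)) :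
    ∃ c₀ > 0, (∀ k, c₀ ≤ lam k) ∧ ∃ e : HilbertBasis ℕ ℂ R, ∀ b k,
      (inner ℂ (e k) b : ℂ) = (lam k ^ (1 / 2 : ℝ) : ℝ) * inner ℂ (φ k) (J b) := by
  choose ρ hρ hin using h
  have hlam : ∀ k, ‖ρ k‖ ^ 2 = lam k := fun k => by
    have := hin k (ρ k)
    rw [hρ, inner_self_eq_norm_sq_to_K, inner_self_eq_norm_sq_to_K, φ.orthonormal.1] at this
    have h2 : ((‖ρ k‖ ^ 2 : ℝ) : ℂ) = (lam k : ℂ) := by simpa using this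
    exact_mod_cast h2
  -- From `lam k = ‖ρ k‖²` and `1 = ‖J (ρ k)‖ ≤ ‖J‖ ‖ρ k‖`. The summand 1 makes positivity of the
  -- constant immediate, with no need for `J ≠ 0`.
  have hc : ∀ k, (‖J‖ ^ 2 + 1)⁻¹ ≤ lam k := fun k => by
    have h1 : 1 ≤ ‖J‖ * ‖ρ k‖ := by
      rw [← φ.orthonormal.1 k, ← hρ]
      exact J.le_opNorm _
    rw [← hlam, inv_le_iff_one_le_mul₀ (by positivity)]
    nlinarith [sq_nonneg ‖ρ k‖]
  have hc0 : 0 < (‖J‖ ^ 2 + 1)⁻¹ := by positivity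
  have hpos := fun k => hc0.trans_le (hc k)
  refine ⟨_, hc0, hc, ?_⟩
  have hsq : ∀ k, (lam k ^ (1 / 2 : ℝ)) * (lam k ^ (1 / 2 : ℝ)) = lam k := fun k => by
    rw [← Real.rpow_add (hpos k)]
    norm_num
  have hsp : ∀ k, 0 < lam k ^ (1 / 2 : ℝ) := fun k => Real.rpow_pos_of_pos (hpos k) _
  let v : ℕ → R := fun k => (((lam k ^ (1 / 2 : ℝ))⁻¹ : ℝ) : ℂ) • ρ k
  have hv : ∀ b k, (inner ℂ b (v k) : ℂ) = (lam k ^ (1 / 2 : ℝ) : ℝ) * inner ℂ (J b) (φ k) :=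
    fun b k => by
      rw [inner_smul_right, hin, ← mul_assoc, ← Complex.ofReal_mul]
      congr 3
      nth_rw 2 [← hsq k]
      rw [inv_mul_cancel_left₀ (hsp k).ne']
  have hJv : ∀ k, J (v k) = (((lam k ^ (1 / 2 : ℝ))⁻¹ : ℝ) : ℂ) • φ k := fun k => by
    rw [map_smul, hρ]
  have hon : Orthonormal ℂ v := by
    classical
    rw [orthonormal_iff_ite]
    intro i j
    rw [hv, hJv, inner_smul_left, Complex.conj_ofReal, orthonormal_iff_ite.1 φ.orthonormal]
    split_ifs with hij
    · subst hij
      rw [mul_one, ← Complex.ofReal_mul, mul_inv_cancel₀ (hsp _).ne', Complex.ofReal_one]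
    · simp
  have htot : (Submodule.span ℂ (Set.range v))ᗮ = ⊥ := by
    rw [Submodule.eq_bot_iff]
    intro b hb
    refine hJ ?_
    rw [map_zero]
    refine ext_coef φ fun k => ?_
    have h1 := (Submodule.mem_orthogonal' _ _).1 hb (v k) (Submodule.subset_span ⟨k, rfl⟩)
    rw [hv, mul_eq_zero, Complex.ofReal_eq_zero] at h1
    rw [inner_zero_right, ← inner_conj_symm, h1.resolve_left (hsp k).ne', map_zero]
  refine ⟨HilbertBasis.mkOfOrthogonalEqBot hon htot, fun b k => ?_⟩
  rw [HilbertBasis.coe_mkOfOrthogonalEqBot, ← inner_conj_symm, hv, map_mul, Complex.conj_ofReal,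
    inner_conj_symm]

end Compact

end KreinFeller

end


noncomputable section

namespace KreinFeller

/-! ### The energy form as a compactly embedded Hilbert space -/

/-- `L²(Ω, ν; ℂ³)`. -/
abbrev L2Grad (Ω : Set S2) : Type := Lp (EuclideanSpace ℂ (Fin 3)) 2 (vol.restrict Ω)

/-- A description of `dom` as a Hilbert space of gradients, compactly and densely embedded in
`L²(Ω, μ)`. -/
structure FormData (μ : Measure S2) (Ω : Set S2) where
  /-- the gradients of the elements of `nullPerp` -/
  R : Submodule ℂ (L2Grad Ω)
  complete : CompleteSpace R
  /-- the `μ`-representative -/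
  J : R →L[ℂ] L2 μ Ω
  /-- the element of `nullPerp` -/
  L : R →L[ℂ] H1 Ω
  injective : Function.Injective J
  mem_dom : ∀ w, w ∈ dom μ Ω ↔ ∃ r, J r = w
  lift_eq : ∀ r, lift μ Ω (J r) = L r
  snd_eq : ∀ r, (L r).snd = r
  compact : IsCompactOperator J
  dense : DenseRange J

namespace FormData

variable {μ : Measure S2} {Ω : Set S2} (d : FormData μ Ω)

theorem energy_eq (a b : d.R) : energy μ Ω (d.J a) (d.J b) = inner ℂ b a := by
  rw [energy, d.lift_eq, d.lift_eq, d.snd_eq, d.snd_eq]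
  rfl

theorem isNegLaplacian_iff (ρ : d.R) (l : ℝ) :
    IsNegLaplacian μ Ω (d.J ρ) ((l : ℂ) • d.J ρ) ↔
      ∀ b, (inner ℂ b ρ : ℂ) = l * inner ℂ (d.J b) (d.J ρ) := by
  constructor
  · intro h b
    have := h.2 (d.J b) ((d.mem_dom _).2 ⟨b, rfl⟩)
    rwa [d.energy_eq, pair, inner_smul_right] at this
  · refine fun h => ⟨(d.mem_dom _).2 ⟨ρ, rfl⟩, fun v hv => ?_⟩
    obtain ⟨b, rfl⟩ := (d.mem_dom _).1 hv
    rw [d.energy_eq, pair, inner_smul_right, h]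


theorem exists_isEigenbasis (d : FormData μ Ω) (hinf : ¬ FiniteDimensional ℂ (L2 μ Ω)) :
    ∃ (φ : HilbertBasis ℕ ℂ (L2 μ Ω)) (lam : ℕ → ℝ),
      IsEigenbasis μ Ω φ lam ∧ (∀ k, 0 < lam k) ∧ Monotone lam ∧ Tendsto lam atTop atTop := by
  have := d.complete
  obtain ⟨φ, lam, h1, h2, h3, h4⟩ := exists_eigenbasis_of_compact d.J d.compact d.dense hinf
  refine ⟨φ, lam, fun k => ?_, h1, h2, h3⟩
  obtain ⟨ρ, hρ, h⟩ := h4 k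
  rw [← hρ] at h ⊢
  exact (d.isNegLaplacian_iff ρ _).2 h


/-- The rescaled eigenvectors are a Hilbert basis `e` of the gradient space with `⟨e k, b⟩ =
lam^{1/2} ⟨φ k, J b⟩`. By Parseval `J` is therefore an isometry of it onto the space of order 1, for
any eigenbasis whatsoever. -/
theorem spectralData (d : FormData μ Ω) {φ : HilbertBasis ℕ ℂ (L2 μ Ω)} {lam : ℕ → ℝ}
    (hφ : IsEigenbasis μ Ω φ lam) : ∃ c₀, SpectralData μ Ω φ lam c₀ := by
  have := d.complete
  obtain ⟨c₀, h0, hl, e, he⟩ := exists_basis_of_eigenbasis d.J d.injective φ lam fun k => by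
    obtain ⟨ρ, hρ⟩ := (d.mem_dom _).1 (hφ k).1
    refine ⟨ρ, hρ, ?_⟩
    have h := hφ k
    rw [← hρ] at h ⊢
    exact (d.isNegLaplacian_iff ρ _).1 h
  have hp : ∀ k, 0 < lam k := fun k => h0.trans_le (hl k)
  have hnorm : ∀ b k, ‖(inner ℂ (e k) b : ℂ)‖ ^ 2 =
      ‖(inner ℂ (φ k) (d.J b) : ℂ)‖ ^ 2 * lam k ^ (1 : ℝ) := fun b k => by
    rw [he, norm_mul, mul_pow, Complex.norm_real, Real.norm_eq_abs, sq_abs, ← Real.rpow_natCast,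
      ← Real.rpow_mul (hp k).le, mul_comm]
    norm_num
  have hmem : ∀ w, w ∈ dom μ Ω ↔ EMem φ lam 1 w := fun w => by
    rw [d.mem_dom]
    constructor
    · rintro ⟨b, rfl⟩
      refine (hasSum_norm_sq_coef e b).summable.congr fun k => hnorm b k
    · intro hw
      have hs : Summable fun k => ‖((lam k ^ (1 / 2 : ℝ) : ℝ) : ℂ) * inner ℂ (φ k) w‖ ^ 2 := by
        refine hw.congr fun k => ?_
        rw [norm_mul, mul_pow, Complex.norm_real, Real.norm_eq_abs, sq_abs,
          ← Real.rpow_natCast (lam k ^ _), ← Real.rpow_mul (hp k).le, mul_comm]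
        norm_num
      refine ⟨ofCoef e fun k => ((lam k ^ (1 / 2 : ℝ) : ℝ) : ℂ) * inner ℂ (φ k) w,
        ext_coef φ fun k => ?_⟩
      have h1 := he (ofCoef e fun k => ((lam k ^ (1 / 2 : ℝ) : ℝ) : ℂ) * inner ℂ (φ k) w) k
      rw [inner_ofCoef e hs] at h1
      exact (mul_left_cancel₀ (Complex.ofReal_ne_zero.2 (Real.rpow_pos_of_pos (hp k) _).ne') h1).symm
  have henergy : ∀ u ∈ dom μ Ω, ∀ v ∈ dom μ Ω, energy μ Ω u v =
      inner ℂ (diagPow φ lam (1 / 2) v) (diagPow φ lam (1 / 2) u) := fun u hu v hv => by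
    have hu' := (hmem u).1 hu
    have hv' := (hmem v).1 hv
    obtain ⟨a, rfl⟩ := (d.mem_dom _).1 hu
    obtain ⟨b, rfl⟩ := (d.mem_dom _).1 hv
    rw [d.energy_eq]
    refine (hasSum_inner_coef e b a).unique ?_
    convert hasSum_inner_coef φ (diagPow φ lam (1 / 2) (d.J b)) (diagPow φ lam (1 / 2) (d.J a))
      using 2 with k
    rw [he, he, hu'.inner_diagPow φ hp, hv'.inner_diagPow φ hp]
  have hEN : ∀ w ∈ dom μ Ω, energyNorm μ Ω w = ENorm φ lam 1 w := fun w hw => by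
    obtain ⟨b, rfl⟩ := (d.mem_dom _).1 hw
    have h1 : (energy μ Ω (d.J b) (d.J b)).re = ‖b‖ ^ 2 := by
      rw [d.energy_eq]
      exact inner_self_eq_norm_sq (𝕜 := ℂ) b
    rw [energyNorm, h1, ← (hasSum_norm_sq_coef e b).tsum_eq, ENorm]
    simp only [hnorm]
  refine ⟨c₀, h0, hl, hmem, henergy, fun T u => ⟨?_, ?_⟩⟩
  · rintro ⟨h1, h2, C, h3⟩
    refine ⟨?_, h2.mono fun t ht => (hmem _).1 ht, C, ?_⟩
    -- The curve `u` is a continuous image of its lift: take the gradient, project to `R` (where it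
    -- already lies) and apply `J`.
    · have hcont : Continuous fun h : H1 Ω =>
          d.J (d.R.orthogonalProjectionOnto h.snd) :=
        d.J.continuous.comp (d.R.orthogonalProjectionOnto.continuous.comp
          (WithLp.continuous_snd 2 _ _))
      refine (hcont.comp_aestronglyMeasurable h1).congr ?_
      filter_upwards [h2] with t ht
      obtain ⟨b, hb⟩ := (d.mem_dom _).1 ht
      rw [← hb, d.lift_eq, d.snd_eq, Submodule.orthogonalProjectionOnto_mem_subspace_eq_self]
    · filter_upwards [h2, h3] with t ht ht'
      rwa [← hEN _ ht]
  · rintro ⟨h1, h2, C, h3⟩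
    have h2' : ∀ᵐ t ∂volume.restrict (Icc 0 T), u t ∈ dom μ Ω := h2.mono fun t ht => (hmem _).2 ht
    refine ⟨?_, h2', C, ?_⟩
    -- Preimages are chosen pointwise; the choice is unique wherever `u t ∈ dom`, and its
    -- measurability is recovered from the coefficients.
    · have hsel : ∀ t, ∃ b, u t ∈ dom μ Ω → d.J b = u t := fun t => by
        by_cases ht : u t ∈ dom μ Ω
        · obtain ⟨b, hb⟩ := (d.mem_dom _).1 ht
          exact ⟨b, fun _ => hb⟩
        · exact ⟨0, fun h => absurd h ht⟩
      choose r hr using hsel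
      have hrm : AEStronglyMeasurable r (volume.restrict (Icc 0 T)) := by
        refine aestronglyMeasurable_of_coef e fun k => ?_
        refine ((AEStronglyMeasurable.coef φ h1 k).const_mul
          ((lam k ^ (1 / 2 : ℝ) : ℝ) : ℂ)).congr ?_
        filter_upwards [h2'] with t ht
        rw [he, hr t ht]
      refine (d.L.continuous.comp_aestronglyMeasurable hrm).congr ?_
      filter_upwards [h2'] with t ht
      rw [← d.lift_eq, hr t ht]
    · filter_upwards [h2', h3] with t ht ht'
      rwa [hEN _ ht]

end FormData

end KreinFeller

end


/-! ### Radial extensions, the Poincaré inequality and traces on upper regular measures. -/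

noncomputable section

namespace KreinFeller

/-! ### Smooth functions on the sphere -/

/-- Smooth complex valued functions on the sphere. -/
abbrev IsSmooth (u : S2 → ℂ) : Prop := ContMDiff (𝓡 2) 𝓘(ℝ, ℂ) ∞ u

variable {u v : S2 → ℂ}

theorem radialExt_coe (u : S2 → ℂ) (x : S2) : radialExt u x = u x := by
  have hx : ‖(x : E3)‖ = 1 := norm_eq_of_mem_sphere x
  have h0 : (x : E3) ≠ 0 := norm_ne_zero_iff.1 (by rw [hx]; exact one_ne_zero)
  rw [radialExt, dif_neg h0]
  congr 1
  apply Subtype.ext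
  simp [hx]

theorem radialExt_smul (u : S2 → ℂ) {r : ℝ} (hr : 0 < r) (y : E3) :
    radialExt u (r • y) = radialExt u y := by
  by_cases hy : y = 0
  · rw [hy, smul_zero]
  · rw [radialExt, radialExt, dif_neg (smul_ne_zero hr.ne' hy), dif_neg hy]
    congr 1
    apply Subtype.ext
    simp only [norm_smul, Real.norm_eq_abs, abs_of_pos hr, smul_smul]
    congr 1
    field_simp

theorem radialExt_smul_coe (u : S2 → ℂ) {r : ℝ} (hr : 0 < r) (x : S2) :
    radialExt u (r • (x : E3)) = u x := by rw [radialExt_smul u hr, radialExt_coe]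

theorem coe_ne_zero (x : S2) : (x : E3) ≠ 0 :=
  norm_ne_zero_iff.1 (by rw [norm_eq_of_mem_sphere x]; exact one_ne_zero)

/-- Off the origin the extension is `u` composed with `y ↦ y / ‖y‖`, a smooth map into the sphere.
This allows the remaining analysis to take place in Euclidean space. -/
theorem IsSmooth.contDiffAt_radialExt (hu : IsSmooth u) {y : E3} (hy : y ≠ 0) :
    ContDiffAt ℝ ∞ (radialExt u) y := by
  let U : TopologicalSpace.Opens E3 := ⟨{0}ᶜ, isOpen_compl_singleton⟩
  let f₀ : E3 → E3 := fun y => (‖y‖⁻¹ : ℝ) • y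
  let f : U → E3 := fun y => f₀ y
  have hf : ContMDiff 𝓘(ℝ, E3) 𝓘(ℝ, E3) ∞ f := fun y => by
    refine contMDiffAt_subtype_iff.2 (ContDiffAt.contMDiffAt ?_)
    exact ((contDiffAt_norm ℝ y.2).inv (norm_ne_zero_iff.2 y.2)).smul contDiffAt_id
  have hfS : ∀ y, f y ∈ Metric.sphere (0 : E3) 1 := fun y => by
    rw [mem_sphere_zero_iff_norm, norm_smul, norm_inv, norm_norm,
      inv_mul_cancel₀ (norm_ne_zero_iff.2 y.2)]
  have : Fact (Module.finrank ℝ E3 = 2 + 1) := ⟨by simp⟩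
  have hg := hu.comp (hf.codRestrict_sphere (n := 2) hfS)
  have he : (u ∘ Set.codRestrict _ _ hfS) = fun y : U => radialExt u y := by
    funext y
    have : (y : E3) ≠ 0 := y.2
    simp only [Function.comp_apply, radialExt, dif_neg this]
    rfl
  rw [he] at hg
  exact (contMDiffAt_subtype_iff.1 (hg ⟨y, hy⟩)).contDiffAt

theorem IsSmooth.differentiableAt_radialExt (hu : IsSmooth u) {y : E3} (hy : y ≠ 0) :
    DifferentiableAt ℝ (radialExt u) y :=
  (hu.contDiffAt_radialExt hy).differentiableAt (by simp)

theorem IsSmooth.continuousAt_fderiv (hu : IsSmooth u) {y : E3} (hy : y ≠ 0) :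
    ContinuousAt (fderiv ℝ (radialExt u)) y :=
  (hu.contDiffAt_radialExt hy).continuousAt_fderiv (by simp)

theorem fderiv_radialExt_smul (u : S2 → ℂ) {r : ℝ} (hr : 0 < r) (y : E3) :
    fderiv ℝ (radialExt u) (r • y) = r⁻¹ • fderiv ℝ (radialExt u) y := by
  have h : (fun z => radialExt u (r • z)) = radialExt u := funext fun z => radialExt_smul u hr z
  have h1 := fderiv_comp_smul (𝕜 := ℝ) (f := radialExt u) (x := y) r
  rw [h] at h1
  rw [h1, inv_smul_smul₀ hr.ne']

theorem grad_apply (u : S2 → ℂ) (x : S2) (j : Fin 3) :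
    grad u x j = fderiv ℝ (radialExt u) (x : E3) (EuclideanSpace.single j 1) := rfl

/-- The differential at `z` is the pairing of the real vector `z` with the complex gradient, so
Cauchy–Schwarz applies. Only this direction is needed. -/
theorem norm_fderiv_le (u : S2 → ℂ) (x : S2) : ‖fderiv ℝ (radialExt u) (x : E3)‖ ≤ ‖grad u x‖ := by
  refine ContinuousLinearMap.opNorm_le_bound _ (norm_nonneg _) fun z => ?_
  have hz : z = ∑ j, z j • EuclideanSpace.single j (1 : ℝ) := by
    ext i
    simp [Fin.sum_univ_three]
    fin_cases i <;> simp
  have h : fderiv ℝ (radialExt u) (x : E3) z =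
      inner ℂ (WithLp.toLp 2 fun j => ((z j : ℝ) : ℂ)) (grad u x) := by
    conv_lhs => rw [hz, map_sum]
    simp [PiLp.inner_apply, grad_apply, mul_comm]
  have h2 : ‖(WithLp.toLp 2 fun j => ((z j : ℝ) : ℂ) : EuclideanSpace ℂ (Fin 3))‖ = ‖z‖ := by
    simp [EuclideanSpace.norm_eq]
  rw [h, mul_comm, ← h2]
  exact norm_inner_le_norm _ _

theorem radialExt_add (u v : S2 → ℂ) : radialExt (u + v) = radialExt u + radialExt v := by
  funext y
  by_cases hy : y = 0 <;> simp [radialExt, hy]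

theorem radialExt_const_smul (c : ℂ) (u : S2 → ℂ) : radialExt (c • u) = c • radialExt u := by
  funext y
  by_cases hy : y = 0 <;> simp [radialExt, hy]

theorem grad_add (hu : IsSmooth u) (hv : IsSmooth v) : grad (u + v) = grad u + grad v := by
  funext x
  ext j
  simp only [grad_apply, Pi.add_apply, PiLp.add_apply]
  rw [radialExt_add, fderiv_add (hu.differentiableAt_radialExt (coe_ne_zero x))
    (hv.differentiableAt_radialExt (coe_ne_zero x))]
  rfl

theorem grad_const_smul (c : ℂ) (hu : IsSmooth u) : grad (c • u) = c • grad u := by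
  funext x
  ext j
  simp only [grad_apply, Pi.smul_apply, PiLp.smul_apply]
  rw [radialExt_const_smul, fderiv_const_smul (hu.differentiableAt_radialExt (coe_ne_zero x))]
  rfl

theorem IsSmooth.continuous_grad (hu : IsSmooth u) : Continuous (grad u) := by
  refine (PiLp.continuous_toLp 2 _).comp (continuous_pi fun j => ?_)
  refine continuous_iff_continuousAt.2 fun x => ?_
  have := (hu.continuousAt_fderiv (coe_ne_zero x)).comp (continuous_subtype_val.continuousAt)
  exact this.clm_apply continuousAt_const

theorem grad_eq_zero_of_notMem_tsupport {x : S2} (hx : x ∉ tsupport u) : grad u x = 0 := by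
  have hev : radialExt u =ᶠ[𝓝 (x : E3)] 0 := by
    have hU : {y : S2 | u y = 0} ∈ 𝓝 x := by
      filter_upwards [(isClosed_tsupport u).isOpen_compl.mem_nhds hx] with y hy
      exact image_eq_zero_of_notMem_tsupport hy
    obtain ⟨ε, hε, hb⟩ := Metric.mem_nhds_iff.1 hU
    have hc : ContinuousAt (fun y : E3 => (‖y‖⁻¹ : ℝ) • y) (x : E3) :=
      (continuous_norm.continuousAt.inv₀ (norm_ne_zero_iff.2 (coe_ne_zero x))).smul continuousAt_id
    have hc' := hc.preimage_mem_nhds (Metric.ball_mem_nhds _ hε)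
    filter_upwards [hc'] with y hy
    by_cases h0 : y = 0
    · simp [radialExt, h0]
    · rw [radialExt, dif_neg h0]
      refine hb (show dist _ _ < ε from ?_)
      rw [Subtype.dist_eq]
      simpa [norm_eq_of_mem_sphere x] using hy
  ext j
  rw [grad_apply, hev.fderiv_eq]
  simp

section Test

variable {Ω : Set S2}

theorem IsTest.smooth (hu : IsTest Ω u) : IsSmooth u := hu.1

theorem IsSmooth.isTest (hu : IsSmooth u) (h : tsupport u ⊆ Ω) : IsTest Ω u :=
  ⟨hu, (isClosed_tsupport u).isCompact, h⟩

theorem IsTest.add (hu : IsTest Ω u) (hv : IsTest Ω v) : IsTest Ω (u + v) :=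
  IsSmooth.isTest (hu.1.add hv.1) ((tsupport_add u v).trans (union_subset hu.2.2 hv.2.2))

theorem IsTest.const_smul (c : ℂ) (hu : IsTest Ω u) : IsTest Ω (c • u) :=
  IsSmooth.isTest ((contDiff_const_smul c).contMDiff.comp hu.1) ((tsupport_smul_subset_right (fun _ => c) u).trans hu.2.2)

theorem IsTest.zero : IsTest Ω (0 : S2 → ℂ) :=
  IsSmooth.isTest contMDiff_const (by simp)

instance : IsFiniteMeasure vol := inferInstanceAs (IsFiniteMeasure (volume : Measure E3).toSphere)

theorem memLp_of_continuous {F : Type*} [NormedAddCommGroup F] {f : S2 → F} (hf : Continuous f)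
    (ν : Measure S2) [IsFiniteMeasure ν] : MemLp f 2 ν := by
  obtain ⟨C, hC⟩ := isCompact_univ.exists_bound_of_continuousOn hf.continuousOn
  exact MemLp.of_bound hf.aestronglyMeasurable C (ae_of_all _ fun x => hC x (mem_univ x))

theorem IsSmooth.memLp (hu : IsSmooth u) (ν : Measure S2) [IsFiniteMeasure ν] : MemLp u 2 ν :=
  memLp_of_continuous hu.continuous ν

theorem IsSmooth.memLp_grad (hu : IsSmooth u) (ν : Measure S2) [IsFiniteMeasure ν] :
    MemLp (grad u) 2 ν :=
  memLp_of_continuous hu.continuous_grad ν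

/-- The pair (function, gradient) of a smooth function. -/
def jet (Ω : Set S2) (hu : IsSmooth u) : H1 Ω :=
  WithLp.toLp 2 ((hu.memLp (vol.restrict Ω)).toLp u, (hu.memLp_grad (vol.restrict Ω)).toLp (grad u))

theorem isJet_jet (hu : IsSmooth u) : IsJet Ω u (jet Ω hu) :=
  ⟨(hu.memLp _).coeFn_toLp, (hu.memLp_grad _).coeFn_toLp⟩

theorem IsJet.add {h k : H1 Ω} (hu : IsSmooth u) (hv : IsSmooth v) (h1 : IsJet Ω u h) (h2 : IsJet Ω v k) :
    IsJet Ω (u + v) (h + k) := by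
  constructor
  · exact (Lp.coeFn_add h.fst k.fst).trans (h1.1.add h2.1)
  · rw [grad_add hu hv]
    exact (Lp.coeFn_add h.snd k.snd).trans (h1.2.add h2.2)

theorem IsJet.const_smul {h : H1 Ω} (c : ℂ) (hu : IsSmooth u) (h1 : IsJet Ω u h) :
    IsJet Ω (c • u) (c • h) := by
  constructor
  · exact (Lp.coeFn_smul c h.fst).trans (h1.1.const_smul c)
  · rw [grad_const_smul c hu]
    exact (Lp.coeFn_smul c h.snd).trans (h1.2.const_smul c)

end Test

end KreinFeller

end


noncomputable section

namespace KreinFeller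

/-! ### Polar coordinates -/

theorem ae_ne_zero : ∀ᵐ y : E3, y ≠ 0 := by
  simp [ae_iff]

theorem lintegral_polar {F : E3 → ENNReal} (hF : Measurable F) :
    ∫⁻ y, F y = ∫⁻ x : S2, (∫⁻ ρ in Ioi (0 : ℝ), ENNReal.ofReal (ρ ^ 2) * F (ρ • (x : E3))) ∂vol := by
  have hmp := (volume : Measure E3).measurePreserving_homeomorphUnitSphereProd
  have hdim : Module.finrank ℝ E3 - 1 = 2 := by simp
  rw [hdim] at hmp
  let G : S2 × Ioi (0 : ℝ) → ENNReal := fun p => F ((p.2 : ℝ) • (p.1 : E3))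
  have hG : Measurable G := hF.comp (by fun_prop)
  have h1 : ∫⁻ y, F y = ∫⁻ y : ({(0)}ᶜ : Set E3), F (y : E3) ∂(volume.comap ((↑) : ({(0)}ᶜ : Set E3) → E3)) := by
    rw [lintegral_subtype_comap (measurableSet_singleton _).compl, restrict_compl_singleton]
  have h2 : ∀ y : ({(0)}ᶜ : Set E3), F y = G (homeomorphUnitSphereProd E3 y) := fun y => by
    have hy : ‖(y : E3)‖ ≠ 0 := norm_ne_zero_iff.2 y.2
    simp only [G]
    congr 1
    simp [smul_smul, mul_inv_cancel₀ hy]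
  rw [h1, lintegral_congr h2, hmp.lintegral_comp hG, lintegral_prod _ hG.aemeasurable]
  refine lintegral_congr fun x => ?_
  have hm : Measurable fun r : Ioi (0 : ℝ) => ENNReal.ofReal ((r : ℝ) ^ 2) := by fun_prop
  rw [Measure.volumeIoiPow, lintegral_withDensity_eq_lintegral_mul _ hm (by fun_prop)]
  exact lintegral_subtype_comap measurableSet_Ioi
    fun ρ : ℝ => ENNReal.ofReal (ρ ^ 2) * F (ρ • (x : E3))

/-- The squared norm of the differential of the radial extension. -/
def gradSq (u : S2 → ℂ) (y : E3) : ENNReal := ‖fderiv ℝ (radialExt u) y‖ₑ ^ 2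

theorem measurable_gradSq (u : S2 → ℂ) : Measurable (gradSq u) :=
  (measurable_fderiv ℝ _).enorm.pow_const _

/-- The differential of a function homogeneous of degree 0 is homogeneous of degree `-1`. The
resulting factor cancels the `ρ²` of polar coordinates. -/
theorem gradSq_smul (u : S2 → ℂ) {r : ℝ} (hr : 0 < r) (y : E3) :
    ENNReal.ofReal (r ^ 2) * gradSq u (r • y) = gradSq u y := by
  rw [gradSq, fderiv_radialExt_smul u hr, enorm_smul, mul_pow, ← mul_assoc, gradSq,
    Real.enorm_of_nonneg (inv_nonneg.2 hr.le), ← ENNReal.ofReal_pow (inv_nonneg.2 hr.le),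
    ← ENNReal.ofReal_mul (sq_nonneg _), ← mul_pow, mul_inv_cancel₀ hr.ne', one_pow,
    ENNReal.ofReal_one, one_mul]

/-- The Dirichlet energy of a function on the sphere. -/
def dirichlet (u : S2 → ℂ) : ENNReal := ∫⁻ x, gradSq u (x : E3) ∂vol

/-- After the cancellation in `gradSq_smul` the radial integrand is constant, so a shell carries its
thickness times the energy on the sphere. -/
theorem lintegral_gradSq_shell (u : S2 → ℂ) {a b : ℝ} (ha : 0 ≤ a) :
    ∫⁻ y in {y : E3 | ‖y‖ ∈ Ioo a b}, gradSq u y = ENNReal.ofReal (b - a) * dirichlet u := by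
  have hms : MeasurableSet {y : E3 | ‖y‖ ∈ Ioo a b} := measurable_norm measurableSet_Ioo
  have hgm : Measurable fun x : S2 => gradSq u (x : E3) :=
    (measurable_gradSq u).comp measurable_subtype_coe
  rw [← lintegral_indicator hms, lintegral_polar ((measurable_gradSq u).indicator hms), dirichlet,
    mul_comm, ← lintegral_mul_const _ (hgm)]
  refine lintegral_congr fun x => ?_
  have hx : ‖(x : E3)‖ = 1 := norm_eq_of_mem_sphere x
  have h : ∀ ρ ∈ Ioi (0 : ℝ), ENNReal.ofReal (ρ ^ 2) *
      {y : E3 | ‖y‖ ∈ Ioo a b}.indicator (gradSq u) (ρ • (x : E3)) =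
      (Ioo a b).indicator (fun _ => gradSq u x) ρ := fun ρ hρ => by
    have hn : ‖ρ • (x : E3)‖ = ρ := by rw [norm_smul, hx, mul_one, Real.norm_of_nonneg (le_of_lt hρ)]
    by_cases hm : ρ ∈ Ioo a b
    · rw [indicator_of_mem hm, indicator_of_mem (by rwa [mem_ofPred_eq, hn]), gradSq_smul u hρ]
    · rw [indicator_of_notMem hm, indicator_of_notMem (by rwa [mem_ofPred_eq, hn]), mul_zero]
  rw [setLIntegral_congr_fun measurableSet_Ioi h, lintegral_indicator measurableSet_Ioo,
    setLIntegral_const, Measure.restrict_apply measurableSet_Ioo, inter_eq_left.2 (show Ioo a b ⊆ Ioi 0 from fun ρ hρ => ha.trans_lt hρ.1),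
    Real.volume_Ioo]

theorem dirichlet_le (u : S2 → ℂ) : dirichlet u ≤ ∫⁻ x, ‖grad u x‖ₑ ^ 2 ∂vol :=
  lintegral_mono fun x => by
    have : ‖fderiv ℝ (radialExt u) (x : E3)‖ₑ ≤ ‖grad u x‖ₑ := by
      rw [enorm_le_iff_norm_le]
      exact norm_fderiv_le u x
    exact pow_le_pow_left' this 2

theorem measurable_radialExt {u : S2 → ℂ} (hu : IsSmooth u) : Measurable (radialExt u) := by
  have h : ContinuousOn (radialExt u) {0}ᶜ := fun y hy =>
    (hu.differentiableAt_radialExt hy).continuousAt.continuousWithinAt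
  exact measurable_of_continuousOn_compl_singleton 0 h

/-- The factor 3 is the inverse of `∫₀¹ ρ² dρ`. -/
theorem lintegral_radial_ball {H : S2 → ENNReal} {V : E3 → ENNReal} (hV : Measurable V)
    (h : ∀ (x : S2) (ρ : ℝ), 0 < ρ → V (ρ • (x : E3)) = H x) :
    3 * ∫⁻ y in Metric.ball (0 : E3) 1, V y = ∫⁻ x, H x ∂vol := by
  have hms : MeasurableSet (Metric.ball (0 : E3) 1) := Metric.isOpen_ball.measurableSet
  have hH : Measurable H := by
    have : H = fun x : S2 => V ((1 : ℝ) • (x : E3)) := funext fun x => (h x 1 one_pos).symm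
    rw [this]
    exact hV.comp (by fun_prop)
  rw [← lintegral_indicator hms, lintegral_polar (hV.indicator hms), ← lintegral_const_mul']
  · refine lintegral_congr fun x => ?_
    have hx : ‖(x : E3)‖ = 1 := norm_eq_of_mem_sphere x
    have h : ∀ ρ ∈ Ioi (0 : ℝ), ENNReal.ofReal (ρ ^ 2) *
        (Metric.ball (0 : E3) 1).indicator V (ρ • (x : E3)) =
        (Ioo (0 : ℝ) 1).indicator (fun ρ => ENNReal.ofReal (ρ ^ 2) * H x) ρ := fun ρ hρ => by
      have hn : ‖ρ • (x : E3)‖ = ρ := by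
        rw [norm_smul, hx, mul_one, Real.norm_of_nonneg (le_of_lt hρ)]
      by_cases hm : ρ < 1
      · rw [indicator_of_mem (show ρ ∈ Ioo (0 : ℝ) 1 from ⟨hρ, hm⟩), indicator_of_mem
          (by rwa [mem_ball_zero_iff, hn]), h x ρ hρ]
      · rw [indicator_of_notMem (s := Metric.ball (0 : E3) 1) (by rwa [mem_ball_zero_iff, hn]),
          indicator_of_notMem (s := Ioo (0 : ℝ) 1) fun h' => hm h'.2, mul_zero]
    rw [setLIntegral_congr_fun measurableSet_Ioi h, lintegral_indicator measurableSet_Ioo,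
      Measure.restrict_restrict measurableSet_Ioo, inter_eq_left.2 fun ρ hρ => hρ.1,
      lintegral_mul_const _ (by fun_prop), ← mul_assoc]
    have hI : ∫⁻ ρ in Ioo (0 : ℝ) 1, ENNReal.ofReal (ρ ^ 2) = ENNReal.ofReal (1 / 3) := by
      rw [Measure.restrict_congr_set Ioo_ae_eq_Ioc, ← ofReal_integral_eq_lintegral_ofReal,
        ← intervalIntegral.integral_of_le zero_le_one]
      · norm_num
      · exact (intervalIntegral.intervalIntegrable_pow 2).1
      · exact ae_of_all _ fun ρ => sq_nonneg ρ
    rw [hI, show (3 : ENNReal) = ENNReal.ofReal 3 by simp, ← ENNReal.ofReal_mul (by norm_num)]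
    norm_num
  · simp

end KreinFeller

end


noncomputable section

namespace KreinFeller

/-! ### The Poincaré inequality on the sphere -/

theorem sq_lintegral_mul_le {α : Type*} [MeasurableSpace α] {ν : Measure α} {f g : α → ENNReal}
    (hf : AEMeasurable f ν) (hg : AEMeasurable g ν) :
    (∫⁻ a, f a * g a ∂ν) ^ 2 ≤ (∫⁻ a, f a ^ 2 ∂ν) * ∫⁻ a, g a ^ 2 ∂ν := by
  have h := ENNReal.lintegral_mul_le_Lp_mul_Lq ν Real.HolderConjugate.two_two hf hg
  have h2 : ∀ a : ENNReal, (a ^ (1 / (2 : ℝ))) ^ 2 = a := fun a => by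
    rw [← ENNReal.rpow_natCast, ← ENNReal.rpow_mul]
    norm_num
  calc (∫⁻ a, f a * g a ∂ν) ^ 2 ≤ _ := pow_le_pow_left' h 2
    _ = _ := by
      rw [mul_pow, h2, h2]
      simp only [ENNReal.rpow_two]

theorem lintegral_rotate {α β γ : Type*} [MeasurableSpace α] [MeasurableSpace β]
    [MeasurableSpace γ] {μ : Measure α} {ν : Measure β} {ρ : Measure γ} [SFinite μ] [SFinite ν]
    [SFinite ρ] {K : α × β × γ → ENNReal} (hK : Measurable K) (c : ENNReal) :
    ∫⁻ x, ∫⁻ y, c * ∫⁻ t, K (x, y, t) ∂ρ ∂ν ∂μ = c * ∫⁻ t, ∫⁻ x, ∫⁻ y, K (x, y, t) ∂ν ∂μ ∂ρ := by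
  have h1 : ∀ x, ∫⁻ y, c * ∫⁻ t, K (x, y, t) ∂ρ ∂ν = c * ∫⁻ t, ∫⁻ y, K (x, y, t) ∂ν ∂ρ := fun x => by
    have hx : Measurable fun p : β × γ => K (x, p) := hK.comp measurable_prodMk_left
    rw [lintegral_const_mul _ hx.lintegral_prod_right']
    exact congrArg (c * ·) (lintegral_lintegral_swap (f := fun y t => K (x, y, t)) hx.aemeasurable)
  have h2 : Measurable fun q : (α × γ) × β => K (q.1.1, q.2, q.1.2) := hK.comp (by fun_prop)
  simp only [h1]
  have h3 : Measurable fun x => ∫⁻ t, ∫⁻ y, K (x, y, t) ∂ν ∂ρ :=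
    h2.lintegral_prod_right'.lintegral_prod_right'
  rw [lintegral_const_mul _ h3]
  refine congrArg (c * ·) ?_
  exact lintegral_lintegral_swap (f := fun x t => ∫⁻ y, K (x, y, t) ∂ν)
    h2.lintegral_prod_right'.aemeasurable

theorem enorm_sub_le_segment {u : S2 → ℂ} (hu : IsSmooth u) {x z : E3} {r : ℝ} (hr : 0 ≤ r)
    (h0 : ∀ t ∈ Icc 0 r, x + t • z ≠ 0) :
    ‖radialExt u (x + r • z) - radialExt u x‖ₑ ≤
      ∫⁻ t in Icc 0 r, ‖fderiv ℝ (radialExt u) (x + t • z)‖ₑ * ‖z‖ₑ := by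
  let f : ℝ → ℂ := fun t => radialExt u (x + t • z)
  have hf : ContDiffOn ℝ 1 f (Icc 0 r) := fun t ht => by
    have h1 : ContDiffAt ℝ 1 (radialExt u) (x + t • z) :=
      (hu.contDiffAt_radialExt (h0 t ht)).of_le (by exact_mod_cast le_top)
    have h2 : ContDiffAt ℝ 1 (fun t : ℝ => x + t • z) t := by fun_prop
    exact (ContDiffAt.comp t h1 h2).contDiffWithinAt
  have h := enorm_sub_le_lintegral_deriv_of_contDiffOn_Icc hf hr
  simp only [f, zero_smul, add_zero] at h
  refine h.trans (setLIntegral_mono' measurableSet_Icc fun t ht => ?_)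
  have h1 : HasDerivAt (fun t : ℝ => x + t • z) z t := by
    simpa using ((hasDerivAt_id t).smul_const z).const_add x
  have h2 := (hu.differentiableAt_radialExt (h0 t ht)).hasFDerivAt.comp_hasDerivAt t h1
  have h3 : deriv (fun t : ℝ => radialExt u (x + t • z)) t =
      fderiv ℝ (radialExt u) (x + t • z) z := h2.deriv
  rw [h3]
  exact ContinuousLinearMap.le_opENorm _ _

theorem lintegral_comp_add_smul {F : E3 → ENNReal} (hF : Measurable F) (c : E3) {t : ℝ}
    (ht : 0 < t) : ∫⁻ y, F (c + t • y) = ENNReal.ofReal (t ^ 3)⁻¹ * ∫⁻ y, F y := by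
  have h1 : ∫⁻ y, F (c + t • y) = ∫⁻ y, F (c + y) ∂(volume.map fun y : E3 => t • y) :=
    (lintegral_map (μ := volume) (f := fun y => F (c + y)) (g := fun y : E3 => t • y)
      (by fun_prop) (by fun_prop)).symm
  rw [h1, Measure.map_addHaar_smul volume ht.ne', lintegral_smul_measure, smul_eq_mul,
    lintegral_add_left_eq_self]
  congr 2
  rw [abs_of_pos (by positivity)]
  simp

theorem setLIntegral_ball_comp_add_smul {F : E3 → ENNReal} (hF : Measurable F) (c : E3) {t : ℝ}
    (ht : 0 < t) : ∫⁻ y in Metric.ball (0 : E3) 1, F (c + t • y) =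
      ENNReal.ofReal (t ^ 3)⁻¹ * ∫⁻ y in Metric.ball c t, F y := by
  have hb : ∀ c : E3, ∀ t, MeasurableSet (Metric.ball c t) := fun c t => measurableSet_ball
  rw [← lintegral_indicator (hb 0 1), ← lintegral_indicator (hb c t),
    ← lintegral_comp_add_smul (hF.indicator (hb c t)) c ht]
  refine lintegral_congr fun y => ?_
  have : (c + t • y ∈ Metric.ball c t) ↔ y ∈ Metric.ball (0 : E3) 1 := by
    rw [mem_ball_iff_norm, mem_ball_zero_iff, add_sub_cancel_left, norm_smul, Real.norm_of_nonneg ht.le]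
    exact ⟨fun h => by nlinarith, fun h => by nlinarith⟩
  by_cases hy : y ∈ Metric.ball (0 : E3) 1
  · rw [indicator_of_mem hy, indicator_of_mem (this.2 hy)]
  · rw [indicator_of_notMem hy, indicator_of_notMem fun h => hy (this.1 h)]

/-- The line through `x` and `y` meets the origin only if `y` lies on the line spanned by `x`, a
null set. The extension is smooth along all other segments. -/
theorem ae_segment_ne_zero {x : E3} (hx : x ≠ 0) :
    ∀ᵐ y : E3, ∀ t : ℝ, x + t • (y - x) ≠ 0 := by
  have hs : volume ((Submodule.span ℝ {x} : Submodule ℝ E3) : Set E3) = 0 := by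
    refine Measure.addHaar_submodule _ _ fun h => ?_
    have h1 : Module.finrank ℝ (Submodule.span ℝ {x} : Submodule ℝ E3) ≤ 1 := by
      simpa using finrank_span_le_card (R := ℝ) ({x} : Set E3)
    rw [h, finrank_top] at h1
    simp at h1
  refine measure_mono_null (fun y hy => ?_) hs
  simp only [mem_compl_iff, mem_ofPred_eq, not_forall, not_not] at hy
  obtain ⟨t, ht⟩ := hy
  have ht0 : t ≠ 0 := by
    rintro rfl
    exact hx (by simpa using ht)
  refine Submodule.mem_span_singleton.2 ⟨1 - t⁻¹, ?_⟩
  have h2 : t⁻¹ • (x + t • (y - x)) = 0 := by rw [ht, smul_zero]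
  rw [smul_add, inv_smul_smul₀ ht0] at h2
  rw [sub_smul, one_smul]
  refine (eq_of_sub_eq_zero (Eq.trans ?_ h2)).symm
  abel

theorem lintegral_gradSq_ball (u : S2 → ℂ) :
    ∫⁻ y in Metric.ball (0 : E3) 1, gradSq u y = dirichlet u := by
  have h := lintegral_gradSq_shell u (a := 0) (b := 1) le_rfl
  rw [sub_zero, ENNReal.ofReal_one, one_mul] at h
  rw [← h]
  refine setLIntegral_congr ?_
  filter_upwards [ae_ne_zero] with y hy
  have : (y ∈ Metric.ball (0 : E3) 1) = (y ∈ {y : E3 | ‖y‖ ∈ Ioo 0 1}) := by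
    rw [mem_ball_zero_iff, mem_ofPred_eq, mem_Ioo]
    simp [hy]
  exact this

/-- The change of variables `y ↦ (1 - t) x + t y` has Jacobian `t³ ≥ 1/8` and maps the unit ball
into itself by convexity. -/
theorem lintegral_gradSq_segment (u : S2 → ℂ) {x : E3} (hx : x ∈ Metric.ball (0 : E3) 1) {t : ℝ}
    (ht : 1 / 2 ≤ t) (ht1 : t ≤ 1) :
    ∫⁻ y in Metric.ball (0 : E3) 1, gradSq u ((1 - t) • x + t • y) ≤ 8 * dirichlet u := by
  have ht0 : 0 < t := by linarith
  rw [setLIntegral_ball_comp_add_smul (measurable_gradSq u) _ ht0, ← lintegral_gradSq_ball]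
  refine mul_le_mul' ?_ (lintegral_mono_set fun y hy => ?_)
  · rw [show (8 : ENNReal) = ENNReal.ofReal 8 by simp]
    refine ENNReal.ofReal_le_ofReal ?_
    rw [inv_le_comm₀ (by positivity) (by norm_num)]
    calc (8 : ℝ)⁻¹ = (1 / 2) ^ 3 := by norm_num
      _ ≤ t ^ 3 := by gcongr
  · rw [mem_ball_iff_norm] at hy
    rw [mem_ball_zero_iff] at hx ⊢
    calc ‖y‖ = ‖(y - (1 - t) • x) + (1 - t) • x‖ := by rw [sub_add_cancel]
      _ ≤ ‖y - (1 - t) • x‖ + ‖(1 - t) • x‖ := norm_add_le _ _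
      _ < 1 := by
        rw [norm_smul, Real.norm_of_nonneg (by linarith)]
        nlinarith [norm_nonneg x]

theorem enorm_sub_sq_le_segment {u : S2 → ℂ} (hu : IsSmooth u) {x y : E3}
    (hx : x ∈ Metric.ball (0 : E3) 1) (hy : y ∈ Metric.ball (0 : E3) 1)
    (h0 : ∀ t : ℝ, x + t • (y - x) ≠ 0) :
    ‖radialExt u x - radialExt u y‖ₑ ^ 2 ≤
      4 * ∫⁻ t in Icc (0 : ℝ) 1, gradSq u ((1 - t) • x + t • y) := by
  have h := enorm_sub_le_segment hu (r := 1) zero_le_one fun t _ => h0 t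
  have e : x + (1 : ℝ) • (y - x) = y := by simp
  have e' : ∀ t : ℝ, x + t • (y - x) = (1 - t) • x + t • y := fun t => by
    rw [smul_sub, sub_smul, one_smul]; abel
  rw [e] at h
  simp only [e'] at h
  have hm : Measurable fun t : ℝ => ‖fderiv ℝ (radialExt u) ((1 - t) • x + t • y)‖ₑ :=
    ((measurable_fderiv ℝ _).comp (by fun_prop)).enorm
  have h2 : ‖y - x‖ₑ ≤ 2 := by
    rw [mem_ball_zero_iff] at hx hy
    rw [← ofReal_norm]
    exact (ENNReal.ofReal_le_ofReal (q := 2) ((norm_sub_le _ _).trans (by linarith))).trans_eq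
      (by simp)
  rw [enorm_sub_rev]
  refine (pow_le_pow_left' h 2).trans ((sq_lintegral_mul_le hm.aemeasurable aemeasurable_const).trans ?_)
  rw [setLIntegral_const, Real.volume_Icc, sub_zero, ENNReal.ofReal_one, mul_one, mul_comm]
  refine mul_le_mul' ((pow_le_pow_left' h2 2).trans_eq (by norm_num)) le_rfl

/-- Poincaré inequality for smooth functions on the sphere. -/
theorem lintegral_enorm_sub_sq_le {u : S2 → ℂ} (hu : IsSmooth u) :
    ∫⁻ x, ∫⁻ y, ‖u x - u y‖ₑ ^ 2 ∂vol ∂vol ≤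
      288 * volume (Metric.ball (0 : E3) 1) * dirichlet u := by
  set B : Set E3 := Metric.ball (0 : E3) 1 with hB
  have hBm : MeasurableSet B := measurableSet_ball
  have hV := measurable_radialExt hu
  have hW : Measurable fun p : E3 × E3 => ‖radialExt u p.1 - radialExt u p.2‖ₑ ^ 2 :=
    ((hV.comp measurable_fst).sub (hV.comp measurable_snd)).enorm.pow_const _
  have h1 : ∀ x : S2, ∫⁻ y, ‖u x - u y‖ₑ ^ 2 ∂vol =
      3 * ∫⁻ y in B, ‖radialExt u x - radialExt u y‖ₑ ^ 2 := fun x => by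
    have hm : Measurable fun y => ‖radialExt u x - radialExt u y‖ₑ ^ 2 :=
      (measurable_const.sub hV).enorm.pow_const _
    refine (lintegral_radial_ball hm fun y ρ hρ => ?_).symm
    rw [radialExt_smul_coe u hρ, radialExt_coe]
  have h2 : ∫⁻ x, ∫⁻ y, ‖u x - u y‖ₑ ^ 2 ∂vol ∂vol =
      9 * ∫⁻ x in B, ∫⁻ y in B, ‖radialExt u x - radialExt u y‖ₑ ^ 2 := by
    simp only [h1]
    rw [← lintegral_radial_ball (V := fun x => 3 * ∫⁻ y in B, ‖radialExt u x - radialExt u y‖ₑ ^ 2)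
      (Measurable.const_mul (hW.lintegral_prod_right') _)]
    · rw [lintegral_const_mul _ hW.lintegral_prod_right', ← mul_assoc,
        show (3 : ENNReal) * 3 = 9 by norm_num]
    · intro x ρ hρ
      simp only [radialExt_smul_coe u hρ, radialExt_coe]
  have h3 : ∀ x ∈ B, x ≠ 0 → ∫⁻ y in B, ‖radialExt u x - radialExt u y‖ₑ ^ 2 ≤
      ∫⁻ y in B, 4 * ∫⁻ t in Icc (0 : ℝ) 1, gradSq u ((1 - t) • x + t • y) := fun x hx hx0 => by
    refine lintegral_mono_ae ?_
    filter_upwards [ae_restrict_of_ae (ae_segment_ne_zero hx0), ae_restrict_mem hBm] with y hy hyB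
    exact enorm_sub_sq_le_segment hu hx hyB hy
  have h4 : ∫⁻ x in B, ∫⁻ y in B, ‖radialExt u x - radialExt u y‖ₑ ^ 2 ≤
      ∫⁻ x in B, ∫⁻ y in B, 4 * ∫⁻ t in Icc (0 : ℝ) 1, gradSq u ((1 - t) • x + t • y) := by
    refine lintegral_mono_ae ?_
    filter_upwards [ae_restrict_of_ae ae_ne_zero, ae_restrict_mem hBm] with x hx hxB
    exact h3 x hxB hx
  have h5 : ∫⁻ x in B, ∫⁻ y in B, 4 * ∫⁻ t in Icc (0 : ℝ) 1, gradSq u ((1 - t) • x + t • y) =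
      4 * ∫⁻ t in Icc (0 : ℝ) 1, ∫⁻ x in B, ∫⁻ y in B, gradSq u ((1 - t) • x + t • y) := by
    have hK : Measurable fun p : E3 × E3 × ℝ => gradSq u ((1 - p.2.2) • p.1 + p.2.2 • p.2.1) :=
      (measurable_gradSq u).comp (by fun_prop)
    exact lintegral_rotate (μ := volume.restrict B) (ν := volume.restrict B)
      (ρ := volume.restrict (Icc (0 : ℝ) 1)) hK 4
  -- For `t ≤ 1/2` the roles of `x` and `y` are exchanged, so that the variable integrated first
  -- always has coefficient at least `1/2`. The final constant is `288 = 9 * 4 * 8`.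
  have h6 : ∀ t ∈ Icc (0 : ℝ) 1, ∫⁻ x in B, ∫⁻ y in B, gradSq u ((1 - t) • x + t • y) ≤
      8 * dirichlet u * volume B := fun t ht => by
    rcases le_total (1 / 2) t with h | h
    · refine (setLIntegral_mono' hBm fun x hx => lintegral_gradSq_segment u hx h ht.2).trans ?_
      rw [setLIntegral_const]
    · have hm : Measurable fun p : E3 × E3 => gradSq u ((1 - t) • p.1 + t • p.2) :=
        (measurable_gradSq u).comp (by fun_prop)
      rw [lintegral_lintegral_swap hm.aemeasurable]
      refine (setLIntegral_mono' hBm fun y hy => ?_).trans_eq (setLIntegral_const _ _)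
      have := lintegral_gradSq_segment u hy (t := 1 - t) (by linarith) (by linarith [ht.1])
      simpa only [sub_sub_cancel, add_comm] using this
  rw [h2]
  refine (mul_le_mul' le_rfl (h4.trans (h5.trans_le (mul_le_mul' le_rfl
    (setLIntegral_mono' measurableSet_Icc h6))))).trans_eq ?_
  rw [setLIntegral_const, Real.volume_Icc, sub_zero, ENNReal.ofReal_one, mul_one]
  ring

end KreinFeller

end


noncomputable section

namespace KreinFeller

/-! ### Approximation of smooth functions by averages, with respect to upper regular measures -/

/-- Upper regularity: the measure of a ball is at most a constant times a power of its radius. -/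
structure UpperRegular (μ : Measure S2) (C : ENNReal) (s : ℝ) : Prop where
  ne_top : C ≠ ⊤
  pos : 0 < s
  le : ∀ (x : S2) (t : ℝ), 0 < t → μ (Metric.ball x t) ≤ C * ENNReal.ofReal (t ^ s)

variable {μ : Measure S2} {C : ENNReal} {s : ℝ}

theorem lintegral_const_mul_swap {α β : Type*} [MeasurableSpace α] [MeasurableSpace β]
    {μ : Measure α} {ν : Measure β} [SFinite μ] [SFinite ν] {K : α × β → ENNReal}
    (hK : Measurable K) (c : ENNReal) :
    ∫⁻ x, c * ∫⁻ y, K (x, y) ∂ν ∂μ = c * ∫⁻ y, ∫⁻ x, K (x, y) ∂μ ∂ν := by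
  rw [lintegral_const_mul _ hK.lintegral_prod_right']
  exact congrArg (c * ·) (lintegral_lintegral_swap (f := fun x y => K (x, y)) hK.aemeasurable)

theorem lintegral₂_const_mul {α β : Type*} [MeasurableSpace α] [MeasurableSpace β]
    {μ : Measure α} {ν : Measure β} [SFinite ν] {K : α × β → ENNReal} (hK : Measurable K)
    (c : ENNReal) : ∫⁻ x, ∫⁻ y, c * K (x, y) ∂ν ∂μ = c * ∫⁻ x, ∫⁻ y, K (x, y) ∂ν ∂μ := by
  rw [← lintegral_const_mul _ hK.lintegral_prod_right']
  exact lintegral_congr fun x => lintegral_const_mul _ (hK.comp measurable_prodMk_left)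

theorem lintegral_rpow {p r : ℝ} (hp : -1 < p) (hr : 0 ≤ r) :
    ∫⁻ t in Ioc 0 r, ENNReal.ofReal (t ^ p) = ENNReal.ofReal (r ^ (p + 1) / (p + 1)) := by
  rw [← ofReal_integral_eq_lintegral_ofReal, ← intervalIntegral.integral_of_le hr,
    integral_rpow (Or.inl hp), Real.zero_rpow (by linarith), sub_zero]
  · exact (intervalIntegral.intervalIntegrable_rpow' hp).1
  · filter_upwards [ae_restrict_mem measurableSet_Ioc] with t ht
    exact Real.rpow_nonneg ht.1.le _

/-- A point within `t` of the sphere has norm within `t` of 1, and any two sphere points within `t`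
of it are within `2t` of each other. -/
theorem UpperRegular.measure_near_le (h : UpperRegular μ C s) {t : ℝ} (ht : 0 < t) (y : E3) :
    μ {x : S2 | y ∈ Metric.ball (x : E3) t} ≤
      {y : E3 | ‖y‖ ∈ Ioo (1 - t) (1 + t)}.indicator
        (fun _ => C * ENNReal.ofReal ((2 * t) ^ s)) y := by
  rcases Set.eq_empty_or_nonempty {x : S2 | y ∈ Metric.ball (x : E3) t} with he | ⟨x₀, hx₀⟩
  · rw [he, measure_empty]
    exact zero_le
  · have hx₀' : dist y (x₀ : E3) < t := hx₀
    have hn : ‖(x₀ : E3)‖ = 1 := norm_eq_of_mem_sphere x₀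
    have hy : ‖y‖ ∈ Ioo (1 - t) (1 + t) := by
      rw [dist_eq_norm] at hx₀'
      have h1 := abs_norm_sub_norm_le y (x₀ : E3)
      rw [hn, abs_le] at h1
      constructor <;> linarith
    rw [indicator_of_mem (show y ∈ {y : E3 | ‖y‖ ∈ Ioo (1 - t) (1 + t)} from hy)]
    refine (measure_mono fun x hx => ?_).trans (h.le x₀ (2 * t) (by linarith))
    have hx' : dist y (x : E3) < t := hx
    rw [Metric.mem_ball, Subtype.dist_eq]
    linarith [dist_triangle_left (x : E3) (x₀ : E3) y]

/-- After rescaling and Tonelli, three factors remain: the Jacobian `t⁻³`, the thickness `2t` of the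
shell, and `(2t)^s` from upper regularity. -/
theorem UpperRegular.lintegral_gradSq_le [IsFiniteMeasure μ] (h : UpperRegular μ C s) (u : S2 → ℂ)
    {t : ℝ} (ht : 0 < t) (ht1 : t ≤ 1) :
    ∫⁻ x, ∫⁻ z in Metric.ball (0 : E3) 1, gradSq u ((x : E3) + t • z) ∂volume ∂μ ≤
      ENNReal.ofReal (2 ^ (s + 1) * t ^ (s - 2)) * (C * dirichlet u) := by
  have h1 : ∀ x : S2, ∫⁻ z in Metric.ball (0 : E3) 1, gradSq u ((x : E3) + t • z) =
      ENNReal.ofReal (t ^ 3)⁻¹ * ∫⁻ y, (Metric.ball (x : E3) t).indicator (gradSq u) y := fun x => by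
    rw [setLIntegral_ball_comp_add_smul (measurable_gradSq u) _ ht,
      lintegral_indicator measurableSet_ball]
  have hms : MeasurableSet {p : S2 × E3 | p.2 ∈ Metric.ball (p.1 : E3) t} := by
    have : {p : S2 × E3 | p.2 ∈ Metric.ball (p.1 : E3) t} = {p | dist p.2 (p.1 : E3) < t} := rfl
    rw [this]
    exact measurableSet_lt (by fun_prop) measurable_const
  have hm : Measurable fun p : S2 × E3 => (Metric.ball (p.1 : E3) t).indicator (gradSq u) p.2 := by
    have : (fun p : S2 × E3 => (Metric.ball (p.1 : E3) t).indicator (gradSq u) p.2) =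
        {p : S2 × E3 | p.2 ∈ Metric.ball (p.1 : E3) t}.indicator (fun p => gradSq u p.2) := by
      funext p
      by_cases hp : p.2 ∈ Metric.ball (p.1 : E3) t
      · rw [indicator_of_mem hp, indicator_of_mem
          (show p ∈ {p : S2 × E3 | p.2 ∈ Metric.ball (p.1 : E3) t} from hp)]
      · rw [indicator_of_notMem hp, indicator_of_notMem
          (show p ∉ {p : S2 × E3 | p.2 ∈ Metric.ball (p.1 : E3) t} from hp)]
    rw [this]
    exact ((measurable_gradSq u).comp measurable_snd).indicator hms
  have h2 : ∀ y : E3, ∫⁻ x : S2, (Metric.ball (x : E3) t).indicator (gradSq u) y ∂μ =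
      gradSq u y * μ {x : S2 | y ∈ Metric.ball (x : E3) t} := fun y => by
    have hmy : MeasurableSet {x : S2 | y ∈ Metric.ball (x : E3) t} :=
      measurableSet_lt (by fun_prop : Measurable fun x : S2 => dist y (x : E3)) measurable_const
    rw [← setLIntegral_const, ← lintegral_indicator hmy]
    refine lintegral_congr fun x => ?_
    by_cases hx : y ∈ Metric.ball (x : E3) t
    · rw [indicator_of_mem hx, indicator_of_mem (show x ∈ {x : S2 | y ∈ Metric.ball (x : E3) t} from hx)]
    · rw [indicator_of_notMem hx,
        indicator_of_notMem (show x ∉ {x : S2 | y ∈ Metric.ball (x : E3) t} from hx)]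
  simp only [h1]
  have hsw : ∫⁻ x : S2, ENNReal.ofReal (t ^ 3)⁻¹ *
      (∫⁻ y, (Metric.ball (x : E3) t).indicator (gradSq u) y) ∂μ =
      ENNReal.ofReal (t ^ 3)⁻¹ *
        ∫⁻ y, ∫⁻ x : S2, (Metric.ball (x : E3) t).indicator (gradSq u) y ∂μ :=
    lintegral_const_mul_swap (μ := μ) (ν := (volume : Measure E3)) hm _
  rw [hsw]
  simp only [h2]
  have h3 : ∫⁻ y, gradSq u y * μ {x : S2 | y ∈ Metric.ball (x : E3) t} ≤
      ENNReal.ofReal (2 * t) * dirichlet u * (C * ENNReal.ofReal ((2 * t) ^ s)) := by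
    have hsh : MeasurableSet {y : E3 | ‖y‖ ∈ Ioo (1 - t) (1 + t)} := measurable_norm measurableSet_Ioo
    calc _ ≤ ∫⁻ y, {y : E3 | ‖y‖ ∈ Ioo (1 - t) (1 + t)}.indicator
          (fun y => gradSq u y * (C * ENNReal.ofReal ((2 * t) ^ s))) y := by
          refine lintegral_mono fun y => ?_
          refine (mul_le_mul' le_rfl (h.measure_near_le ht y)).trans_eq ?_
          simp only [indicator]
          split_ifs <;> simp
      _ = _ := by
          rw [lintegral_indicator hsh, lintegral_mul_const _ (measurable_gradSq u),
            lintegral_gradSq_shell u (by linarith)]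
          congr 3
          ring
  refine (mul_le_mul' le_rfl h3).trans_eq ?_
  have h4 : ENNReal.ofReal (t ^ 3)⁻¹ * (ENNReal.ofReal (2 * t) * dirichlet u *
      (C * ENNReal.ofReal ((2 * t) ^ s))) = (ENNReal.ofReal (t ^ 3)⁻¹ * ENNReal.ofReal (2 * t) *
        ENNReal.ofReal ((2 * t) ^ s)) * (C * dirichlet u) := by ring
  rw [h4, ← ENNReal.ofReal_mul (by positivity), ← ENNReal.ofReal_mul (by positivity)]
  congr 2
  rw [Real.mul_rpow zero_le_two ht.le, Real.rpow_add two_pos, Real.rpow_one, Real.rpow_sub ht,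
    Real.rpow_two]
  field_simp

/-- Cauchy–Schwarz along the segment, splitting 1 as `t^((a-1)/2) * t^((1-a)/2)`; the first square
is integrable for `a > 0`, with integral `r^a / a`. The condition `r ≤ 1/2` keeps the segment away
from the origin. -/
theorem enorm_sub_sq_le_weighted {u : S2 → ℂ} (hu : IsSmooth u) (x : S2) {z : E3}
    (hz : z ∈ Metric.ball (0 : E3) 1) {r a : ℝ} (hr : 0 < r) (hr1 : r ≤ 1 / 2) (ha : 0 < a) :
    ‖u x - radialExt u ((x : E3) + r • z)‖ₑ ^ 2 ≤ ENNReal.ofReal (r ^ a / a) *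
      ∫⁻ t in Ioc 0 r, ENNReal.ofReal (t ^ (1 - a)) * gradSq u ((x : E3) + t • z) := by
  rw [mem_ball_zero_iff] at hz
  have hn : ‖(x : E3)‖ = 1 := norm_eq_of_mem_sphere x
  have h0 : ∀ t ∈ Icc 0 r, (x : E3) + t • z ≠ 0 := fun t ht h => by
    have h1 : (x : E3) = -(t • z) := eq_neg_of_add_eq_zero_left h
    have h2 := congrArg norm h1
    rw [hn, norm_neg, norm_smul, Real.norm_of_nonneg ht.1] at h2
    nlinarith [ht.1, ht.2, norm_nonneg z]
  have h1 := enorm_sub_le_segment hu hr.le h0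
  rw [radialExt_coe, enorm_sub_rev] at h1
  have hz1 : ‖z‖ₑ ≤ 1 := by
    rw [← ofReal_norm]
    exact (ENNReal.ofReal_le_ofReal hz.le).trans_eq ENNReal.ofReal_one
  have hN : Measurable fun t : ℝ => ‖fderiv ℝ (radialExt u) ((x : E3) + t • z)‖ₑ :=
    ((measurable_fderiv ℝ _).comp (by fun_prop)).enorm
  have h2 : ∫⁻ t in Icc 0 r, ‖fderiv ℝ (radialExt u) ((x : E3) + t • z)‖ₑ * ‖z‖ₑ ≤
      ∫⁻ t in Ioc 0 r, ENNReal.ofReal (t ^ ((a - 1) / 2)) *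
        (ENNReal.ofReal (t ^ ((1 - a) / 2)) * ‖fderiv ℝ (radialExt u) ((x : E3) + t • z)‖ₑ) := by
    rw [← restrict_Ioc_eq_restrict_Icc]
    refine setLIntegral_mono' measurableSet_Ioc fun t ht => ?_
    rw [← mul_assoc, ← ENNReal.ofReal_mul (Real.rpow_nonneg ht.1.le _), ← Real.rpow_add ht.1,
      show (a - 1) / 2 + (1 - a) / 2 = 0 by ring, Real.rpow_zero, ENNReal.ofReal_one, one_mul]
    exact mul_le_of_le_one_right' hz1
  refine (pow_le_pow_left' (h1.trans h2) 2).trans ((sq_lintegral_mul_le (by fun_prop)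
    (Measurable.aemeasurable (by fun_prop))).trans_eq ?_)
  have h3 : ∀ t ∈ Ioc 0 r, ENNReal.ofReal (t ^ ((a - 1) / 2)) ^ 2 = ENNReal.ofReal (t ^ (a - 1)) :=
    fun t ht => by
      rw [← ENNReal.ofReal_pow (Real.rpow_nonneg ht.1.le _), ← Real.rpow_natCast, ← Real.rpow_mul ht.1.le]
      congr 2
      push_cast
      ring
  have h4 : ∀ t ∈ Ioc 0 r, (ENNReal.ofReal (t ^ ((1 - a) / 2)) *
      ‖fderiv ℝ (radialExt u) ((x : E3) + t • z)‖ₑ) ^ 2 =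
      ENNReal.ofReal (t ^ (1 - a)) * gradSq u ((x : E3) + t • z) := fun t ht => by
    rw [mul_pow, ← ENNReal.ofReal_pow (Real.rpow_nonneg ht.1.le _), ← Real.rpow_natCast,
      ← Real.rpow_mul ht.1.le, gradSq]
    congr 3
    push_cast
    ring
  rw [setLIntegral_congr_fun measurableSet_Ioc h3, setLIntegral_congr_fun measurableSet_Ioc h4,
    lintegral_rpow (by linarith) hr.le, sub_add_cancel]

/-- The mean square oscillation of `u` at scale `r`. -/
def oscillation (u : S2 → ℂ) (r : ℝ) (x : S2) : ENNReal :=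
  ∫⁻ z in Metric.ball (0 : E3) 1, ‖u x - radialExt u ((x : E3) + r • z)‖ₑ ^ 2

theorem measurable_oscillation {u : S2 → ℂ} (hu : IsSmooth u) (r : ℝ) :
    Measurable (oscillation u r) := by
  have hm : Measurable fun p : S2 × E3 => ‖u p.1 - radialExt u ((p.1 : E3) + r • p.2)‖ₑ ^ 2 :=
    ((hu.continuous.measurable.comp measurable_fst).sub ((measurable_radialExt hu).comp
      (by fun_prop))).enorm.pow_const _
  exact hm.lintegral_prod_right'

theorem UpperRegular.lintegral_oscillation_le [IsFiniteMeasure μ] (h : UpperRegular μ C s) :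
    ∃ K : ENNReal, K ≠ ⊤ ∧ ∀ u, IsSmooth u → ∀ r, 0 < r → r ≤ 1 / 2 →
      ∫⁻ x, oscillation u r x ∂μ ≤ ENNReal.ofReal (r ^ s) * (K * dirichlet u) := by
  have hs := h.pos
  -- With `a = s / 2` the other integrand is `t^(1-a) t^(s-2) = t^(s/2-1)`, again integrable at 0.
  -- Each of the two integrals contributes `r^(s/2)`.
  have ha : 0 < s / 2 := by linarith
  refine ⟨ENNReal.ofReal (2 ^ (s + 1) / (s / 2) / (s / 2)) * C,
    ENNReal.mul_ne_top ENNReal.ofReal_ne_top h.ne_top, fun u hu r hr hr1 => ?_⟩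
  have hK : Measurable fun p : S2 × E3 × ℝ =>
      ENNReal.ofReal (p.2.2 ^ (1 - s / 2)) * gradSq u ((p.1 : E3) + p.2.2 • p.2.1) := by
    refine Measurable.mul (by fun_prop) ((measurable_gradSq u).comp (by fun_prop))
  have h1 : ∫⁻ x, oscillation u r x ∂μ ≤ ∫⁻ x, ∫⁻ z in Metric.ball (0 : E3) 1,
      ENNReal.ofReal (r ^ (s / 2) / (s / 2)) * (∫⁻ t in Ioc 0 r,
        ENNReal.ofReal (t ^ (1 - s / 2)) * gradSq u ((x : E3) + t • z)) ∂volume ∂μ :=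
    lintegral_mono fun x => setLIntegral_mono' measurableSet_ball fun z hz =>
      enorm_sub_sq_le_weighted hu x hz hr hr1 ha
  have h2 := lintegral_rotate (μ := μ) (ν := volume.restrict (Metric.ball (0 : E3) 1))
      (ρ := volume.restrict (Ioc (0 : ℝ) r)) hK (ENNReal.ofReal (r ^ (s / 2) / (s / 2)))
  have h3 : ∀ t ∈ Ioc 0 r, ∫⁻ x, ∫⁻ z in Metric.ball (0 : E3) 1,
      ENNReal.ofReal (t ^ (1 - s / 2)) * gradSq u ((x : E3) + t • z) ∂volume ∂μ ≤
      ENNReal.ofReal (t ^ (s / 2 - 1)) * (ENNReal.ofReal (2 ^ (s + 1)) * (C * dirichlet u)) :=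
    fun t ht => by
      have hm : Measurable fun p : S2 × E3 => gradSq u ((p.1 : E3) + t • p.2) :=
        (measurable_gradSq u).comp (by fun_prop)
      refine (lintegral₂_const_mul (μ := μ) (ν := volume.restrict (Metric.ball (0 : E3) 1)) hm
        (ENNReal.ofReal (t ^ (1 - s / 2)))).trans_le ?_
      refine (mul_le_mul' le_rfl (h.lintegral_gradSq_le u ht.1 (by linarith [ht.2]))).trans_eq ?_
      rw [← mul_assoc, ← mul_assoc (ENNReal.ofReal (t ^ (s / 2 - 1))),
        ← ENNReal.ofReal_mul (Real.rpow_nonneg ht.1.le _),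
        ← ENNReal.ofReal_mul (Real.rpow_nonneg ht.1.le _),
        mul_left_comm (t ^ (1 - s / 2)), ← Real.rpow_add ht.1, mul_comm (2 ^ (s + 1) : ℝ), show 1 - s / 2 + (s - 2) = s / 2 - 1 by ring]
  refine h1.trans (h2.le.trans ((mul_le_mul' le_rfl
    (setLIntegral_mono' measurableSet_Ioc h3)).trans_eq ?_))
  have h4 : ENNReal.ofReal (r ^ (s / 2) / (s / 2)) * (ENNReal.ofReal (r ^ (s / 2) / (s / 2)) *
      (ENNReal.ofReal (2 ^ (s + 1)) * (C * dirichlet u))) = ENNReal.ofReal (r ^ (s / 2) / (s / 2)) *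
      ENNReal.ofReal (r ^ (s / 2) / (s / 2)) * ENNReal.ofReal (2 ^ (s + 1)) * (C * dirichlet u) := by
    ring
  rw [lintegral_mul_const _ (by fun_prop), lintegral_rpow (by linarith) hr.le, sub_add_cancel, h4,
    ← ENNReal.ofReal_mul (by positivity), ← ENNReal.ofReal_mul (by positivity), mul_assoc _ C,
    ← mul_assoc (ENNReal.ofReal (r ^ s)), ← ENNReal.ofReal_mul (by positivity)]
  congr 2
  have : r ^ s = r ^ (s / 2) * r ^ (s / 2) := by
    rw [← Real.rpow_add hr]
    congr 1
    ring
  rw [this]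
  field_simp

end KreinFeller

end


noncomputable section

namespace KreinFeller

/-! ### Trace inequality and compactness -/

section Lp

variable {α F : Type*} [MeasurableSpace α] [NormedAddCommGroup F] {ν : Measure α}

theorem enorm_sq_eq_lintegral (f : Lp F 2 ν) : ‖f‖ₑ ^ 2 = ∫⁻ x, ‖f x‖ₑ ^ 2 ∂ν := by
  rw [Lp.enorm_def, eLpNorm_eq_lintegral_rpow_enorm_toReal two_ne_zero ENNReal.ofNat_ne_top,
    ← ENNReal.rpow_natCast, ← ENNReal.rpow_mul]
  simp

theorem enorm_sq_eq_of_ae {f : Lp F 2 ν} {g : α → F} (h : (f : α → F) =ᵐ[ν] g) :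
    ‖f‖ₑ ^ 2 = ∫⁻ x, ‖g x‖ₑ ^ 2 ∂ν := by
  rw [enorm_sq_eq_lintegral]
  refine lintegral_congr_ae ?_
  filter_upwards [h] with x hx
  rw [hx]

theorem enorm_add_sq_le (a b : F) : ‖a + b‖ₑ ^ 2 ≤ 2 * ‖a‖ₑ ^ 2 + 2 * ‖b‖ₑ ^ 2 := by
  have h : ‖a + b‖ ^ 2 ≤ 2 * ‖a‖ ^ 2 + 2 * ‖b‖ ^ 2 := by
    nlinarith [norm_add_le a b, norm_nonneg (a + b), sq_nonneg (‖a‖ - ‖b‖)]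
  have h2 := ENNReal.ofReal_le_ofReal h
  rw [ENNReal.ofReal_add (by positivity) (by positivity), ENNReal.ofReal_mul zero_le_two,
    ENNReal.ofReal_mul zero_le_two, ENNReal.ofReal_pow (norm_nonneg _),
    ENNReal.ofReal_pow (norm_nonneg _), ENNReal.ofReal_pow (norm_nonneg _), ofReal_norm,
    ofReal_norm, ofReal_norm] at h2
  simpa using h2

theorem enorm_average_sq_le [NormedSpace ℝ F] {s : Set α} (h0 : ν s ≠ 0) (ht : ν s ≠ ⊤) {f : α → F}
    (hf : AEMeasurable (fun x => ‖f x‖ₑ) (ν.restrict s)) :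
    ‖⨍ x in s, f x ∂ν‖ₑ ^ 2 ≤ (ν s)⁻¹ * ∫⁻ x in s, ‖f x‖ₑ ^ 2 ∂ν := by
  have h1 : ‖⨍ x in s, f x ∂ν‖ₑ ≤ (ν s)⁻¹ * ∫⁻ x in s, ‖f x‖ₑ ∂ν := by
    rw [setAverage_eq, enorm_smul]
    refine mul_le_mul' (le_of_eq ?_) (enorm_integral_le_lintegral_enorm _)
    rw [Real.enorm_of_nonneg (by positivity), Measure.real, ← ENNReal.toReal_inv,
      ENNReal.ofReal_toReal (ENNReal.inv_ne_top.2 h0)]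
  have h2 := sq_lintegral_mul_le (ν := ν.restrict s) (aemeasurable_const (b := (1 : ENNReal))) hf
  simp only [one_mul, one_pow, lintegral_const, Measure.restrict_apply_univ] at h2
  refine (pow_le_pow_left' h1 2).trans ?_
  rw [mul_pow]
  refine (mul_le_mul' le_rfl h2).trans_eq ?_
  rw [sq, mul_assoc, ← mul_assoc _ (ν s), ENNReal.inv_mul_cancel h0 ht, one_mul]

end Lp

variable {u : S2 → ℂ} {r : ℝ}

/-- The average of the radial extension of `u` over a ball. -/
def ballAvg (u : S2 → ℂ) (r : ℝ) (p : S2) : ℂ :=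
  ⨍ z in Metric.ball (0 : E3) 1, radialExt u ((p : E3) + r • z)

theorem volume_ball_ne_zero : (volume (Metric.ball (0 : E3) 1)) ≠ 0 :=
  (Metric.measure_ball_pos _ _ one_pos).ne'

theorem volume_ball_ne_top : (volume (Metric.ball (0 : E3) 1)) ≠ ⊤ := measure_ball_lt_top.ne

theorem IsSmooth.exists_bound (hu : IsSmooth u) : ∃ C, ∀ y, ‖radialExt u y‖ ≤ C := by
  obtain ⟨C, hC⟩ := isCompact_univ.exists_bound_of_continuousOn hu.continuous.continuousOn
  refine ⟨max C 0, fun y => ?_⟩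
  by_cases hy : y = 0
  · simp [radialExt, hy]
  · rw [radialExt, dif_neg hy]
    exact (hC _ (mem_univ _)).trans (le_max_left _ _)

theorem measurable_radialExt_comp (hu : IsSmooth u) (r : ℝ) (p : S2) :
    Measurable fun z : E3 => radialExt u ((p : E3) + r • z) :=
  (measurable_radialExt hu).comp (by fun_prop)

/-- The ball of radius `r` about `p` lies in the ball of radius `2r` about `x`, at the price of the
volume ratio 8. Thus the centre of averaging may be any point near `x`. -/
theorem enorm_sub_ballAvg_sq_le (hu : IsSmooth u) (hr : 0 < r) {p x : S2} (hpx : dist p x ≤ r) :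
    ‖u x - ballAvg u r p‖ₑ ^ 2 ≤
      8 * (volume (Metric.ball (0 : E3) 1))⁻¹ * oscillation u (2 * r) x := by
  have hV := measurable_radialExt hu
  have hVr := measurable_radialExt_comp hu r p
  have hcint : IntegrableOn (fun z : E3 => radialExt u ((p : E3) + r • z)) (Metric.ball (0 : E3) 1) := by
    obtain ⟨C, hC⟩ := hu.exists_bound
    exact Measure.integrableOn_of_bounded volume_ball_ne_top hVr.aestronglyMeasurable
      (ae_of_all _ fun z => hC _)
  have h1 : u x - ballAvg u r p =
      ⨍ z in Metric.ball (0 : E3) 1, (u x - radialExt u ((p : E3) + r • z)) := by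
    have hb : (volume.real (Metric.ball (0 : E3) 1)) ≠ 0 :=
      (ENNReal.toReal_pos volume_ball_ne_zero volume_ball_ne_top).ne'
    have hc : Integrable (fun _ : E3 => u x) (volume.restrict (Metric.ball (0 : E3) 1)) :=
      integrableOn_const volume_ball_ne_top
    rw [ballAvg, setAverage_eq, setAverage_eq, integral_sub hc hcint, setIntegral_const, smul_sub, smul_smul,
      inv_mul_cancel₀ hb, one_smul]
  have h2 : ∫⁻ z in Metric.ball (0 : E3) 1, ‖u x - radialExt u ((p : E3) + r • z)‖ₑ ^ 2 ≤
      8 * oscillation u (2 * r) x := by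
    have hF : Measurable fun y => ‖u x - radialExt u y‖ₑ ^ 2 :=
      (measurable_const.sub hV).enorm.pow_const _
    have e1 := setLIntegral_ball_comp_add_smul hF (p : E3) hr
    have e2 := setLIntegral_ball_comp_add_smul hF (x : E3) (t := 2 * r) (by linarith)
    rw [oscillation, e1, e2, ← mul_assoc, show (8 : ENNReal) = ENNReal.ofReal 8 by simp,
      ← ENNReal.ofReal_mul (by norm_num)]
    refine mul_le_mul' (ENNReal.ofReal_le_ofReal (le_of_eq ?_)) (lintegral_mono_set fun y hy => ?_)
    · field_simp
      norm_num
    · have h1 : dist y (p : E3) < r := hy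
      have h2 : dist (p : E3) (x : E3) ≤ r := hpx
      rw [Metric.mem_ball]
      linarith [dist_triangle y (p : E3) (x : E3)]
  rw [h1]
  refine (enorm_average_sq_le volume_ball_ne_zero volume_ball_ne_top
    (measurable_const.sub hVr).enorm.aemeasurable).trans ((mul_le_mul' le_rfl h2).trans_eq ?_)
  ring

/-- The averaging ball lies in the ball of radius 2, over which the homogeneous extension has 8
times its integral over the unit ball. -/
theorem enorm_ballAvg_sq_le (hu : IsSmooth u) (hr : 0 < r) (hr1 : r ≤ 1) (p : S2) :
    ‖ballAvg u r p‖ₑ ^ 2 ≤ ENNReal.ofReal (8 / r ^ 3) * (volume (Metric.ball (0 : E3) 1))⁻¹ *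
      ∫⁻ x, ‖u x‖ₑ ^ 2 ∂vol := by
  have hF : Measurable fun y => ‖radialExt u y‖ₑ ^ 2 := (measurable_radialExt hu).enorm.pow_const _
  refine (enorm_average_sq_le volume_ball_ne_zero volume_ball_ne_top
    (measurable_radialExt_comp hu r p).enorm.aemeasurable).trans ?_
  have h1 := setLIntegral_ball_comp_add_smul hF (p : E3) hr
  have h2 := setLIntegral_ball_comp_add_smul hF 0 (t := 2) two_pos
  have h3 := lintegral_radial_ball (H := fun x => ‖u x‖ₑ ^ 2) hF fun x ρ hρ => by
    rw [radialExt_smul_coe u hρ]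
  have h4 : ∫⁻ y in Metric.ball (0 : E3) 1, ‖radialExt u (0 + (2 : ℝ) • y)‖ₑ ^ 2 =
      ∫⁻ y in Metric.ball (0 : E3) 1, ‖radialExt u y‖ₑ ^ 2 := by
    simp only [zero_add, radialExt_smul u two_pos]
  have h5 : ∫⁻ y in Metric.ball (p : E3) r, ‖radialExt u y‖ₑ ^ 2 ≤
      8 * ∫⁻ x, ‖u x‖ₑ ^ 2 ∂vol := by
    calc _ ≤ ∫⁻ y in Metric.ball (0 : E3) 2, ‖radialExt u y‖ₑ ^ 2 := by
          refine lintegral_mono_set fun y hy => ?_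
          have hp : dist (p : E3) 0 = 1 := by
            rw [dist_zero_right]
            exact norm_eq_of_mem_sphere p
          have h1 : dist y (p : E3) < r := hy
          rw [Metric.mem_ball]
          linarith [dist_triangle y (p : E3) 0]
      _ = 8 * ∫⁻ y in Metric.ball (0 : E3) 1, ‖radialExt u y‖ₑ ^ 2 := by
          rw [← h4, h2, ← mul_assoc, show (8 : ENNReal) = ENNReal.ofReal 8 by simp,
            ← ENNReal.ofReal_mul (by norm_num)]
          norm_num
      _ ≤ _ := by
          refine mul_le_mul' le_rfl ?_
          rw [← h3]
          exact le_mul_of_one_le_left' (by norm_num)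
  rw [h1, mul_comm (ENNReal.ofReal (8 / r ^ 3)), mul_assoc]
  refine mul_le_mul' le_rfl ((mul_le_mul' le_rfl h5).trans_eq ?_)
  rw [← mul_assoc, show (8 : ENNReal) = ENNReal.ofReal 8 by simp,
    ← ENNReal.ofReal_mul (by positivity)]
  congr 2
  field_simp

variable {μ : Measure S2} {C : ENNReal} {s : ℝ}

/-- Trace inequality. -/
theorem UpperRegular.exists_trace_le [IsFiniteMeasure μ] (h : UpperRegular μ C s) :
    ∃ K : ENNReal, K ≠ ⊤ ∧ ∀ u, IsSmooth u →
      ∫⁻ x, ‖u x‖ₑ ^ 2 ∂μ ≤ K * (dirichlet u + ∫⁻ x, ‖u x‖ₑ ^ 2 ∂vol) := by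
  obtain ⟨K, hK, hle⟩ := h.lintegral_oscillation_le
  set b := (volume (Metric.ball (0 : E3) 1))⁻¹
  have hb : b ≠ ⊤ := ENNReal.inv_ne_top.2 volume_ball_ne_zero
  set A : ENNReal := 2 * (8 * b) * (ENNReal.ofReal ((1 / 2) ^ s) * K)
  set D : ENNReal := 2 * (ENNReal.ofReal (8 / (1 / 4) ^ 3) * b) * μ univ
  have hA : A ≠ ⊤ := ENNReal.mul_ne_top (ENNReal.mul_ne_top (by simp)
    (ENNReal.mul_ne_top (by simp) hb)) (ENNReal.mul_ne_top ENNReal.ofReal_ne_top hK)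
  have hD : D ≠ ⊤ := ENNReal.mul_ne_top (ENNReal.mul_ne_top (by simp)
    (ENNReal.mul_ne_top ENNReal.ofReal_ne_top hb)) (measure_ne_top μ _)
  refine ⟨A + D, ENNReal.add_ne_top.2 ⟨hA, hD⟩, fun u hu => ?_⟩
  -- Split `u` into its deviation from the average at radius `1/4`, an oscillation at the largest
  -- admissible scale `1/2`, and the average itself.
  have h1 : ∀ x, ‖u x‖ₑ ^ 2 ≤ 2 * (8 * b) * oscillation u (1 / 2) x +
      2 * (ENNReal.ofReal (8 / (1 / 4) ^ 3) * b) * ∫⁻ x, ‖u x‖ₑ ^ 2 ∂vol := fun x => by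
    have e1 := enorm_sub_ballAvg_sq_le hu (r := 1 / 4) (by norm_num) (p := x) (x := x) (by simp)
    have e2 := enorm_ballAvg_sq_le hu (r := 1 / 4) (by norm_num) (by norm_num) x
    rw [show 2 * (1 / 4 : ℝ) = 1 / 2 by norm_num] at e1
    calc ‖u x‖ₑ ^ 2 = ‖(u x - ballAvg u (1 / 4) x) + ballAvg u (1 / 4) x‖ₑ ^ 2 := by
          rw [sub_add_cancel]
      _ ≤ _ := enorm_add_sq_le _ _
      _ ≤ _ := by
          rw [mul_assoc 2, mul_assoc 2]
          exact add_le_add (mul_le_mul' le_rfl e1) (mul_le_mul' le_rfl e2)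
  calc ∫⁻ x, ‖u x‖ₑ ^ 2 ∂μ ≤ _ := lintegral_mono h1
    _ ≤ A * dirichlet u + D * ∫⁻ x, ‖u x‖ₑ ^ 2 ∂vol := by
      rw [lintegral_add_right _ measurable_const, lintegral_const,
        lintegral_const_mul _ (measurable_oscillation hu _)]
      refine add_le_add ?_ (le_of_eq ?_)
      · refine (mul_le_mul' le_rfl (hle u hu (1 / 2) (by norm_num) le_rfl)).trans_eq ?_
        ring
      · ring
    _ ≤ _ := by
      rw [mul_add]
      exact add_le_add (mul_le_mul' le_self_add le_rfl) (mul_le_mul' le_add_self le_rfl)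

end KreinFeller

end


/-! ### Compactness of the trace and weighted Poincaré inequalities. -/

noncomputable section

namespace KreinFeller

variable {u : S2 → ℂ} {r : ℝ} {μ : Measure S2} {C : ENNReal} {s : ℝ} {Ω : Set S2}

/-- A simple function close to the identity. -/
theorem exists_simpleFunc_near (hr : 0 < r) :
    ∃ q : SimpleFunc S2 S2, ∀ x, dist (q x) x ≤ r := by
  have : Nonempty S2 := ⟨polar 0 0⟩
  let e := TopologicalSpace.denseSeq S2
  have hcov : (univ : Set S2) ⊆ ⋃ k, Metric.ball (e k) r := fun x _ => by
    obtain ⟨k, hk⟩ := (TopologicalSpace.denseRange_denseSeq S2).exists_dist_lt x hr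
    exact mem_iUnion.2 ⟨k, hk⟩
  obtain ⟨t, ht⟩ := isCompact_univ.elim_finite_subcover _ (fun k => Metric.isOpen_ball) hcov
  refine ⟨SimpleFunc.nearestPt e (t.sup id), fun x => ?_⟩
  obtain ⟨k, hk, hx⟩ := mem_iUnion₂.1 (ht (mem_univ x))
  have h := SimpleFunc.edist_nearestPt_le e x (Finset.le_sup (f := id) hk)
  rw [edist_dist, edist_dist] at h
  refine ((ENNReal.ofReal_le_ofReal_iff dist_nonneg).1 h).trans ?_
  rw [dist_comm]
  exact (Metric.mem_ball.1 hx).le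

theorem exists_small_radius (hs : 0 < s) (A : ENNReal) (hA : A ≠ ⊤) {ε : ℝ} (hε : 0 < ε) :
    ∃ r, 0 < r ∧ r ≤ 1 / 4 ∧ ENNReal.ofReal ((2 * r) ^ s) * A ≤ ENNReal.ofReal ε := by
  have hc : ContinuousAt (fun r : ℝ => (2 * r) ^ s * A.toReal) 0 := by
    refine ContinuousAt.mul (ContinuousAt.rpow_const (by fun_prop) (Or.inr hs.le)) continuousAt_const
  have hlt : ∀ᶠ r in 𝓝[>] (0 : ℝ), (2 * r) ^ s * A.toReal < ε := by
    refine (hc.tendsto.eventually_lt_const ?_).filter_mono nhdsWithin_le_nhds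
    simpa [Real.zero_rpow hs.ne'] using hε
  obtain ⟨r, hr1, hr2⟩ := (hlt.and (Ioc_mem_nhdsGT (by norm_num : (0 : ℝ) < 1 / 4))).exists
  refine ⟨r, hr2.1, hr2.2, ?_⟩
  rw [← ENNReal.ofReal_toReal hA, ← ENNReal.ofReal_mul (Real.rpow_nonneg (by linarith [hr2.1]) _)]
  exact ENNReal.ofReal_le_ofReal hr1.le

/-- Bounded sets of smooth functions are totally bounded in `L²`. -/
theorem UpperRegular.totallyBounded [IsFiniteMeasure μ] (h : UpperRegular μ C s) (Ω : Set S2) :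
    TotallyBounded {w : L2 μ Ω | ∃ u, IsSmooth u ∧ dirichlet u ≤ 1 ∧
      ∫⁻ x, ‖u x‖ₑ ^ 2 ∂vol ≤ 1 ∧ (w : S2 → ℂ) =ᵐ[μ.restrict Ω] u} := by
  obtain ⟨K, hK, hle⟩ := h.lintegral_oscillation_le
  set b := (volume (Metric.ball (0 : E3) 1))⁻¹ with hbdef
  have hb : b ≠ ⊤ := ENNReal.inv_ne_top.2 volume_ball_ne_zero
  rw [Metric.totallyBounded_iff]
  intro ε hε
  -- The radius is chosen so that replacing `u` by nearby ball averages costs at most `ε / 2` in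
  -- `L²`.
  obtain ⟨r, hr, hr1, hrA⟩ := exists_small_radius h.pos (8 * b * K)
    (ENNReal.mul_ne_top (ENNReal.mul_ne_top (by simp) hb) hK) (ε := (ε / 2) ^ 2) (by positivity)
  obtain ⟨q, hq⟩ := exists_simpleFunc_near hr
  set D : ENNReal := ENNReal.ofReal (8 / r ^ 3) * b
  have hD : D ≠ ⊤ := ENNReal.mul_ne_top ENNReal.ofReal_ne_top hb
  -- Functions that factor through the finite range of `q` form a finite-dimensional space, where
  -- bounded sets are totally bounded.
  let qr : S2 → q.range := fun x => ⟨q x, q.mem_range_self x⟩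
  have hqr : Measurable qr := q.measurable.subtype_mk
  have hmeas : ∀ c : q.range → ℂ, MemLp (fun x => c (qr x)) 2 (μ.restrict Ω) := fun c =>
    MemLp.of_bound ((measurable_of_finite c).comp hqr).aestronglyMeasurable ‖c‖
      (ae_of_all _ fun x => norm_le_pi_norm c _)
  let T : (q.range → ℂ) → L2 μ Ω := fun c => (hmeas c).toLp
  have hT : Continuous T := by
    refine (LipschitzWith.of_dist_le_mul (K := (measureUnivNNReal (μ.restrict Ω)) ^
      ((2 : ENNReal).toReal)⁻¹) fun c c' => ?_).continuous
    rw [dist_eq_norm, dist_eq_norm]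
    refine Lp.norm_le_of_ae_bound (norm_nonneg _) ?_
    filter_upwards [Lp.coeFn_sub (T c) (T c'), (hmeas c).coeFn_toLp, (hmeas c').coeFn_toLp]
      with x h1 h2 h3
    rw [h1, Pi.sub_apply, h2, h3]
    exact norm_le_pi_norm (c - c') (qr x)
  have hTB : TotallyBounded (T '' Metric.closedBall 0 (√D.toReal)) :=
    ((isCompact_closedBall _ _).image hT).totallyBounded
  obtain ⟨t, ht, htc⟩ := Metric.totallyBounded_iff.1 hTB (ε / 2) (by linarith)
  refine ⟨t, ht, ?_⟩
  rintro w ⟨u, hu, hu1, hu2, hw⟩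
  -- The approximant takes at `x` the ball average centred at `q x`; these averages are bounded by
  -- the `L²(vol)` norm of `u`.
  let c : q.range → ℂ := fun p => ballAvg u r p
  have hc : T c ∈ T '' Metric.closedBall 0 (√D.toReal) := by
    refine ⟨c, ?_, rfl⟩
    rw [mem_closedBall_zero_iff, pi_norm_le_iff_of_nonneg (Real.sqrt_nonneg _)]
    intro p
    refine Real.le_sqrt_of_sq_le ?_
    have h1 : ‖ballAvg u r p‖ₑ ^ 2 ≤ D :=
      (enorm_ballAvg_sq_le hu hr (by linarith) p).trans (mul_le_of_le_one_right' hu2)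
    have h2 := ENNReal.toReal_mono hD h1
    rwa [ENNReal.toReal_pow, toReal_enorm] at h2
  have hdist : dist w (T c) ≤ ε / 2 := by
    rw [dist_eq_norm]
    have hae : ((w - T c : L2 μ Ω) : S2 → ℂ) =ᵐ[μ.restrict Ω] fun x => u x - ballAvg u r (q x) := by
      filter_upwards [Lp.coeFn_sub w (T c), hw, (hmeas c).coeFn_toLp] with x h1 h2 h3
      rw [h1, Pi.sub_apply, h2, h3]
    have h1 : ‖w - T c‖ₑ ^ 2 ≤ ENNReal.ofReal ((ε / 2) ^ 2) := by
      rw [enorm_sq_eq_of_ae hae]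
      calc ∫⁻ x in Ω, ‖u x - ballAvg u r (q x)‖ₑ ^ 2 ∂μ
          ≤ ∫⁻ x, 8 * b * oscillation u (2 * r) x ∂μ :=
            (setLIntegral_le_lintegral _ _).trans
              (lintegral_mono fun x => enorm_sub_ballAvg_sq_le hu hr (hq x))
        _ ≤ 8 * b * (ENNReal.ofReal ((2 * r) ^ s) * (K * dirichlet u)) := by
            rw [lintegral_const_mul _ (measurable_oscillation hu _)]
            exact mul_le_mul' le_rfl (hle u hu _ (by linarith) (by linarith))
        _ ≤ 8 * b * (ENNReal.ofReal ((2 * r) ^ s) * K) :=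
            mul_le_mul' le_rfl (mul_le_mul' le_rfl (mul_le_of_le_one_right' hu1))
        _ = ENNReal.ofReal ((2 * r) ^ s) * (8 * b * K) := by ring
        _ ≤ _ := hrA
    rw [← ofReal_norm, ← ENNReal.ofReal_pow (norm_nonneg _),
      ENNReal.ofReal_le_ofReal_iff (by positivity)] at h1
    exact (pow_le_pow_iff_left₀ (norm_nonneg _) (by linarith) two_ne_zero).1 h1
  obtain ⟨y, hy, hyc⟩ := mem_iUnion₂.1 (htc hc)
  refine mem_iUnion₂.2 ⟨y, hy, ?_⟩
  rw [Metric.mem_ball] at hyc ⊢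
  linarith [dist_triangle w (T c) y]

/-! ### Norms of jets, and the Poincaré inequality of the measure -/

theorem setLIntegral_enorm_sq_of_support {F : Type*} [NormedAddCommGroup F] {f : S2 → F}
    (ν : Measure S2) (hΩ : IsOpen Ω) (hf : ∀ x ∉ Ω, f x = 0) :
    ∫⁻ x in Ω, ‖f x‖ₑ ^ 2 ∂ν = ∫⁻ x, ‖f x‖ₑ ^ 2 ∂ν := by
  rw [← lintegral_indicator hΩ.measurableSet]
  refine lintegral_congr fun x => ?_
  by_cases hx : x ∈ Ω
  · rw [indicator_of_mem hx]
  · rw [indicator_of_notMem hx, hf x hx]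
    simp

theorem IsTest.eq_zero (hu : IsTest Ω u) (x : S2) (hx : x ∉ Ω) : u x = 0 :=
  image_eq_zero_of_notMem_tsupport fun h => hx (hu.2.2 h)

theorem IsTest.grad_eq_zero (hu : IsTest Ω u) (x : S2) (hx : x ∉ Ω) : grad u x = 0 :=
  grad_eq_zero_of_notMem_tsupport fun h => hx (hu.2.2 h)

theorem ofReal_setIntegral_norm_sq {F : Type*} [NormedAddCommGroup F] {f : S2 → F}
    (hf : Continuous f) (ν : Measure S2) [IsFiniteMeasure ν] (Ω : Set S2) :
    ENNReal.ofReal (∫ x in Ω, ‖f x‖ ^ 2 ∂ν) = ∫⁻ x in Ω, ‖f x‖ₑ ^ 2 ∂ν := by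
  rw [ofReal_integral_eq_lintegral_ofReal ((memLp_of_continuous hf _).integrable_norm_pow two_ne_zero)
    (ae_of_all _ fun x => sq_nonneg _)]
  refine lintegral_congr fun x => ?_
  rw [ENNReal.ofReal_pow (norm_nonneg _), ofReal_norm]

theorem UpperRegular.poincareInequality [IsFiniteMeasure μ] (h : UpperRegular μ C s)
    (hΩ : IsOpen Ω) : PoincareInequality μ Ω := by
  obtain ⟨K, hK, hle⟩ := h.exists_trace_le
  -- The summand 1 makes the constant positive even if `K = 0`.
  refine ⟨K.toReal + 1, by positivity, fun u hu => ?_⟩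
  have hnn : 0 ≤ ∫ x in Ω, ‖grad u x‖ ^ 2 ∂vol + ∫ x in Ω, ‖u x‖ ^ 2 ∂vol :=
    add_nonneg (integral_nonneg fun x => sq_nonneg _) (integral_nonneg fun x => sq_nonneg _)
  rw [← ENNReal.ofReal_le_ofReal_iff (mul_nonneg (by positivity) hnn),
    ENNReal.ofReal_mul (by positivity), ENNReal.ofReal_add (integral_nonneg fun x => sq_nonneg _)
      (integral_nonneg fun x => sq_nonneg _), ofReal_setIntegral_norm_sq hu.1.continuous,
    ofReal_setIntegral_norm_sq hu.smooth.continuous_grad, ofReal_setIntegral_norm_sq hu.1.continuous,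
    setLIntegral_enorm_sq_of_support vol hΩ hu.eq_zero,
    setLIntegral_enorm_sq_of_support vol hΩ hu.grad_eq_zero]
  refine (setLIntegral_le_lintegral _ _).trans ((hle u hu.1).trans (mul_le_mul' ?_
    (add_le_add (dirichlet_le u) le_rfl)))
  rw [← ENNReal.ofReal_toReal hK, ENNReal.toReal_ofReal ENNReal.toReal_nonneg]
  exact ENNReal.ofReal_le_ofReal (by linarith)

theorem IsJet.enorm_fst {h : H1 Ω} (hΩ : IsOpen Ω) (hu : IsTest Ω u) (hj : IsJet Ω u h) :
    ‖h.fst‖ₑ ^ 2 = ∫⁻ x, ‖u x‖ₑ ^ 2 ∂vol := by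
  rw [enorm_sq_eq_of_ae hj.1, setLIntegral_enorm_sq_of_support vol hΩ hu.eq_zero]

theorem IsJet.dirichlet_le {h : H1 Ω} (hΩ : IsOpen Ω) (hu : IsTest Ω u) (hj : IsJet Ω u h) :
    dirichlet u ≤ ‖h.snd‖ₑ ^ 2 := by
  rw [enorm_sq_eq_of_ae hj.2, setLIntegral_enorm_sq_of_support vol hΩ hu.grad_eq_zero]
  exact KreinFeller.dirichlet_le u

/-- Poincaré inequality with a weighted mean. -/
theorem weighted_poincare (hu : IsSmooth u) {w : S2 → ℂ} (hw : MemLp w 2 vol) :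
    ‖∫ y, w y ∂vol‖ₑ ^ 2 * ∫⁻ x, ‖u x‖ₑ ^ 2 ∂vol ≤
      2 * ((∫⁻ y, ‖w y‖ₑ ^ 2 ∂vol) * (288 * volume (Metric.ball (0 : E3) 1) * dirichlet u)) +
        2 * (‖∫ y, w y * u y ∂vol‖ₑ ^ 2 * vol univ) := by
  have hwi : Integrable w vol := hw.integrable one_le_two
  have hum : Measurable u := hu.continuous.measurable
  have hwu : Integrable (fun y => w y * u y) vol := by
    obtain ⟨C, hC⟩ := isCompact_univ.exists_bound_of_continuousOn hu.continuous.continuousOn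
    exact hwi.mul_bdd hum.aestronglyMeasurable (ae_of_all _ fun x => hC x (mem_univ x))
  have hW : Measurable fun p : S2 × S2 => ‖u p.1 - u p.2‖ₑ ^ 2 :=
    ((hum.comp measurable_fst).sub (hum.comp measurable_snd)).enorm.pow_const _
  have h1 : ∀ x, ‖∫ y, w y ∂vol‖ₑ ^ 2 * ‖u x‖ₑ ^ 2 ≤
      2 * ((∫⁻ y, ‖w y‖ₑ ^ 2 ∂vol) * ∫⁻ y, ‖u x - u y‖ₑ ^ 2 ∂vol) +
        2 * ‖∫ y, w y * u y ∂vol‖ₑ ^ 2 := fun x => by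
    -- The first term is controlled by differences of `u`, the second by the weighted mean. The
    -- inequality is useful when `w` has nonzero integral and the weighted mean is known to be
    -- small.
    have e : (∫ y, w y ∂vol) * u x =
        (∫ y, w y * (u x - u y) ∂vol) + ∫ y, w y * u y ∂vol := by
      have : (fun y => w y * (u x - u y)) = fun y => w y * u x - w y * u y := by
        funext y
        ring
      rw [this, integral_sub (hwi.mul_const _) hwu, sub_add_cancel, integral_mul_const]
    have e2 : ‖∫ y, w y * (u x - u y) ∂vol‖ₑ ^ 2 ≤
        (∫⁻ y, ‖w y‖ₑ ^ 2 ∂vol) * ∫⁻ y, ‖u x - u y‖ₑ ^ 2 ∂vol := by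
      refine (pow_le_pow_left' (enorm_integral_le_lintegral_enorm _) 2).trans ?_
      simp only [enorm_mul]
      exact sq_lintegral_mul_le hw.1.enorm (measurable_const.sub hum).enorm.aemeasurable
    rw [← mul_pow, ← enorm_mul, e]
    exact (enorm_add_sq_le _ _).trans (add_le_add (mul_le_mul' le_rfl e2) le_rfl)
  have hWm : Measurable fun x => ∫⁻ y, ‖u x - u y‖ₑ ^ 2 ∂vol := hW.lintegral_prod_right'
  rw [← lintegral_const_mul _ (hum.enorm.pow_const _)]
  refine (lintegral_mono h1).trans ?_
  rw [lintegral_add_right _ measurable_const, lintegral_const,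
    lintegral_const_mul _ (hWm.const_mul _), lintegral_const_mul _ hWm, mul_assoc 2 (_ ^ 2)]
  exact add_le_add (mul_le_mul' le_rfl (mul_le_mul' le_rfl (lintegral_enorm_sub_sq_le hu))) le_rfl

end KreinFeller

end


/-! ### Coercivity of the energy and the Hilbert space of the form. -/

noncomputable section

namespace KreinFeller

variable {μ : Measure S2} {Ω : Set S2}

/-! ### Coercivity of the energy on the complement of the null space -/

theorem inner_fst_eq_integral {h : H1 Ω} {u v : S2 → ℂ} (hΩ : IsOpen Ω) (hu : IsTest Ω u)
    (hj : IsJet Ω u h) {k : Lp ℂ 2 (vol.restrict Ω)} (hk : (k : S2 → ℂ) =ᵐ[vol.restrict Ω] v) :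
    (inner ℂ k h.fst : ℂ) = ∫ x, conj (v x) * u x ∂vol := by
  rw [L2.inner_def]
  have h1 : ∫ x in Ω, (inner ℂ (k x) (h.fst x) : ℂ) ∂vol = ∫ x in Ω, conj (v x) * u x ∂vol := by
    refine integral_congr_ae ?_
    filter_upwards [hj.1, hk] with x h1 h2
    rw [h1, h2, RCLike.inner_apply, mul_comm]
  rw [h1, ← integral_indicator hΩ.measurableSet]
  refine integral_congr_ae (ae_of_all _ fun x => ?_)
  by_cases hx : x ∈ Ω
  · simp only [indicator_of_mem hx]
  · simp only [indicator_of_notMem hx, hu.eq_zero x hx, mul_zero]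

theorem weighted_poincare_jet (hΩ : IsOpen Ω) {w : S2 → ℂ} (hw : MemLp w 2 vol)
    (hI : ∫ y, w y ∂vol ≠ 0) :
    ∃ A B : ℝ, 0 ≤ A ∧ 0 ≤ B ∧ ∀ u h, IsTest Ω u → IsJet Ω u h →
      ‖h.fst‖ ^ 2 ≤ A * ‖h.snd‖ ^ 2 + B * ‖∫ y, w y * u y ∂vol‖ ^ 2 := by
  set I := ∫ y, w y ∂vol
  have hI' : 0 < ‖I‖ ^ 2 := by positivity
  set a : ENNReal := 2 * ((∫⁻ y, ‖w y‖ₑ ^ 2 ∂vol) * (288 * volume (Metric.ball (0 : E3) 1)))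
  have ha : a ≠ ⊤ := by
    refine ENNReal.mul_ne_top (by simp) (ENNReal.mul_ne_top ?_ (ENNReal.mul_ne_top (by simp)
      volume_ball_ne_top))
    rw [← enorm_sq_eq_of_ae hw.coeFn_toLp]
    exact ENNReal.pow_ne_top enorm_ne_top
  set b : ENNReal := 2 * vol univ
  have hb : b ≠ ⊤ := ENNReal.mul_ne_top (by simp) (measure_ne_top _ _)
  refine ⟨a.toReal / ‖I‖ ^ 2, b.toReal / ‖I‖ ^ 2, by positivity, by positivity,
    fun u h hu hj => ?_⟩
  have h1 : ‖I‖ₑ ^ 2 * ‖h.fst‖ₑ ^ 2 ≤ a * ‖h.snd‖ₑ ^ 2 + b * ‖∫ y, w y * u y ∂vol‖ₑ ^ 2 := by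
    rw [hj.enorm_fst hΩ hu]
    refine (weighted_poincare hu.1 hw).trans (add_le_add ?_ (le_of_eq (by ring)))
    calc _ = a * dirichlet u := by ring
      _ ≤ _ := mul_le_mul' le_rfl (hj.dirichlet_le hΩ hu)
  have h2 := ENNReal.toReal_mono (ENNReal.add_ne_top.2 ⟨ENNReal.mul_ne_top ha
    (ENNReal.pow_ne_top enorm_ne_top), ENNReal.mul_ne_top hb (ENNReal.pow_ne_top enorm_ne_top)⟩) h1
  rw [ENNReal.toReal_add (ENNReal.mul_ne_top ha (ENNReal.pow_ne_top enorm_ne_top))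
    (ENNReal.mul_ne_top hb (ENNReal.pow_ne_top enorm_ne_top))] at h2
  simp only [ENNReal.toReal_mul, ENNReal.toReal_pow, toReal_enorm] at h2
  rw [div_mul_eq_mul_div, div_mul_eq_mul_div, ← add_div, le_div_iff₀ hI', mul_comm]
  exact h2

theorem norm_fst_le_of_mem_W0 {A B : ℝ} (k : Lp ℂ 2 (vol.restrict Ω))
    (hk : ∀ u h, IsTest Ω u → IsJet Ω u h →
      ‖h.fst‖ ^ 2 ≤ A * ‖h.snd‖ ^ 2 + B * ‖(inner ℂ k h.fst : ℂ)‖ ^ 2) {h : H1 Ω} (hh : h ∈ W0 Ω) :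
    ‖h.fst‖ ^ 2 ≤ A * ‖h.snd‖ ^ 2 + B * ‖(inner ℂ k h.fst : ℂ)‖ ^ 2 := by
  have c1 : Continuous fun h : H1 Ω => h.fst := WithLp.continuous_fst 2 _ _
  have c2 : Continuous fun h : H1 Ω => h.snd := WithLp.continuous_snd 2 _ _
  have hcl : IsClosed {h : H1 Ω | ‖h.fst‖ ^ 2 ≤ A * ‖h.snd‖ ^ 2 + B * ‖(inner ℂ k h.fst : ℂ)‖ ^ 2} :=
    isClosed_le (c1.norm.pow 2) (((c2.norm.pow 2).const_mul A).add
      (((continuous_const.inner c1).norm.pow 2).const_mul B))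
  refine closure_minimal ?_ hcl hh
  rintro h ⟨u, hu, hj⟩
  exact hk u h hu hj

theorem IsTest.isRep_zero {u : S2 → ℂ} (hu : IsTest Ω u) (h0 : u =ᵐ[μ.restrict Ω] 0) {k : H1 Ω}
    (hk : IsJet Ω u k) : k ∈ nullSpace μ Ω :=
  ⟨subset_closure ⟨u, hu, hk⟩, subset_closure ⟨u, hu, hk, (Lp.coeFn_zero _ _ _).trans h0.symm⟩⟩

/-- On the orthogonal complement of the null space the energy controls the `L²` norm, if the
measure is carried by a closed set with a nonempty complement. -/
theorem exists_coercive (hΩ : IsOpen Ω) {D : Set S2} (hD : IsClosed D) (hμD : μ Dᶜ = 0)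
    (hDc : Dᶜ.Nonempty) : ∃ A : ℝ, ∀ h ∈ nullPerp μ Ω, ‖h.fst‖ ≤ A * ‖h.snd‖ := by
  suffices H : ∃ A : ℝ, 0 ≤ A ∧ ∀ h ∈ nullPerp μ Ω, ‖h.fst‖ ^ 2 ≤ A * ‖h.snd‖ ^ 2 by
    obtain ⟨A, hA, H⟩ := H
    refine ⟨√A, fun h hh => ?_⟩
    rw [← abs_of_nonneg (norm_nonneg h.fst), ← Real.sqrt_sq_eq_abs]
    refine (Real.sqrt_le_sqrt (H h hh)).trans_eq ?_
    rw [Real.sqrt_mul hA, Real.sqrt_sq (norm_nonneg _)]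
  -- Constants must be excluded. If `Ω` has full volume they are excluded by orthogonality to a bump
  -- off `D`; otherwise by vanishing on `Ωᶜ`.
  by_cases hv : vol Ωᶜ = 0
  · have hU : IsOpen (Ω ∩ Dᶜ) := hΩ.inter hD.isOpen_compl
    have : (volume : Measure E3).toSphere.IsOpenPosMeasure := inferInstance
    have hDv : vol Dᶜ ≠ 0 := (hD.isOpen_compl.measure_pos ((volume : Measure E3).toSphere) hDc).ne'
    have hUv : vol (Ω ∩ Dᶜ) ≠ 0 := fun h0 => hDv (measure_mono_null (fun x hx => by
      by_cases hxΩ : x ∈ Ω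
      · exact Or.inl ⟨hxΩ, hx⟩
      · exact Or.inr hxΩ) (measure_union_null h0 hv))
    obtain ⟨g, hg, hgU, hgI⟩ : ∃ g : S2 → ℝ, ContMDiff (𝓡 2) 𝓘(ℝ, ℝ) ∞ g ∧ tsupport g ⊆ Ω ∩ Dᶜ ∧
        ∫ x, g x ∂vol ≠ 0 := by
      -- If all smooth functions supported in the open set had integral zero, the constant 1 would
      -- vanish almost everywhere on it.
      by_contra! hcon
      refine hUv ?_
      have hae := hU.ae_eq_zero_of_integral_contMDiff_smul_eq_zero (𝓡 2) (μ := vol)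
        (f := fun _ => (1 : ℝ)) ((integrable_const _).locallyIntegrable.locallyIntegrableOn _)
        fun g hg _ hgU => by simpa using hcon g hg hgU
      refine measure_mono_null (fun x hx => ?_) (ae_iff.1 hae)
      simpa using hx
    let n : S2 → ℂ := fun x => (g x : ℂ)
    have hnU : tsupport n ⊆ Ω ∩ Dᶜ := (closure_mono fun x hx => by
      simpa [n] using hx).trans hgU
    have hns : IsSmooth n := Complex.ofRealCLM.contMDiff.comp hg
    have hn : IsTest Ω n := hns.isTest (hnU.trans inter_subset_left)
    have hn0 : n =ᵐ[μ.restrict Ω] 0 := by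
      refine ae_restrict_of_ae (measure_mono_null (fun x hx => ?_) hμD)
      have hx' : n x ≠ 0 := hx
      exact (hnU (subset_tsupport _ hx')).2
    have hnI : ∫ x, n x ∂vol ≠ 0 := by
      rw [integral_complex_ofReal]
      exact_mod_cast hgI
    obtain ⟨A, B, hA, hB, hAB⟩ := weighted_poincare_jet hΩ (hns.memLp vol) hnI
    have hkj := isJet_jet (Ω := Ω) hns
    set k := jet Ω hns
    refine ⟨A + B * ‖k.snd‖ ^ 2, by positivity, fun h hh => ?_⟩
    have h1 := norm_fst_le_of_mem_W0 (A := A) (B := B) k.fst (fun u h hu hj => by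
      rw [inner_fst_eq_integral hΩ hu hj hkj.1]
      simpa [n] using hAB u h hu hj) hh.1
    -- The bump is zero `μ`-a.e., so its jet lies in the null space. Orthogonality in `W^{1,2}`
    -- trades the mean of `h` against the bump for a pairing of gradients.
    have h2 := hh.2 k (hn.isRep_zero hn0 hkj)
    rw [WithLp.prod_inner_apply] at h2
    have h3 : ‖(inner ℂ k.fst h.fst : ℂ)‖ ≤ ‖k.snd‖ * ‖h.snd‖ := by
      have : (inner ℂ k.fst h.fst : ℂ) = -inner ℂ k.snd h.snd := eq_neg_of_add_eq_zero_left h2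
      rw [this, norm_neg]
      exact norm_inner_le_norm _ _
    have h4 := pow_le_pow_left₀ (norm_nonneg _) h3 2
    have h5 := mul_le_mul_of_nonneg_left h4 hB
    rw [mul_pow] at h5
    linarith
  · have hm : MeasurableSet Ωᶜ := hΩ.measurableSet.compl
    -- With the weight concentrated on `Ωᶜ` the weighted mean of every test function is zero.
    let w : S2 → ℂ := Ωᶜ.indicator fun _ => 1
    have hw : MemLp w 2 vol := (memLp_const (1 : ℂ)).indicator hm
    have hwI : ∫ x, w x ∂vol ≠ 0 := by
      rw [integral_indicator hm, setIntegral_const]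
      have : vol.real Ωᶜ ≠ 0 := (ENNReal.toReal_pos hv (measure_ne_top _ _)).ne'
      simpa using this
    obtain ⟨A, B, hA, hB, hAB⟩ := weighted_poincare_jet hΩ hw hwI
    refine ⟨A, hA, fun h hh => ?_⟩
    have h1 := norm_fst_le_of_mem_W0 (A := A) (B := 0) 0 (fun u h hu hj => by
      have h0 : ∫ y, w y * u y ∂vol = 0 := by
        rw [← integral_zero S2 ℂ (μ := vol)]
        refine integral_congr_ae (ae_of_all _ fun x => ?_)
        by_cases hx : x ∈ Ω
        · have : w x = 0 := indicator_of_notMem (s := Ωᶜ) (fun h => h hx) _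
          simp [this]
        · simp [hu.eq_zero x hx]
      have := hAB u h hu hj
      rw [h0] at this
      simpa using this) hh.1
    simpa using h1

/-! ### Density of test functions -/

/-- The classes of test functions in `L²(Ω, μ)`. -/
def testClasses (μ : Measure S2) (Ω : Set S2) : Set (L2 μ Ω) :=
  {w | ∃ u, IsTest Ω u ∧ (w : S2 → ℂ) =ᵐ[μ.restrict Ω] u}

theorem eq_zero_of_inner_test [IsFiniteMeasure μ] (hΩ : IsOpen Ω) (f : L2 μ Ω)
    (h : ∀ w ∈ testClasses μ Ω, (inner ℂ w f : ℂ) = 0) : f = 0 := by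
  have hf : Integrable f (μ.restrict Ω) := (Lp.memLp f).integrable one_le_two
  have hae := hΩ.ae_eq_zero_of_integral_contMDiff_smul_eq_zero (𝓡 2) (μ := μ.restrict Ω)
    (f := f) (hf.locallyIntegrable.locallyIntegrableOn _) fun g hg _ hgΩ => by
      let n : S2 → ℂ := fun x => (g x : ℂ)
      have hns : IsSmooth n := Complex.ofRealCLM.contMDiff.comp hg
      have hn : IsTest Ω n := hns.isTest ((closure_mono fun x hx => by simpa [n] using hx).trans hgΩ)
      have h1 := h ((hns.memLp (μ.restrict Ω)).toLp n) ⟨n, hn, (hns.memLp _).coeFn_toLp⟩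
      rw [L2.inner_def] at h1
      rw [← h1]
      refine integral_congr_ae ?_
      filter_upwards [(hns.memLp (μ.restrict Ω)).coeFn_toLp] with x hx
      rw [hx, RCLike.inner_apply, Complex.real_smul, mul_comm]
      simp [n]
  refine Lp.eq_zero_iff_ae_eq_zero.2 ?_
  filter_upwards [hae, ae_restrict_mem hΩ.measurableSet] with x hx hxΩ
  exact hx hxΩ

end KreinFeller

end


noncomputable section

namespace KreinFeller

variable {μ : Measure S2} {Ω : Set S2}

/-! ### The Hilbert space of gradients -/

theorem isJet_zero (Ω : Set S2) : IsJet Ω 0 0 := by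
  refine ⟨Lp.coeFn_zero _ _ _, (Lp.coeFn_zero _ _ _).trans (ae_of_all _ fun x => ?_)⟩
  rw [grad_eq_zero_of_notMem_tsupport (by simp)]
  rfl

/-- The graph of the trace on test functions. -/
def testGraph (μ : Measure S2) (Ω : Set S2) : Submodule ℂ (H1 Ω × L2 μ Ω) where
  carrier := {q | ∃ u, IsTest Ω u ∧ IsJet Ω u q.1 ∧ (q.2 : S2 → ℂ) =ᵐ[μ.restrict Ω] u}
  zero_mem' := ⟨0, IsTest.zero, isJet_zero Ω, Lp.coeFn_zero _ _ _⟩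
  add_mem' := by
    rintro a b ⟨u, hu, ha, ha'⟩ ⟨v, hv, hb, hb'⟩
    exact ⟨u + v, hu.add hv, IsJet.add hu.1 hv.1 ha hb, (Lp.coeFn_add _ _).trans (ha'.add hb')⟩
  smul_mem' := by
    rintro c a ⟨u, hu, ha, ha'⟩
    exact ⟨c • u, hu.const_smul c, IsJet.const_smul c hu.1 ha,
      (Lp.coeFn_smul _ _).trans (ha'.const_smul c)⟩

/-- The graph of the trace on `W0`. -/
def traceGraph (μ : Measure S2) (Ω : Set S2) : Submodule ℂ (H1 Ω × L2 μ Ω) :=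
  (testGraph μ Ω).topologicalClosure

theorem isClosed_traceGraph : IsClosed (traceGraph μ Ω : Set (H1 Ω × L2 μ Ω)) :=
  Submodule.isClosed_topologicalClosure _

theorem mem_W0_of_mem_traceGraph {q : H1 Ω × L2 μ Ω} (hq : q ∈ traceGraph μ Ω) : q.1 ∈ W0 Ω := by
  have := image_closure_subset_closure_image (s := (testGraph μ Ω : Set (H1 Ω × L2 μ Ω)))
    continuous_fst (mem_image_of_mem Prod.fst hq)
  refine closure_mono ?_ this
  rintro _ ⟨q, ⟨u, hu, hj, -⟩, rfl⟩
  exact ⟨u, hu, hj⟩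

theorem UpperRegular.exists_norm_trace_le [IsFiniteMeasure μ] {C : ENNReal} {s : ℝ}
    (h : UpperRegular μ C s) (hΩ : IsOpen Ω) :
    ∃ K : ℝ, 0 ≤ K ∧ ∀ q ∈ traceGraph μ Ω, ‖q.2‖ ≤ K * ‖q.1‖ := by
  obtain ⟨K, hK, hle⟩ := h.exists_trace_le
  refine ⟨√K.toReal, Real.sqrt_nonneg _, fun q hq => ?_⟩
  have hcl : IsClosed {q : H1 Ω × L2 μ Ω | ‖q.2‖ ≤ √K.toReal * ‖q.1‖} :=
    isClosed_le continuous_snd.norm (continuous_fst.norm.const_mul _)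
  refine closure_minimal ?_ hcl hq
  rintro q ⟨u, hu, hj, hw⟩
  have h1 : ‖q.2‖ₑ ^ 2 ≤ K * ‖q.1‖ₑ ^ 2 := by
    have h2 : ‖q.2‖ₑ ^ 2 ≤ ∫⁻ x, ‖u x‖ₑ ^ 2 ∂μ := by
      rw [enorm_sq_eq_of_ae hw]
      exact setLIntegral_le_lintegral _ _
    refine h2.trans ((hle u hu.1).trans (mul_le_mul' le_rfl ?_))
    rw [← hj.enorm_fst hΩ hu]
    refine (add_le_add (hj.dirichlet_le hΩ hu) le_rfl).trans (le_of_eq ?_)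
    have := WithLp.prod_norm_sq_eq_of_L2 q.1
    rw [add_comm, ← ofReal_norm, ← ofReal_norm, ← ofReal_norm, ← ENNReal.ofReal_pow (norm_nonneg _),
      ← ENNReal.ofReal_pow (norm_nonneg _), ← ENNReal.ofReal_pow (norm_nonneg _),
      ← ENNReal.ofReal_add (by positivity) (by positivity), this]
  have h3 := ENNReal.toReal_mono (ENNReal.mul_ne_top hK (ENNReal.pow_ne_top enorm_ne_top)) h1
  simp only [ENNReal.toReal_mul, ENNReal.toReal_pow, toReal_enorm] at h3
  have h4 := Real.sqrt_le_sqrt h3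
  rwa [Real.sqrt_mul ENNReal.toReal_nonneg, Real.sqrt_sq (norm_nonneg _),
    Real.sqrt_sq (norm_nonneg _)] at h4

/-- The null space as a submodule. -/
def nullSubmodule (μ : Measure S2) (Ω : Set S2) : Submodule ℂ (H1 Ω) :=
  (traceGraph μ Ω).comap (LinearMap.inl ℂ (H1 Ω) (L2 μ Ω))

theorem mem_nullSubmodule {h : H1 Ω} : h ∈ nullSubmodule μ Ω ↔ (h, (0 : L2 μ Ω)) ∈ traceGraph μ Ω :=
  Iff.rfl

theorem mem_nullSpace_iff {h : H1 Ω} : h ∈ nullSpace μ Ω ↔ h ∈ nullSubmodule μ Ω :=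
  ⟨fun h => h.2, fun h => ⟨mem_W0_of_mem_traceGraph h, h⟩⟩

theorem mem_nullPerp_iff {h : H1 Ω} :
    h ∈ nullPerp μ Ω ↔ h ∈ W0 Ω ∧ h ∈ (nullSubmodule μ Ω)ᗮ := by
  rw [Submodule.mem_orthogonal]
  exact and_congr_right fun _ => forall_congr' fun n => by rw [mem_nullSpace_iff]

instance : CompleteSpace (nullSubmodule μ Ω) :=
  IsClosed.completeSpace_coe (hs := isClosed_traceGraph.preimage (ContinuousLinearMap.inl ℂ (H1 Ω) (L2 μ Ω)).continuous)

/-- The graph of the trace on the complement of the null space. -/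
def perpGraph (μ : Measure S2) (Ω : Set S2) : Submodule ℂ (H1 Ω × L2 μ Ω) :=
  traceGraph μ Ω ⊓ (nullSubmodule μ Ω)ᗮ.comap (LinearMap.fst ℂ (H1 Ω) (L2 μ Ω))

theorem mem_perpGraph {q : H1 Ω × L2 μ Ω} :
    q ∈ perpGraph μ Ω ↔ q.1 ∈ nullPerp μ Ω ∧ IsRep μ Ω q.1 q.2 := by
  rw [mem_nullPerp_iff]
  exact ⟨fun h => ⟨⟨mem_W0_of_mem_traceGraph h.1, h.2⟩, h.1⟩, fun h => ⟨h.2, h.1.2⟩⟩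

instance : CompleteSpace (perpGraph μ Ω) :=
  IsClosed.completeSpace_coe (hs := isClosed_traceGraph.inter
    ((Submodule.isClosed_orthogonal _).preimage continuous_fst))

/-- The difference has zero trace and is orthogonal to the null space, hence to itself. This makes
`lift` independent of the choice in its definition. -/
theorem eq_of_mem_perpGraph {h k : H1 Ω} {w : L2 μ Ω} (hh : (h, w) ∈ perpGraph μ Ω)
    (hk : (k, w) ∈ perpGraph μ Ω) : h = k := by
  have h1 : (h - k, (0 : L2 μ Ω)) ∈ perpGraph μ Ω := by
    simpa using (perpGraph μ Ω).sub_mem hh hk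
  have h2 := inner_self_eq_zero (𝕜 := ℂ).1
    ((Submodule.mem_orthogonal _ _).1 h1.2 (h - k) (mem_nullSubmodule.2 h1.1))
  exact sub_eq_zero.1 h2

/-- The gradient. -/
def perpGrad (μ : Measure S2) (Ω : Set S2) : perpGraph μ Ω →L[ℂ] L2Grad Ω :=
  (WithLp.sndL 2 ℂ (Lp ℂ 2 (vol.restrict Ω)) (L2Grad Ω)).comp
    ((ContinuousLinearMap.fst ℂ (H1 Ω) (L2 μ Ω)).comp (perpGraph μ Ω).subtypeL)

theorem perpGrad_apply (q : perpGraph μ Ω) : perpGrad μ Ω q = q.1.1.snd := rfl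

/-- Coercivity bounds the function by its gradient and the trace inequality bounds the
`μ`-representative. The gradient map on the graph is thus injective with closed range, which
provides a complete space of gradients. -/
theorem exists_antilipschitz_perpGrad {K A : ℝ} (hK0 : 0 ≤ K)
    (hK : ∀ q ∈ traceGraph μ Ω, ‖q.2‖ ≤ K * ‖q.1‖)
    (hA : ∀ h ∈ nullPerp μ Ω, ‖h.fst‖ ≤ A * ‖h.snd‖) :
    ∃ c, AntilipschitzWith c (perpGrad μ Ω) := by
  refine ⟨((1 + K) * (|A| + 1)).toNNReal, (perpGrad μ Ω).antilipschitz_of_bound fun q => ?_⟩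
  rw [Real.coe_toNNReal _ (by positivity), perpGrad_apply]
  have h0 := (mem_perpGraph.1 q.2).1
  have h1 : ‖q.1.1‖ ≤ (|A| + 1) * ‖q.1.1.snd‖ := by
    have h2 := WithLp.prod_norm_sq_eq_of_L2 q.1.1
    have h3 : ‖q.1.1.fst‖ ≤ |A| * ‖q.1.1.snd‖ := (hA _ h0).trans
      (mul_le_mul_of_nonneg_right (le_abs_self _) (norm_nonneg _))
    refine le_of_sq_le_sq ?_ (by positivity)
    have h4 := pow_le_pow_left₀ (norm_nonneg _) h3 2
    rw [h2]
    nlinarith [mul_nonneg (abs_nonneg A) (sq_nonneg ‖q.1.1.snd‖)]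
  have h2 : ‖q‖ ≤ (1 + K) * ‖q.1.1‖ := by
    change ‖q.1‖ ≤ _
    rw [Prod.norm_def]
    have h3 := hK q.1 q.2.1
    refine max_le ?_ ?_ <;> nlinarith [norm_nonneg q.1.1, mul_nonneg hK0 (norm_nonneg q.1.1)]
  rw [mul_assoc]
  exact h2.trans (mul_le_mul_of_nonneg_left h1 (by positivity))

theorem UpperRegular.totallyBounded_trace [IsFiniteMeasure μ] {C : ENNReal} {s : ℝ}
    (h : UpperRegular μ C s) (hΩ : IsOpen Ω) {M : ℝ} (hM : 0 < M) :
    TotallyBounded (Prod.snd '' {q : H1 Ω × L2 μ Ω | q ∈ traceGraph μ Ω ∧ ‖q.1‖ < M}) := by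
  have hS := (h.totallyBounded Ω).image (f := fun w : L2 μ Ω => (M : ℂ) • w)
    (ContinuousLinearMap.uniformContinuous ((M : ℂ) • ContinuousLinearMap.id ℂ (L2 μ Ω)))
  refine hS.closure.subset ?_
  -- Since the norm ball is open, elements of the closed graph inside it are limits of test elements
  -- inside it. These are rescaled to the unit ball, where total boundedness is known.
  have ho : IsOpen {q : H1 Ω × L2 μ Ω | ‖q.1‖ < M} :=
    isOpen_lt continuous_fst.norm continuous_const
  have hsub : {q : H1 Ω × L2 μ Ω | q ∈ traceGraph μ Ω ∧ ‖q.1‖ < M} ⊆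
      closure {q | ‖q.1‖ < M ∧ q ∈ testGraph μ Ω} :=
    fun q hq => ho.inter_closure ⟨hq.2, hq.1⟩
  refine (image_mono hsub).trans ((image_closure_subset_closure_image continuous_snd).trans
    (closure_mono ?_))
  rintro _ ⟨q, ⟨hq, hqt⟩, rfl⟩
  have hMc : (M : ℂ) ≠ 0 := Complex.ofReal_ne_zero.2 hM.ne'
  obtain ⟨u, hu, hj, hw⟩ := (testGraph μ Ω).smul_mem ((M : ℂ)⁻¹) hqt
  have hn : ‖((M : ℂ)⁻¹ • q).1‖ ≤ 1 := by
    rw [Prod.smul_fst, norm_smul, norm_inv, Complex.norm_real, Real.norm_of_nonneg hM.le]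
    rw [inv_mul_le_iff₀ hM, mul_one]
    exact hq.le
  have hn2 : ∀ {E : Type} [NormedAddCommGroup E] (x : E), ‖x‖ ≤ 1 → ‖x‖ₑ ^ 2 ≤ 1 := fun x hx => by
    refine pow_le_one' ?_ 2
    rw [← ofReal_norm]
    exact ENNReal.ofReal_le_one.2 hx
  refine ⟨(M : ℂ)⁻¹ • q.2, ⟨u, hu.1, ?_, ?_, hw⟩, ?_⟩
  · exact (hj.dirichlet_le hΩ hu).trans (hn2 _ ((WithLp.norm_snd_le _ _).trans hn))
  · rw [← hj.enorm_fst hΩ hu]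
    exact hn2 _ ((WithLp.norm_fst_le _ _).trans hn)
  · simp [smul_smul, mul_inv_cancel₀ hMc]

theorem exists_equiv_of_antilipschitz {E F : Type*} [NormedAddCommGroup E] [NormedSpace ℂ E]
    [NormedAddCommGroup F] [NormedSpace ℂ F] [CompleteSpace E] [CompleteSpace F] (f : E →L[ℂ] F)
    {c : NNReal} (hc : AntilipschitzWith c f) :
    ∃ (R : Submodule ℂ F) (_ : CompleteSpace R) (e : R ≃L[ℂ] E), ∀ r, f (e r) = r := by
  have hcl : IsClosed (range f) := hc.isClosed_range f.uniformContinuous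
  refine ⟨f.range, hcl.completeSpace_coe, (f.equivRange hc.injective hcl).symm, fun r => ?_⟩
  obtain ⟨q, rfl⟩ := (f.equivRange hc.injective hcl).surjective r
  rw [ContinuousLinearEquiv.symm_apply_apply]
  rfl

theorem UpperRegular.exists_formData_of_equiv [IsFiniteMeasure μ] {C : ENNReal} {s : ℝ}
    (h : UpperRegular μ C s) (hΩ : IsOpen Ω) {R : Submodule ℂ (L2Grad Ω)} (hR : CompleteSpace R)
    (e : R ≃L[ℂ] perpGraph μ Ω) (he : ∀ r, (e r).1.1.snd = r) : Nonempty (FormData μ Ω) := by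
  let J : R →L[ℂ] L2 μ Ω := (ContinuousLinearMap.snd ℂ (H1 Ω) (L2 μ Ω)).comp
    ((perpGraph μ Ω).subtypeL.comp (e : R →L[ℂ] perpGraph μ Ω))
  let L : R →L[ℂ] H1 Ω := (ContinuousLinearMap.fst ℂ (H1 Ω) (L2 μ Ω)).comp
    ((perpGraph μ Ω).subtypeL.comp (e : R →L[ℂ] perpGraph μ Ω))
  have hJL : ∀ r, (L r, J r) ∈ perpGraph μ Ω := fun r => (e r).2
  have hL : ∀ r, (L r).snd = r := he
  have hex : ∀ q ∈ perpGraph μ Ω, ∃ r, J r = q.2 := fun q hq => by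
    refine ⟨e.symm ⟨q, hq⟩, ?_⟩
    change (e (e.symm ⟨q, hq⟩)).1.2 = q.2
    rw [e.apply_symm_apply]
  clear_value J L
  have hinj : Function.Injective J := fun r r' hrr => by
    have h1 := hJL r
    rw [hrr] at h1
    have h2 := eq_of_mem_perpGraph h1 (hJL r')
    exact Subtype.ext (by rw [← hL r, ← hL r', h2])
  have hdom : ∀ w, w ∈ dom μ Ω ↔ ∃ r, J r = w := fun w => by
    constructor
    · rintro ⟨k, hk, hr⟩
      exact hex (k, w) (mem_perpGraph.2 ⟨hk, hr⟩)
    · rintro ⟨r, rfl⟩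
      have := mem_perpGraph.1 (hJL r)
      exact ⟨L r, this.1, this.2⟩
  have hlift : ∀ r, lift μ Ω (J r) = L r := fun r => by
    have hmem : J r ∈ dom μ Ω := (hdom _).2 ⟨r, rfl⟩
    rw [lift, dif_pos hmem]
    exact eq_of_mem_perpGraph (mem_perpGraph.2 hmem.choose_spec) (hJL r)
  have hcpt : IsCompactOperator J := by
    refine (isCompactOperator_iff_isCompact_closure_image_ball (J : R →ₗ[ℂ] L2 μ Ω) one_pos).2 ?_
    have hM : 0 < ‖L‖ + 1 := by positivity
    have hT := (h.totallyBounded_trace hΩ hM).subset (s₁ := J '' Metric.ball 0 1) (by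
      rintro _ ⟨r, hr, rfl⟩
      refine ⟨(L r, J r), ⟨(hJL r).1, ?_⟩, rfl⟩
      have h1 := L.le_opNorm r
      have h2 : ‖r‖ < 1 := by simpa using hr
      have h3 : ‖L‖ * ‖r‖ ≤ ‖L‖ * 1 := mul_le_mul_of_nonneg_left h2.le L.opNorm_nonneg
      change ‖L r‖ < _
      linarith)
    exact hT.closure.isCompact_of_isClosed isClosed_closure
  have hdense : DenseRange J := by
    have htop : J.range.topologicalClosure = ⊤ := by
      rw [Submodule.topologicalClosure_eq_top_iff, Submodule.eq_bot_iff]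
      intro f hf
      refine eq_zero_of_inner_test hΩ f fun w hw => ?_
      obtain ⟨u, hu, hw⟩ := hw
      have hg : (jet Ω hu.1, w) ∈ traceGraph μ Ω :=
        subset_closure ⟨u, hu, isJet_jet hu.1, hw⟩
      -- Subtracting the projection onto the null space does not change the trace, so every class of
      -- a test function is in the range of `J`.
      set n : H1 Ω := (nullSubmodule μ Ω).starProjection (jet Ω hu.1)
      have hn : (n, (0 : L2 μ Ω)) ∈ traceGraph μ Ω :=
        mem_nullSubmodule.1 (Submodule.starProjection_apply_mem _ _)
      have hq : (jet Ω hu.1 - n, w) ∈ perpGraph μ Ω :=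
        ⟨by simpa using (traceGraph μ Ω).sub_mem hg hn,
          Submodule.sub_starProjection_mem_orthogonal _⟩
      obtain ⟨r, hr⟩ := hex _ hq
      exact (Submodule.mem_orthogonal _ _).1 hf w ⟨r, hr⟩
    have := Submodule.dense_iff_topologicalClosure_eq_top.2 htop
    exact this
  exact ⟨⟨R, hR, J, L, hinj, hdom, hlift, hL, hcpt, hdense⟩⟩

theorem UpperRegular.exists_formData [IsFiniteMeasure μ] {C : ENNReal} {s : ℝ}
    (h : UpperRegular μ C s) (hΩ : IsOpen Ω) {D : Set S2} (hD : IsClosed D) (hμD : μ Dᶜ = 0)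
    (hDc : Dᶜ.Nonempty) : Nonempty (FormData μ Ω) := by
  obtain ⟨K, hK0, hK⟩ := h.exists_norm_trace_le hΩ
  obtain ⟨A, hA⟩ := exists_coercive hΩ hD hμD hDc
  obtain ⟨c, hc⟩ := exists_antilipschitz_perpGrad hK0 hK hA
  obtain ⟨R, hR, e, he⟩ := exists_equiv_of_antilipschitz (perpGrad μ Ω) hc
  exact h.exists_formData_of_equiv hΩ hR e he

end KreinFeller

end


noncomputable section

namespace KreinFeller

/-! ### Infinite dimension of the `L²` space -/

theorem not_finiteDimensional_L2_of_pairwise_disjoint {X : Type*} [MeasurableSpace X]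
    {ν : Measure X} [IsFiniteMeasure ν] {A : ℕ → Set X} (hA : ∀ k, MeasurableSet (A k))
    (hpos : ∀ k, ν (A k) ≠ 0) (hd : Pairwise fun i j => Disjoint (A i) (A j)) :
    ¬ FiniteDimensional ℂ (Lp ℂ 2 ν) := by
  intro hfin
  let v : ℕ → Lp ℂ 2 ν := fun k => indicatorConstLp 2 (hA k) (measure_ne_top ν _) (1 : ℂ)
  have hli : LinearIndependent ℂ v := by
    refine linearIndependent_of_ne_zero_of_inner_eq_zero (fun k h0 => ?_) fun i j hij => ?_
    · have h1 : ‖v k‖ = 0 := by rw [h0, norm_zero]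
      rw [norm_indicatorConstLp (by simp) (by simp)] at h1
      have : 0 < ν.real (A k) := ENNReal.toReal_pos (hpos k) (measure_ne_top _ _)
      have h2 : 0 < ν.real (A k) ^ (1 / (2 : ENNReal).toReal) := Real.rpow_pos_of_pos this _
      simp only [norm_one, one_mul] at h1
      exact h2.ne' h1
    · have h1 := L2.inner_indicatorConstLp_one_indicatorConstLp_one (𝕜 := ℂ) (hA i) (hA j)
        (measure_ne_top ν _) (measure_ne_top ν _)
      rw [(hd hij).inter_eq, measureReal_empty] at h1
      simpa using h1
  have := LinearIndependent.finite hli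
  exact not_finite ℕ

theorem UpperRegular.restrict {μ : Measure S2} {C : ENNReal} {s : ℝ} (h : UpperRegular μ C s)
    (Ω : Set S2) : UpperRegular (μ.restrict Ω) C s :=
  ⟨h.ne_top, h.pos, fun x t ht => (Measure.restrict_apply_le _ _).trans (h.le x t ht)⟩

/-- Balls about a point of the support have positive mass tending to 0. Along a subsequence the
masses decrease strictly, and the successive annuli are disjoint sets of positive measure. -/
theorem UpperRegular.not_finiteDimensional {ν : Measure S2} [IsFiniteMeasure ν] {C : ENNReal}
    {s : ℝ} (h : UpperRegular ν C s) (hν : ν ≠ 0) : ¬ FiniteDimensional ℂ (Lp ℂ 2 ν) := by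
  obtain ⟨x, hx⟩ := Measure.nonempty_support hν
  let r : ℕ → ℝ := fun k => 1 / ((k : ℝ) + 1)
  have hr : ∀ k, 0 < r k := fun k => Nat.one_div_pos_of_nat
  have hra : Antitone r := fun i j hij => Nat.one_div_le_one_div hij
  have hpos : ∀ k, 0 < ν.real (Metric.ball x (r k)) := fun k =>
    ENNReal.toReal_pos (((Measure.mem_support_iff_forall x).1 hx _
      (Metric.ball_mem_nhds x (hr k))).ne') (measure_ne_top _ _)
  have hlim : Tendsto (fun k => ν.real (Metric.ball x (r k))) atTop (𝓝 0) := by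
    have h1 : Tendsto (fun k => C.toReal * r k ^ s) atTop (𝓝 0) := by
      have := (tendsto_one_div_add_atTop_nhds_zero_nat (𝕜 := ℝ)).rpow_const (p := s)
        (Or.inr h.pos.le)
      rw [Real.zero_rpow h.pos.ne'] at this
      simpa only [mul_zero] using this.const_mul C.toReal
    refine squeeze_zero (fun k => (hpos k).le) (fun k => ?_) h1
    have := ENNReal.toReal_mono (ENNReal.mul_ne_top h.ne_top ENNReal.ofReal_ne_top)
      (h.le x (r k) (hr k))
    rwa [ENNReal.toReal_mul, ENNReal.toReal_ofReal (Real.rpow_nonneg (hr k).le _)] at this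
  have hinv : Tendsto (fun k => (ν.real (Metric.ball x (r k)))⁻¹) atTop atTop :=
    (tendsto_nhdsWithin_iff.2 ⟨hlim, Eventually.of_forall hpos⟩).inv_tendsto_nhdsGT_zero
  obtain ⟨φ, hφ, hmono⟩ := strictMono_subseq_of_tendsto_atTop hinv
  have hanti : Antitone fun k => Metric.ball x (r (φ k)) := fun i j hij =>
    Metric.ball_subset_ball (hra (hφ.monotone hij))
  refine not_finiteDimensional_L2_of_pairwise_disjoint
    (A := fun k => Metric.ball x (r (φ k)) \ Metric.ball x (r (φ (k + 1))))
    (fun k => measurableSet_ball.diff measurableSet_ball) (fun k h0 => ?_) ?_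
  · have h1 : ν.real (Metric.ball x (r (φ (k + 1)))) < ν.real (Metric.ball x (r (φ k))) :=
      (inv_lt_inv₀ (hpos _) (hpos _)).1 (hmono (Nat.lt_succ_self k))
    have h2 := measureReal_sdiff (μ := ν) (hanti (Nat.le_succ k)) measurableSet_ball
    have h3 : ν.real (Metric.ball x (r (φ k)) \ Metric.ball x (r (φ (k + 1)))) = 0 := by
      rw [measureReal_def, h0]; rfl
    simp only [Nat.succ_eq_add_one] at h2
    linarith
  · refine (pairwise_disjoint_on _).2 fun i j hij => ?_
    exact disjoint_left.2 fun y hy hy' => hy.2 (hanti (Nat.succ_le_of_lt hij) hy'.1)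

end KreinFeller

end


/-! ### The iterated function system and its invariant measures. -/

noncomputable section

namespace KreinFeller

/-! ### Geometry of the iterated function system -/

theorem inner_eq_coords (p q : S2) : (inner ℝ (p : E3) (q : E3) : ℝ) =
    (p : E3) 0 * (q : E3) 0 + (p : E3) 1 * (q : E3) 1 + (p : E3) 2 * (q : E3) 2 := by
  rw [PiLp.inner_apply, Fin.sum_univ_three]
  simp [mul_comm]

theorem inner_self_S2 (p : S2) : (inner ℝ (p : E3) (p : E3) : ℝ) = 1 := by
  rw [real_inner_self_eq_norm_sq, mem_sphere_zero_iff_norm.1 p.2, one_pow]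

theorem dist_sq_eq (p q : S2) : dist p q ^ 2 = 2 * (1 - inner ℝ (p : E3) (q : E3)) := by
  rw [Subtype.dist_eq, dist_eq_norm, norm_sub_sq_real, mem_sphere_zero_iff_norm.1 p.2,
    mem_sphere_zero_iff_norm.1 q.2]
  ring

theorem inner_le_one_S2 (p q : S2) : (inner ℝ (p : E3) (q : E3) : ℝ) ≤ 1 := by
  nlinarith [dist_sq_eq p q, sq_nonneg (dist p q)]

theorem neg_one_le_inner_S2 (p q : S2) : -1 ≤ (inner ℝ (p : E3) (q : E3) : ℝ) := by
  have h := abs_real_inner_le_norm (p : E3) (q : E3)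
  rw [mem_sphere_zero_iff_norm.1 p.2, mem_sphere_zero_iff_norm.1 q.2, mul_one] at h
  exact (abs_le.1 h).1

/-- The chordal distance in terms of the great-circle distance. -/
theorem dist_eq_two_mul_sin (p q : S2) : dist p q = 2 * Real.sin (sphereDist p q / 2) := by
  have h0 : 0 ≤ sphereDist p q := Real.arccos_nonneg _
  have h1 : sphereDist p q ≤ Real.pi := Real.arccos_le_pi _
  have hs : 0 ≤ Real.sin (sphereDist p q / 2) :=
    Real.sin_nonneg_of_nonneg_of_le_pi (by linarith) (by linarith)
  rw [← pow_left_inj₀ dist_nonneg (by positivity) two_ne_zero, dist_sq_eq, mul_pow,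
    Real.sin_sq_eq_half_sub]
  have hc : Real.cos (2 * (sphereDist p q / 2)) = inner ℝ (p : E3) (q : E3) := by
    rw [mul_div_cancel₀ _ (two_ne_zero), sphereDist,
      Real.cos_arccos (neg_one_le_inner_S2 p q) (inner_le_one_S2 p q)]
  rw [hc]
  ring

theorem dist_le_sphereDist (p q : S2) : dist p q ≤ sphereDist p q := by
  have h0 : 0 ≤ sphereDist p q := Real.arccos_nonneg _
  rw [dist_eq_two_mul_sin]
  have := Real.sin_le (x := sphereDist p q / 2) (by linarith)
  linarith

theorem polar_coord_zero (φ θ : ℝ) : ((polar φ θ : S2) : E3) 0 = Real.sin φ * Real.cos θ := by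
  simp [polar]

theorem polar_coord_one (φ θ : ℝ) : ((polar φ θ : S2) : E3) 1 = Real.sin φ * Real.sin θ := by
  simp [polar]

theorem polar_coord_two (φ θ : ℝ) : ((polar φ θ : S2) : E3) 2 = Real.cos φ := by
  simp [polar]

theorem S2_ext {p q : S2} (h0 : (p : E3) 0 = (q : E3) 0) (h1 : (p : E3) 1 = (q : E3) 1)
    (h2 : (p : E3) 2 = (q : E3) 2) : p = q := by
  refine Subtype.ext (PiLp.ext fun i => ?_)
  fin_cases i
  exacts [h0, h1, h2]

theorem mem_quarter_iff (p : S2) :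
    p ∈ quarter ↔ 0 ≤ (p : E3) 0 ∧ 0 ≤ (p : E3) 1 ∧ 0 ≤ (p : E3) 2 := by
  constructor
  · rintro ⟨φ, hφ, θ, hθ, rfl⟩
    have hp := Real.pi_pos
    rw [polar_coord_zero, polar_coord_one, polar_coord_two]
    have h1 := Real.sin_nonneg_of_nonneg_of_le_pi hφ.1 (by linarith [hφ.2])
    have h2 := Real.cos_nonneg_of_neg_pi_div_two_le_of_le (by linarith [hφ.1]) hφ.2
    have h3 := Real.sin_nonneg_of_nonneg_of_le_pi hθ.1 (by linarith [hθ.2])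
    have h4 := Real.cos_nonneg_of_neg_pi_div_two_le_of_le (by linarith [hθ.1]) hθ.2
    exact ⟨mul_nonneg h1 h4, mul_nonneg h1 h3, h2⟩
  · rintro ⟨h0, h1, h2⟩
    have hs := (mem_sphere_iff _).1 p.2
    set z : ℂ := ⟨(p : E3) 0, (p : E3) 1⟩ with hz
    have hn : Real.sin (Real.arccos ((p : E3) 2)) = ‖z‖ := by
      rw [Real.sin_arccos, ← Real.sqrt_sq (norm_nonneg z), Complex.sq_norm, Complex.normSq_apply]
      congr 1
      simp only [hz]
      linarith
    refine ⟨Real.arccos ((p : E3) 2), ⟨Real.arccos_nonneg _, Real.arccos_le_pi_div_two.2 h2⟩,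
      z.arg, ⟨Complex.arg_nonneg_iff.2 h1,
        (abs_le.1 (Complex.abs_arg_le_pi_div_two_iff.2 h0)).2⟩, S2_ext ?_ ?_ ?_⟩
    · rw [polar_coord_zero, hn, Complex.norm_mul_cos_arg]
    · rw [polar_coord_one, hn, Complex.norm_mul_sin_arg]
    · rw [polar_coord_two, Real.cos_arccos (by linarith) (by nlinarith)]

theorem continuous_coord (i : Fin 3) : Continuous fun p : S2 => (p : E3) i :=
  (EuclideanSpace.proj (𝕜 := ℝ) i).continuous.comp continuous_subtype_val

theorem isClosed_quarter : IsClosed quarter := by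
  have h : quarter = {p : S2 | 0 ≤ (p : E3) 0} ∩
      ({p : S2 | 0 ≤ (p : E3) 1} ∩ {p : S2 | 0 ≤ (p : E3) 2}) := by
    ext p
    exact mem_quarter_iff p
  rw [h]
  exact (isClosed_le continuous_const (continuous_coord 0)).inter
    ((isClosed_le continuous_const (continuous_coord 1)).inter
      (isClosed_le continuous_const (continuous_coord 2)))

theorem quarter_compl_nonempty : quarterᶜ.Nonempty :=
  ⟨polar Real.pi 0, fun h => by
    have := ((mem_quarter_iff _).1 h).2.2
    rw [polar_coord_two, Real.cos_pi] at this
    linarith⟩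

theorem inner_rotX (α : ℝ) (p q : S2) :
    (inner ℝ (rotX α p : E3) (rotX α q : E3) : ℝ) = inner ℝ (p : E3) (q : E3) := by
  rw [inner_eq_coords, inner_eq_coords]
  simp [rotX, rotXMatrix, dotProduct, Fin.sum_univ_three]
  linear_combination ((p : E3) 1 * (q : E3) 1 + (p : E3) 2 * (q : E3) 2) *
    Real.sin_sq_add_cos_sq α

theorem inner_rotY (α : ℝ) (p q : S2) :
    (inner ℝ (rotY α p : E3) (rotY α q : E3) : ℝ) = inner ℝ (p : E3) (q : E3) := by
  rw [inner_eq_coords, inner_eq_coords]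
  simp [rotY, rotYMatrix, dotProduct, Fin.sum_univ_three]
  linear_combination ((p : E3) 0 * (q : E3) 0 + (p : E3) 2 * (q : E3) 2) *
    Real.sin_sq_add_cos_sq α

theorem inner_ifs (i : Fin 3) (p q : S2) : (inner ℝ (ifs i p : E3) (ifs i q : E3) : ℝ) =
    inner ℝ (halfPolar p : E3) (halfPolar q : E3) := by
  fin_cases i
  · rfl
  · exact inner_rotY _ _ _
  · exact inner_rotX _ _ _

theorem half_angle_bounds {φ : ℝ} (h0 : 0 ≤ φ) (h1 : φ ≤ Real.pi / 2) :
    0 ≤ Real.sin (φ / 2) ∧ Real.sin (φ / 2) ≤ √2 / 2 ∧ √2 / 2 ≤ Real.cos (φ / 2) ∧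
      Real.cos (φ / 2) ≤ 1 := by
  have hp := Real.pi_pos
  refine ⟨Real.sin_nonneg_of_nonneg_of_le_pi (by linarith) (by linarith), ?_, ?_,
    Real.cos_le_one _⟩
  · rw [← Real.sin_pi_div_four]
    exact Real.sin_le_sin_of_le_of_le_pi_div_two (by linarith) (by linarith) (by linarith)
  · rw [← Real.cos_pi_div_four]
    exact Real.cos_le_cos_of_nonneg_of_le_pi (by linarith) (by linarith) (by linarith)

/-- After halving, the first two coordinates are at most `sin (φ / 2) ≤ √2 / 2 ≤ cos (φ / 2)`.
Rotation through `π/4` subtracts one of them from the third coordinate, up to the factor `√2 / 2`,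
and leaves it nonnegative. -/
theorem mapsTo_ifs (i : Fin 3) : MapsTo (ifs i) quarter quarter := by
  rintro _ ⟨φ, hφ, θ, hθ, rfl⟩
  have hp := Real.pi_pos
  have hmem : polar (φ / 2) θ ∈ quarter :=
    ⟨φ / 2, ⟨by linarith [hφ.1], by linarith [hφ.1, hφ.2]⟩, θ, hθ, rfl⟩
  obtain ⟨hs0, hs1, hc1, -⟩ := half_angle_bounds hφ.1 hφ.2
  obtain ⟨h0, h1, h2⟩ := (mem_quarter_iff _).1 hmem
  have hx : Real.sin (φ / 2) * Real.cos θ ≤ Real.sin (φ / 2) :=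
    mul_le_of_le_one_right hs0 (Real.cos_le_one _)
  have hy : Real.sin (φ / 2) * Real.sin θ ≤ Real.sin (φ / 2) :=
    mul_le_of_le_one_right hs0 (Real.sin_le_one _)
  rw [polar_coord_zero] at h0
  rw [polar_coord_one] at h1
  rw [polar_coord_two] at h2
  have h20 : 0 ≤ √2 / 2 := by positivity
  fin_cases i
  · change halfPolar _ ∈ _
    rwa [halfPolar_polar _ _ hφ.1 hφ.2]
  · change rotY (Real.pi / 4) (halfPolar _) ∈ _
    rw [halfPolar_polar _ _ hφ.1 hφ.2, mem_quarter_iff]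
    simp only [rotY, rotYMatrix, Matrix.mulVec, dotProduct, Fin.sum_univ_three, polar_coord_zero,
      polar_coord_one, polar_coord_two, Real.cos_pi_div_four, Real.sin_pi_div_four]
    simp only [Fin.isValue, Matrix.of_apply, Matrix.cons_val', Matrix.cons_val_zero,
      Matrix.cons_val_fin_one, Matrix.cons_val_one, Matrix.cons_val]
    refine ⟨?_, ?_, ?_⟩
    · nlinarith
    · nlinarith
    · nlinarith
  · change rotX (-(Real.pi / 4)) (halfPolar _) ∈ _
    rw [halfPolar_polar _ _ hφ.1 hφ.2, mem_quarter_iff]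
    simp only [rotX, rotXMatrix, Matrix.mulVec, dotProduct, Fin.sum_univ_three, polar_coord_zero,
      polar_coord_one, polar_coord_two, Real.cos_neg, Real.sin_neg, Real.cos_pi_div_four,
      Real.sin_pi_div_four]
    simp only [Fin.isValue, Matrix.of_apply, Matrix.cons_val', Matrix.cons_val_zero,
      Matrix.cons_val_fin_one, Matrix.cons_val_one, Matrix.cons_val]
    refine ⟨?_, ?_, ?_⟩
    · nlinarith
    · nlinarith
    · nlinarith

theorem one_sub_inner_polar (φ φ' θ θ' : ℝ) :
    1 - (inner ℝ (polar φ θ : E3) (polar φ' θ' : E3) : ℝ) =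
      2 * Real.sin ((φ - φ') / 2) ^ 2 +
        Real.sin φ * Real.sin φ' * (1 - Real.cos (θ - θ')) := by
  rw [inner_eq_coords]
  simp only [polar_coord_zero, polar_coord_one, polar_coord_two]
  rw [Real.sin_sq_eq_half_sub, mul_div_cancel₀ _ (two_ne_zero), Real.cos_sub, Real.cos_sub]
  ring

/-- Both terms of `one_sub_inner_polar` are compared with their halved versions by double-angle
formulas. The ratios are `1 / (4 cos² δ)` and `1 / (4 c)`, with `cos² δ` and `c` in `[1/2, 1]` as
all half angles are at most `π/4`. -/
theorem one_sub_inner_halfPolar {p q : S2} (hp : p ∈ quarter) (hq : q ∈ quarter) :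
    (1 - (inner ℝ (p : E3) (q : E3) : ℝ)) / 4 ≤
        1 - (inner ℝ (halfPolar p : E3) (halfPolar q : E3) : ℝ) ∧
      1 - (inner ℝ (halfPolar p : E3) (halfPolar q : E3) : ℝ) ≤
        (1 - (inner ℝ (p : E3) (q : E3) : ℝ)) / 2 := by
  obtain ⟨φ, hφ, θ, -, rfl⟩ := hp
  obtain ⟨φ', hφ', θ', -, rfl⟩ := hq
  have hpi := Real.pi_pos
  rw [halfPolar_polar _ _ hφ.1 hφ.2, halfPolar_polar _ _ hφ'.1 hφ'.2, one_sub_inner_polar,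
    one_sub_inner_polar]
  obtain ⟨s0, -, c0, c1⟩ := half_angle_bounds hφ.1 hφ.2
  obtain ⟨s0', -, c0', c1'⟩ := half_angle_bounds hφ'.1 hφ'.2
  have h2 : √2 ^ 2 = 2 := Real.sq_sqrt (by norm_num)
  have h20 : 0 ≤ √2 := Real.sqrt_nonneg 2
  set δ := (φ / 2 - φ' / 2) / 2
  have hδ : (φ - φ') / 2 = 2 * δ := by simp only [δ]; ring
  have e1 : Real.sin φ = 2 * Real.sin (φ / 2) * Real.cos (φ / 2) := by
    rw [← Real.sin_two_mul]; congr 1; ring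
  have e2 : Real.sin φ' = 2 * Real.sin (φ' / 2) * Real.cos (φ' / 2) := by
    rw [← Real.sin_two_mul]; congr 1; ring
  rw [hδ, Real.sin_two_mul, e1, e2]
  have hcδ : 1 / 2 ≤ Real.cos δ ^ 2 := by
    have h1 : √2 / 2 ≤ Real.cos δ := by
      rw [← Real.cos_pi_div_four, ← Real.cos_abs δ]
      refine Real.cos_le_cos_of_nonneg_of_le_pi (abs_nonneg _) (by linarith) (abs_le.2 ⟨?_, ?_⟩) <;>
        simp only [δ] <;> linarith [hφ.1, hφ.2, hφ'.1, hφ'.2]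
    nlinarith
  have hcδ1 : Real.cos δ ^ 2 ≤ 1 := Real.cos_sq_le_one _
  set k := 1 - Real.cos (θ - θ')
  have hk : 0 ≤ k := sub_nonneg.2 (Real.cos_le_one _)
  set s := Real.sin (φ / 2) * Real.sin (φ' / 2) * k
  have hs : 0 ≤ s := mul_nonneg (mul_nonneg s0 s0') hk
  set c := Real.cos (φ / 2) * Real.cos (φ' / 2)
  have hc0 : 1 / 2 ≤ c := by
    have : √2 / 2 * (√2 / 2) ≤ c := mul_le_mul c0 c0' (by positivity) (by linarith)
    nlinarith
  have hc1 : c ≤ 1 := mul_le_one₀ c1 (by linarith) c1'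
  have hrw : 2 * Real.sin (φ / 2) * Real.cos (φ / 2) * (2 * Real.sin (φ' / 2) * Real.cos (φ' / 2)) * k =
      4 * (s * c) := by simp only [s, c]; ring
  rw [hrw]
  have hsd := sq_nonneg (Real.sin δ)
  constructor
  · nlinarith [mul_nonneg hs (sub_nonneg.2 hc1), mul_nonneg hsd (sub_nonneg.2 hcδ1)]
  · nlinarith [mul_nonneg hs (sub_nonneg.2 hc0), mul_nonneg hsd (sub_nonneg.2 hcδ)]

theorem dist_ifs (i : Fin 3) {p q : S2} (hp : p ∈ quarter) (hq : q ∈ quarter) :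
    dist p q / 2 ≤ dist (ifs i p) (ifs i q) ∧ dist (ifs i p) (ifs i q) ≤ dist p q / √2 := by
  obtain ⟨h1, h2⟩ := one_sub_inner_halfPolar hp hq
  rw [← inner_ifs i] at h1 h2
  have e1 := dist_sq_eq p q
  have e2 := dist_sq_eq (ifs i p) (ifs i q)
  refine ⟨le_of_sq_le_sq ?_ dist_nonneg, le_of_sq_le_sq ?_ (by positivity)⟩
  · rw [div_pow]; linarith
  · rw [div_pow, Real.sq_sqrt zero_le_two]; linarith

theorem sphereDist_le_pi_div_two {p q : S2} (hp : p ∈ quarter) (hq : q ∈ quarter) :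
    sphereDist p q ≤ Real.pi / 2 := by
  refine Real.arccos_le_pi_div_two.2 ?_
  rw [inner_eq_coords]
  obtain ⟨a, b, c⟩ := (mem_quarter_iff p).1 hp
  obtain ⟨a', b', c'⟩ := (mem_quarter_iff q).1 hq
  positivity

theorem mul_sin_le_sin_mul {r x : ℝ} (hr0 : 0 ≤ r) (hr1 : r ≤ 1) (hx0 : 0 ≤ x)
    (hx1 : x ≤ Real.pi) : r * Real.sin x ≤ Real.sin (r * x) := by
  have h := strictConcaveOn_sin_Icc.concaveOn.2 (x := x) ⟨hx0, hx1⟩ (y := 0)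
    ⟨le_rfl, Real.pi_pos.le⟩ hr0 (sub_nonneg.2 hr1) (by ring)
  simpa using h

/-- Lower bound: an arc is at least its chord, and Jordan's inequality gives the constant `1/π`.
Upper bound: concavity of the sine carries the chordal ratio `1/√2` over to arcs without loss. -/
theorem isBiLipschitzContractionOn_ifs (i : Fin 3) :
    IsBiLipschitzContractionOn (ifs i) quarter := by
  have hpi := Real.pi_gt_three
  have h2 : (1 : ℝ) < √2 := by
    rw [Real.lt_sqrt] <;> norm_num
  have h22 : √2 < 3 := by
    rw [Real.sqrt_lt'] <;> norm_num
  refine ⟨1 / Real.pi, 1 / √2, by positivity, ?_, ?_, fun p hp q hq => ?_⟩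
  · exact one_div_le_one_div_of_le (by positivity) (by linarith)
  · rw [div_lt_one] <;> linarith
  obtain ⟨h3, h4⟩ := dist_ifs i hp hq
  have d0 : 0 ≤ sphereDist p q := Real.arccos_nonneg _
  have d1 := sphereDist_le_pi_div_two hp hq
  have d0' : 0 ≤ sphereDist (ifs i p) (ifs i q) := Real.arccos_nonneg _
  have d1' := sphereDist_le_pi_div_two (mapsTo_ifs i hp) (mapsTo_ifs i hq)
  constructor
  · have h5 := dist_le_sphereDist (ifs i p) (ifs i q)
    have h6 := Real.mul_le_sin (x := sphereDist p q / 2) (by linarith) (by linarith)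
    rw [dist_eq_two_mul_sin p q] at h3
    have h7 : 1 / Real.pi * sphereDist p q = 2 / Real.pi * (sphereDist p q / 2) := by ring
    linarith
  · rw [dist_eq_two_mul_sin, dist_eq_two_mul_sin] at h4
    have hr1 : 1 / √2 ≤ 1 := by rw [div_le_one] <;> linarith
    have h5 := mul_sin_le_sin_mul (r := 1 / √2) (x := sphereDist p q / 2) (by positivity) hr1
      (by linarith) (by linarith)
    have h6 : Real.sin (sphereDist (ifs i p) (ifs i q) / 2) ≤
        Real.sin (1 / √2 * (sphereDist p q / 2)) := by
      refine le_trans ?_ h5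
      rw [one_div, inv_mul_eq_div]
      rw [mul_div_assoc] at h4
      linarith
    have h7 : 1 / √2 * (sphereDist p q / 2) ≤ sphereDist p q / 2 :=
      mul_le_of_le_one_left (by linarith) hr1
    have h8 : 0 ≤ 1 / √2 * (sphereDist p q / 2) := by positivity
    have h9 := (Real.strictMonoOn_sin.le_iff_le ⟨by linarith, by linarith⟩
      ⟨by linarith, by linarith⟩).1 h6
    linarith

end KreinFeller

end


noncomputable section

namespace KreinFeller

/-! ### Upper regularity of invariant measures -/

theorem continuous_of_coord {X : Type*} [TopologicalSpace X] {f : X → S2}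
    (h : ∀ i, Continuous fun x => (f x : E3) i) : Continuous f :=
  continuous_induced_rng.2 ((PiLp.continuous_toLp 2 _).comp (continuous_pi h))

theorem continuous_polar : Continuous fun x : ℝ × ℝ => polar x.1 x.2 := by
  refine continuous_of_coord (Fin.forall_fin_succ.2 ⟨?_, Fin.forall_fin_two.2 ⟨?_, ?_⟩⟩)
  · simp only [polar_coord_zero]
    fun_prop
  · simp only [Fin.succ_zero_eq_one, polar_coord_one]
    fun_prop
  · simp only [Fin.succ_one_eq_two, polar_coord_two]
    fun_prop

theorem measurable_halfPolar : Measurable halfPolar := by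
  have h1 : Measurable fun p : S2 => Real.arccos ((p : E3) 2) / 2 :=
    ((Real.continuous_arccos.comp (continuous_coord 2)).div_const 2).measurable
  have h2 : Measurable fun p : S2 => Complex.arg ⟨(p : E3) 0, (p : E3) 1⟩ := by
    have h3 : Continuous fun p : S2 => Complex.equivRealProdCLM.symm ((p : E3) 0, (p : E3) 1) :=
      Complex.equivRealProdCLM.symm.continuous.comp
        ((continuous_coord 0).prodMk (continuous_coord 1))
    exact Complex.measurable_arg.comp h3.measurable
  have h3 := continuous_polar.measurable.comp (h1.prodMk h2)
  exact h3

theorem continuous_rotX (α : ℝ) : Continuous (rotX α) := by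
  have h0 := continuous_coord 0
  have h1 := continuous_coord 1
  have h2 := continuous_coord 2
  refine Continuous.subtype_mk ((PiLp.continuous_toLp 2 _).comp (continuous_pi fun i => ?_)) _
  simp only [Matrix.mulVec, dotProduct, Fin.sum_univ_three]
  fun_prop

theorem continuous_rotY (α : ℝ) : Continuous (rotY α) := by
  have h0 := continuous_coord 0
  have h1 := continuous_coord 1
  have h2 := continuous_coord 2
  refine Continuous.subtype_mk ((PiLp.continuous_toLp 2 _).comp (continuous_pi fun i => ?_)) _
  simp only [Matrix.mulVec, dotProduct, Fin.sum_univ_three]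
  fun_prop

theorem measurable_ifs (i : Fin 3) : Measurable (ifs i) := by
  fin_cases i
  · exact measurable_halfPolar
  · exact (continuous_rotY _).measurable.comp measurable_halfPolar
  · exact (continuous_rotX _).measurable.comp measurable_halfPolar

theorem abs_coord_sub_le_dist (p q : S2) (i : Fin 3) : |(p : E3) i - (q : E3) i| ≤ dist p q := by
  rw [Subtype.dist_eq, dist_eq_norm]
  exact PiLp.norm_apply_le ((p : E3) - (q : E3)) i

/-- The images of `quarter` under two of the compositions of the maps are separated. -/
theorem exists_separation : ∃ η > 0, ∀ p ∈ quarter, ∀ q ∈ quarter,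
    η ≤ dist (ifs 0 (ifs 0 p)) (ifs 1 q) := by
  have hpi := Real.pi_pos
  -- The third coordinate separates the two sets: halving twice leaves a polar angle of at most
  -- `π/8`, while the rotation makes the third coordinate at most `cos (π/4)`.
  refine ⟨Real.cos (Real.pi / 8) - Real.cos (Real.pi / 4), sub_pos.2
    (Real.cos_lt_cos_of_nonneg_of_le_pi_div_two (by linarith) (by linarith) (by linarith)),
    fun p hp q hq => ?_⟩
  refine le_trans ?_ ((le_abs_self _).trans (abs_coord_sub_le_dist _ _ 2))
  have h1 : Real.cos (Real.pi / 8) ≤ ((ifs 0 (ifs 0 p) : S2) : E3) 2 := by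
    obtain ⟨φ, hφ, θ, hθ, rfl⟩ := hp
    change _ ≤ ((halfPolar (halfPolar _) : S2) : E3) 2
    rw [halfPolar_polar _ _ hφ.1 hφ.2,
      halfPolar_polar _ _ (by linarith [hφ.1]) (by linarith [hφ.1, hφ.2]), polar_coord_two]
    exact Real.cos_le_cos_of_nonneg_of_le_pi (by linarith [hφ.1]) (by linarith)
      (by linarith [hφ.2])
  have h2 : ((ifs 1 q : S2) : E3) 2 ≤ Real.cos (Real.pi / 4) := by
    have hq' : halfPolar q ∈ quarter := mapsTo_ifs 0 hq
    obtain ⟨h0, -, h2⟩ := (mem_quarter_iff _).1 hq'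
    have hs := (mem_sphere_iff _).1 (halfPolar q).2
    change ((rotY (Real.pi / 4) (halfPolar q) : S2) : E3) 2 ≤ _
    simp only [rotY, rotYMatrix, Matrix.mulVec, dotProduct, Fin.sum_univ_three,
      Real.cos_pi_div_four, Real.sin_pi_div_four]
    simp only [Fin.isValue, Matrix.of_apply, Matrix.cons_val', Matrix.cons_val_zero,
      Matrix.cons_val_fin_one, Matrix.cons_val_one, Matrix.cons_val]
    have h3 : ((halfPolar q : S2) : E3) 2 ≤ 1 := by nlinarith
    have h4 : 0 ≤ √2 / 2 := by positivity
    nlinarith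
  linarith

/-- The centre `x` need not be in the image, so the preimage is enclosed in a ball about one of its
own points; this doubles the radius. -/
theorem measureReal_preimage_ball_le {μ : Measure S2} [IsFiniteMeasure μ]
    (hμ : μ quarterᶜ = 0) {f : S2 → S2} {K t a : ℝ} (hK : 0 < K)
    (hf : ∀ p ∈ quarter, ∀ q ∈ quarter, dist p q ≤ K * dist (f p) (f q)) (ha : 0 ≤ a)
    (h : ∀ x, μ.real (Metric.ball x (2 * K * t)) ≤ a) (x : S2) :
    μ.real (f ⁻¹' Metric.ball x t) ≤ a := by
  have hμ' : μ.real quarterᶜ = 0 := by rw [measureReal_def, hμ]; rfl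
  by_cases hp : ∃ p ∈ quarter, f p ∈ Metric.ball x t
  · obtain ⟨p, hp, hpx⟩ := hp
    have hsub : f ⁻¹' Metric.ball x t ⊆ Metric.ball p (2 * K * t) ∪ quarterᶜ := fun q hq => by
      by_cases hqD : q ∈ quarter
      · left
        have h1 := dist_triangle_right (f q) (f p) x
        rw [Metric.mem_ball] at hpx ⊢
        have h2 : dist (f q) x < t := hq
        have h3 : dist (f q) (f p) < 2 * t := by linarith
        have h4 := hf q hqD p hp
        have h5 := mul_lt_mul_of_pos_left h3 hK
        linarith
      · exact Or.inr hqD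
    have h1 := measureReal_mono hsub (μ := μ)
    have h2 := measureReal_union_le (μ := μ) (Metric.ball p (2 * K * t)) quarterᶜ
    linarith [h p]
  · have hsub : f ⁻¹' Metric.ball x t ⊆ quarterᶜ := fun q hq hqD => hp ⟨q, hqD, hq⟩
    have h1 := measureReal_mono hsub (μ := μ)
    linarith

theorem measureReal_eq_zero_of_disjoint {μ : Measure S2} (hμ : μ quarterᶜ = 0) {S : Set S2}
    (h : ∀ p ∈ quarter, p ∉ S) : μ.real S = 0 := by
  rw [measureReal_def, measure_mono_null (fun p hp hpD => h p hpD hp) hμ]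
  rfl

namespace IsInvariantMeasure

variable {w : Fin 3 → NNReal} {μ : Measure S2}

theorem measureReal_eq (h : IsInvariantMeasure w μ) {B : Set S2} (hB : MeasurableSet B) :
    μ.real B = w 0 * μ.real (ifs 0 ⁻¹' B) + w 1 * μ.real (ifs 1 ⁻¹' B) +
      w 2 * μ.real (ifs 2 ⁻¹' B) := by
  have := h.prob
  have h1 : μ B = (∑ i, w i • μ.map (ifs i)) B := congrArg (fun ν : Measure S2 => ν B) h.invariant
  rw [Measure.finsetSum_apply, Fin.sum_univ_three] at h1
  simp only [Measure.smul_apply, Measure.map_apply (measurable_ifs _) hB, ENNReal.smul_def,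
    smul_eq_mul] at h1
  rw [measureReal_def, h1, ENNReal.toReal_add (by finiteness) (by finiteness),
    ENNReal.toReal_add (by finiteness) (by finiteness)]
  simp [measureReal_def]

/-- The maximal measure of a ball drops by a fixed factor when the radius is divided by `8`. -/
theorem exists_ball_decay (h : IsInvariantMeasure w μ) : ∃ κ η : ℝ, 0 < κ ∧ κ < 1 ∧ 0 < η ∧
    ∀ t a : ℝ, 2 * t ≤ η → 0 ≤ a → (∀ x, μ.real (Metric.ball x (8 * t)) ≤ a) →
      ∀ x, μ.real (Metric.ball x t) ≤ κ * a := by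
  have := h.prob
  obtain ⟨η, hη, hsep⟩ := exists_separation
  have hsum : (w 0 : ℝ) + w 1 + w 2 = 1 := by
    have := h.sum_one
    rw [Fin.sum_univ_three] at this
    exact_mod_cast this
  have p0 : (0 : ℝ) < w 0 := h.pos 0
  have p1 : (0 : ℝ) < w 1 := h.pos 1
  have p2 : (0 : ℝ) < w 2 := h.pos 2
  -- If the ball misses the image of `ifs 1`, the weight `w 1` is lost. Otherwise, having diameter
  -- at most `η`, it misses the image of `ifs 0 ∘ ifs 0`, and `w 0 ^ 2` is lost.
  refine ⟨max (1 - w 1) (1 - w 0 ^ 2), η, lt_max_of_lt_left (by linarith),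
    max_lt (by linarith) (by nlinarith), hη, fun t a ht ha hball x => ?_⟩
  -- Inverting two maps expands by at most `4`, and the change of centre doubles this: hence the
  -- factor 8. For a single map the constant 4 is generous but harmless.
  have hball' : ∀ y, μ.real (Metric.ball y (2 * 4 * t)) ≤ a := by
    rw [show (2 : ℝ) * 4 * t = 8 * t by ring]
    exact hball
  have hexp : ∀ i, ∀ p ∈ quarter, ∀ q ∈ quarter, dist p q ≤ 2 * dist (ifs i p) (ifs i q) :=
    fun i p hp q hq => by linarith [(dist_ifs i hp hq).1]
  have hone : ∀ i, μ.real (ifs i ⁻¹' Metric.ball x t) ≤ a := fun i =>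
    measureReal_preimage_ball_le h.carried (K := 4) (by norm_num) (fun p hp q hq => by
      linarith [hexp i p hp q hq, dist_nonneg (x := ifs i p) (y := ifs i q)]) ha hball' x
  have htwo : ∀ i, μ.real (ifs i ⁻¹' (ifs 0 ⁻¹' Metric.ball x t)) ≤ a := fun i =>
    measureReal_preimage_ball_le h.carried (f := ifs 0 ∘ ifs i) (K := 4) (by norm_num)
      (fun p hp q hq => by
        have h1 := hexp i p hp q hq
        have h2 := hexp 0 _ (mapsTo_ifs i hp) _ (mapsTo_ifs i hq)
        simp only [Function.comp_apply]
        linarith) ha hball' x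
  have hB : MeasurableSet (Metric.ball x t) := measurableSet_ball
  rw [h.measureReal_eq hB]
  have m0 := mul_le_mul_of_nonneg_left (hone 0) p0.le
  have m1 := mul_le_mul_of_nonneg_left (hone 1) p1.le
  have m2 := mul_le_mul_of_nonneg_left (hone 2) p2.le
  by_cases hq : ∃ q ∈ quarter, ifs 1 q ∈ Metric.ball x t
  · obtain ⟨q, hqD, hq⟩ := hq
    have hz : μ.real (ifs 0 ⁻¹' (ifs 0 ⁻¹' Metric.ball x t)) = 0 :=
      measureReal_eq_zero_of_disjoint h.carried fun p hp hpx => by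
        have h1 := hsep p hp q hqD
        have h2 := dist_triangle_right (ifs 0 (ifs 0 p)) (ifs 1 q) x
        rw [Metric.mem_ball] at hq
        have h3 : dist (ifs 0 (ifs 0 p)) x < t := hpx
        linarith
    have h0 := h.measureReal_eq (measurable_ifs 0 hB)
    rw [hz] at h0
    have n1 := mul_le_mul_of_nonneg_left (htwo 1) p1.le
    have n2 := mul_le_mul_of_nonneg_left (htwo 2) p2.le
    have h3 : μ.real (ifs 0 ⁻¹' Metric.ball x t) ≤ (1 - w 0) * a := by
      rw [h0]
      have : (1 - (w 0 : ℝ)) * a = w 1 * a + w 2 * a := by rw [← hsum]; ring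
      linarith
    have n0 := mul_le_mul_of_nonneg_left h3 p0.le
    have h4 : (1 - (w 0 : ℝ) ^ 2) * a ≤ max (1 - (w 1 : ℝ)) (1 - w 0 ^ 2) * a :=
      mul_le_mul_of_nonneg_right (le_max_right _ _) ha
    have h5 : (1 - (w 0 : ℝ) ^ 2) * a = w 0 * ((1 - w 0) * a) + w 1 * a + w 2 * a := by
      have : (w 2 : ℝ) = 1 - w 0 - w 1 := by linarith
      rw [this]; ring
    linarith
  · have hz : μ.real (ifs 1 ⁻¹' Metric.ball x t) = 0 :=
      measureReal_eq_zero_of_disjoint h.carried fun p hp hpx => hq ⟨p, hp, hpx⟩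
    rw [hz]
    have h4 : (1 - (w 1 : ℝ)) * a ≤ max (1 - (w 1 : ℝ)) (1 - w 0 ^ 2) * a :=
      mul_le_mul_of_nonneg_right (le_max_left _ _) ha
    have h5 : (1 - (w 1 : ℝ)) * a = w 0 * a + w 2 * a := by rw [← hsum]; ring
    linarith

theorem exists_ball_le (h : IsInvariantMeasure w μ) : ∃ C s : ℝ, 0 < C ∧ 0 < s ∧
    ∀ x t, 0 < t → μ.real (Metric.ball x t) ≤ C * t ^ s := by
  have := h.prob
  obtain ⟨κ, η, hκ0, hκ1, hη, hdec⟩ := h.exists_ball_decay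
  -- The exponent is chosen so that `8 ^ s = κ⁻¹`: the gain from one division of the radius by 8
  -- matches the power law exactly.
  set s := Real.log κ⁻¹ / Real.log 8 with hs
  have hlog8 : 0 < Real.log 8 := Real.log_pos (by norm_num)
  have hs0 : 0 < s := div_pos (Real.log_pos ((one_lt_inv₀ hκ0).2 hκ1)) hlog8
  have h8 : (8 : ℝ) ^ s = κ⁻¹ := by
    rw [Real.rpow_def_of_pos (by norm_num), hs, mul_div_cancel₀ _ hlog8.ne',
      Real.exp_log (inv_pos.2 hκ0)]
  set t₀ := η / 2
  have ht₀ : 0 < t₀ := by positivity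
  -- Induction over the scales `t₀ / 8 ^ n`. Above `t₀` the right-hand side is at least 1, and `μ`
  -- is a probability measure.
  have key : ∀ n : ℕ, ∀ t, t₀ / 8 ^ n ≤ t → ∀ x, μ.real (Metric.ball x t) ≤ (t / t₀) ^ s := by
    have base : ∀ t, t₀ ≤ t → ∀ x, μ.real (Metric.ball x t) ≤ (t / t₀) ^ s := fun t ht x =>
      measureReal_le_one.trans (Real.one_le_rpow ((one_le_div ht₀).2 ht) hs0.le)
    intro n
    induction n with
    | zero => simpa using base
    | succ n ih =>
      intro t ht x
      rcases le_total t₀ t with h1 | h1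
      · exact base t h1 x
      have htp : 0 < t := lt_of_lt_of_le (by positivity) ht
      have h2 : t₀ / 8 ^ n ≤ 8 * t := by
        rw [pow_succ, ← div_div, div_le_iff₀ (by norm_num)] at ht
        linarith
      have h3 := hdec t ((8 * t / t₀) ^ s) (by simp only [t₀] at h1; linarith) (by positivity)
        (ih (8 * t) h2) x
      refine h3.trans_eq ?_
      rw [mul_div_assoc, Real.mul_rpow (by norm_num) (by positivity), h8, ← mul_assoc,
        mul_inv_cancel₀ hκ0.ne', one_mul]
  refine ⟨(t₀ ^ s)⁻¹, s, by positivity, hs0, fun x t ht => ?_⟩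
  obtain ⟨n, hn⟩ := exists_pow_lt_of_lt_one (div_pos ht ht₀) (by norm_num : (1 / 8 : ℝ) < 1)
  refine (key n t ?_ x).trans_eq ?_
  · rw [lt_div_iff₀ ht₀, one_div, inv_pow, inv_mul_eq_div] at hn
    exact hn.le
  · rw [Real.div_rpow ht.le ht₀.le, div_eq_inv_mul]

theorem exists_upperRegular (h : IsInvariantMeasure w μ) : ∃ C s, UpperRegular μ C s := by
  have := h.prob
  obtain ⟨C, s, hC, hs, hle⟩ := h.exists_ball_le
  refine ⟨ENNReal.ofReal C, s, ENNReal.ofReal_ne_top, hs, fun x t ht => ?_⟩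
  rw [← ENNReal.ofReal_mul hC.le, ← ofReal_measureReal]
  exact ENNReal.ofReal_le_ofReal (hle x t ht)

end IsInvariantMeasure

theorem continuous_sphereDist (x : S2) : Continuous fun y => sphereDist x y :=
  Real.continuous_arccos.comp (continuous_const.inner continuous_subtype_val)

theorem sphereDist_self (x : S2) : sphereDist x x = 0 := by
  rw [sphereDist, inner_self_S2, Real.arccos_one]

/-- Dividing `log m ≤ log C + s log δ` by the negative `log δ` gives a quotient of at least `s + log
C / log δ`, which tends to `s`. A point of the support keeps `m` positive, and great-circle balls
lie in chordal balls of the same radius. -/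
theorem lowerLinftyDim_pos {μ : Measure S2} [IsFiniteMeasure μ] (hμ : μ ≠ 0) {C s : ℝ}
    (hC : 0 < C) (hs : 0 < s) (h : ∀ x t, 0 < t → μ.real (Metric.ball x t) ≤ C * t ^ s) :
    0 < lowerLinftyDim μ := by
  obtain ⟨x₀, hx₀⟩ := Measure.nonempty_support hμ
  set m : ℝ → ENNReal := fun δ => ⨆ x ∈ μ.support, μ {y | sphereDist x y < δ}
  have hle : ∀ δ, 0 < δ → m δ ≤ ENNReal.ofReal (C * δ ^ s) := fun δ hδ => by
    refine iSup₂_le fun x _ => ?_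
    refine (measure_mono (t := Metric.ball x δ) fun y hy => ?_).trans ?_
    · rw [Metric.mem_ball, dist_comm]
      exact (dist_le_sphereDist x y).trans_lt hy
    · rw [← ofReal_measureReal]
      exact ENNReal.ofReal_le_ofReal (h x δ hδ)
  have hpos : ∀ δ, 0 < δ → 0 < m δ := fun δ hδ => by
    have h1 : {y | sphereDist x₀ y < δ} ∈ 𝓝 x₀ :=
      (isOpen_lt (continuous_sphereDist x₀) continuous_const).mem_nhds (by
        change sphereDist x₀ x₀ < δ
        rwa [sphereDist_self])
    exact ((Measure.mem_support_iff_forall x₀).1 hx₀ _ h1).trans_le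
      (le_iSup₂ (f := fun x (_ : x ∈ μ.support) => μ {y | sphereDist x y < δ}) x₀ hx₀)
  have hlim : Tendsto (fun δ : ℝ => s + Real.log C / Real.log δ) (𝓝[>] 0) (𝓝 (s + 0)) :=
    tendsto_const_nhds.add (Real.tendsto_log_nhdsGT_zero.const_div_atBot _)
  rw [add_zero] at hlim
  have hev : ∀ᶠ δ : ℝ in 𝓝[>] 0, ((s / 2 : ℝ) : EReal) ≤
      ((Real.log (m δ).toReal / Real.log δ : ℝ) : EReal) := by
    filter_upwards [hlim.eventually (lt_mem_nhds (half_lt_self hs)), self_mem_nhdsWithin,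
      Ioo_mem_nhdsGT (zero_lt_one (α := ℝ))] with δ h1 h0 hδ
    rw [EReal.coe_le_coe_iff]
    refine h1.le.trans ?_
    have hlog : Real.log δ < 0 := Real.log_neg hδ.1 hδ.2
    have h2 : (m δ).toReal ≤ C * δ ^ s := by
      have := ENNReal.toReal_mono ENNReal.ofReal_ne_top (hle δ hδ.1)
      rwa [ENNReal.toReal_ofReal (mul_pos hC (Real.rpow_pos_of_pos hδ.1 s)).le] at this
    have h3 : 0 < (m δ).toReal :=
      ENNReal.toReal_pos (hpos δ hδ.1).ne' (ne_top_of_le_ne_top ENNReal.ofReal_ne_top (hle δ hδ.1))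
    have h4 := Real.log_le_log h3 h2
    rw [Real.log_mul hC.ne' (Real.rpow_pos_of_pos hδ.1 s).ne', Real.log_rpow hδ.1] at h4
    rw [le_div_iff_of_neg hlog, add_mul, div_mul_cancel₀ _ hlog.ne]
    linarith
  refine lt_of_lt_of_le ?_ (le_liminf_of_le (by isBoundedDefault) hev)
  exact_mod_cast half_pos hs

end KreinFeller

end


/-! ### Assembly of the three parts. -/

theorem mainTheorem8 :
    (∀ i, MapsTo (KreinFeller.ifs i) KreinFeller.quarter KreinFeller.quarter ∧
      KreinFeller.IsBiLipschitzContractionOn (KreinFeller.ifs i) KreinFeller.quarter) ∧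
    ∀ (w : Fin 3 → NNReal) (μ : Measure KreinFeller.S2), KreinFeller.IsInvariantMeasure w μ →
      0 < KreinFeller.lowerLinftyDim μ ∧
      ∀ Ω : Set KreinFeller.S2, IsOpen Ω → μ.support ⊆ closure Ω → 0 < μ Ω →
        KreinFeller.PoincareInequality μ Ω ∧
        (∃ (φ : HilbertBasis ℕ ℂ (KreinFeller.L2 μ Ω)) (lam : ℕ → ℝ),
          KreinFeller.IsEigenbasis μ Ω φ lam ∧ (∀ k, 0 < lam k) ∧ Monotone lam ∧
            Tendsto lam atTop atTop) ∧
        ∀ (φ : HilbertBasis ℕ ℂ (KreinFeller.L2 μ Ω)) (lam : ℕ → ℝ),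
          KreinFeller.IsEigenbasis μ Ω φ lam →
            KreinFeller.WaveLinear μ Ω φ lam ∧ KreinFeller.WaveSemilinear μ Ω φ lam ∧
            KreinFeller.HeatLinear μ Ω φ lam ∧ KreinFeller.HeatSemilinear μ Ω φ lam ∧
            KreinFeller.SchrodingerLinear μ Ω φ lam ∧
            KreinFeller.SchrodingerSemilinear μ Ω φ lam := by
  refine ⟨fun i => ⟨KreinFeller.mapsTo_ifs i, KreinFeller.isBiLipschitzContractionOn_ifs i⟩,
    fun w μ h => ?_⟩
  have := h.prob
  obtain ⟨C, s, hC, hs, hle⟩ := h.exists_ball_le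
  obtain ⟨_, _, hreg⟩ := h.exists_upperRegular
  refine ⟨KreinFeller.lowerLinftyDim_pos (IsProbabilityMeasure.ne_zero μ) hC hs hle,
    fun Ω hΩ _ hpos => ?_⟩
  obtain ⟨d⟩ := hreg.exists_formData hΩ KreinFeller.isClosed_quarter h.carried
    KreinFeller.quarter_compl_nonempty
  refine ⟨hreg.poincareInequality hΩ, ?_, fun φ lam hφ => ?_⟩
  · refine d.exists_isEigenbasis ((hreg.restrict Ω).not_finiteDimensional fun h0 => hpos.ne' ?_)
    rw [← Measure.restrict_apply_self, h0]
    rfl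
  · obtain ⟨c₀, hd⟩ := d.spectralData hφ
    exact ⟨hd.waveLinear, hd.waveSemilinear, hd.heatLinear, hd.heatSemilinear,
      hd.schrodingerLinear, hd.schrodingerSemilinear⟩
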